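/- \textbf{Setting.} Let $A$ be a locally compact Hausdorff abelian group with a gaussian exponential, i.e. a continuous function $\langle\cdot\rangle\colon A\to\mathbb T$ with $\langle -x\rangle=\langle x\rangle$ such that the Fourier kernel $\langle x;y\rangle=\frac{\langle x+y\rangle}{\langle x\rangle\langle y\rangle}$ is a bicharacter and $x\mapsto\langle x;\cdot\rangle$ is an isomorphism of topological groups from $A$ onto its Pontryagin dual. Let $dx$ be the Haar measure on $A$ for which the Fourier operator $(\mathsf F h)(x)=\int_A\langle x;y\rangle h(y)\,dy$ is isometric on $L^2(A)$. For bounded measurable $f\colon A\to\mathbb C$ let $f(\mathsf q)$ be multiplication by $f$ on $L^2(A)$, $f(\mathsf p)=\mathsf F f(\mathsf q)\mathsf F^*$ and $f(\mathsf p+\mathsf q)=\langle\mathsf q\rangle^*f(\mathsf p)\langle\mathsf q\rangle$. A bounded measurable family $f_0,\dots,f_4\colon A\to\mathbb C$ is of \emph{Faddeev type} if $$f_1(\mathsf p)f_3(\mathsf q)=f_4(\mathsf q)f_2(\mathsf p+\mathsf q)f_0(\mathsf p).$$ Put $\tilde f=\mathsf F^{-1}f$, i.e. $\tilde f(x)=\int_A\langle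 x;-y\rangle f(y)\,dy$, and $\hat f(x)=\langle x\rangle\tilde f(x)$; these are distributions on $A$. Let $\chi\colon A^2\to\mathbb T$ be a continuous bicharacter with $\langle x;y\rangle=\chi(x,y)\chi(y,x)$ for all $x,y\in A$, and let $B\subset A$ be a closed subgroup that is isotropic: $\langle b;b'\rangle=1$ for all $b,b'\in B$. Fix Haar measures on $B$ and $A/B$ with $\int_A h(x)\,dx=\int_{A/B}\int_B h(z+b)\,db\,dz$ for all $h\in C_c(A)$. For a bounded measurable family $(f_i)$ define $$g_i(x,y)=\chi(x,y)\int_B\hat f_i(x+b)\langle b;y\rangle\,db,\qquad \phi_i(x,y)=g_i(-y,x+y),\qquad i=0,\dots,4.$$ These are distributions on $A^2$, i.e. functionals on the space $\mathcal A$ of continuous compactly supported functions on $A^2$ with integrable Fourier transform: $g_i$ takes the value $$g_i(\theta)=\int_A f_i(\eta)\int_A\langle x;-\eta\rangle\langle x\rangle\int_B\int_A\theta(x-b,y)\chi(x-b,y)\langle b;y\rangle\,dy\,db\,dx\,d\eta ,\qquad \theta\in\mathcal A,$$ and $\phi_i(\theta)=g_i\big((x,y)\mapsto\theta(x+y,-x)\big)$.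 The identities (1) and (2) below are identities of distributions in $(x,y,u,v)\in A^4$, evaluated at products $\theta(x,y)\theta'(u,v)$ with $\theta,\theta'\in\mathcal A$. Their right-hand sides are understood by regularization: if $\tilde f_4,\tilde f_2,\tilde f_0$ are replaced by functions $k_4,k_2,k_0\in C_c(A)$, then the $g_i$ and $\phi_i$ with $i\in\{4,2,0\}$ are functions, the integrands are $B$-periodic in $z$ and integrable over $A/B$, and the right-hand side, integrated against $\theta(x,y)\theta'(u,v)$, is a number; the value of the right-hand side is the limit of these numbers as, for each $i\in\{4,2,0\}$, $\mathsf Fk_i\to f_i$ in $L^1$ on every compact set with $|\mathsf Fk_i|\le C$ everywhere, where $C$ is any constant with $|f_i|\le C$ for $i\in\{4,2,0\}$. It is part of the identities that such $k_i$ exist arbitrarily close to the limit, and that the limit exists. \textbf{Lemma.} The integrals defining $g_i(\theta)$ converge absolutely, and the integrands over $A/B$ are, for $k_i\in C_c(A)$, $B$-periodic in $z$ and integrable over $A/B$. If $(f_i)$ is of Faddeev type, then the $g_i$ are automorphic, $$g_i(x+b,y)=\chi(-y,b)g_i(x,y),\qquad g_i(x,y+b)=\chi(x,b)g_i(x,y)\qquad(b\in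 B,\ 0\le i\le 4),$$ they satisfy $$g_1(x,y)g_3(u,v)=\int_{A/B}g_4(u-z,v+z-x)\,g_2(z,y+v)\,g_0(x-z,y+z-u)\,dz,\tag{1}$$ and the $\phi_i$ satisfy the automorphic Beta pentagon identity $$\phi_1(x,y)\phi_3(u,v)=\int_{A/B}\phi_4(u+y,v-z)\,\phi_2(x+y+u+v-z,z)\,\phi_0(x+v,y-z)\,dz.\tag{2}$$ Moreover, for every bounded measurable family $(f_i)$, the identities (1) and (2) are equivalent. -/

import Mathlib

open MeasureTheory Filter Topology
open scoped ENNReal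

noncomputable section

namespace AutomorphicBeta

/-! ### Gaussian exponentials, Fourier kernel, bicharacters, isotropic subgroups -/

/-- A gaussian exponential on a locally compact abelian group `A`: a continuous even function
`⟨·⟩ : A → 𝕋` whose coboundary `⟨x;y⟩ = ⟨x+y⟩ / (⟨x⟩⟨y⟩)` is a bicharacter that identifies `A`,
as a topological group, with its Pontryagin dual. (The coboundary is symmetric, so additivity in
the first argument is enough.) -/
structure GaussianExponential (A : Type*) [AddCommGroup A] [TopologicalSpace A] where
  /-- the function `x ↦ ⟨x⟩` -/
  toFun : A → Circle
  continuous_toFun : Continuous toFun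
  map_neg : ∀ x, toFun (-x) = toFun x
  kernel_add_left : ∀ x x' y,
    toFun (x + x' + y) / (toFun (x + x') * toFun y) =
      toFun (x + y) / (toFun x * toFun y) * (toFun (x' + y) / (toFun x' * toFun y))
  selfDual : ∃ Φ : A ≃ₜ PontryaginDual (Multiplicative A),
    ∀ x y, Φ x (Multiplicative.ofAdd y) = toFun (x + y) / (toFun x * toFun y)

/-- The Fourier kernel `⟨x;y⟩ = ⟨x+y⟩ / (⟨x⟩⟨y⟩)`. -/
def GaussianExponential.kernel {A : Type*} [AddCommGroup A] [TopologicalSpace A]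
    (G : GaussianExponential A) (x y : A) : Circle :=
  G.toFun (x + y) / (G.toFun x * G.toFun y)

/-- A (continuous) bicharacter `χ : A × A → 𝕋`. -/
structure Bicharacter (A : Type*) [AddCommGroup A] [TopologicalSpace A] where
  /-- the function `(x, y) ↦ χ(x, y)` -/
  toFun : A → A → Circle
  continuous_toFun : Continuous fun p : A × A => toFun p.1 p.2
  map_add_left : ∀ x x' y, toFun (x + x') y = toFun x y * toFun x' y
  map_add_right : ∀ x y y', toFun x (y + y') = toFun x y * toFun x y'

/-- `χ` splits the Fourier kernel: `⟨x;y⟩ = χ(x,y) χ(y,x)`. -/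
def Bicharacter.Splits {A : Type*} [AddCommGroup A] [TopologicalSpace A]
    (χ : Bicharacter A) (G : GaussianExponential A) : Prop :=
  ∀ x y, G.kernel x y = χ.toFun x y * χ.toFun y x

/-- `B` is isotropic: `⟨b;b'⟩ = 1` on `B × B`. -/
def IsIsotropic {A : Type*} [AddCommGroup A] [TopologicalSpace A]
    (G : GaussianExponential A) (B : AddSubgroup A) : Prop :=
  ∀ b ∈ B, ∀ b' ∈ B, G.kernel b b' = 1

section Fourier

variable {A : Type*} [AddCommGroup A] [TopologicalSpace A] [MeasurableSpace A]

/-- `(𝖥 h)(x) = ∫ ⟨x;y⟩ h(y) dy`. -/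
def fourier (G : GaussianExponential A) (μ : Measure A) (h : A → ℂ) (x : A) : ℂ :=
  ∫ y, (G.kernel x y : ℂ) * h y ∂μ

/-- `(𝖥⁻¹ h)(x) = ∫ ⟨x;-y⟩ h(y) dy`. -/
def fourierInv (G : GaussianExponential A) (μ : Measure A) (h : A → ℂ) (x : A) : ℂ :=
  ∫ y, (G.kernel x (-y) : ℂ) * h y ∂μ

/-- The Haar measure is normalized so that the Fourier transform is isometric for the `L²`-norm
on `L¹ ∩ L²` (the self-dual Haar measure). -/
def IsSelfDualMeasure (G : GaussianExponential A) (μ : Measure A) : Prop :=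
  ∀ h : A → ℂ, Integrable h μ → MemLp h 2 μ →
    MemLp (fourier G μ h) 2 μ ∧ eLpNorm (fourier G μ h) 2 μ = eLpNorm h 2 μ

/-! ### Operators on `L²(A)` -/

/-- The subspace `L¹ ∩ L²` of `L²(A)`. -/
def integrableL2 (μ : Measure A) : Submodule ℂ (Lp ℂ 2 μ) where
  carrier := {h | Integrable h μ}
  add_mem' {a b} ha hb := (Integrable.add ha hb).congr (Lp.coeFn_add a b).symm
  zero_mem' := (integrable_zero A ℂ μ).congr (Lp.coeFn_zero ℂ 2 μ).symm
  smul_mem' c a ha := (Integrable.smul c ha).congr (Lp.coeFn_smul c a).symm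

theorem integrable_kernel_mul {G : GaussianExponential A} {μ : Measure A}
    [IsTopologicalAddGroup A] [BorelSpace A] {h : A → ℂ} (hh : Integrable h μ) (x : A) :
    Integrable (fun y => (G.kernel x y : ℂ) * h y) μ := by
  have hc : Continuous fun y => (G.kernel x y : ℂ) := by
    have h1 := G.continuous_toFun
    have h2 : Continuous fun y => G.toFun (x + y) / (G.toFun x * G.toFun y) :=
      (h1.comp (continuous_const.add continuous_id)).div' (continuous_const.mul h1)
    exact continuous_induced_dom.comp h2
  exact hh.bdd_mul (c := 1) hc.measurable.aestronglyMeasurable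
    (Eventually.of_forall fun y => (Circle.norm_coe _).le)

/-- The Fourier transform as a linear map on `L¹ ∩ L²`. -/
def fourierLin [IsTopologicalAddGroup A] [BorelSpace A] (G : GaussianExponential A)
    (μ : Measure A) (hμ : IsSelfDualMeasure G μ) : integrableL2 μ →ₗ[ℂ] Lp ℂ 2 μ where
  toFun h := (hμ h.1 h.2 (Lp.memLp h.1)).1.toLp
  map_add' a b := by
    rw [← MemLp.toLp_add]
    congr 1
    funext x
    simp only [fourier, Pi.add_apply]
    rw [← integral_add (integrable_kernel_mul a.2 x) (integrable_kernel_mul b.2 x)]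
    refine integral_congr_ae ?_
    filter_upwards [Lp.coeFn_add a.1 b.1] with y hy
    simp only [Submodule.coe_add, hy, Pi.add_apply, mul_add]
  map_smul' c a := by
    rw [RingHom.id_apply, ← MemLp.toLp_const_smul]
    congr 1
    funext x
    simp only [fourier, Pi.smul_apply, smul_eq_mul]
    rw [← integral_const_mul]
    refine integral_congr_ae ?_
    filter_upwards [Lp.coeFn_smul c a.1] with y hy
    simp only [Submodule.coe_smul, hy, Pi.smul_apply, smul_eq_mul]
    ring

theorem norm_fourierLin [IsTopologicalAddGroup A] [BorelSpace A] (G : GaussianExponential A)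
    (μ : Measure A) (hμ : IsSelfDualMeasure G μ) (h : integrableL2 μ) :
    ‖fourierLin G μ hμ h‖ = ‖(h : Lp ℂ 2 μ)‖ := by
  change ‖(hμ h.1 h.2 (Lp.memLp h.1)).1.toLp‖ = _
  rw [Lp.norm_toLp, (hμ h.1 h.2 (Lp.memLp h.1)).2, ← Lp.norm_def]

set_option linter.unusedSectionVars false in
theorem dense_integrableL2 (μ : Measure A) :
    DenseRange (integrableL2 μ).subtype := by
  have h := Lp.simpleFunc.dense (E := ℂ) (μ := μ) (p := 2) (by norm_num)
  refine Dense.mono ?_ h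
  rintro f hf
  refine ⟨⟨f, ?_⟩, rfl⟩
  have h1 := Lp.simpleFunc.memLp (⟨f, hf⟩ : Lp.simpleFunc ℂ 2 μ)
  have h2 := (SimpleFunc.memLp_iff_integrable (by norm_num) (by norm_num)).1 h1
  exact h2.congr (Lp.simpleFunc.toSimpleFunc_eq_toFun (⟨f, hf⟩ : Lp.simpleFunc ℂ 2 μ))

/-- The Fourier operator `𝖥` on `L²(A)`, with integral kernel `⟨x;y⟩`: the continuous extension of
the Fourier transform from `L¹ ∩ L²`. -/
def fourierOp [IsTopologicalAddGroup A] [BorelSpace A] (G : GaussianExponential A)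
    (μ : Measure A) (hμ : IsSelfDualMeasure G μ) : Lp ℂ 2 μ →L[ℂ] Lp ℂ 2 μ :=
  (fourierLin G μ hμ).extendOfNorm (integrableL2 μ).subtype

theorem fourierOp_apply [IsTopologicalAddGroup A] [BorelSpace A] (G : GaussianExponential A)
    (μ : Measure A) (hμ : IsSelfDualMeasure G μ) (h : Lp ℂ 2 μ) (hh : Integrable h μ) :
    fourierOp G μ hμ h =ᵐ[μ] fourier G μ h := by
  have h1 : fourierOp G μ hμ h = fourierLin G μ hμ ⟨h, hh⟩ :=
    LinearMap.extendOfNorm_eq (dense_integrableL2 μ)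
      ⟨1, fun x => by rw [norm_fourierLin, one_mul]; rfl⟩ ⟨h, hh⟩
  rw [h1]
  exact MemLp.coeFn_toLp (hμ h hh (Lp.memLp h)).1

open Classical in
/-- `f(𝗊)`: multiplication by the (essentially bounded) function `f` on `L²(A)`. -/
def opQ (μ : Measure A) (f : A → ℂ) : Lp ℂ 2 μ →L[ℂ] Lp ℂ 2 μ :=
  if hf : MemLp f ∞ μ then
    (ContinuousLinearMap.mul ℂ ℂ).holderL μ ∞ 2 2 hf.toLp
  else 0

set_option linter.unusedSectionVars false in
theorem opQ_apply (μ : Measure A) {f : A → ℂ} (hf : MemLp f ∞ μ) (h : Lp ℂ 2 μ) :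
    opQ μ f h =ᵐ[μ] fun x => f x * h x := by
  rw [opQ, dif_pos hf]
  refine ((ContinuousLinearMap.mul ℂ ℂ).coeFn_holder (r := 2) hf.toLp h).trans ?_
  filter_upwards [hf.coeFn_toLp] with x hx
  simp [hx]

/-- `f(𝗉) = 𝖥 f(𝗊) 𝖥*`. -/
def opP [IsTopologicalAddGroup A] [BorelSpace A] (G : GaussianExponential A)
    (μ : Measure A) (hμ : IsSelfDualMeasure G μ) (f : A → ℂ) : Lp ℂ 2 μ →L[ℂ] Lp ℂ 2 μ :=
  fourierOp G μ hμ ∘L opQ μ f ∘L ContinuousLinearMap.adjoint (fourierOp G μ hμ)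

/-- `f(𝗉+𝗊) = ⟨𝗊⟩* f(𝗉) ⟨𝗊⟩`. -/
def opPQ [IsTopologicalAddGroup A] [BorelSpace A] (G : GaussianExponential A)
    (μ : Measure A) (hμ : IsSelfDualMeasure G μ) (f : A → ℂ) : Lp ℂ 2 μ →L[ℂ] Lp ℂ 2 μ :=
  ContinuousLinearMap.adjoint (opQ μ fun x => (G.toFun x : ℂ)) ∘L opP G μ hμ f ∘L
    opQ μ fun x => (G.toFun x : ℂ)

/-- A bounded (measurable) function `[4] × A → ℂ`. -/
def IsBoundedFamily (f : Fin 5 → A → ℂ) : Prop :=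
  (∀ i, Measurable (f i)) ∧ ∃ C : ℝ, ∀ i x, ‖f i x‖ ≤ C

/-- The operator pentagon relation `f₁(𝗉) f₃(𝗊) = f₄(𝗊) f₂(𝗉+𝗊) f₀(𝗉)`. -/
def IsFaddeevType [IsTopologicalAddGroup A] [BorelSpace A] (G : GaussianExponential A)
    (μ : Measure A) (hμ : IsSelfDualMeasure G μ) (f : Fin 5 → A → ℂ) : Prop :=
  IsBoundedFamily f ∧
    opP G μ hμ (f 1) ∘L opQ μ (f 3) = opQ μ (f 4) ∘L opPQ G μ hμ (f 2) ∘L opP G μ hμ (f 0)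

/-! ### Test functions on `A × A` and the distributions `gᵢ`, `φᵢ` -/

/-- Test functions on `A × A`: continuous compactly supported functions with integrable Fourier
transform. They contain the smooth compactly supported (Bruhat) functions; functionals on them
are known as quasimeasures. -/
def IsTest (G : GaussianExponential A) (μ : Measure A) (θ : A × A → ℂ) : Prop :=
  Continuous θ ∧ HasCompactSupport θ ∧
    ∫⁻ ξ, ∫⁻ η, ‖∫ x, ∫ y, (G.kernel x ξ : ℂ) * (G.kernel y η : ℂ) * θ (x, y) ∂μ ∂μ‖ₑ ∂μ ∂μ < ∞

variable {B : AddSubgroup A}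

/-- The transpose, applied to `θ`, of the operation
`\hat f ↦ χ(x,y) ∫_B \hat f(x+b) ⟨b;y⟩ db`, namely
`x ↦ ∫_B ∫_A θ(x-b,y) χ(x-b,y) ⟨b;y⟩ dy db`. -/
def transposeTest (G : GaussianExponential A) (χ : Bicharacter A) (μ : Measure A)
    (ν : Measure B) (θ : A × A → ℂ) (x : A) : ℂ :=
  ∫ b : B, ∫ y, θ (x - b, y) * (χ.toFun (x - b) y : ℂ) * (G.kernel b y : ℂ) ∂μ ∂ν

/-- The distribution `g(x,y) = χ(x,y) ∫_B \hat f(x+b) ⟨b;y⟩ db` on `A × A`, evaluated at a test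
function `θ`. Here `\hat f(x) = ⟨x⟩ \tilde f(x)`, and `\tilde f = 𝖥⁻¹ f` is the distribution
`P ↦ ∫ f(η) (∫ ⟨x;-η⟩ P(x) dx) dη`. -/
def gDist (G : GaussianExponential A) (χ : Bicharacter A) (μ : Measure A)
    (ν : Measure B) (f : A → ℂ) (θ : A × A → ℂ) : ℂ :=
  ∫ η, f η * fourierInv G μ (fun x => (G.toFun x : ℂ) * transposeTest G χ μ ν θ x) η ∂μ

/-- All integrals in the definition of `gDist` at `θ` converge absolutely, for every bounded
measurable `f`. -/
def GDistConverges (G : GaussianExponential A) (χ : Bicharacter A) (μ : Measure A)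
    (ν : Measure B) (θ : A × A → ℂ) : Prop :=
  (∀ (x : A) (b : B), Integrable
      (fun y => θ (x - b, y) * (χ.toFun (x - b) y : ℂ) * (G.kernel b y : ℂ)) μ) ∧
  (∀ x : A, Integrable
      (fun b : B => ∫ y, θ (x - b, y) * (χ.toFun (x - b) y : ℂ) * (G.kernel b y : ℂ) ∂μ) ν) ∧
  Integrable (fun x => (G.toFun x : ℂ) * transposeTest G χ μ ν θ x) μ ∧
  Integrable
    (fourierInv G μ (fun x => (G.toFun x : ℂ) * transposeTest G χ μ ν θ x)) μ

/-- Automorphicity of a distribution `T` on `A × A`: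
`T(x+b,y) = χ(-y,b) T(x,y)` and `T(x,y+b) = χ(x,b) T(x,y)` for `b ∈ B`. -/
def IsAutomorphic (G : GaussianExponential A) (χ : Bicharacter A) (μ : Measure A)
    (B : AddSubgroup A) (T : (A × A → ℂ) → ℂ) : Prop :=
  ∀ θ, IsTest G μ θ → ∀ b ∈ B,
    T (fun p => θ (p.1 - b, p.2)) = T (fun p => (χ.toFun (-p.2) b : ℂ) * θ p) ∧
    T (fun p => θ (p.1, p.2 - b)) = T (fun p => (χ.toFun p.1 b : ℂ) * θ p)

/-- The distribution `φ(x,y) = g(-y,x+y)` on `A × A`, evaluated at `θ`. -/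
def phiDist (G : GaussianExponential A) (χ : Bicharacter A) (μ : Measure A)
    (ν : Measure B) (f : A → ℂ) (θ : A × A → ℂ) : ℂ :=
  gDist G χ μ ν f fun p => θ (p.1 + p.2, -p.1)

/-! ### The integral identities -/

/-- `g(x,y) = χ(x,y) ∫_B \hat f(x+b) ⟨b;y⟩ db` when `\tilde f = k` is an honest function. -/
def gFun (G : GaussianExponential A) (χ : Bicharacter A) (ν : Measure B)
    (k : A → ℂ) (x y : A) : ℂ :=
  (χ.toFun x y : ℂ) *
    ∫ b : B, k (x + b) * (G.toFun (x + b) : ℂ) * (G.kernel b y : ℂ) ∂ν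

/-- `φ(x,y) = g(-y,x+y)` when `\tilde f = k` is an honest function. -/
def phiFun (G : GaussianExponential A) (χ : Bicharacter A) (ν : Measure B)
    (k : A → ℂ) (x y : A) : ℂ :=
  gFun G χ ν k (-y) (x + y)

/-- `g₄(u-z,v+z-x) g₂(z,y+v) g₀(x-z,y+z-u)`, a function of `z`. -/
def gIntegrand (G : GaussianExponential A) (χ : Bicharacter A) (ν : Measure B)
    (k₄ k₂ k₀ : A → ℂ) (x y u v z : A) : ℂ :=
  gFun G χ ν k₄ (u - z) (v + z - x) * gFun G χ ν k₂ z (y + v) *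
    gFun G χ ν k₀ (x - z) (y + z - u)

/-- `φ₄(u+y,v-z) φ₂(x+y+u+v-z,z) φ₀(x+v,y-z)`, a function of `z`. -/
def phiIntegrand (G : GaussianExponential A) (χ : Bicharacter A) (ν : Measure B)
    (k₄ k₂ k₀ : A → ℂ) (x y u v z : A) : ℂ :=
  phiFun G χ ν k₄ (u + y) (v - z) * phiFun G χ ν k₂ (x + y + u + v - z) z *
    phiFun G χ ν k₀ (x + v) (y - z)

/-- The integral over `A/B` of a `B`-periodic function on `A`, computed with representatives. -/
def quotientIntegral [MeasurableSpace (A ⧸ B)] (ρ : Measure (A ⧸ B)) (J : A → ℂ) : ℂ :=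
  ∫ z : A ⧸ B, J z.out ∂ρ

/-- The measures on `A`, `B` and `A/B` are normalized compatibly:
`∫_A h = ∫_{A/B} ∫_B h(z+b) db dz`. -/
def WeilFormula [MeasurableSpace (A ⧸ B)] (μ : Measure A) (ν : Measure B)
    (ρ : Measure (A ⧸ B)) : Prop :=
  ∀ h : A → ℂ, Continuous h → HasCompactSupport h →
    ∫ x, h x ∂μ = quotientIntegral ρ fun z => ∫ b : B, h (z + b) ∂ν

/-- The integrand, built from honest functions `kᵢ ∈ C_c(A)`, is `B`-periodic in `z` and
integrable over `A/B`. -/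
def QuotientIntegrable [MeasurableSpace (A ⧸ B)] (ρ : Measure (A ⧸ B))
    (J : (A → ℂ) → (A → ℂ) → (A → ℂ) → A → A → A → A → A → ℂ) : Prop :=
  ∀ k₄ k₂ k₀ : A → ℂ, Continuous k₄ → HasCompactSupport k₄ → Continuous k₂ →
    HasCompactSupport k₂ → Continuous k₀ → HasCompactSupport k₀ → ∀ x y u v : A,
      (∀ z, ∀ b ∈ B, J k₄ k₂ k₀ x y u v (z + b) = J k₄ k₂ k₀ x y u v z) ∧
      Integrable (fun z : A ⧸ B => J k₄ k₂ k₀ x y u v z.out) ρ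

/-- Regularizations of the distribution `\tilde f = 𝖥⁻¹ f`, for a function `f` bounded by `C`:
functions `k ∈ C_c(A)` whose Fourier transform is bounded by `C` and approaches `f` in
`L¹` on every compact set. -/
def regularizations (G : GaussianExponential A) (μ : Measure A) (C : ℝ) (f : A → ℂ) :
    Filter (A → ℂ) :=
  ⨅ (K : Set A) (_ : IsCompact K) (ε : ℝ) (_ : 0 < ε),
    𝓟 {k | Continuous k ∧ HasCompactSupport k ∧ (∀ y, ‖fourier G μ k y‖ ≤ C) ∧
      ∫ y in K, ‖fourier G μ k y - f y‖ ∂μ < ε}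

/-- The value `c` of a trilinear expression `T` in the distributions `\tilde f₄, \tilde f₂,
\tilde f₀`: it is the limit of the values of `T` at regularizations, for all regularizations. -/
def HasRegularizedValue (G : GaussianExponential A) (μ : Measure A)
    (T : (A → ℂ) → (A → ℂ) → (A → ℂ) → ℂ) (f₄ f₂ f₀ : A → ℂ) (c : ℂ) : Prop :=
  ∀ C : ℝ, (∀ x, ‖f₄ x‖ ≤ C) → (∀ x, ‖f₂ x‖ ≤ C) → (∀ x, ‖f₀ x‖ ≤ C) →
    (regularizations G μ C f₄ ×ˢ regularizations G μ C f₂ ×ˢ regularizations G μ C f₀).NeBot ∧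
    Tendsto (fun k : (A → ℂ) × (A → ℂ) × (A → ℂ) => T k.1 k.2.1 k.2.2)
      (regularizations G μ C f₄ ×ˢ regularizations G μ C f₂ ×ˢ regularizations G μ C f₀) (𝓝 c)

/-- The identity of distributions in `(x,y,u,v) ∈ A⁴`
`g₁(x,y) g₃(u,v) = ∫_{A/B} g₄(u-z,v+z-x) g₂(z,y+v) g₀(x-z,y+z-u) dz`,
evaluated at `θ(x,y) θ'(u,v)`. -/
def IntegralIdentity [MeasurableSpace (A ⧸ B)] (G : GaussianExponential A) (χ : Bicharacter A)
    (μ : Measure A) (ν : Measure B) (ρ : Measure (A ⧸ B)) (f : Fin 5 → A → ℂ) : Prop :=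
  ∀ θ θ' : A × A → ℂ, IsTest G μ θ → IsTest G μ θ' →
    HasRegularizedValue G μ
      (fun k₄ k₂ k₀ => ∫ x, ∫ y, ∫ u, ∫ v, θ (x, y) * θ' (u, v) *
        quotientIntegral ρ (gIntegrand G χ ν k₄ k₂ k₀ x y u v) ∂μ ∂μ ∂μ ∂μ)
      (f 4) (f 2) (f 0) (gDist G χ μ ν (f 1) θ * gDist G χ μ ν (f 3) θ')

/-- The automorphic Beta pentagon identity, an identity of distributions in `(x,y,u,v) ∈ A⁴`:
`φ₁(x,y) φ₃(u,v) = ∫_{A/B} φ₄(u+y,v-z) φ₂(x+y+u+v-z,z) φ₀(x+v,y-z) dz`,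
evaluated at `θ(x,y) θ'(u,v)`. -/
def BetaPentagon [MeasurableSpace (A ⧸ B)] (G : GaussianExponential A) (χ : Bicharacter A)
    (μ : Measure A) (ν : Measure B) (ρ : Measure (A ⧸ B)) (f : Fin 5 → A → ℂ) : Prop :=
  ∀ θ θ' : A × A → ℂ, IsTest G μ θ → IsTest G μ θ' →
    HasRegularizedValue G μ
      (fun k₄ k₂ k₀ => ∫ x, ∫ y, ∫ u, ∫ v, θ (x, y) * θ' (u, v) *
        quotientIntegral ρ (phiIntegrand G χ ν k₄ k₂ k₀ x y u v) ∂μ ∂μ ∂μ ∂μ)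
      (f 4) (f 2) (f 0) (phiDist G χ μ ν (f 1) θ * phiDist G χ μ ν (f 3) θ')

end Fourier

end AutomorphicBeta

end

open scoped Pointwise NNReal

set_option linter.unusedSectionVars false

noncomputable section

namespace AutomorphicBeta

/-! ### Integrals of compactly supported continuous functions -/

/-! Let `T_x` be the translation `h ↦ h(·+x)`. An operator on `L²(A)` that superposes the operators
`h ↦ ⟨u;·+x⟩ T_x h` with weight `E(x,u)` is said to have the symbol `E` (`HasSymbol`). If `fᵢ = 𝖥kᵢ`
with `kᵢ ∈ C_c(A)`, then `f₁(𝗉)f₃(𝗊)` has the symbol `k₁(x)k₃(u)` (`hasSymbol_opP_opQ`), and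
`f₄(𝗊)f₂(𝗉+𝗊)f₀(𝗉)` has the symbol `tripleKernel` (`hasSymbol_tripleKernel`).

On the other side, let `P(x) = ⟨x⟩ t(x)` with `t` the transpose of the test function `θ`
(`phaseTranspose`), and `P'` likewise for `θ'`. Since `g₂` is itself a sum over `B`, Weil's formula
unfolds the integral over `A/B` to one over `A`. An identity of phases (`unfolded_phase`), in which
the splitting by `χ` and the isotropy of `B` enter, then shows that the regularized right-hand side
of the integral identity is `∫∫ P(x) P'(u) tripleKernel(x,u) dx du` (`integral_gIntegrand`). The
left-hand side is, for regularized `f₁, f₃`, the same pairing with `k₁(x)k₃(u)`. Formally the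
integral identity therefore says that equal operators have equal symbols.

For bounded `fᵢ` the symbols are only distributions, and regularizations converge only strongly,
with bounded norms (`tendsto_opP_opQ`, `tendsto_opQ_opPQ_opP`). What has to be shown is that the
pairing of the symbol with `P ⊗ P'` is strongly continuous on bounded sets of operators. Put `q =
𝖥⁻¹P'`. Matrix elements of the operator between the packets `⟨·;η⟩ h₂(·-s+a)` and `⟨·;η⟩ q h₁(·-s)`,
integrated over `s`, give the pairing of the symbol with `⟨x;η⟩ P'(u)` times an overlap of windows
at `x - a`; a superposition over `a ∈ B` and over `η`, whose coefficients come from the Fourier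
transforms of the sections of `θ`, recovers `P(x) P'(u)`. Truncating to compact sets changes the
result by at most `ε` times the bound on the operator (`PacketData.exists_packetSum_close`), and a
truncated superposition is strongly continuous since it involves only a compact set of packets
(`PacketData.tendsto_packetSum`). `tendsto_integral_tripleKernel` combines the two.

The truncation needs two absolute convergences: of the transforms of the sections, jointly in `a`
and `η` (`exists_sectionTransform_bound`), and of the local norms `‖q h₁(·-s)‖₂` in `s`
(`IsAmalgamWindow.exists_localNorm_bound`). Both, and the convergence of the integrals defining
`gᵢ(θ)`, follow from one estimate, `IsWindow.exists_bound`: the sections of `θ`, paired with a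
family `e_a`, are bounded by the supremum of the windowed Fourier transforms of the `e_a`. Its proof
replaces the quadratic phase `⟨x⟩χ(x,y)` by a superposition of characters cut off by windows, and
uses the integrability of the Fourier transform of `θ`.

The automorphy is a substitution in the transposes. The two identities are equivalent because `(x,y)
↦ (x+y,-x)` preserves Haar measure and test functions and has finite order.

The group need not be σ-compact, so Haar measure need not be σ-finite. Interchanges of integrals are
made for continuous functions with compact support, after inserting cutoffs or summability kernels.
-/

theorem exists_of_integral_ne_zero {X E : Type*} [MeasurableSpace X] {μ : Measure X}
    [NormedAddCommGroup E] [NormedSpace ℝ E] {f : X → E} (h : ∫ x, f x ∂μ ≠ 0) :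
    ∃ x, f x ≠ 0 := by
  by_contra! h0
  exact h (by simp [h0])

section CompactSupport

variable {X Y Z E : Type*} [TopologicalSpace X] [TopologicalSpace Y] [TopologicalSpace Z]
  [NormedAddCommGroup E]

/-- Compact support, phrased through a compact set containing the support. -/
theorem hasCompactSupport_of_ne [T2Space X] {F : Type*} [Zero F] {f : X → F} {K : Set X}
    (hK : IsCompact K) (h : ∀ x, f x ≠ 0 → x ∈ K) : HasCompactSupport f :=
  HasCompactSupport.intro hK fun x hx => by
    by_contra h0
    exact hx (h x h0)

/-- Supports are tracked as implications `f x ≠ 0 → x ∈ K`. In this form they pass through products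
by `left_ne_zero_of_mul` and `right_ne_zero_of_mul`, and through integrals by
`exists_of_integral_ne_zero`. -/
theorem exists_compact_of_hasCompactSupport {F : Type*} [Zero F] {f : X → F}
    (hf : HasCompactSupport f) : ∃ K : Set X, IsCompact K ∧ ∀ x, f x ≠ 0 → x ∈ K :=
  ⟨tsupport f, hf, fun _ hx => subset_tsupport f hx⟩

theorem exists_compact_prod_of_hasCompactSupport {F : Type*} [Zero F] {f : X × Y → F}
    (hf : HasCompactSupport f) : ∃ (K : Set X) (L : Set Y), IsCompact K ∧ IsCompact L ∧
      ∀ x y, f (x, y) ≠ 0 → x ∈ K ∧ y ∈ L :=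
  ⟨Prod.fst '' tsupport f, Prod.snd '' tsupport f, hf.image continuous_fst,
    hf.image continuous_snd, fun _ _ hx => ⟨⟨_, subset_tsupport f hx, rfl⟩,
      ⟨_, subset_tsupport f hx, rfl⟩⟩⟩

theorem exists_cutoff [T2Space X] [LocallyCompactSpace X] {K : Set X} (hK : IsCompact K) :
    ∃ κ : X → ℝ, Continuous κ ∧ HasCompactSupport κ ∧ (∀ x, 0 ≤ κ x) ∧ (∀ x, κ x ≤ 1) ∧
      ∀ x ∈ K, κ x = 1 := by
  obtain ⟨f, h1, -, h3, h4⟩ := exists_continuous_one_zero_of_isCompact (X := X) hK isClosed_empty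
    (Set.disjoint_empty K)
  exact ⟨f, f.continuous, h3, fun x => (h4 x).1, fun x => (h4 x).2, fun x hx => h1 hx⟩

variable [MeasurableSpace X] [MeasurableSpace Y] [OpensMeasurableSpace X] [OpensMeasurableSpace Y]
  {μ : Measure X} {ν : Measure Y} [IsFiniteMeasureOnCompacts μ] [IsFiniteMeasureOnCompacts ν]

theorem integrable_of_ne [T2Space X] {f : X → E} (hf : Continuous f) {K : Set X}
    (hK : IsCompact K) (h : ∀ x, f x ≠ 0 → x ∈ K) : Integrable f μ :=
  hf.integrable_of_hasCompactSupport (hasCompactSupport_of_ne hK h)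

variable [NormedSpace ℝ E]

/-- The version of Fubini's theorem on which the interchanges below rest: compact support takes the
place of σ-finiteness. -/
theorem integral_swap_of_ne [T2Space X] [T2Space Y] {f : X → Y → E}
    (hf : Continuous fun p : X × Y => f p.1 p.2)
    {K : Set X} {L : Set Y} (hK : IsCompact K) (hL : IsCompact L)
    (h : ∀ x y, f x y ≠ 0 → x ∈ K ∧ y ∈ L) :
    ∫ x, ∫ y, f x y ∂ν ∂μ = ∫ y, ∫ x, f x y ∂μ ∂ν :=
  integral_integral_swap_of_hasCompactSupport hf
    (hasCompactSupport_of_ne (hK.prod hL) fun p hp => h p.1 p.2 hp)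

theorem continuous_integral_of_locally {f : Z → Y → E}
    (hf : Continuous fun p : Z × Y => f p.1 p.2)
    (h : ∀ z₀, ∃ U ∈ 𝓝 z₀, ∃ L : Set Y, IsCompact L ∧ ∀ z ∈ U, ∀ y, f z y ≠ 0 → y ∈ L) :
    Continuous fun z => ∫ y, f z y ∂ν := by
  rw [continuous_iff_continuousAt]
  intro z₀
  obtain ⟨U, hU, L, hL, hfL⟩ := h z₀
  refine ContinuousOn.continuousAt ?_ hU
  refine continuousOn_integral_of_compact_support hL (f := f) (hf.continuousOn) ?_
  intro p x hp hx
  by_contra h0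
  exact hx (hfL p hp x h0)

theorem continuous_integral_of_ne {f : Z → Y → E}
    (hf : Continuous fun p : Z × Y => f p.1 p.2) {L : Set Y} (hL : IsCompact L)
    (h : ∀ z y, f z y ≠ 0 → y ∈ L) :
    Continuous fun z => ∫ y, f z y ∂ν :=
  continuous_integral_of_locally hf fun _ => ⟨Set.univ, univ_mem, L, hL, fun z _ y => h z y⟩

end CompactSupport

/-! ### Integrability of continuous functions via compactly supported weights -/

/-- A test function that nearly recovers `κ ‖f‖` when multiplied with `f`. -/
theorem exists_phase {Y : Type*} [TopologicalSpace Y] {f : Y → ℂ} (hf : Continuous f) {κ : Y → ℝ} (hκ : Continuous κ)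
    (hκc : HasCompactSupport κ) (hκ0 : ∀ y, 0 ≤ κ y) (hκ1 : ∀ y, κ y ≤ 1) {δ : ℝ} (hδ : 0 < δ) :
    ∃ (g : Y → ℂ) (s : Y → ℝ), Continuous g ∧ HasCompactSupport g ∧ (∀ y, ‖g y‖ ≤ 1) ∧
      Continuous s ∧ HasCompactSupport s ∧
      (∀ y, f y * g y = (s y : ℂ)) ∧ ∀ y, κ y * ‖f y‖ ≤ s y + δ * κ y := by
  have hpos : ∀ y, 0 < ‖f y‖ + δ := fun y => by positivity
  have hc1 : Continuous fun y => κ y / (‖f y‖ + δ) := by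
    refine hκ.div (by fun_prop) fun y => (hpos y).ne'
  refine ⟨fun y => ((κ y / (‖f y‖ + δ) : ℝ) : ℂ) * (starRingEnd ℂ) (f y),
    fun y => κ y / (‖f y‖ + δ) * ‖f y‖ ^ 2, ?_, ?_, ?_, ?_, ?_, ?_, ?_⟩
  · exact (Complex.continuous_ofReal.comp hc1).mul (Complex.continuous_conj.comp hf)
  · refine hκc.mono fun y hy => ?_
    simp only [Function.mem_support] at hy ⊢
    contrapose! hy
    simp [hy]
  · intro y
    rw [norm_mul, Complex.norm_real, RCLike.norm_conj, Real.norm_eq_abs,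
      abs_of_nonneg (div_nonneg (hκ0 y) (hpos y).le), div_mul_eq_mul_div, div_le_one (hpos y)]
    nlinarith [norm_nonneg (f y), hκ1 y]
  · fun_prop
  · refine hκc.mono fun y hy => ?_
    simp only [Function.mem_support] at hy ⊢
    contrapose! hy
    simp [hy]
  · intro y
    rw [mul_left_comm, Complex.mul_conj, Complex.normSq_eq_norm_sq]
    push_cast
    ring
  · intro y
    have h2 : κ y / (‖f y‖ + δ) * ‖f y‖ ^ 2 + δ * κ y - κ y * ‖f y‖
        = κ y * δ ^ 2 / (‖f y‖ + δ) := by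
      field_simp [(hpos y).ne']
      ring
    have h3 : 0 ≤ κ y * δ ^ 2 / (‖f y‖ + δ) :=
      div_nonneg (mul_nonneg (hκ0 y) (sq_nonneg _)) (hpos y).le
    linarith

section Integrability

variable {Y E : Type*} [TopologicalSpace Y] [T2Space Y] [LocallyCompactSpace Y]
  [MeasurableSpace Y] [BorelSpace Y] {μ : Measure Y} [μ.Regular] [NormedAddCommGroup E]

theorem setLIntegral_le_of_cutoff {f : Y → E} (hf : Continuous f) {M : ℝ}
    (h : ∀ κ : Y → ℝ, Continuous κ → HasCompactSupport κ → (∀ y, 0 ≤ κ y) → (∀ y, κ y ≤ 1) →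
      ∫ y, κ y * ‖f y‖ ∂μ ≤ M) {K : Set Y} (hK : IsCompact K) :
    ∫⁻ y in K, ‖f y‖ₑ ∂μ ≤ ENNReal.ofReal M := by
  obtain ⟨κ, h1, h2, h3, h4, h5⟩ := exists_cutoff hK
  have hint : Integrable (fun y => κ y * ‖f y‖) μ :=
    (h1.mul hf.norm).integrable_of_hasCompactSupport h2.mul_right
  calc ∫⁻ y in K, ‖f y‖ₑ ∂μ ≤ ∫⁻ y in K, ENNReal.ofReal (κ y * ‖f y‖) ∂μ := by
        refine setLIntegral_mono' hK.measurableSet fun y hy => ?_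
        rw [h5 y hy, one_mul, ofReal_norm]
    _ ≤ ∫⁻ y, ENNReal.ofReal (κ y * ‖f y‖) ∂μ := setLIntegral_le_lintegral _ _
    _ = ENNReal.ofReal (∫ y, κ y * ‖f y‖ ∂μ) :=
        (ofReal_integral_eq_lintegral_ofReal hint
          (Eventually.of_forall fun y => mul_nonneg (h3 y) (norm_nonneg _))).symm
    _ ≤ ENNReal.ofReal M := ENNReal.ofReal_le_ofReal (h κ h1 h2 h3 h4)

/-- A continuous function is integrable as soon as its integrals against compactly supported
weights with values in `[0, 1]` are bounded. -/
theorem integrable_of_cutoff {f : Y → E} (hf : Continuous f) {M : ℝ}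
    (h : ∀ κ : Y → ℝ, Continuous κ → HasCompactSupport κ → (∀ y, 0 ≤ κ y) → (∀ y, κ y ≤ 1) →
      ∫ y, κ y * ‖f y‖ ∂μ ≤ M) :
    Integrable f μ ∧ ∫ y, ‖f y‖ ∂μ ≤ M := by
  have hM : 0 ≤ M := by
    simpa using h 0 continuous_zero HasCompactSupport.zero (fun _ => le_rfl)
      (fun _ => zero_le_one)
  have hKle := fun {K : Set Y} (hK : IsCompact K) => setLIntegral_le_of_cutoff hf h hK
  -- Inner regularity on open sets and Chebyshev's inequality give the superlevel sets `V n` finite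
  -- measure, and compact sets then exhaust each of them up to a null set. The union `S` of these
  -- compact sets is σ-compact and carries `f` almost everywhere, which yields measurability (`E`
  -- need not be separable) as well as the bound.
  set V : ℕ → Set Y := fun n => {y | (1 : ℝ) / (n + 1) < ‖f y‖} with hV
  have hVo : ∀ n, IsOpen (V n) := fun n => isOpen_lt continuous_const hf.norm
  have hVfin : ∀ n, μ (V n) ≠ ∞ := by
    intro n
    have hpos : (0 : ℝ) < 1 / (n + 1) := by positivity
    have key : ENNReal.ofReal (1 / (n + 1)) * μ (V n) ≤ ENNReal.ofReal M := by
      rw [(hVo n).measure_eq_iSup_isCompact, ENNReal.mul_iSup]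
      refine iSup_le fun K => ?_
      rw [ENNReal.mul_iSup]
      refine iSup_le fun hKV => ?_
      rw [ENNReal.mul_iSup]
      refine iSup_le fun hK => ?_
      calc ENNReal.ofReal (1 / (n + 1)) * μ K = ∫⁻ _ in K, ENNReal.ofReal (1 / (n + 1)) ∂μ := by
            rw [setLIntegral_const]
        _ ≤ ∫⁻ y in K, ‖f y‖ₑ ∂μ := by
            refine setLIntegral_mono' hK.measurableSet fun y hy => ?_
            rw [← ofReal_norm]
            exact ENNReal.ofReal_le_ofReal (le_of_lt (hKV hy))
        _ ≤ _ := hKle hK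
    intro htop
    rw [htop, ENNReal.mul_top (by simpa using hpos)] at key
    exact absurd key (by simp)
  have hex : ∀ n m : ℕ, ∃ K ⊆ V n, IsCompact K ∧ μ (V n \ K) < (m + 1 : ℝ≥0∞)⁻¹ := by
    intro n m
    exact (hVo n).measurableSet.exists_isCompact_sdiff_lt (hVfin n) (by simp)
  choose K hKV hKc hKm using hex
  set C : ℕ → Set Y := fun j =>
    ⋃ n ∈ Finset.range (j + 1), ⋃ m ∈ Finset.range (j + 1), K n m with hC
  have hCc : ∀ j, IsCompact (C j) := fun j =>
    (Finset.range (j + 1)).isCompact_biUnion fun n _ =>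
      (Finset.range (j + 1)).isCompact_biUnion fun m _ => hKc n m
  have hCmono : Monotone C := by
    intro i j hij y hy
    simp only [hC, Set.mem_iUnion, Finset.mem_range] at hy ⊢
    obtain ⟨n, hn, m, hm, hy⟩ := hy
    exact ⟨n, by omega, m, by omega, hy⟩
  set S := ⋃ j, C j with hS
  have hSm : MeasurableSet S := MeasurableSet.iUnion fun j => (hCc j).measurableSet
  have hKS : ∀ n m, K n m ⊆ S := by
    intro n m y hy
    refine Set.mem_iUnion.2 ⟨max n m, ?_⟩
    simp only [hC, Set.mem_iUnion, Finset.mem_range]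
    exact ⟨n, by omega, m, by omega, hy⟩
  have hnull : μ {y | y ∉ S ∧ f y ≠ 0} = 0 := by
    have hsub : {y | y ∉ S ∧ f y ≠ 0} ⊆ ⋃ n, (V n \ ⋃ m, K n m) := by
      rintro y ⟨hyS, hy⟩
      obtain ⟨n, hn⟩ := exists_nat_one_div_lt (norm_pos_iff.2 hy)
      refine Set.mem_iUnion.2 ⟨n, hn, fun hyK => ?_⟩
      obtain ⟨m, hm⟩ := Set.mem_iUnion.1 hyK
      exact hyS (hKS n m hm)
    refine measure_mono_null hsub (measure_iUnion_null fun n => ?_)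
    refine le_antisymm (ENNReal.le_of_forall_pos_le_add fun ε hε _ => ?_) zero_le
    obtain ⟨m, hm⟩ := ENNReal.exists_inv_nat_lt (show (ε : ℝ≥0∞) ≠ 0 by simpa using hε.ne')
    calc μ (V n \ ⋃ m, K n m) ≤ μ (V n \ K n m) :=
          measure_mono (Set.sdiff_subset_sdiff_right (Set.subset_iUnion _ m))
      _ ≤ (m + 1 : ℝ≥0∞)⁻¹ := (hKm n m).le
      _ ≤ (m : ℝ≥0∞)⁻¹ := ENNReal.inv_le_inv.2 le_self_add
      _ ≤ 0 + ε := by rw [zero_add]; exact hm.le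
  have hae : S.indicator f =ᵐ[μ] f := by
    rw [Filter.EventuallyEq, ae_iff]
    refine measure_mono_null ?_ hnull
    intro y hy
    by_cases hyS : y ∈ S
    · exact absurd (Set.indicator_of_mem hyS f) hy
    · refine ⟨hyS, fun h0 => hy ?_⟩
      rw [Set.indicator_of_notMem hyS, h0]
  have hmeas : AEStronglyMeasurable f μ := by
    refine AEStronglyMeasurable.congr ?_ hae
    rw [aestronglyMeasurable_indicator_iff hSm, hS, aestronglyMeasurable_iUnion_iff]
    intro j
    exact hf.continuousOn.aestronglyMeasurable_of_isCompact (hCc j) (hCc j).measurableSet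
  have hle : ∫⁻ y, ‖f y‖ₑ ∂μ ≤ ENNReal.ofReal M := by
    calc ∫⁻ y, ‖f y‖ₑ ∂μ = ∫⁻ y, S.indicator (fun y => ‖f y‖ₑ) y ∂μ := by
          refine lintegral_congr_ae ?_
          filter_upwards [hae] with y hy
          by_cases hyS : y ∈ S
          · simp [hyS]
          · rw [Set.indicator_of_notMem hyS] at hy ⊢
            simp [← hy]
      _ = ∫⁻ y in S, ‖f y‖ₑ ∂μ := lintegral_indicator hSm _
      _ = ⨆ j, ∫⁻ y in C j, ‖f y‖ₑ ∂μ :=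
          setLIntegral_iUnion_of_directed _ hCmono.directed_le
      _ ≤ _ := iSup_le fun j => hKle (hCc j)
  refine ⟨⟨hmeas, hle.trans_lt ENNReal.ofReal_lt_top⟩, ?_⟩
  rw [integral_norm_eq_lintegral_enorm hmeas]
  exact ENNReal.toReal_le_of_le_ofReal hM hle

/-- `L¹` is tested by the unit ball of `C_c`: `exists_phase` turns a cutoff `κ` into a `g` for which
`f g` is real and at least `κ‖f‖ - δκ`, and `δ` is arbitrary. -/
theorem integrable_of_pairing {f : Y → ℂ} (hf : Continuous f) {M : ℝ}
    (h : ∀ g : Y → ℂ, Continuous g → HasCompactSupport g → (∀ y, ‖g y‖ ≤ 1) →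
      ‖∫ y, f y * g y ∂μ‖ ≤ M) :
    Integrable f μ ∧ ∫ y, ‖f y‖ ∂μ ≤ M := by
  refine integrable_of_cutoff hf fun κ hκ hκc hκ0 hκ1 => ?_
  have hκint : Integrable κ μ := hκ.integrable_of_hasCompactSupport hκc
  refine le_of_forall_pos_le_add fun ε hε => ?_
  obtain ⟨δ, hδ, hδε⟩ : ∃ δ : ℝ, 0 < δ ∧ δ * ∫ y, κ y ∂μ ≤ ε := by
    have h0 : 0 ≤ ∫ y, κ y ∂μ := integral_nonneg hκ0
    refine ⟨ε / (∫ y, κ y ∂μ + 1), by positivity, ?_⟩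
    rw [div_mul_eq_mul_div, div_le_iff₀ (by positivity)]
    nlinarith
  obtain ⟨g, s, hg, hgc, hg1, hs, hsc, hfg, hle⟩ := exists_phase hf hκ hκc hκ0 hκ1 hδ
  have hsint : Integrable s μ := hs.integrable_of_hasCompactSupport hsc
  have h1 := h g hg hgc hg1
  simp only [hfg] at h1
  rw [integral_complex_ofReal, Complex.norm_real] at h1
  calc ∫ y, κ y * ‖f y‖ ∂μ ≤ ∫ y, (s y + δ * κ y) ∂μ :=
        integral_mono ((hκ.mul hf.norm).integrable_of_hasCompactSupport hκc.mul_right)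
          (hsint.add (hκint.const_mul δ)) hle
    _ = ∫ y, s y ∂μ + δ * ∫ y, κ y ∂μ := by
        rw [integral_add hsint (hκint.const_mul δ), integral_const_mul]
    _ ≤ M + ε := add_le_add ((le_abs_self _).trans h1) hδε

end Integrability

/-! ### Algebra of the Fourier kernel -/

namespace GaussianExponential

variable {A : Type*} [AddCommGroup A] [TopologicalSpace A] (G : GaussianExponential A)

theorem kernel_add_left' (x x' y : A) : G.kernel (x + x') y = G.kernel x y * G.kernel x' y :=
  G.kernel_add_left x x' y

theorem kernel_comm (x y : A) : G.kernel x y = G.kernel y x := by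
  rw [kernel, kernel, add_comm, mul_comm]

theorem kernel_add_right (x y y' : A) : G.kernel x (y + y') = G.kernel x y * G.kernel x y' := by
  rw [kernel_comm, kernel_add_left', kernel_comm G y, kernel_comm G y']

theorem kernel_zero_left (y : A) : G.kernel 0 y = 1 := by
  have h := G.kernel_add_left' 0 0 y
  rw [add_zero] at h
  exact (mul_eq_left (a := _)).1 h.symm

theorem kernel_zero_right (x : A) : G.kernel x 0 = 1 := by
  rw [kernel_comm, kernel_zero_left]

theorem kernel_neg_left (x y : A) : G.kernel (-x) y = (G.kernel x y)⁻¹ := by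
  rw [eq_inv_iff_mul_eq_one, ← kernel_add_left', neg_add_cancel, kernel_zero_left]

theorem kernel_neg_right (x y : A) : G.kernel x (-y) = (G.kernel x y)⁻¹ := by
  rw [kernel_comm, kernel_neg_left, kernel_comm]

theorem kernel_sub_left (x x' y : A) : G.kernel (x - x') y = G.kernel x y / G.kernel x' y := by
  rw [sub_eq_add_neg, kernel_add_left', kernel_neg_left, div_eq_mul_inv]

theorem kernel_sub_right (x y y' : A) : G.kernel x (y - y') = G.kernel x y / G.kernel x y' := by
  rw [sub_eq_add_neg, kernel_add_right, kernel_neg_right, div_eq_mul_inv]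

theorem toFun_add (x y : A) : G.toFun (x + y) = G.toFun x * G.toFun y * G.kernel x y := by
  rw [kernel, mul_div_cancel]

theorem toFun_zero : G.toFun 0 = 1 := by
  have h := G.toFun_add 0 0
  rw [add_zero, kernel_zero_left, mul_one] at h
  exact (mul_eq_left (a := _)).1 h.symm

/-- Evenness of the gaussian, applied to `z + (-z) = 0`. -/
theorem kernel_self (z : A) : G.kernel z z = G.toFun z * G.toFun z := by
  have h := G.toFun_add z (-z)
  rw [add_neg_cancel, toFun_zero, G.map_neg, kernel_neg_right] at h
  exact (mul_inv_eq_one.1 h.symm).symm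

theorem toFun_sub (x y : A) : G.toFun (x - y) = G.toFun x * G.toFun y / G.kernel x y := by
  rw [sub_eq_add_neg, toFun_add, G.map_neg, kernel_neg_right, div_eq_mul_inv]

@[fun_prop]
theorem continuous_coe {X : Type*} [TopologicalSpace X] {f : X → A} (hf : Continuous f) :
    Continuous fun x => (G.toFun (f x) : ℂ) :=
  continuous_induced_dom.comp (G.continuous_toFun.comp hf)

@[fun_prop]
theorem continuous_kernel [ContinuousAdd A] {X : Type*} [TopologicalSpace X] {f g : X → A}
    (hf : Continuous f) (hg : Continuous g) :
    Continuous fun x => (G.kernel (f x) (g x) : ℂ) := by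
  have h1 := G.continuous_toFun
  have h2 : Continuous fun x => G.toFun (f x + g x) / (G.toFun (f x) * G.toFun (g x)) :=
    (h1.comp (hf.add hg)).div' ((h1.comp hf).mul (h1.comp hg))
  exact continuous_induced_dom.comp h2

theorem conj_kernel (x y : A) : (starRingEnd ℂ) (G.kernel x y : ℂ) = (G.kernel x (-y) : ℂ) := by
  rw [kernel_neg_right, Circle.coe_inv_eq_conj]

end GaussianExponential

namespace Bicharacter

variable {A : Type*} [AddCommGroup A] [TopologicalSpace A] (χ : Bicharacter A)

@[fun_prop]
theorem continuous_coe {X : Type*} [TopologicalSpace X] {f g : X → A}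
    (hf : Continuous f) (hg : Continuous g) :
    Continuous fun x => (χ.toFun (f x) (g x) : ℂ) :=
  continuous_induced_dom.comp (χ.continuous_toFun.comp (hf.prodMk hg))

theorem map_zero_left (y : A) : χ.toFun 0 y = 1 := by
  have h := χ.map_add_left 0 0 y
  rw [add_zero] at h
  exact (mul_eq_left (a := _)).1 h.symm

theorem map_zero_right (x : A) : χ.toFun x 0 = 1 := by
  have h := χ.map_add_right x 0 0
  rw [add_zero] at h
  exact (mul_eq_left (a := _)).1 h.symm

theorem map_neg_left (x y : A) : χ.toFun (-x) y = (χ.toFun x y)⁻¹ := by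
  rw [eq_inv_iff_mul_eq_one, ← χ.map_add_left, neg_add_cancel, map_zero_left]

theorem map_neg_right (x y : A) : χ.toFun x (-y) = (χ.toFun x y)⁻¹ := by
  rw [eq_inv_iff_mul_eq_one, ← χ.map_add_right, neg_add_cancel, map_zero_right]

theorem map_sub_left (x x' y : A) : χ.toFun (x - x') y = χ.toFun x y / χ.toFun x' y := by
  rw [sub_eq_add_neg, χ.map_add_left, map_neg_left, div_eq_mul_inv]

theorem map_sub_right (x y y' : A) : χ.toFun x (y - y') = χ.toFun x y / χ.toFun x y' := by
  rw [sub_eq_add_neg, χ.map_add_right, map_neg_right, div_eq_mul_inv]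

/-- Every character `x ↦ χ(x,s)` is of the form `x ↦ ⟨x;σ⟩`. -/
theorem exists_kernel_right (G : GaussianExponential A) (s : A) :
    ∃ σ, ∀ x, χ.toFun x s = G.kernel x σ := by
  obtain ⟨Φ, hΦ⟩ := G.selfDual
  let c : PontryaginDual (Multiplicative A) :=
    { toFun := fun x => χ.toFun (Multiplicative.toAdd x) s
      map_one' := χ.map_zero_left s
      map_mul' := fun x y => χ.map_add_left _ _ s
      continuous_toFun := χ.continuous_toFun.comp
        (continuous_toAdd.prodMk continuous_const) }
  refine ⟨Φ.symm c, fun x => ?_⟩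
  have h := hΦ (Φ.symm c) x
  rw [Φ.apply_symm_apply] at h
  rw [G.kernel_comm]
  exact h

theorem exists_kernel_left (G : GaussianExponential A) (t : A) :
    ∃ σ, ∀ y, χ.toFun t y = G.kernel y σ := by
  obtain ⟨Φ, hΦ⟩ := G.selfDual
  let c : PontryaginDual (Multiplicative A) :=
    { toFun := fun y => χ.toFun t (Multiplicative.toAdd y)
      map_one' := χ.map_zero_right t
      map_mul' := fun x y => χ.map_add_right t _ _
      continuous_toFun := χ.continuous_toFun.comp
        (continuous_const.prodMk continuous_toAdd) }
  refine ⟨Φ.symm c, fun x => ?_⟩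
  have h := hΦ (Φ.symm c) x
  rw [Φ.apply_symm_apply] at h
  rw [G.kernel_comm]
  exact h

end Bicharacter

/-! ### Continuous functions with compact support -/

/-- The continuous functions with compact support. -/
def IsCc {X : Type*} [TopologicalSpace X] (f : X → ℂ) : Prop :=
  Continuous f ∧ HasCompactSupport f

theorem exists_nhds_uniform {Z A E : Type*} [TopologicalSpace Z] [TopologicalSpace A] [Zero A]
    [SeminormedAddCommGroup E] {f : Z → A → E} (hf : Continuous fun p : Z × A => f p.1 p.2)
    {K : Set Z} (hK : IsCompact K) {ε : ℝ} (hε : 0 < ε) :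
    ∃ V ∈ 𝓝 (0 : A), ∀ z ∈ K, ∀ v ∈ V, ‖f z v - f z 0‖ < ε := by
  have hc : Continuous fun p : Z × A => ‖f p.1 p.2 - f p.1 0‖ :=
    (hf.sub (hf.comp (continuous_fst.prodMk continuous_const))).norm
  obtain ⟨u, v, -, hv, hu, h0, hsub⟩ := generalized_tube_lemma hK (isCompact_singleton (x := (0 : A)))
    (isOpen_lt hc (continuous_const (y := ε))) (by
      rintro ⟨z, w⟩ ⟨-, hw⟩
      simp only [Set.mem_singleton_iff] at hw
      simpa [hw] using hε)
  exact ⟨v, hv.mem_nhds (h0 rfl), fun z hz w hw => hsub (Set.mk_mem_prod (hu hz) hw)⟩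

theorem exists_nhds_translate {A E : Type*} [AddCommGroup A] [TopologicalSpace A]
    [IsTopologicalAddGroup A] [LocallyCompactSpace A] [SeminormedAddCommGroup E] {h : A → E}
    (hc : Continuous h) (hs : HasCompactSupport h) {ε : ℝ} (hε : 0 < ε) :
    ∃ V ∈ 𝓝 (0 : A), ∀ x, ∀ v ∈ V, ‖h (x + v) - h x‖ < ε := by
  obtain ⟨K, hK, hKh⟩ := exists_compact_of_hasCompactSupport hs
  obtain ⟨L, hL, hL0⟩ := exists_compact_mem_nhds (0 : A)
  have hKL : IsCompact (K ∪ (fun p : A × A => p.1 - p.2) '' (K ×ˢ L)) :=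
    hK.union ((hK.prod hL).image (by fun_prop))
  obtain ⟨V, hV, hV'⟩ := exists_nhds_uniform (f := fun x v : A => h (x + v)) (by fun_prop) hKL hε
  refine ⟨V ∩ L, inter_mem hV hL0, fun x v hv => ?_⟩
  by_cases hx : x ∈ K ∪ (fun p : A × A => p.1 - p.2) '' (K ×ˢ L)
  · simpa using hV' x hx v hv.1
  · have h1 : h x = 0 := by
      by_contra h0
      exact hx (Or.inl (hKh x h0))
    have h2 : h (x + v) = 0 := by
      by_contra h0
      exact hx (Or.inr ⟨(x + v, v), ⟨hKh _ h0, hv.2⟩, by simp⟩)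
    simpa [h1, h2] using hε

/-- Density of `C_c` in `L^p` for a regular measure, without assuming normality of the space. -/
theorem exists_isCc_eLpNorm_sub_le {Y : Type*} [TopologicalSpace Y] [T2Space Y]
    [LocallyCompactSpace Y] [MeasurableSpace Y] [BorelSpace Y] {μ : Measure Y} [μ.Regular]
    {p : ℝ≥0∞} (hp : p ≠ ∞) {f : Y → ℂ} (hf : MemLp f p μ) {ε : ℝ≥0∞} (hε : ε ≠ 0) :
    ∃ g : Y → ℂ, eLpNorm (f - g) p μ ≤ ε ∧ IsCc g := by
  refine hf.induction_dense hp IsCc ?_ (fun f g hf hg => ⟨hf.1.add hg.1, hf.2.add hg.2⟩)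
    (fun f hf => hf.1.aestronglyMeasurable) hε
  intro c t ht htμ ε hε
  obtain ⟨η, ηpos, hη⟩ := exists_eLpNorm_indicator_le (μ := μ) hp c hε
  have hη2 : ((η / 2 : NNReal) : ℝ≥0∞) ≠ 0 := by simpa using ηpos.ne'
  obtain ⟨s, st, sc, μs⟩ := ht.exists_isCompact_sdiff_lt htμ.ne hη2
  -- The open set surrounds the compact `s` and not `t`, so that a Urysohn function exists by local
  -- compactness alone. It differs from the indicator of `t` only on `(V \ s) ∪ (t \ s)`.
  obtain ⟨V, sV, Vo, -, hV⟩ := sc.measurableSet.exists_isOpen_sdiff_lt (μ := μ)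
    sc.measure_ne_top hη2
  obtain ⟨g, hg1, hg2, hg3, hg4⟩ := exists_continuousMap_one_of_isCompact_subset_isOpen sc Vo sV
  refine ⟨fun x => (g x : ℂ) * c, ?_, by fun_prop, ?_⟩
  · refine le_trans (eLpNorm_mono fun x => ?_) (hη ((V \ s) ∪ (t \ s)) ?_)
    · by_cases hxs : x ∈ s
      · have h1 : g x = 1 := hg1 hxs
        simp [h1, hxs, st hxs]
      · by_cases hxt : x ∈ t
        · have h1 : x ∈ (V \ s) ∪ (t \ s) := Or.inr ⟨hxt, hxs⟩
          simp only [Pi.sub_apply, Set.indicator_of_mem h1, Set.indicator_of_mem hxt]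
          have h2 : (g x : ℂ) * c - c = ((g x - 1 : ℝ) : ℂ) * c := by push_cast; ring
          rw [h2, norm_mul, Complex.norm_real, Real.norm_eq_abs]
          refine mul_le_of_le_one_left (norm_nonneg _) (abs_le.2 ⟨?_, ?_⟩)
          · linarith [(hg4 x).1]
          · linarith [(hg4 x).2]
        · by_cases hxV : x ∈ V
          · have h1 : x ∈ (V \ s) ∪ (t \ s) := Or.inl ⟨hxV, hxs⟩
            simp only [Pi.sub_apply, Set.indicator_of_mem h1, Set.indicator_of_notMem hxt, sub_zero]
            rw [norm_mul, Complex.norm_real, Real.norm_eq_abs, abs_of_nonneg (hg4 x).1]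
            exact mul_le_of_le_one_left (norm_nonneg _) (hg4 x).2
          · have h1 : g x = 0 := by
              by_contra h0
              exact hxV (hg3 (subset_tsupport g h0))
            simp [h1, hxt]
    · refine (measure_union_le _ _).trans ((add_le_add hV.le μs.le).trans (le_of_eq ?_))
      rw [← ENNReal.coe_add, add_halves]
  · have h1 : HasCompactSupport g := hg2
    exact (h1.comp_left (g := fun r : ℝ => (r : ℂ)) (by simp)).mul_right

/-! ### Compactly supported functions on the group and their classes in `L²`. -/

section Fourier

variable {A : Type*} [AddCommGroup A] [TopologicalSpace A] [IsTopologicalAddGroup A]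
  [LocallyCompactSpace A] [T2Space A] [MeasurableSpace A] [BorelSpace A]
  {G : GaussianExponential A} {μ : Measure A} [μ.IsAddHaarMeasure] [μ.Regular]

theorem exists_bump {V : Set A} (hV : V ∈ 𝓝 (0 : A)) :
    ∃ g : A → ℝ, Continuous g ∧ HasCompactSupport g ∧ (∀ x, 0 ≤ g x) ∧ 0 < g 0 ∧
      (∀ x, g x ≠ 0 → x ∈ V) ∧ ∫ x, g x ∂μ = 1 := by
  obtain ⟨U, hUV, hU, h0U⟩ := mem_nhds_iff.1 hV
  obtain ⟨f, h1, h2, h3, h4⟩ := exists_continuous_one_zero_of_isCompact (X := A)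
    (isCompact_singleton (x := (0 : A))) hU.isClosed_compl (by simpa using h0U)
  have hf0 : f 0 = 1 := h1 rfl
  have hpos : 0 < ∫ x, f x ∂μ :=
    f.continuous.integral_pos_of_hasCompactSupport_nonneg_nonzero h3 (fun x => (h4 x).1)
      (x := 0) (by simp [hf0])
  refine ⟨fun x => (∫ x, f x ∂μ)⁻¹ * f x, by fun_prop, h3.mul_left,
    fun x => mul_nonneg (inv_nonneg.2 hpos.le) (h4 x).1, by simp [hf0, hpos], fun x hx => ?_, ?_⟩
  · refine hUV ?_
    by_contra hxU
    exact hx (by simp [show f x = 0 from h2 hxU])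
  · rw [integral_const_mul, inv_mul_cancel₀ hpos.ne']

theorem IsCc.integrable {h : A → ℂ} (hh : IsCc h) : Integrable h μ :=
  hh.1.integrable_of_hasCompactSupport hh.2

theorem IsCc.memLp {h : A → ℂ} (hh : IsCc h) {p : ℝ≥0∞} : MemLp h p μ :=
  hh.1.memLp_of_hasCompactSupport hh.2

theorem IsCc.conj {h : A → ℂ} (hh : IsCc h) : IsCc fun x => (starRingEnd ℂ) (h x) :=
  ⟨Complex.continuous_conj.comp hh.1, hh.2.comp_left (map_zero _)⟩

theorem IsCc.translate {h : A → ℂ} (hh : IsCc h) (a : A) : IsCc fun x => h (x + a) :=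
  ⟨by have := hh.1; fun_prop, hh.2.comp_homeomorph (Homeomorph.addRight a)⟩

theorem IsCc.mul_left {h : A → ℂ} (hh : IsCc h) {g : A → ℂ} (hg : Continuous g) :
    IsCc fun x => g x * h x :=
  ⟨hg.mul hh.1, hh.2.mul_left⟩

variable (μ) in
/-- The class in `L²(A)` of a continuous function with compact support. -/
def IsCc.toL2 {h : A → ℂ} (hh : IsCc h) : Lp ℂ 2 μ := hh.memLp.toLp h

theorem IsCc.coeFn_toL2 {h : A → ℂ} (hh : IsCc h) : hh.toL2 μ =ᵐ[μ] h :=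
  hh.memLp.coeFn_toLp

variable (μ) in
theorem dense_cc : Dense {f : Lp ℂ 2 μ | ∃ (h : A → ℂ) (hh : IsCc h), f = hh.toL2 μ} := by
  rw [Metric.dense_iff]
  intro f r hr
  obtain ⟨g, hg2, hg⟩ := exists_isCc_eLpNorm_sub_le (p := 2)
    (by norm_num) (Lp.memLp f) (ε := ENNReal.ofReal (r / 2)) (by simpa using hr)
  refine ⟨_, ?_, g, hg, rfl⟩
  rw [Metric.mem_ball, dist_comm, dist_eq_norm, ← Lp.toLp_coeFn f (Lp.memLp f), IsCc.toL2,
    ← MemLp.toLp_sub, Lp.norm_toLp]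
  calc _ ≤ (ENNReal.ofReal (r / 2)).toReal := ENNReal.toReal_mono (by simp) hg2
    _ = r / 2 := ENNReal.toReal_ofReal (by positivity)
    _ < r := by linarith

/-! ### Elementary properties of the Fourier transform -/

theorem fourierInv_eq (h : A → ℂ) (x : A) : fourierInv G μ h x = fourier G μ h (-x) := by
  simp only [fourierInv, fourier, G.kernel_neg_right, G.kernel_neg_left]

theorem continuous_fourier {h : A → ℂ} (hh : IsCc h) : Continuous (fourier G μ h) := by
  obtain ⟨K, hK, hKh⟩ := exists_compact_of_hasCompactSupport hh.2
  have := hh.1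
  exact continuous_integral_of_ne (f := fun x y => (G.kernel x y : ℂ) * h y) (by fun_prop) hK
    fun x y hxy => hKh y (right_ne_zero_of_mul hxy)

theorem continuous_fourierInv {h : A → ℂ} (hh : IsCc h) : Continuous (fourierInv G μ h) := by
  have h1 := (continuous_fourier (G := G) (μ := μ) hh).comp continuous_neg
  refine h1.congr fun x => ?_
  rw [fourierInv_eq, Function.comp_apply]

theorem norm_fourier_le (h : A → ℂ) (x : A) : ‖fourier G μ h x‖ ≤ ∫ y, ‖h y‖ ∂μ := by
  refine (norm_integral_le_integral_norm _).trans (le_of_eq ?_)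
  simp only [norm_mul, Circle.norm_coe, one_mul]

theorem norm_fourierInv_le (h : A → ℂ) (x : A) : ‖fourierInv G μ h x‖ ≤ ∫ y, ‖h y‖ ∂μ := by
  rw [fourierInv_eq]
  exact norm_fourier_le h _

theorem conj_fourier (h : A → ℂ) (x : A) :
    (starRingEnd ℂ) (fourier G μ h x) = fourierInv G μ (fun y => (starRingEnd ℂ) (h y)) x := by
  simp only [fourier, fourierInv, ← integral_conj, map_mul, G.conj_kernel]

theorem conj_fourierInv (h : A → ℂ) (x : A) :
    (starRingEnd ℂ) (fourierInv G μ h x) = fourier G μ (fun y => (starRingEnd ℂ) (h y)) x := by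
  rw [fourierInv_eq, conj_fourier, fourierInv_eq, neg_neg]

theorem fourier_translate (h : A → ℂ) (a x : A) :
    fourier G μ (fun y => h (y + a)) x = (G.kernel x (-a) : ℂ) * fourier G μ h x := by
  simp only [fourier]
  rw [← integral_add_right_eq_self (μ := μ) (fun y => (G.kernel x y : ℂ) * h y) a,
    ← integral_const_mul]
  congr 1
  funext y
  rw [G.kernel_add_right, G.kernel_neg_right, Circle.coe_mul, Circle.coe_inv]
  field_simp [Circle.coe_ne_zero]

theorem integral_fourier_mul {h k : A → ℂ} (hh : IsCc h) (hk : IsCc k) :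
    ∫ x, fourier G μ h x * k x ∂μ = ∫ y, h y * fourier G μ k y ∂μ := by
  obtain ⟨K, hK, hKh⟩ := exists_compact_of_hasCompactSupport hh.2
  obtain ⟨L, hL, hLk⟩ := exists_compact_of_hasCompactSupport hk.2
  have := hh.1
  have := hk.1
  have h1 := integral_swap_of_ne (μ := μ) (ν := μ)
    (f := fun x y => (G.kernel x y : ℂ) * h y * k x) (by fun_prop) hL hK
    (fun x y hxy => ⟨hLk x (right_ne_zero_of_mul hxy),
      hKh y (right_ne_zero_of_mul (left_ne_zero_of_mul hxy))⟩)
  simp only [fourier, ← integral_mul_const, ← integral_const_mul]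
  rw [h1]
  congr 1; funext y; congr 1; funext x
  rw [G.kernel_comm x y]
  ring

/-! ### Unitarity of the Fourier operator -/

theorem norm_fourierOp (hμ : IsSelfDualMeasure G μ) (h : Lp ℂ 2 μ) :
    ‖fourierOp G μ hμ h‖ = ‖h‖ := by
  refine (dense_integrableL2 μ).induction_on (p := fun h => ‖fourierOp G μ hμ h‖ = ‖h‖) h ?_ ?_
  · exact isClosed_eq (fourierOp G μ hμ).continuous.norm continuous_norm
  · intro a
    have h1 : fourierOp G μ hμ ((integrableL2 μ).subtype a) = fourierLin G μ hμ a :=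
      LinearMap.extendOfNorm_eq (dense_integrableL2 μ)
        ⟨1, fun x => by rw [norm_fourierLin, one_mul]; rfl⟩ a
    rw [h1, norm_fourierLin]
    rfl

/-- The Fourier operator as a linear isometry. -/
def fourierIsometry (hμ : IsSelfDualMeasure G μ) : Lp ℂ 2 μ →ₗᵢ[ℂ] Lp ℂ 2 μ :=
  ⟨(fourierOp G μ hμ).toLinearMap, norm_fourierOp hμ⟩

theorem inner_fourierOp (hμ : IsSelfDualMeasure G μ) (f g : Lp ℂ 2 μ) :
    inner ℂ (fourierOp G μ hμ f) (fourierOp G μ hμ g) = inner ℂ f g :=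
  (fourierIsometry hμ).inner_map_map f g

theorem memLp_fourier (hμ : IsSelfDualMeasure G μ) {h : A → ℂ} (hh : IsCc h) :
    MemLp (fourier G μ h) 2 μ :=
  (hμ h hh.integrable hh.memLp).1

theorem memLp_fourierInv (hμ : IsSelfDualMeasure G μ) {h : A → ℂ} (hh : IsCc h) :
    MemLp (fourierInv G μ h) 2 μ := by
  have h1 := (memLp_fourier hμ hh.conj).star
  refine (memLp_congr_ae (Eventually.of_forall fun x => ?_)).1 h1
  change (starRingEnd ℂ) _ = _
  rw [conj_fourier]
  simp

theorem fourierOp_toL2 (hμ : IsSelfDualMeasure G μ) {h : A → ℂ} (hh : IsCc h) :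
    fourierOp G μ hμ (hh.toL2 μ) =ᵐ[μ] fourier G μ h := by
  have h1 := fourierOp_apply G μ hμ (hh.toL2 μ) (hh.integrable.congr hh.coeFn_toL2.symm)
  refine h1.trans (Eventually.of_forall fun x => ?_)
  refine integral_congr_ae ?_
  filter_upwards [hh.coeFn_toL2 (μ := μ)] with y hy
  rw [hy]

theorem integral_fourier_mul_conj (hμ : IsSelfDualMeasure G μ) {h g : A → ℂ} (hh : IsCc h)
    (hg : IsCc g) :
    ∫ x, fourier G μ h x * (starRingEnd ℂ) (fourier G μ g x) ∂μ =
      ∫ x, h x * (starRingEnd ℂ) (g x) ∂μ := by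
  have h1 := inner_fourierOp hμ (hg.toL2 μ) (hh.toL2 μ)
  rw [L2.inner_def, L2.inner_def] at h1
  simp only [RCLike.inner_apply] at h1
  rw [← integral_congr_ae (g := fun x => fourier G μ h x * (starRingEnd ℂ) (fourier G μ g x)),
    h1]
  · refine integral_congr_ae ?_
    filter_upwards [hh.coeFn_toL2 (μ := μ), hg.coeFn_toL2 (μ := μ)] with x h2 h3
    rw [h2, h3]
  · filter_upwards [fourierOp_toL2 hμ hh, fourierOp_toL2 hμ hg] with x h2 h3
    rw [h2, h3]

variable (μ) in
/-- The correlation `a ↦ ∫ h(y+a) \overline{g(y)} dy`. -/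
def corr (h g : A → ℂ) (a : A) : ℂ := ∫ y, h (y + a) * (starRingEnd ℂ) (g y) ∂μ

variable (μ) in
theorem isCc_corr {h g : A → ℂ} (hh : IsCc h) (hg : IsCc g) : IsCc (corr μ h g) := by
  obtain ⟨K, hK, hKh⟩ := exists_compact_of_hasCompactSupport hh.2
  obtain ⟨L, hL, hLg⟩ := exists_compact_of_hasCompactSupport hg.conj.2
  have h1 := hh.1
  have h2 := hg.1
  constructor
  · exact continuous_integral_of_ne (f := fun a y => h (y + a) * (starRingEnd ℂ) (g y))
      (by fun_prop) hL fun a y hay => hLg y (right_ne_zero_of_mul hay)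
  · refine hasCompactSupport_of_ne (K := (fun p : A × A => p.1 - p.2) '' (K ×ˢ L))
      ((hK.prod hL).image (by fun_prop)) fun a ha => ?_
    obtain ⟨y, hy⟩ := exists_of_integral_ne_zero ha
    exact ⟨(y + a, y), ⟨hKh _ (left_ne_zero_of_mul hy), hLg _ (right_ne_zero_of_mul hy)⟩, by simp⟩

/-- This makes the transform of a correlation a product of two `L²` functions, hence integrable, and
a nonnegative function when `h = g`. -/
theorem fourier_corr {h g : A → ℂ} (hh : IsCc h) (hg : IsCc g) (x : A) :
    fourier G μ (corr μ h g) x = fourier G μ h x * (starRingEnd ℂ) (fourier G μ g x) := by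
  obtain ⟨K, hK, hKh⟩ := exists_compact_of_hasCompactSupport hh.2
  obtain ⟨L, hL, hLg⟩ := exists_compact_of_hasCompactSupport hg.conj.2
  have h1 := hh.1
  have h2 := hg.1
  have hsw := integral_swap_of_ne (μ := μ) (ν := μ)
    (f := fun a y => (G.kernel x a : ℂ) * (h (y + a) * (starRingEnd ℂ) (g y))) (by fun_prop)
    (K := (fun p : A × A => p.1 - p.2) '' (K ×ˢ L)) ((hK.prod hL).image (by fun_prop)) hL
    (fun a y hay => by
      have hay := right_ne_zero_of_mul hay
      have hy := hLg y (right_ne_zero_of_mul hay)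
      exact ⟨⟨(y + a, y), ⟨hKh _ (left_ne_zero_of_mul hay), hy⟩, by simp⟩, hy⟩)
  rw [conj_fourier]
  simp only [fourier, corr, fourierInv, ← integral_const_mul]
  rw [hsw]
  congr 1
  funext y
  have h3 := fourier_translate (G := G) (μ := μ) h y x
  rw [mul_left_comm]
  change _ = _ * (fourier G μ h x * _)
  rw [← mul_assoc, ← h3, fourier, ← integral_mul_const]
  congr 1
  funext a
  rw [add_comm a y, mul_assoc]

end Fourier

/-! ### Surjectivity of the Fourier operator. -/

section Fourier

variable {A : Type*} [AddCommGroup A] [TopologicalSpace A] [IsTopologicalAddGroup A]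
  [LocallyCompactSpace A] [T2Space A] [MeasurableSpace A] [BorelSpace A]
  {G : GaussianExponential A} {μ : Measure A} [μ.IsAddHaarMeasure] [μ.Regular]

theorem integrable_fourier_corr (hμ : IsSelfDualMeasure G μ) {h g : A → ℂ} (hh : IsCc h)
    (hg : IsCc g) : Integrable (fourier G μ (corr μ h g)) μ := by
  have h1 := (memLp_fourier hμ hh).integrable_mul (memLp_fourier hμ hg).star
  refine h1.congr (Eventually.of_forall fun x => ?_)
  rw [fourier_corr hh hg]
  rfl

/-- Parseval's formula for a translate of `h` and for `g`. Inversion on correlations thus costs no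
more than the isometry property. -/
theorem fourierInv_fourier_corr (hμ : IsSelfDualMeasure G μ) {h g : A → ℂ} (hh : IsCc h)
    (hg : IsCc g) (a : A) : fourierInv G μ (fourier G μ (corr μ h g)) a = corr μ h g a := by
  rw [corr, ← integral_fourier_mul_conj hμ (hh.translate a) hg]
  refine integral_congr_ae (Eventually.of_forall fun x => ?_)
  simp only [fourier_corr hh hg, fourier_translate, G.kernel_neg_right, G.kernel_comm a x]
  ring

theorem norm_toL2_le {h : A → ℂ} (hh : IsCc h) {K : Set A} (hK : ∀ x, h x ≠ 0 → x ∈ K)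
    (hKc : IsCompact K) {ε : ℝ} (hε : 0 ≤ ε) (h1 : ∀ x, ‖h x‖ ≤ ε) :
    ‖hh.toL2 μ‖ ≤ (μ K ^ (2 : ℝ)⁻¹).toReal * ε := by
  rw [IsCc.toL2, Lp.norm_toLp, ← eLpNorm_restrict_eq_of_support_subset (s := K) hK]
  have h2 := eLpNorm_le_of_ae_bound (μ := μ.restrict K) (p := 2) (f := h)
    (Eventually.of_forall h1)
  rw [Measure.restrict_apply_univ] at h2
  have h3 : μ K ^ (2 : ℝ)⁻¹ ≠ ∞ :=
    ENNReal.rpow_ne_top_of_nonneg (by positivity) hKc.measure_ne_top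
  calc _ ≤ (μ K ^ (2 : ℝ≥0∞).toReal⁻¹ * ENNReal.ofReal ε).toReal :=
        ENNReal.toReal_mono (ENNReal.mul_ne_top (by simpa using h3) (by simp)) h2
    _ = _ := by
        rw [ENNReal.toReal_mul, ENNReal.toReal_ofReal hε]
        simp

theorem IsCc.sub {X : Type*} [TopologicalSpace X] {h g : X → ℂ} (hh : IsCc h) (hg : IsCc g) :
    IsCc fun x => h x - g x :=
  ⟨hh.1.sub hg.1, hh.2.sub hg.2⟩

theorem toL2_sub {h g : A → ℂ} (hh : IsCc h) (hg : IsCc g) :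
    (hh.sub hg).toL2 μ = hh.toL2 μ - hg.toL2 μ := by
  rw [IsCc.toL2, IsCc.toL2, IsCc.toL2, ← MemLp.toLp_sub]
  rfl

theorem IsCc.ofReal {X : Type*} [TopologicalSpace X] {g : X → ℝ} (hc : Continuous g)
    (hs : HasCompactSupport g) : IsCc fun x => (g x : ℂ) :=
  ⟨by fun_prop, hs.comp_left (g := fun r : ℝ => (r : ℂ)) (by simp)⟩

/-- Correlation with a narrow bump is an approximate identity. All supports stay in the fixed
compact set `K'`, so uniform closeness implies closeness in `L²`. -/
theorem exists_corr_close {h : A → ℂ} (hh : IsCc h) {ε : ℝ} (hε : 0 < ε) :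
    ∃ (g : A → ℂ) (hg : IsCc g), ‖(isCc_corr μ hh hg).toL2 μ - hh.toL2 μ‖ < ε := by
  obtain ⟨K, hK, hKh⟩ := exists_compact_of_hasCompactSupport hh.2
  obtain ⟨L, hL, hL0⟩ := exists_compact_mem_nhds (0 : A)
  set K' : Set A := K ∪ (fun p : A × A => p.1 - p.2) '' (K ×ˢ L) with hK'
  have hK'c : IsCompact K' := hK.union ((hK.prod hL).image (by fun_prop))
  set c : ℝ := (μ K' ^ (2 : ℝ)⁻¹).toReal with hc
  have hc0 : 0 ≤ c := ENNReal.toReal_nonneg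
  obtain ⟨V, hV, hVh⟩ := exists_nhds_translate hh.1 hh.2 (show 0 < ε / (c + 1) by positivity)
  obtain ⟨g, hg1, hg2, hg3, hg4, hg5, hg6⟩ := exists_bump (μ := μ) (inter_mem hV hL0)
  have hg : IsCc fun x => (g x : ℂ) := IsCc.ofReal hg1 hg2
  refine ⟨_, hg, ?_⟩
  rw [← toL2_sub]
  have hgint : Integrable g μ := hg1.integrable_of_hasCompactSupport hg2
  have hcorr : ∀ a, corr μ h (fun x => (g x : ℂ)) a - h a =
      ∫ y, (h (y + a) - h a) * (g y : ℂ) ∂μ := by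
    intro a
    have h1 : Integrable (fun y => h (y + a) * (g y : ℂ)) μ :=
      (hg.mul_left (hh.translate a).1).integrable
    simp only [sub_mul, corr, Complex.conj_ofReal]
    rw [integral_sub h1 (hg.integrable.const_mul _), integral_const_mul,
      integral_complex_ofReal, hg6]
    simp
  have hb : ∀ a, ‖corr μ h (fun x => (g x : ℂ)) a - h a‖ ≤ ε / (c + 1) := by
    intro a
    rw [hcorr]
    calc _ ≤ ∫ y, ε / (c + 1) * g y ∂μ := by
          refine norm_integral_le_of_norm_le (hgint.const_mul _) (Eventually.of_forall fun y => ?_)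
          rw [norm_mul, Complex.norm_real, Real.norm_eq_abs, abs_of_nonneg (hg3 y)]
          by_cases hy : g y = 0
          · simp [hy]
          · refine mul_le_mul_of_nonneg_right ?_ (hg3 y)
            rw [add_comm]
            exact (hVh a y (hg5 y hy).1).le
      _ = ε / (c + 1) := by rw [integral_const_mul, hg6, mul_one]
  have hsupp : ∀ a, corr μ h (fun x => (g x : ℂ)) a - h a ≠ 0 → a ∈ K' := by
    intro a ha
    by_cases h0 : h a = 0
    · rw [h0, sub_zero] at ha
      obtain ⟨y, hy⟩ := exists_of_integral_ne_zero ha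
      refine Or.inr ⟨(y + a, y), ⟨hKh _ (left_ne_zero_of_mul hy), (hg5 y ?_).2⟩, by simp⟩
      have := right_ne_zero_of_mul hy
      simpa using this
    · exact Or.inl (hKh a h0)
  refine (norm_toL2_le ((isCc_corr μ hh hg).sub hh) hsupp hK'c (by positivity) hb).trans_lt ?_
  rw [← hc, mul_div_assoc', div_lt_iff₀ (by positivity)]
  nlinarith

/-- On correlations `𝖥⁻¹𝖥` is known to be the identity. Complex conjugation exchanges `𝖥` and `𝖥⁻¹`,
and so turns this into a preimage under `𝖥`. -/
theorem corr_mem_range (hμ : IsSelfDualMeasure G μ) {h g : A → ℂ} (hh : IsCc h) (hg : IsCc g) :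
    (isCc_corr μ hh hg).toL2 μ ∈ Set.range (fourierOp G μ hμ) := by
  set m : A → ℂ := fourier G μ (corr μ (fun x => (starRingEnd ℂ) (h x))
    fun x => (starRingEnd ℂ) (g x)) with hm
  have hcc := isCc_corr μ hh.conj hg.conj
  have hmi : Integrable m μ := integrable_fourier_corr hμ hh.conj hg.conj
  have hm2 : MemLp m 2 μ := memLp_fourier hμ hcc
  have hm2' : MemLp (fun x => (starRingEnd ℂ) (m x)) 2 μ := hm2.star
  have hmi' : Integrable (fun x => (starRingEnd ℂ) (m x)) μ :=
    (LinearIsometryEquiv.integrable_comp_iff Complex.conjLIE).2 hmi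
  refine ⟨hm2'.toLp _, ?_⟩
  refine Lp.ext ?_
  have h1 := fourierOp_apply G μ hμ (hm2'.toLp _) (hmi'.congr hm2'.coeFn_toLp.symm)
  refine h1.trans (EventuallyEq.trans (Eventually.of_forall fun x => ?_)
    (isCc_corr μ hh hg).coeFn_toL2.symm)
  have h2 : fourier G μ (hm2'.toLp _) x = fourier G μ (fun x => (starRingEnd ℂ) (m x)) x := by
    refine integral_congr_ae ?_
    filter_upwards [hm2'.coeFn_toLp] with y hy
    rw [hy]
  rw [h2, ← conj_fourierInv, hm, fourierInv_fourier_corr hμ hh.conj hg.conj]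
  simp only [corr, ← integral_conj, map_mul, Complex.conj_conj]

/-- The normalization of the measure only says that `𝖥` is isometric. Its range is therefore closed;
it contains the correlations, and these are dense. -/
theorem surjective_fourierOp (hμ : IsSelfDualMeasure G μ) :
    Function.Surjective (fourierOp G μ hμ) := by
  have hcl : IsClosed (Set.range (fourierOp G μ hμ)) :=
    (fourierIsometry hμ).isometry.isClosedEmbedding.isClosed_range
  have hd : Dense (Set.range (fourierOp G μ hμ)) := by
    intro f
    refine Metric.mem_closure_iff.2 fun ε hε => ?_
    obtain ⟨_, hfb, h, hh, rfl⟩ := Metric.dense_iff.1 (dense_cc μ) f (ε / 2) (by positivity)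
    obtain ⟨g, hg, hgε⟩ := exists_corr_close (μ := μ) hh (show 0 < ε / 2 by positivity)
    refine ⟨_, corr_mem_range hμ hh hg, ?_⟩
    have h1 : dist f (hh.toL2 μ) < ε / 2 := by rw [dist_comm]; exact hfb
    have h2 : dist (hh.toL2 μ) ((isCc_corr μ hh hg).toL2 μ) < ε / 2 := by
      rw [dist_comm, dist_eq_norm]; exact hgε
    linarith [dist_triangle f (hh.toL2 μ) ((isCc_corr μ hh hg).toL2 μ)]
  exact Set.range_eq_univ.1 (hcl.closure_eq ▸ hd.closure_eq)

theorem adjoint_fourierOp_fourierOp (hμ : IsSelfDualMeasure G μ) (f : Lp ℂ 2 μ) :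
    ContinuousLinearMap.adjoint (fourierOp G μ hμ) (fourierOp G μ hμ f) = f := by
  refine ext_inner_right ℂ fun v => ?_
  rw [ContinuousLinearMap.adjoint_inner_left, inner_fourierOp]

theorem fourierOp_adjoint_fourierOp (hμ : IsSelfDualMeasure G μ) (f : Lp ℂ 2 μ) :
    fourierOp G μ hμ (ContinuousLinearMap.adjoint (fourierOp G μ hμ) f) = f := by
  obtain ⟨g, rfl⟩ := surjective_fourierOp hμ f
  rw [adjoint_fourierOp_fourierOp]

theorem adjoint_fourierOp_toL2 (hμ : IsSelfDualMeasure G μ) {h : A → ℂ} (hh : IsCc h) :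
    ContinuousLinearMap.adjoint (fourierOp G μ hμ) (hh.toL2 μ) =
      (memLp_fourierInv hμ hh).toLp _ := by
  refine (dense_cc μ).eq_of_inner_left ℂ ?_
  rintro _ ⟨g, hg, rfl⟩
  rw [ContinuousLinearMap.adjoint_inner_left, L2.inner_def, L2.inner_def]
  simp only [RCLike.inner_apply]
  have h1 := integral_fourier_mul (G := G) (μ := μ) hg hh.conj
  have e1 : ∫ a, (fourierOp G μ hμ (hg.toL2 μ)) a * (starRingEnd ℂ) (hh.toL2 μ a) ∂μ =
      ∫ x, fourier G μ g x * (starRingEnd ℂ) (h x) ∂μ := by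
    refine integral_congr_ae ?_
    filter_upwards [fourierOp_toL2 hμ hg, hh.coeFn_toL2 (μ := μ)] with x h2 h3
    rw [h2, h3]
  rw [e1, h1]
  refine integral_congr_ae ?_
  filter_upwards [hg.coeFn_toL2 (μ := μ), (memLp_fourierInv hμ hh).coeFn_toLp] with x h2 h3
  rw [h2, h3, conj_fourierInv]

/-! ### Summability kernels -/

/-- A summability kernel: a probability density `D = 𝖥ψ` with `ψ ∈ C_c(A)`, of which all but `ε`
of the mass lies in `V`. -/
structure IsFejer (G : GaussianExponential A) (μ : Measure A) (V : Set A) (ε : ℝ) (ψ : A → ℂ)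
    (D : A → ℝ) : Prop where
  cc : IsCc ψ
  cont : Continuous D
  nonneg : ∀ x, 0 ≤ D x
  integrable : Integrable D μ
  integral_eq : ∫ x, D x ∂μ = 1
  fourier_eq : ∀ x, fourier G μ ψ x = D x
  eq_integral : ∀ x, ψ x = ∫ y, (G.kernel x (-y) : ℂ) * D y ∂μ
  tail : ∫ x in Vᶜ, D x ∂μ ≤ ε

/-- `|𝖥φ|²` is nonnegative, has mass `‖φ‖² = 1` by Plancherel, and is the transform of the
autocorrelation of `φ`, for which inversion is known. -/
theorem isFejer_of_corr (hμ : IsSelfDualMeasure G μ) {φ : A → ℂ} (hφ : IsCc φ)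
    (h1 : ∫ x, ‖φ x‖ ^ 2 ∂μ = 1) {V : Set A} {ε : ℝ}
    (h2 : ∫ x in Vᶜ, ‖fourier G μ φ x‖ ^ 2 ∂μ ≤ ε) :
    IsFejer G μ V ε (corr μ φ φ) fun x => ‖fourier G μ φ x‖ ^ 2 := by
  have hF : ∀ x, fourier G μ (corr μ φ φ) x = ((‖fourier G μ φ x‖ ^ 2 : ℝ) : ℂ) := by
    intro x
    rw [fourier_corr hφ hφ, Complex.mul_conj, Complex.normSq_eq_norm_sq]
  refine ⟨isCc_corr μ hφ hφ, (continuous_fourier hφ).norm.pow 2, fun x => by positivity, ?_, ?_,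
    hF, ?_, h2⟩
  · have h3 := (integrable_fourier_corr hμ hφ hφ).norm
    refine h3.congr (Eventually.of_forall fun x => ?_)
    simp only [hF, Complex.norm_real]
    simp
  · have h3 := integral_fourier_mul_conj hμ hφ hφ
    simp only [Complex.mul_conj, Complex.normSq_eq_norm_sq] at h3
    rw [integral_complex_ofReal, integral_complex_ofReal] at h3
    rw [← h1]
    exact_mod_cast h3
  · intro x
    rw [← fourierInv_fourier_corr hμ hφ hφ, fourierInv]
    simp only [hF]

theorem norm_sq_eq_integral (f : Lp ℂ 2 μ) : ‖f‖ ^ 2 = ∫ x, ‖f x‖ ^ 2 ∂μ := by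
  have h1 := L2.inner_def (𝕜 := ℂ) f f
  simp only [inner_self_eq_norm_sq_to_K] at h1
  have h2 : ((‖f‖ ^ 2 : ℝ) : ℂ) = ∫ x, ((‖f x‖ ^ 2 : ℝ) : ℂ) ∂μ := by
    push_cast
    exact h1
  rw [integral_complex_ofReal] at h2
  exact_mod_cast h2

theorem integrable_norm_sq (f : Lp ℂ 2 μ) : Integrable (fun x => ‖f x‖ ^ 2) μ :=
  (Lp.memLp f).integrable_norm_pow (by norm_num)

/-- By surjectivity the indicator of a compact neighbourhood `L ⊆ V` is `𝖥w` for some `w`. If `φ ∈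
C_c` is close to `w` in `L²`, then `|𝖥φ|²` has little mass outside `L`; normalize `φ`. -/
theorem exists_isFejer (hμ : IsSelfDualMeasure G μ) {V : Set A} (hV : V ∈ 𝓝 (0 : A)) {ε : ℝ}
    (hε : 0 < ε) : ∃ ψ D, IsFejer G μ V ε ψ D := by
  obtain ⟨L, hL0, hLV, hL⟩ := local_compact_nhds hV
  have hμL : 0 < μ L := Measure.measure_pos_of_mem_nhds μ hL0
  set f : Lp ℂ 2 μ := indicatorConstLp 2 hL.measurableSet hL.measure_ne_top (1 : ℂ) with hf
  have hfn : 0 < ‖f‖ := by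
    rw [hf, norm_indicatorConstLp (by norm_num) (by norm_num)]
    have : 0 < μ.real L := ENNReal.toReal_pos hμL.ne' hL.measure_ne_top
    simp only [norm_one, one_mul]
    positivity
  -- The first bound keeps `‖φ‖ ≥ ‖f‖/2`, the second makes the tail at most `ε` after division by
  -- `‖φ‖²`.
  set δ : ℝ := min (‖f‖ / 2) (‖f‖ / 2 * Real.sqrt ε) with hδ
  have hδ0 : 0 < δ := lt_min (by positivity) (by positivity)
  obtain ⟨w, hw⟩ := surjective_fourierOp hμ f
  obtain ⟨_, hwb, φ, hφ, rfl⟩ := Metric.dense_iff.1 (dense_cc μ) w δ hδ0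
  have hd : ‖fourierOp G μ hμ (hφ.toL2 μ) - f‖ < δ := by
    rw [← hw, ← map_sub, norm_fourierOp, ← dist_eq_norm]
    exact hwb
  set n : ℝ := ‖hφ.toL2 μ‖ with hn
  have hn1 : ‖f‖ / 2 ≤ n := by
    have h1 : ‖f‖ ≤ ‖fourierOp G μ hμ (hφ.toL2 μ)‖ + δ := by
      have := norm_sub_norm_le f (fourierOp G μ hμ (hφ.toL2 μ))
      rw [norm_sub_rev] at this
      linarith
    rw [norm_fourierOp] at h1
    linarith [min_le_left (‖f‖ / 2) (‖f‖ / 2 * Real.sqrt ε)]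
  have hn0 : 0 < n := by linarith
  have hnsq : n ^ 2 = ∫ x, ‖φ x‖ ^ 2 ∂μ := by
    rw [hn, norm_sq_eq_integral]
    refine integral_congr_ae ?_
    filter_upwards [hφ.coeFn_toL2 (μ := μ)] with x hx
    rw [hx]
  have htail : ∫ x in Vᶜ, ‖fourier G μ φ x‖ ^ 2 ∂μ ≤ δ ^ 2 := by
    have hsub : Integrable (fun x => ‖(fourierOp G μ hμ (hφ.toL2 μ) - f) x‖ ^ 2) μ :=
      integrable_norm_sq _
    have hFi : Integrable (fun x => ‖fourier G μ φ x‖ ^ 2) μ :=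
      (memLp_fourier hμ hφ).integrable_norm_pow (by norm_num)
    calc ∫ x in Vᶜ, ‖fourier G μ φ x‖ ^ 2 ∂μ ≤ ∫ x in Lᶜ, ‖fourier G μ φ x‖ ^ 2 ∂μ := by
          refine setIntegral_mono_set hFi.integrableOn
            (Eventually.of_forall fun x => by positivity) ?_
          exact (Set.compl_subset_compl.2 hLV).eventuallyLE
      _ = ∫ x in Lᶜ, ‖(fourierOp G μ hμ (hφ.toL2 μ) - f) x‖ ^ 2 ∂μ := by
          refine setIntegral_congr_ae hL.measurableSet.compl ?_
          filter_upwards [fourierOp_toL2 hμ hφ, Lp.coeFn_sub (fourierOp G μ hμ (hφ.toL2 μ)) f,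
            indicatorConstLp_coeFn (p := 2) (hs := hL.measurableSet) (hμs := hL.measure_ne_top)
              (c := (1 : ℂ))] with x h1 h2 h3 hx
          rw [h2, Pi.sub_apply, h1, hf, h3, Set.indicator_of_notMem hx, sub_zero]
      _ ≤ ∫ x, ‖(fourierOp G μ hμ (hφ.toL2 μ) - f) x‖ ^ 2 ∂μ :=
          setIntegral_le_integral hsub (Eventually.of_forall fun x => by positivity)
      _ = ‖fourierOp G μ hμ (hφ.toL2 μ) - f‖ ^ 2 := (norm_sq_eq_integral _).symm
      _ ≤ δ ^ 2 := by gcongr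
  have hφ' : IsCc fun x => ((n⁻¹ : ℝ) : ℂ) * φ x := hφ.mul_left continuous_const
  have hF : ∀ x, fourier G μ (fun x => ((n⁻¹ : ℝ) : ℂ) * φ x) x =
      ((n⁻¹ : ℝ) : ℂ) * fourier G μ φ x := by
    intro x
    simp only [fourier, mul_left_comm _ ((n⁻¹ : ℝ) : ℂ)]
    rw [integral_const_mul]
  refine ⟨_, _, isFejer_of_corr hμ hφ' (V := V) (ε := ε) ?_ ?_⟩
  · simp only [norm_mul, mul_pow, Complex.norm_real, Real.norm_eq_abs, sq_abs]
    rw [integral_const_mul, ← hnsq]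
    field_simp
  · simp only [hF, norm_mul, mul_pow, Complex.norm_real, Real.norm_eq_abs, sq_abs]
    rw [integral_const_mul]
    calc n⁻¹ ^ 2 * ∫ x in Vᶜ, ‖fourier G μ φ x‖ ^ 2 ∂μ
        ≤ n⁻¹ ^ 2 * (‖f‖ / 2 * Real.sqrt ε) ^ 2 := by
          gcongr
          exact htail.trans (by gcongr; exact min_le_right _ _)
      _ ≤ n⁻¹ ^ 2 * (n * Real.sqrt ε) ^ 2 := by gcongr
      _ = ε := by
          rw [mul_pow, Real.sq_sqrt hε.le]
          field_simp

theorem IsFejer.norm_le {V : Set A} {ε : ℝ} {ψ : A → ℂ} {D : A → ℝ} (h : IsFejer G μ V ε ψ D)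
    (x : A) : ‖ψ x‖ ≤ 1 := by
  rw [h.eq_integral, ← h.integral_eq]
  refine norm_integral_le_of_norm_le h.integrable (Eventually.of_forall fun y => ?_)
  rw [norm_mul, Circle.norm_coe, one_mul, Complex.norm_real, Real.norm_eq_abs,
    abs_of_nonneg (h.nonneg y)]

/-- Averaging a bounded function against a summability kernel nearly reproduces its value
at `0`. -/
theorem IsFejer.average_close {V : Set A} {ε : ℝ} {ψ : A → ℂ} {D : A → ℝ}
    (h : IsFejer G μ V ε ψ D) (hV : MeasurableSet V) {H : A → ℂ} (hH : Continuous H) {M δ : ℝ}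
    (hM : ∀ x, ‖H x‖ ≤ M) (hδ : 0 ≤ δ) (hHV : ∀ v ∈ V, ‖H v - H 0‖ ≤ δ) :
    ‖∫ v, (D v : ℂ) * H v ∂μ - H 0‖ ≤ δ + 2 * M * ε := by
  have hM0 : 0 ≤ M := (norm_nonneg _).trans (hM 0)
  have hDi : Integrable (fun v => (D v : ℂ)) μ := h.integrable.ofReal
  have hi : Integrable (fun v => (D v : ℂ) * H v) μ := by
    have := hDi.bdd_mul (c := M) hH.aestronglyMeasurable (Eventually.of_forall hM)
    simpa only [mul_comm] using this
  have h1 : ∫ v, (D v : ℂ) * H v ∂μ - H 0 = ∫ v, (D v : ℂ) * (H v - H 0) ∂μ := by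
    simp only [mul_sub]
    rw [integral_sub hi (hDi.mul_const _), integral_mul_const, integral_complex_ofReal,
      h.integral_eq]
    simp
  have hb : Integrable (fun v => D v * δ + Vᶜ.indicator (fun v => D v * (2 * M)) v) μ :=
    (h.integrable.mul_const δ).add ((h.integrable.mul_const (2 * M)).indicator hV.compl)
  rw [h1]
  calc _ ≤ ∫ v, (D v * δ + Vᶜ.indicator (fun v => D v * (2 * M)) v) ∂μ := by
        refine norm_integral_le_of_norm_le hb (Eventually.of_forall fun v => ?_)
        rw [norm_mul, Complex.norm_real, Real.norm_eq_abs, abs_of_nonneg (h.nonneg v)]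
        by_cases hv : v ∈ V
        · rw [Set.indicator_of_notMem (by simpa using hv), add_zero]
          exact mul_le_mul_of_nonneg_left (hHV v hv) (h.nonneg v)
        · rw [Set.indicator_of_mem (by simpa using hv)]
          have h2 : ‖H v - H 0‖ ≤ 2 * M := by
            linarith [norm_sub_le (H v) (H 0), hM v, hM 0]
          have h3 := mul_le_mul_of_nonneg_left h2 (h.nonneg v)
          have h4 := mul_nonneg (h.nonneg v) hδ
          linarith
    _ = δ + (∫ v in Vᶜ, D v ∂μ) * (2 * M) := by
        rw [integral_add (h.integrable.mul_const δ)
          ((h.integrable.mul_const (2 * M)).indicator hV.compl), integral_mul_const, h.integral_eq,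
          integral_indicator hV.compl, integral_mul_const, one_mul]
    _ ≤ δ + 2 * M * ε := by
        have := mul_le_mul_of_nonneg_right h.tail (show 0 ≤ 2 * M by positivity)
        linarith

/-- A multiplier `ψ` on the Fourier side is an average against `D` on the group. As `ψ` has compact
support, Fubini suffices and no inversion theorem for `k` is needed. -/
theorem IsFejer.fourierInv_mul_fourier {V : Set A} {ε : ℝ} {ψ : A → ℂ} {D : A → ℝ}
    (h : IsFejer G μ V ε ψ D) {k : A → ℂ} (hk : IsCc k) (x : A) :
    fourierInv G μ (fun ξ => ψ ξ * fourier G μ k ξ) x = ∫ v, (D v : ℂ) * k (x + v) ∂μ := by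
  obtain ⟨K, hK, hKk⟩ := exists_compact_of_hasCompactSupport hk.2
  obtain ⟨L, hL, hLψ⟩ := exists_compact_of_hasCompactSupport h.cc.2
  have h1 := hk.1
  have h2 := h.cc.1
  have hsw := integral_swap_of_ne (μ := μ) (ν := μ)
    (f := fun ξ y => (G.kernel x (-ξ) : ℂ) * (ψ ξ * ((G.kernel ξ y : ℂ) * k y))) (by fun_prop)
    hL hK (fun ξ y hy => by
      have hy := right_ne_zero_of_mul hy
      exact ⟨hLψ _ (left_ne_zero_of_mul hy),
        hKk _ (right_ne_zero_of_mul (right_ne_zero_of_mul hy))⟩)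
  simp only [fourierInv, fourier, ← integral_const_mul]
  rw [hsw, ← integral_add_left_eq_self _ x]
  congr 1
  funext v
  rw [← h.fourier_eq, fourier, ← integral_mul_const]
  congr 1
  funext ξ
  simp only [G.kernel_neg_right, G.kernel_comm x ξ, G.kernel_add_right, G.kernel_comm v ξ,
    Circle.coe_mul, Circle.coe_inv]
  field_simp [Circle.coe_ne_zero]

/-- The summability kernels are close to `1` on compact sets in the Fourier domain. -/
theorem exists_isFejer_adapted (hμ : IsSelfDualMeasure G μ) {V : Set A} (hV : V ∈ 𝓝 (0 : A))
    {K : Set A} (hK : IsCompact K) {ε : ℝ} (hε : 0 < ε) :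
    ∃ ψ D U, IsFejer G μ U ε ψ D ∧ U ⊆ V ∧ MeasurableSet U ∧ ∀ x ∈ K, ‖ψ x - 1‖ ≤ ε := by
  obtain ⟨W, hW, hWK⟩ := exists_nhds_uniform (A := A) (Z := A)
    (f := fun x v => (G.kernel x (-v) : ℂ)) (by fun_prop) hK (show 0 < ε / 2 by positivity)
  obtain ⟨U, hUVW, hUo, h0U⟩ := mem_nhds_iff.1 (inter_mem hV hW)
  obtain ⟨ψ, D, h⟩ := exists_isFejer hμ (hUo.mem_nhds h0U) (show 0 < ε / 4 by positivity)
  refine ⟨ψ, D, U, ⟨h.1, h.2, h.3, h.4, h.5, h.6, h.7, h.8.trans (by linarith)⟩,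
    fun x hx => (hUVW hx).1, hUo.measurableSet, fun x hx => ?_⟩
  have h1 := h.average_close hUo.measurableSet (H := fun v => (G.kernel x (-v) : ℂ)) (by fun_prop)
    (M := 1) (δ := ε / 2) (fun v => (Circle.norm_coe _).le) (by positivity)
    (fun v hv => (hWK x hx v (hUVW hv).2).le)
  rw [h.eq_integral]
  simp only [neg_zero, G.kernel_zero_right, Circle.coe_one] at h1
  simp only [mul_comm (G.kernel x _ : ℂ)]
  linarith

end Fourier

/-! ### Interchange of integrals in three and four variables. -/

section Swap

variable {X Y Z W E : Type*} [TopologicalSpace X] [TopologicalSpace Y] [TopologicalSpace Z]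
  [TopologicalSpace W] [NormedAddCommGroup E] [T2Space X] [T2Space Y] [T2Space Z] [T2Space W]
  [MeasurableSpace X] [MeasurableSpace Y] [MeasurableSpace Z] [MeasurableSpace W]
  [OpensMeasurableSpace X] [OpensMeasurableSpace Y] [OpensMeasurableSpace Z]
  [OpensMeasurableSpace W]
  {μX : Measure X} {μY : Measure Y} {μZ : Measure Z} {μW : Measure W}
  [IsFiniteMeasureOnCompacts μX] [IsFiniteMeasureOnCompacts μY] [IsFiniteMeasureOnCompacts μZ]
  [IsFiniteMeasureOnCompacts μW] [NormedSpace ℝ E]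

theorem integral_rotate_of_ne {f : X → Y → Z → E}
    (hf : Continuous fun p : X × Y × Z => f p.1 p.2.1 p.2.2)
    {K : Set X} {L : Set Y} {M : Set Z} (hK : IsCompact K) (hL : IsCompact L) (hM : IsCompact M)
    (h : ∀ x y z, f x y z ≠ 0 → x ∈ K ∧ y ∈ L ∧ z ∈ M) :
    ∫ x, ∫ y, ∫ z, f x y z ∂μZ ∂μY ∂μX = ∫ z, ∫ x, ∫ y, f x y z ∂μY ∂μX ∂μZ := by
  have h1 : ∀ x, ∫ y, ∫ z, f x y z ∂μZ ∂μY = ∫ z, ∫ y, f x y z ∂μY ∂μZ := fun x =>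
    integral_swap_of_ne (by fun_prop) hL hM fun y z hyz => (h x y z hyz).2
  simp only [h1]
  refine integral_swap_of_ne ?_ hK hM fun x z hxz => ?_
  · exact continuous_integral_of_ne (f := fun (p : X × Z) y => f p.1 y p.2) (by fun_prop) hL
      fun p y hy => (h _ _ _ hy).2.1
  · obtain ⟨y, hy⟩ := exists_of_integral_ne_zero hxz
    exact ⟨(h _ _ _ hy).1, (h _ _ _ hy).2.2⟩

theorem integral_exchange_of_ne {f : X → Y → Z → W → E}
    (hf : Continuous fun p : X × Y × Z × W => f p.1 p.2.1 p.2.2.1 p.2.2.2)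
    {K : Set X} {L : Set Y} {M : Set Z} {N : Set W} (hK : IsCompact K) (hL : IsCompact L)
    (hM : IsCompact M) (hN : IsCompact N)
    (h : ∀ x y z w, f x y z w ≠ 0 → x ∈ K ∧ y ∈ L ∧ z ∈ M ∧ w ∈ N) :
    ∫ x, ∫ y, ∫ z, ∫ w, f x y z w ∂μW ∂μZ ∂μY ∂μX =
      ∫ z, ∫ w, ∫ x, ∫ y, f x y z w ∂μY ∂μX ∂μW ∂μZ := by
  rw [integral_rotate_of_ne (f := fun x y z => ∫ w, f x y z w ∂μW) ?_ hK hL hM ?_]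
  · congr 1
    funext z
    exact integral_rotate_of_ne (by fun_prop) hK hL hN fun x y w hw =>
      ⟨(h _ _ _ _ hw).1, (h _ _ _ _ hw).2.1, (h _ _ _ _ hw).2.2.2⟩
  · exact continuous_integral_of_ne (f := fun (p : X × Y × Z) w => f p.1 p.2.1 p.2.2 w)
      (by fun_prop) hN fun p w hw => (h _ _ _ _ hw).2.2.2
  · intro x y z hxyz
    obtain ⟨w, hw⟩ := exists_of_integral_ne_zero hxyz
    exact ⟨(h _ _ _ _ hw).1, (h _ _ _ _ hw).2.1, (h _ _ _ _ hw).2.2.1⟩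

end Swap

section Fourier

variable {A : Type*} [AddCommGroup A] [TopologicalSpace A] [IsTopologicalAddGroup A]
  [LocallyCompactSpace A] [T2Space A] [MeasurableSpace A] [BorelSpace A]
  {G : GaussianExponential A} {μ : Measure A} [μ.IsAddHaarMeasure] [μ.Regular]

/-! ### The Fourier transform of integrable functions -/

theorem exists_isCc_integral_sub_le {f : A → ℂ} (hf : Integrable f μ) {ε : ℝ} (hε : 0 < ε) :
    ∃ g : A → ℂ, IsCc g ∧ ∫ x, ‖f x - g x‖ ∂μ ≤ ε := by
  obtain ⟨g, h1, h2⟩ := exists_isCc_eLpNorm_sub_le (p := 1) (by norm_num)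
    (memLp_one_iff_integrable.2 hf) (ε := ENNReal.ofReal ε) (by simpa using hε)
  refine ⟨g, h2, ?_⟩
  rw [eLpNorm_one_eq_lintegral_enorm] at h1
  change ∫ x, ‖(f - g) x‖ ∂μ ≤ ε
  rw [integral_norm_eq_lintegral_enorm (hf.sub h2.integrable).aestronglyMeasurable]
  exact ENNReal.toReal_le_of_le_ofReal hε.le h1

theorem fourier_sub {f g : A → ℂ} (hf : Integrable f μ) (hg : Integrable g μ) (x : A) :
    fourier G μ (fun y => f y - g y) x = fourier G μ f x - fourier G μ g x := by
  simp only [fourier, mul_sub]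
  exact integral_sub (integrable_kernel_mul hf x) (integrable_kernel_mul hg x)

theorem continuous_fourier_of_integrable {f : A → ℂ} (hf : Integrable f μ) :
    Continuous (fourier G μ f) := by
  refine continuous_of_uniform_approx_of_continuous fun u hu => ?_
  obtain ⟨ε, hε, hεu⟩ := Metric.mem_uniformity_dist.1 hu
  obtain ⟨g, hg, hgε⟩ := exists_isCc_integral_sub_le hf (half_pos hε)
  refine ⟨fourier G μ g, continuous_fourier hg, fun x => hεu ?_⟩
  rw [dist_eq_norm, ← fourier_sub hf hg.integrable]
  exact (norm_fourier_le _ _).trans_lt (hgε.trans_lt (by linarith))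

theorem continuous_fourierInv_of_integrable {f : A → ℂ} (hf : Integrable f μ) :
    Continuous (fourierInv G μ f) := by
  have h1 := (continuous_fourier_of_integrable (G := G) hf).comp continuous_neg
  refine h1.congr fun x => ?_
  rw [fourierInv_eq, Function.comp_apply]

/-- `∫ (𝖥f) m = ∫ f (𝖥m)` for `f ∈ L¹` and `m ∈ C_c`. -/
theorem integral_fourier_mul_of_integrable {f m : A → ℂ} (hf : Integrable f μ) (hm : IsCc m) :
    ∫ x, fourier G μ f x * m x ∂μ = ∫ y, f y * fourier G μ m y ∂μ := by
  rw [← sub_eq_zero, ← norm_le_zero_iff]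
  refine le_of_forall_pos_le_add fun ε hε => ?_
  set c := ∫ x, ‖m x‖ ∂μ with hc
  have hc0 : 0 ≤ c := integral_nonneg fun x => norm_nonneg _
  obtain ⟨g, hg, hgε⟩ := exists_isCc_integral_sub_le hf (show 0 < ε / (2 * c + 1) by positivity)
  have i1 : ∀ {f : A → ℂ}, Integrable f μ → Integrable (fun x => fourier G μ f x * m x) μ :=
    fun hf => (hm.mul_left (continuous_fourier_of_integrable hf)).integrable
  have i2 : ∀ {f : A → ℂ}, Integrable f μ → Integrable (fun x => f x * fourier G μ m x) μ := by
    intro f hf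
    have := hf.bdd_mul (c := c) (continuous_fourier (G := G) (μ := μ) hm).aestronglyMeasurable
      (Eventually.of_forall fun x => norm_fourier_le m x)
    simpa only [mul_comm] using this
  have hfg := hf.sub hg.integrable
  have e1 : ∫ x, fourier G μ f x * m x ∂μ - ∫ y, f y * fourier G μ m y ∂μ =
      ∫ x, fourier G μ (fun y => f y - g y) x * m x ∂μ
        - ∫ y, (f y - g y) * fourier G μ m y ∂μ := by
    simp only [fourier_sub hf hg.integrable, sub_mul]
    rw [integral_sub (i1 hf) (i1 hg.integrable), integral_sub (i2 hf) (i2 hg.integrable),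
      integral_fourier_mul hg hm]
    ring
  have b1 : ‖∫ x, fourier G μ (fun y => f y - g y) x * m x ∂μ‖ ≤ ε / (2 * c + 1) * c := by
    rw [hc, ← integral_const_mul]
    refine norm_integral_le_of_norm_le (hm.integrable.norm.const_mul _)
      (Eventually.of_forall fun x => ?_)
    rw [norm_mul]
    exact mul_le_mul_of_nonneg_right ((norm_fourier_le _ _).trans hgε) (norm_nonneg _)
  have b2 : ‖∫ y, (f y - g y) * fourier G μ m y ∂μ‖ ≤ ε / (2 * c + 1) * c := by
    refine le_trans ?_ (mul_le_mul_of_nonneg_right hgε hc0)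
    rw [← integral_mul_const]
    refine norm_integral_le_of_norm_le (hfg.norm.mul_const _) (Eventually.of_forall fun x => ?_)
    rw [norm_mul]
    exact mul_le_mul_of_nonneg_left (norm_fourier_le m x) (norm_nonneg _)
  rw [e1]
  refine (norm_sub_le _ _).trans ((add_le_add b1 b2).trans ?_)
  rw [zero_add, ← two_mul, div_mul_eq_mul_div, mul_div_assoc', div_le_iff₀ (by positivity)]
  nlinarith

theorem integral_fourierInv_mul_of_integrable {f m : A → ℂ} (hf : Integrable f μ) (hm : IsCc m) :
    ∫ x, fourierInv G μ f x * m x ∂μ = ∫ y, f y * fourierInv G μ m y ∂μ := by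
  have h1 := integral_fourier_mul_of_integrable (G := G)
    ((LinearIsometryEquiv.integrable_comp_iff Complex.conjLIE).2 hf) hm.conj
  have h2 := congrArg (starRingEnd ℂ) h1
  simp only [← integral_conj, map_mul, Complex.conj_conj, conj_fourier] at h2
  simpa using h2

theorem IsFejer.translate_close {V : Set A} {ε : ℝ} {ψ : A → ℂ} {D : A → ℝ}
    (h : IsFejer G μ V ε ψ D) (hV : MeasurableSet V) {k : A → ℂ} (hk : Continuous k) {M δ : ℝ}
    (hM : ∀ x, ‖k x‖ ≤ M) (hδ : 0 ≤ δ) (hkV : ∀ x, ∀ v ∈ V, ‖k (x + v) - k x‖ ≤ δ) (x : A) :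
    ‖∫ v, (D v : ℂ) * k (x + v) ∂μ - k x‖ ≤ δ + 2 * M * ε := by
  have h1 := h.average_close hV (H := fun v => k (x + v)) (by fun_prop) (fun v => hM _) hδ
    (fun v hv => by simpa using hkV x v hv)
  simpa using h1

/-- Weak form of the inversion formula. -/
theorem integral_mul_eq_of_integrable_fourierInv (hμ : IsSelfDualMeasure G μ) {P k : A → ℂ}
    (hP : Integrable P μ) (hPi : Integrable (fourierInv G μ P) μ) (hk : IsCc k) :
    ∫ x, P x * k x ∂μ = ∫ ξ, fourierInv G μ P ξ * fourier G μ k ξ ∂μ := by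
  rw [← sub_eq_zero, ← norm_le_zero_iff]
  refine le_of_forall_pos_le_add fun ε hε => ?_
  obtain ⟨M, hM⟩ := hk.1.bounded_above_of_compact_support hk.2
  have hM0 : 0 ≤ M := (norm_nonneg _).trans (hM 0)
  set c := ∫ x, ‖k x‖ ∂μ with hc
  have hc0 : 0 ≤ c := integral_nonneg fun x => norm_nonneg _
  set p := ∫ x, ‖P x‖ ∂μ with hp
  have hp0 : 0 ≤ p := integral_nonneg fun x => norm_nonneg _
  obtain ⟨g, hg, hgε⟩ := exists_isCc_integral_sub_le hPi
    (show 0 < ε / (4 * (2 * c + 1)) by positivity)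
  obtain ⟨K, hK, hKg⟩ := exists_compact_of_hasCompactSupport hg.2
  set q := ∫ x, ‖g x‖ ∂μ with hq
  have hq0 : 0 ≤ q := integral_nonneg fun x => norm_nonneg _
  obtain ⟨δ, hδ, hδ1, hδ2⟩ : ∃ δ : ℝ, 0 < δ ∧ p * (δ + 2 * M * δ) ≤ ε / 4 ∧
      q * δ * c ≤ ε / 4 := by
    refine ⟨ε / (4 * (p * (1 + 2 * M) + q * c + 1)), by positivity, ?_, ?_⟩
    · rw [show ∀ a : ℝ, p * (a + 2 * M * a) = (p * (1 + 2 * M)) * a from fun a => by ring,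
        mul_div_assoc', div_le_div_iff₀ (by positivity) (by positivity)]
      have : 0 ≤ q * c := by positivity
      nlinarith
    · rw [show ∀ a : ℝ, q * a * c = (q * c) * a from fun a => by ring,
        mul_div_assoc', div_le_div_iff₀ (by positivity) (by positivity)]
      have : 0 ≤ p * (1 + 2 * M) := by positivity
      nlinarith
  obtain ⟨V, hV, hVk⟩ := exists_nhds_translate hk.1 hk.2 hδ
  obtain ⟨ψ, D, U, hF, hUV, hUm, hψK⟩ := exists_isFejer_adapted hμ hV hK hδ
  have hm : IsCc fun ξ => ψ ξ * fourier G μ k ξ := by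
    have := hF.cc.mul_left (continuous_fourier (G := G) (μ := μ) hk)
    simpa only [mul_comm] using this
  -- With the factor `ψ` the formula is exact, with the average of `k` against `D` in place of `k`.
  -- It remains to remove `ψ`: the average is uniformly close to `k`, and `ψ` is close to `1` on the
  -- support of `g`, which carries almost all the mass of `𝖥⁻¹P`.
  have e1 := integral_fourierInv_mul_of_integrable (G := G) hP hm
  simp only [hF.fourierInv_mul_fourier hk] at e1
  have hclose : ∀ x, ‖∫ v, (D v : ℂ) * k (x + v) ∂μ - k x‖ ≤ δ + 2 * M * δ :=
    hF.translate_close hUm hk.1 hM hδ.le fun x v hv => (hVk x v (hUV hv)).le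
  have hDk : Continuous fun x => ∫ v, (D v : ℂ) * k (x + v) ∂μ := by
    simp only [← hF.fourierInv_mul_fourier hk]
    exact continuous_fourierInv hm
  have hkP : Integrable (fun x => P x * k x) μ := by
    have := hP.bdd_mul (c := M) hk.1.aestronglyMeasurable (Eventually.of_forall hM)
    simpa only [mul_comm] using this
  have hkDP : Integrable (fun x => P x * ∫ v, (D v : ℂ) * k (x + v) ∂μ) μ := by
    have := hP.bdd_mul (c := M + (δ + 2 * M * δ)) hDk.aestronglyMeasurable
      (Eventually.of_forall fun x => by
        have h1 := norm_sub_norm_le (∫ v, (D v : ℂ) * k (x + v) ∂μ) (k x)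
        linarith [hclose x, hM x])
    simpa only [mul_comm] using this
  have b1 : ‖∫ x, P x * k x ∂μ - ∫ x, P x * ∫ v, (D v : ℂ) * k (x + v) ∂μ ∂μ‖ ≤ ε / 4 := by
    rw [← integral_sub hkP hkDP]
    refine le_trans ?_ hδ1
    rw [hp, ← integral_mul_const]
    refine norm_integral_le_of_norm_le (hP.norm.mul_const _) (Eventually.of_forall fun x => ?_)
    rw [← mul_sub, norm_mul, norm_sub_rev]
    exact mul_le_mul_of_nonneg_left (hclose x) (norm_nonneg _)
  have hFk : ∀ ξ, ‖fourier G μ k ξ‖ ≤ c := norm_fourier_le k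
  have hψFk : Integrable (fun ξ => fourierInv G μ P ξ * fourier G μ k ξ) μ := by
    have := hPi.bdd_mul (c := c) (continuous_fourier (G := G) (μ := μ) hk).aestronglyMeasurable
      (Eventually.of_forall hFk)
    simpa only [mul_comm] using this
  have hψFk' : Integrable (fun ξ => fourierInv G μ P ξ * (ψ ξ * fourier G μ k ξ)) μ := by
    have := hPi.bdd_mul (c := 1 * c) hm.1.aestronglyMeasurable
      (Eventually.of_forall fun ξ => by
        rw [norm_mul]
        exact mul_le_mul (hF.norm_le ξ) (hFk ξ) (norm_nonneg _) zero_le_one)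
    simpa only [mul_comm] using this
  have b2 : ‖∫ ξ, fourierInv G μ P ξ * (ψ ξ * fourier G μ k ξ) ∂μ -
      ∫ ξ, fourierInv G μ P ξ * fourier G μ k ξ ∂μ‖ ≤ ε / 2 := by
    rw [← integral_sub hψFk' hψFk]
    have hi1 : Integrable (fun ξ => ‖fourierInv G μ P ξ - g ξ‖ * (2 * c)) μ :=
      (hPi.sub hg.integrable).norm.mul_const (2 * c)
    have hi2 := hg.integrable (μ := μ) |>.norm.mul_const (δ * c)
    calc _ ≤ ∫ ξ, (‖fourierInv G μ P ξ - g ξ‖ * (2 * c) + ‖g ξ‖ * (δ * c)) ∂μ := by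
          refine norm_integral_le_of_norm_le (hi1.add hi2) (Eventually.of_forall fun ξ => ?_)
          have e : fourierInv G μ P ξ * (ψ ξ * fourier G μ k ξ) -
              fourierInv G μ P ξ * fourier G μ k ξ =
              (fourierInv G μ P ξ - g ξ) * ((ψ ξ - 1) * fourier G μ k ξ) +
              g ξ * ((ψ ξ - 1) * fourier G μ k ξ) := by ring
          rw [e]
          refine (norm_add_le _ _).trans (add_le_add ?_ ?_)
          · rw [norm_mul, norm_mul]
            refine mul_le_mul_of_nonneg_left (mul_le_mul ?_ (hFk ξ) (norm_nonneg _) (by norm_num))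
              (norm_nonneg _)
            have := norm_sub_le (ψ ξ) 1
            rw [norm_one] at this
            linarith [hF.norm_le ξ]
          · rw [norm_mul, norm_mul]
            by_cases h0 : g ξ = 0
            · simp [h0]
            · exact mul_le_mul_of_nonneg_left (mul_le_mul (hψK ξ (hKg ξ h0)) (hFk ξ)
                (norm_nonneg _) hδ.le) (norm_nonneg _)
      _ = (∫ ξ, ‖fourierInv G μ P ξ - g ξ‖ ∂μ) * (2 * c) + q * (δ * c) := by
          rw [integral_add hi1 hi2, integral_mul_const, integral_mul_const]
      _ ≤ ε / (4 * (2 * c + 1)) * (2 * c) + ε / 4 := by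
          refine add_le_add (mul_le_mul_of_nonneg_right hgε (by positivity)) ?_
          rw [← mul_assoc]
          exact hδ2
      _ ≤ ε / 4 + ε / 4 := by
          refine add_le_add ?_ le_rfl
          rw [div_mul_eq_mul_div, div_le_div_iff₀ (by positivity) (by positivity)]
          nlinarith
      _ = ε / 2 := by ring
  rw [zero_add]
  calc _ = ‖(∫ x, P x * k x ∂μ - ∫ x, P x * ∫ v, (D v : ℂ) * k (x + v) ∂μ ∂μ) +
        (∫ ξ, fourierInv G μ P ξ * (ψ ξ * fourier G μ k ξ) ∂μ -
          ∫ ξ, fourierInv G μ P ξ * fourier G μ k ξ ∂μ)‖ := by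
        rw [e1]
        congr 1
        ring
    _ ≤ ε / 4 + ε / 2 := (norm_add_le _ _).trans (add_le_add b1 b2)
    _ ≤ ε := by linarith

end Fourier

section Fourier

variable {A : Type*} [AddCommGroup A] [TopologicalSpace A] [IsTopologicalAddGroup A]
  [LocallyCompactSpace A] [T2Space A] [MeasurableSpace A] [BorelSpace A]
  {G : GaussianExponential A} {μ : Measure A} [μ.IsAddHaarMeasure] [μ.Regular]

/-! ### Existence of regularizations -/

/-- The radial retraction onto the closed disc of radius `C`. The case `C = 0` is separate because
the formula divides by `max ‖z‖ C`. -/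
theorem exists_retraction {C : ℝ} (hC0 : 0 ≤ C) :
    ∃ r : ℂ → ℂ, Continuous r ∧ r 0 = 0 ∧ (∀ z, ‖r z‖ ≤ C) ∧
      ∀ z w : ℂ, ‖w‖ ≤ C → ‖r z - w‖ ≤ 2 * ‖z - w‖ := by
  rcases hC0.eq_or_lt with hC00 | hCpos
  · refine ⟨0, continuous_zero, rfl, by simpa using hC0, fun z w hw => ?_⟩
    have : w = 0 := norm_le_zero_iff.1 (hw.trans hC00.ge)
    simp [this]
  have hmax : ∀ z : ℂ, 0 < max ‖z‖ C := fun z => lt_max_of_lt_right hCpos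
  refine ⟨fun z => ((C / max ‖z‖ C : ℝ) : ℂ) * z, ?_, by simp, fun z => ?_, fun z w hw => ?_⟩
  · have h1 : Continuous fun z : ℂ => C / max ‖z‖ C :=
      continuous_const.div (by fun_prop) fun z => (hmax z).ne'
    exact (Complex.continuous_ofReal.comp h1).mul continuous_id
  · rw [norm_mul, Complex.norm_real, Real.norm_eq_abs, abs_of_nonneg (div_nonneg hC0 (hmax z).le),
      div_mul_eq_mul_div, div_le_iff₀ (hmax z)]
    exact mul_le_mul_of_nonneg_left (le_max_left _ _) hC0
  · beta_reduce
    by_cases hz : ‖z‖ ≤ C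
    · rw [max_eq_right hz, div_self hCpos.ne', Complex.ofReal_one, one_mul]
      linarith [norm_nonneg (z - w)]
    · have hz : C < ‖z‖ := not_le.1 hz
      have hz0 : 0 < ‖z‖ := hCpos.trans hz
      rw [max_eq_left hz.le]
      have h3 : C / ‖z‖ - 1 ≤ 0 := by
        rw [sub_nonpos, div_le_one hz0]; exact hz.le
      have h2 : ‖((C / ‖z‖ : ℝ) : ℂ) * z - z‖ = ‖z‖ - C := by
        have : ((C / ‖z‖ : ℝ) : ℂ) * z - z = ((C / ‖z‖ - 1 : ℝ) : ℂ) * z := by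
          push_cast; ring
        rw [this, norm_mul, Complex.norm_real, Real.norm_eq_abs, abs_of_nonpos h3, neg_mul,
          sub_mul, div_mul_cancel₀ _ hz0.ne']
        ring
      have h4 : ‖z‖ - ‖w‖ ≤ ‖z - w‖ := norm_sub_norm_le z w
      have h5 := norm_sub_le_norm_sub_add_norm_sub (((C / ‖z‖ : ℝ) : ℂ) * z) z w
      rw [h2] at h5
      linarith

/-- An `L¹` approximation by a function in `C_c` need not respect the bound `C`; the retraction onto
the disc restores it and at most doubles the error. -/
theorem exists_isCc_bounded_close {f : A → ℂ} (hf : Measurable f) {C : ℝ} (hC : ∀ x, ‖f x‖ ≤ C)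
    {K : Set A} (hK : IsCompact K) {ε : ℝ} (hε : 0 < ε) :
    ∃ h : A → ℂ, IsCc h ∧ (∀ x, ‖h x‖ ≤ C) ∧ ∫ y in K, ‖h y - f y‖ ∂μ ≤ ε := by
  have hC0 : 0 ≤ C := (norm_nonneg _).trans (hC 0)
  have hfi : IntegrableOn f K μ :=
    Measure.integrableOn_of_bounded hK.measure_ne_top hf.aestronglyMeasurable
      (Eventually.of_forall hC)
  obtain ⟨g, hg, hgε⟩ := exists_isCc_integral_sub_le
    ((integrable_indicator_iff hK.measurableSet).2 hfi) (show 0 < ε / 2 by positivity)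
  obtain ⟨r, hrc, hr0, hr1, hr2⟩ := exists_retraction hC0
  refine ⟨fun x => r (g x), ⟨hrc.comp hg.1, hg.2.comp_left hr0⟩, fun x => hr1 _, ?_⟩
  have hi : Integrable (fun x => ‖K.indicator f x - g x‖) μ :=
    (((integrable_indicator_iff hK.measurableSet).2 hfi).sub hg.integrable).norm
  calc ∫ y in K, ‖r (g y) - f y‖ ∂μ ≤ ∫ y in K, 2 * ‖K.indicator f y - g y‖ ∂μ := by
        refine integral_mono_of_nonneg (Eventually.of_forall fun y => norm_nonneg _)
          (hi.const_mul 2).integrableOn ?_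
        filter_upwards [ae_restrict_mem hK.measurableSet] with y hy
        rw [Set.indicator_of_mem hy, norm_sub_rev (f y)]
        exact hr2 _ _ (hC y)
    _ ≤ ∫ y, 2 * ‖K.indicator f y - g y‖ ∂μ :=
        setIntegral_le_integral (hi.const_mul 2)
          (Eventually.of_forall fun y => mul_nonneg zero_le_two (norm_nonneg _))
    _ ≤ ε := by
        rw [integral_const_mul]
        linarith

theorem IsFejer.fourier_mul_fourierInv {V : Set A} {ε : ℝ} {ψ : A → ℂ} {D : A → ℝ}
    (h : IsFejer G μ V ε ψ D) {k : A → ℂ} (hk : IsCc k) (x : A) :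
    fourier G μ (fun y => fourierInv G μ k y * ψ y) x = ∫ v, (D v : ℂ) * k (x - v) ∂μ := by
  obtain ⟨K, hK, hKk⟩ := exists_compact_of_hasCompactSupport hk.2
  obtain ⟨L, hL, hLψ⟩ := exists_compact_of_hasCompactSupport h.cc.2
  have h1 := hk.1
  have h2 := h.cc.1
  have hsw := integral_swap_of_ne (μ := μ) (ν := μ)
    (f := fun y z => (G.kernel x y : ℂ) * ((G.kernel y (-z) : ℂ) * k z * ψ y)) (by fun_prop)
    hL hK (fun y z hy => by
      have hy := right_ne_zero_of_mul hy
      exact ⟨hLψ _ (right_ne_zero_of_mul hy),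
        hKk _ (right_ne_zero_of_mul (left_ne_zero_of_mul hy))⟩)
  simp only [fourierInv, fourier, ← integral_const_mul, ← integral_mul_const]
  rw [hsw, ← integral_sub_left_eq_self _ _ x]
  congr 1
  funext v
  rw [← h.fourier_eq, fourier, ← integral_mul_const]
  congr 1
  funext y
  simp only [G.kernel_neg_right, G.kernel_comm x y, G.kernel_sub_right, G.kernel_comm v y,
    Circle.coe_div, Circle.coe_inv]
  field_simp [Circle.coe_ne_zero]

/-- After approximating `f` by `h ∈ C_c`, take `k = ψ 𝖥⁻¹h`. It has compact support, and `𝖥k` is an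
average of `h` against the probability density `D`, so it keeps the bound `C` and is uniformly close
to `h`. -/
theorem exists_regularization (hμ : IsSelfDualMeasure G μ) {f : A → ℂ} (hf : Measurable f) {C : ℝ}
    (hC : ∀ x, ‖f x‖ ≤ C) {K : Set A} (hK : IsCompact K) {ε : ℝ} (hε : 0 < ε) :
    ∃ k : A → ℂ, Continuous k ∧ HasCompactSupport k ∧ (∀ y, ‖fourier G μ k y‖ ≤ C) ∧
      ∫ y in K, ‖fourier G μ k y - f y‖ ∂μ < ε := by
  have hC0 : 0 ≤ C := (norm_nonneg _).trans (hC 0)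
  obtain ⟨h, hh, hhC, hhε⟩ := exists_isCc_bounded_close (μ := μ) hf hC hK
    (show 0 < ε / 2 by positivity)
  set m := μ.real K with hm
  have hm0 : 0 ≤ m := ENNReal.toReal_nonneg
  obtain ⟨δ, hδ, hδ1⟩ : ∃ δ : ℝ, 0 < δ ∧ (δ + 2 * C * δ) * m < ε / 2 := by
    refine ⟨ε / (4 * ((1 + 2 * C) * m + 1)), by positivity, ?_⟩
    rw [show ∀ a : ℝ, (a + 2 * C * a) * m = ((1 + 2 * C) * m) * a from fun a => by ring,
      mul_div_assoc', div_lt_div_iff₀ (by positivity) (by positivity)]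
    have : 0 ≤ (1 + 2 * C) * m := by positivity
    nlinarith
  obtain ⟨V, hV, hVh⟩ := exists_nhds_translate hh.1 hh.2 hδ
  -- The kernel is concentrated in `-V` because the average runs over `h(y - v)`.
  obtain ⟨ψ, D, U, hF, hUV, hUm, -⟩ := exists_isFejer_adapted hμ (neg_mem_nhds_zero A hV)
    (isCompact_empty (X := A)) hδ
  have hk : IsCc fun y => fourierInv G μ h y * ψ y := hF.cc.mul_left (continuous_fourierInv hh)
  refine ⟨_, hk.1, hk.2, fun y => ?_, ?_⟩
  · rw [hF.fourier_mul_fourierInv hh]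
    calc _ ≤ ∫ v, D v * C ∂μ := by
          refine norm_integral_le_of_norm_le (hF.integrable.mul_const C)
            (Eventually.of_forall fun v => ?_)
          rw [norm_mul, Complex.norm_real, Real.norm_eq_abs, abs_of_nonneg (hF.nonneg v)]
          exact mul_le_mul_of_nonneg_left (hhC _) (hF.nonneg v)
      _ = C := by rw [integral_mul_const, hF.integral_eq, one_mul]
  · have hclose : ∀ y, ‖fourier G μ (fun y => fourierInv G μ h y * ψ y) y - h y‖ ≤
        δ + 2 * C * δ := by
      intro y
      rw [hF.fourier_mul_fourierInv hh]
      have hc := hh.1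
      have h1 := hF.average_close hUm (H := fun v => h (y - v)) (by fun_prop) (fun v => hhC _)
        hδ.le (fun v hv => by
          have := hVh y (-v) (by simpa using hUV hv)
          simpa [sub_eq_add_neg] using this.le)
      simpa using h1
    have hi1 : IntegrableOn (fun y => ‖h y - f y‖) K μ :=
      (hh.integrable.integrableOn.sub (Measure.integrableOn_of_bounded hK.measure_ne_top
        hf.aestronglyMeasurable (Eventually.of_forall hC))).norm
    have hi2 : IntegrableOn (fun _ : A => δ + 2 * C * δ) K μ :=
      integrableOn_const hK.measure_ne_top
    calc _ ≤ ∫ y in K, ((δ + 2 * C * δ) + ‖h y - f y‖) ∂μ := by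
          refine integral_mono_of_nonneg (Eventually.of_forall fun y => norm_nonneg _)
            (hi2.add hi1) (Eventually.of_forall fun y => ?_)
          have := norm_add_le (fourier G μ (fun y => fourierInv G μ h y * ψ y) y - h y)
            (h y - f y)
          rw [sub_add_sub_cancel] at this
          simp only
          linarith [hclose y]
      _ = (δ + 2 * C * δ) * m + ∫ y in K, ‖h y - f y‖ ∂μ := by
          rw [integral_add hi2 hi1, setIntegral_const, smul_eq_mul, mul_comm]
      _ < ε := by linarith

theorem integrableOn_of_bounded_measurable {f : A → ℂ} (hf : Measurable f) {C : ℝ}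
    (hC : ∀ x, ‖f x‖ ≤ C) {K : Set A} (hK : IsCompact K) : IntegrableOn f K μ :=
  Measure.integrableOn_of_bounded hK.measure_ne_top hf.aestronglyMeasurable
    (Eventually.of_forall hC)

theorem regularizations_hasBasis {f : A → ℂ} (hf : Measurable f) {C : ℝ} (hC : ∀ x, ‖f x‖ ≤ C) :
    (regularizations G μ C f).HasBasis (fun p : Set A × ℝ => IsCompact p.1 ∧ 0 < p.2)
      fun p => {k | Continuous k ∧ HasCompactSupport k ∧ (∀ y, ‖fourier G μ k y‖ ≤ C) ∧
        ∫ y in p.1, ‖fourier G μ k y - f y‖ ∂μ < p.2} := by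
  have h1 : regularizations G μ C f = ⨅ p ∈ {p : Set A × ℝ | IsCompact p.1 ∧ 0 < p.2},
      𝓟 {k | Continuous k ∧ HasCompactSupport k ∧ (∀ y, ‖fourier G μ k y‖ ≤ C) ∧
        ∫ y in p.1, ‖fourier G μ k y - f y‖ ∂μ < p.2} := by
    simp only [regularizations, Set.mem_ofPred_eq, iInf_and, iInf_prod]
    exact iInf_congr fun K => iInf_comm
  rw [h1]
  refine hasBasis_biInf_principal ?_ ⟨(∅, 1), isCompact_empty, one_pos⟩
  rintro ⟨K₁, ε₁⟩ ⟨hK₁, hε₁⟩ ⟨K₂, ε₂⟩ ⟨hK₂, hε₂⟩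
  refine ⟨(K₁ ∪ K₂, min ε₁ ε₂), ⟨hK₁.union hK₂, lt_min hε₁ hε₂⟩, ?_, ?_⟩
  all_goals
    rintro k ⟨hk1, hk2, hk3, hk4⟩
    refine ⟨hk1, hk2, hk3, ?_⟩
    have hi : IntegrableOn (fun y => ‖fourier G μ k y - f y‖) (K₁ ∪ K₂) μ :=
      (((continuous_fourier ⟨hk1, hk2⟩).continuousOn.integrableOn_compact (hK₁.union hK₂)).sub
        (integrableOn_of_bounded_measurable hf hC (hK₁.union hK₂))).norm
  · exact (setIntegral_mono_set hi (Eventually.of_forall fun _ => norm_nonneg _)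
      (Eventually.of_forall Set.subset_union_left)).trans_lt (hk4.trans_le (min_le_left _ _))
  · exact (setIntegral_mono_set hi (Eventually.of_forall fun _ => norm_nonneg _)
      (Eventually.of_forall Set.subset_union_right)).trans_lt (hk4.trans_le (min_le_right _ _))

theorem regularizations_neBot (hμ : IsSelfDualMeasure G μ) {f : A → ℂ} (hf : Measurable f) {C : ℝ}
    (hC : ∀ x, ‖f x‖ ≤ C) : (regularizations G μ C f).NeBot :=
  (regularizations_hasBasis hf hC).neBot_iff.2 fun hp =>
    exists_regularization hμ hf hC hp.1 hp.2

theorem isCc_of_mem_regularizations (C : ℝ) (f : A → ℂ) :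
    ∀ᶠ k in regularizations G μ C f, IsCc k ∧ ∀ y, ‖fourier G μ k y‖ ≤ C := by
  have : {k | Continuous k ∧ HasCompactSupport k ∧ (∀ y, ‖fourier G μ k y‖ ≤ C) ∧
      ∫ y in (∅ : Set A), ‖fourier G μ k y - f y‖ ∂μ < 1} ∈ regularizations G μ C f :=
    mem_iInf_of_mem ∅ <| mem_iInf_of_mem isCompact_empty <| mem_iInf_of_mem 1 <|
      mem_iInf_of_mem one_pos <| mem_principal_self _
  filter_upwards [this] with k hk
  exact ⟨⟨hk.1, hk.2.1⟩, hk.2.2.1⟩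

/-! ### Test functions -/

variable (G μ) in
/-- The Fourier transform on `A × A`. -/
def fourier₂ (H : A × A → ℂ) (ξ η : A) : ℂ :=
  ∫ x, ∫ y, (G.kernel x ξ : ℂ) * (G.kernel y η : ℂ) * H (x, y) ∂μ ∂μ

theorem continuous_fourier₂ {H : A × A → ℂ} (hH : IsCc H) :
    Continuous fun p : A × A => fourier₂ G μ H p.1 p.2 := by
  obtain ⟨K, L, hK, hL, hKL⟩ := exists_compact_prod_of_hasCompactSupport hH.2
  have h1 := hH.1
  refine continuous_integral_of_ne (L := K) ?_ hK ?_
  · refine continuous_integral_of_ne (L := L) ?_ hL ?_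
    · fun_prop
    · intro z y hy
      exact (hKL _ _ (right_ne_zero_of_mul hy)).2
  · intro z x hx
    obtain ⟨y, hy⟩ := exists_of_integral_ne_zero hx
    exact (hKL _ _ (right_ne_zero_of_mul hy)).1

theorem continuous_fourier₂_comp {H : A × A → ℂ} (hH : IsCc H) {X : Type*} [TopologicalSpace X]
    {f g : X → A} (hf : Continuous f) (hg : Continuous g) :
    Continuous fun x => fourier₂ G μ H (f x) (g x) := by
  change Continuous ((fun p : A × A => fourier₂ G μ H p.1 p.2) ∘ fun x => (f x, g x))
  exact (continuous_fourier₂ hH).comp (hf.prodMk hg)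

/-- The identity `IsFejer.fourierInv_mul_fourier` in the second variable on each slice, and then in
the first variable. -/
theorem IsFejer.average_eq_integral_fourier₂ {V : Set A} {ε : ℝ} {ψ : A → ℂ} {D : A → ℝ}
    (h : IsFejer G μ V ε ψ D) {θ : A × A → ℂ} (hθ : IsCc θ) (x y : A) :
    ∫ v, (D v : ℂ) * ∫ w, (D w : ℂ) * θ (x + v, y + w) ∂μ ∂μ =
      ∫ ξ, ∫ η, ψ ξ * ψ η * fourier₂ G μ θ ξ η *
        ((G.kernel x (-ξ) : ℂ) * (G.kernel y (-η) : ℂ)) ∂μ ∂μ := by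
  obtain ⟨K, L, hK, hL, hKL⟩ := exists_compact_prod_of_hasCompactSupport hθ.2
  obtain ⟨M, hM, hMψ⟩ := exists_compact_of_hasCompactSupport h.cc.2
  have h1 := hθ.1
  have h2 := h.cc.1
  have hsl : ∀ x', IsCc fun y => θ (x', y) := fun x' =>
    ⟨by fun_prop, hasCompactSupport_of_ne hL fun y hy => (hKL _ _ hy).2⟩
  have hF : Continuous fun p : A × A => ∫ y', (G.kernel p.2 y' : ℂ) * θ (p.1, y') ∂μ :=
    continuous_integral_of_ne (L := L) (by fun_prop) hL
      fun z y hy => (hKL _ _ (right_ne_zero_of_mul hy)).2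
  have hF0 : ∀ x' η, ∫ y', (G.kernel η y' : ℂ) * θ (x', y') ∂μ ≠ 0 → x' ∈ K := by
    intro x' η hx
    obtain ⟨y, hy⟩ := exists_of_integral_ne_zero hx
    exact (hKL _ _ (right_ne_zero_of_mul hy)).1
  set k : A → ℂ := fun x' => fourierInv G μ (fun η => ψ η * fourier G μ (fun y => θ (x', y)) η) y
    with hk
  have hkc : IsCc k := by
    constructor
    · refine continuous_integral_of_ne (L := M) ?_ hM ?_
      · simp only [fourier]
        fun_prop
      · intro x' η hη
        exact hMψ _ (left_ne_zero_of_mul (right_ne_zero_of_mul hη))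
    · refine hasCompactSupport_of_ne hK fun x' hx => ?_
      obtain ⟨η, hη⟩ := exists_of_integral_ne_zero hx
      exact hF0 _ _ (right_ne_zero_of_mul (right_ne_zero_of_mul hη))
  calc _ = ∫ v, (D v : ℂ) * k (x + v) ∂μ := by
        congr 1
        funext v
        rw [hk]
        simp only
        rw [h.fourierInv_mul_fourier (hsl _)]
    _ = fourierInv G μ (fun ξ => ψ ξ * fourier G μ k ξ) x := (h.fourierInv_mul_fourier hkc x).symm
    _ = _ := by
        rw [fourierInv]
        congr 1
        funext ξ
        have hsw := integral_swap_of_ne (μ := μ) (ν := μ)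
          (f := fun x' η => (G.kernel ξ x' : ℂ) * ((G.kernel y (-η) : ℂ) *
            (ψ η * ∫ y', (G.kernel η y' : ℂ) * θ (x', y') ∂μ))) (by fun_prop) hK hM
          (fun x' η hη => by
            have hη := right_ne_zero_of_mul (right_ne_zero_of_mul hη)
            exact ⟨hF0 _ _ (right_ne_zero_of_mul hη), hMψ _ (left_ne_zero_of_mul hη)⟩)
        have hk' : fourier G μ k ξ = ∫ η, ψ η * fourier₂ G μ θ ξ η * (G.kernel y (-η) : ℂ) ∂μ := by
          simp only [fourier, hk, fourierInv, ← integral_const_mul] at hsw ⊢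
          rw [hsw]
          congr 1
          funext η
          simp only [fourier₂, ← integral_const_mul, ← integral_mul_const]
          congr 1
          funext x'
          congr 1
          funext y'
          rw [G.kernel_comm ξ x', G.kernel_comm η y']
          ring
        rw [hk', ← integral_const_mul, ← integral_const_mul]
        congr 1
        funext η
        ring

theorem continuous_average {D : A → ℝ} (hD : Integrable D μ) {θ : A × A → ℂ} (hθ : IsCc θ)
    (y : A) : Continuous fun x => ∫ w, (D w : ℂ) * θ (x, y + w) ∂μ := by
  rw [continuous_iff_continuousAt]
  intro x₀
  rw [ContinuousAt, Metric.tendsto_nhds]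
  intro ε hε
  obtain ⟨δ, hδ, hδε⟩ : ∃ δ : ℝ, 0 < δ ∧ (∫ w, ‖D w‖ ∂μ) * δ < ε := by
    have h0 : 0 ≤ ∫ w, ‖D w‖ ∂μ := integral_nonneg fun _ => norm_nonneg _
    refine ⟨ε / ((∫ w, ‖D w‖ ∂μ) + 1), by positivity, ?_⟩
    rw [mul_div_assoc', div_lt_iff₀ (by positivity)]
    nlinarith
  obtain ⟨V, hV, hVθ⟩ := exists_nhds_translate hθ.1 hθ.2 hδ
  have h1 : Tendsto (fun x : A => (x - x₀, (0 : A))) (𝓝 x₀) (𝓝 0) := by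
    have : Continuous fun x : A => (x - x₀, (0 : A)) := by fun_prop
    have h2 := this.tendsto x₀
    rwa [sub_self] at h2
  have hb : ∃ M, ∀ p, ‖θ p‖ ≤ M := by
    obtain ⟨M, hM⟩ := hθ.2.exists_bound_of_continuous hθ.1
    exact ⟨M, hM⟩
  obtain ⟨M, hM⟩ := hb
  have hi : ∀ x, Integrable (fun w => (D w : ℂ) * θ (x, y + w)) μ := by
    intro x
    have h1 := hθ.1
    have hc : Continuous fun w => θ (x, y + w) := by fun_prop
    exact (hD.ofReal).mul_bdd (c := M) hc.measurable.aestronglyMeasurable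
      (Eventually.of_forall fun w => hM _)
  filter_upwards [h1 hV] with x hx
  rw [dist_eq_norm, ← integral_sub (hi _) (hi _)]
  refine lt_of_le_of_lt ?_ hδε
  rw [← integral_mul_const]
  refine norm_integral_le_of_norm_le (hD.norm.mul_const δ) (Eventually.of_forall fun w => ?_)
  rw [← mul_sub, norm_mul, Complex.norm_real]
  refine mul_le_mul_of_nonneg_left ?_ (norm_nonneg _)
  have := hVθ (x₀, y + w) _ hx
  simpa using this.le

theorem exists_isFejer_average_close (hμ : IsSelfDualMeasure G μ) {θ : A × A → ℂ} (hθ : IsCc θ)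
    {ε : ℝ} (hε : 0 < ε) : ∃ V δ ψ D, IsFejer G μ V δ ψ D ∧ ∀ x y,
      ‖∫ v, (D v : ℂ) * ∫ w, (D w : ℂ) * θ (x + v, y + w) ∂μ ∂μ - θ (x, y)‖ ≤ ε := by
  obtain ⟨M, hM⟩ := hθ.2.exists_bound_of_continuous hθ.1
  have hM0 : 0 ≤ M := (norm_nonneg _).trans (hM 0)
  set δ := ε / (2 * (1 + 2 * M)) with hδd
  have hδ : 0 < δ := by positivity
  have hδε : 2 * (δ + 2 * M * δ) = ε := by rw [hδd]; field_simp
  obtain ⟨V, hV, hVθ⟩ := exists_nhds_translate hθ.1 hθ.2 hδ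
  obtain ⟨V₁, hV₁, V₂, hV₂, hVV⟩ := mem_nhds_prod_iff.1 hV
  obtain ⟨ψ, D, U, hF, hUV, hUm, -⟩ := exists_isFejer_adapted hμ (inter_mem hV₁ hV₂)
    (isCompact_empty (X := A)) hδ
  refine ⟨U, δ, ψ, D, hF, fun x y => ?_⟩
  have hc := hθ.1
  have hi : ∀ x y, Integrable (fun w => (D w : ℂ) * θ (x, y + w)) μ := by
    intro x y
    have hc : Continuous fun w => θ (x, y + w) := by fun_prop
    exact (hF.integrable.ofReal).mul_bdd (c := M) hc.measurable.aestronglyMeasurable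
      (Eventually.of_forall fun w => hM _)
  have havg : ∀ g : A → ℂ, ∀ c, (∀ w, ‖g w‖ ≤ c) → ‖∫ w, (D w : ℂ) * g w ∂μ‖ ≤ c := by
    intro g c hg
    calc _ ≤ ∫ w, D w * c ∂μ := by
          refine norm_integral_le_of_norm_le (hF.integrable.mul_const c)
            (Eventually.of_forall fun w => ?_)
          rw [norm_mul, Complex.norm_real, Real.norm_eq_abs, abs_of_nonneg (hF.nonneg w)]
          exact mul_le_mul_of_nonneg_left (hg w) (hF.nonneg w)
      _ = c := by rw [integral_mul_const, hF.integral_eq, one_mul]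
  have h1 := hF.average_close hUm (H := fun w => θ (x, y + w)) (by fun_prop)
    (fun w => hM _) hδ.le (fun w hw => by
      have := hVθ (x, y) (0, w) (hVV ⟨mem_of_mem_nhds hV₁, (hUV hw).2⟩)
      simpa using this.le)
  have hc2 := continuous_average hF.integrable hθ y
  have h2 := hF.average_close hUm (H := fun v => ∫ w, (D w : ℂ) * θ (x + v, y + w) ∂μ)
    (hc2.comp (continuous_const.add continuous_id))
    (fun v => havg _ _ fun w => hM _) hδ.le (fun v hv => by
      rw [← integral_sub (hi _ _) (hi _ _)]
      simp only [← mul_sub]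
      refine havg _ _ fun w => ?_
      have := hVθ (x, y + w) (v, 0) (hVV ⟨(hUV hv).1, mem_of_mem_nhds hV₂⟩)
      simpa using this.le)
  simp only [add_zero] at h1 h2
  have := norm_sub_le_norm_sub_add_norm_sub
    (∫ v, (D v : ℂ) * ∫ w, (D w : ℂ) * θ (x + v, y + w) ∂μ ∂μ)
    (∫ w, (D w : ℂ) * θ (x, y + w) ∂μ) (θ (x, y))
  linarith

/-- Norms are moved inside as lower integrals, which requires no joint measurability. -/
theorem norm_integral_integral_le (F : A → A → ℂ) {D : ℝ} {N : ℝ≥0∞} (hN : N ≠ ∞) (hD : 0 ≤ D)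
    {Θ : A → A → ℂ} (hF : ∀ ξ η, ‖F ξ η‖ ≤ ‖Θ ξ η‖ * D)
    (hΘ : ∫⁻ ξ, ∫⁻ η, ‖Θ ξ η‖ₑ ∂μ ∂μ ≤ N) :
    ‖∫ ξ, ∫ η, F ξ η ∂μ ∂μ‖ ≤ N.toReal * D := by
  have h1 : ‖∫ ξ, ∫ η, F ξ η ∂μ ∂μ‖ₑ ≤ N * ENNReal.ofReal D := by
    calc ‖∫ ξ, ∫ η, F ξ η ∂μ ∂μ‖ₑ ≤ ∫⁻ ξ, ‖∫ η, F ξ η ∂μ‖ₑ ∂μ := enorm_integral_le_lintegral_enorm _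
      _ ≤ ∫⁻ ξ, ∫⁻ η, ‖F ξ η‖ₑ ∂μ ∂μ := lintegral_mono fun ξ => enorm_integral_le_lintegral_enorm _
      _ ≤ ∫⁻ ξ, ∫⁻ η, ‖Θ ξ η‖ₑ * ENNReal.ofReal D ∂μ ∂μ := by
          refine lintegral_mono fun ξ => lintegral_mono fun η => ?_
          rw [← ofReal_norm, ← ofReal_norm, ← ENNReal.ofReal_mul (norm_nonneg _)]
          exact ENNReal.ofReal_le_ofReal (hF ξ η)
      _ = (∫⁻ ξ, ∫⁻ η, ‖Θ ξ η‖ₑ ∂μ ∂μ) * ENNReal.ofReal D := by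
          simp only [lintegral_mul_const' _ _ ENNReal.ofReal_ne_top]
      _ ≤ _ := by gcongr
  have h2 := ENNReal.toReal_mono (ENNReal.mul_ne_top hN ENNReal.ofReal_ne_top) h1
  rwa [toReal_enorm, ENNReal.toReal_mul, ENNReal.toReal_ofReal hD] at h2

set_option maxHeartbeats 1000000 in
-- Parseval's formula bounds `∫∫ θH` by the `L¹` norm of the transform of `θ` times the supremum of
-- that of `H`. To interchange integrals, `θ` is replaced by its average `θ'` against a summability
-- kernel; this multiplies the transform by `ψ(ξ)ψ(η)`, of modulus at most `1` and compactly
-- supported, and moves `θ` by little in the uniform norm.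
theorem IsTest.exists_bound (hμ : IsSelfDualMeasure G μ) {θ : A × A → ℂ} (hθ : IsTest G μ θ) :
    ∃ N : ℝ, 0 ≤ N ∧ ∀ H : A × A → ℂ, IsCc H → ∀ D, (∀ ξ η, ‖fourier₂ G μ H ξ η‖ ≤ D) →
      ‖∫ x, ∫ y, θ (x, y) * H (x, y) ∂μ ∂μ‖ ≤ N * D := by
  have hθc : IsCc θ := ⟨hθ.1, hθ.2.1⟩
  refine ⟨_, ENNReal.toReal_nonneg (a := ∫⁻ ξ, ∫⁻ η, ‖fourier₂ G μ θ ξ η‖ₑ ∂μ ∂μ), ?_⟩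
  intro H hH C hC
  have hC0 : 0 ≤ C := (norm_nonneg _).trans (hC 0 0)
  obtain ⟨K, L, hK, hL, hKL⟩ := exists_compact_prod_of_hasCompactSupport hH.2
  set m : ℝ := ∫ x, ∫ y, ‖H (x, y)‖ ∂μ ∂μ with hm
  have hm0 : 0 ≤ m := integral_nonneg fun x => integral_nonneg fun y => norm_nonneg _
  have hHc := hH.1
  refine le_of_forall_pos_le_add fun ε hε => ?_
  obtain ⟨V, δ, ψ, D, hF, hcl⟩ := exists_isFejer_average_close hμ hθc
    (show 0 < ε / (m + 1) by positivity)
  obtain ⟨M, hM, hMψ⟩ := exists_compact_of_hasCompactSupport hF.cc.2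
  have hψ := hF.cc.1
  set θ' : A × A → ℂ := fun p => ∫ ξ, ∫ η, ψ ξ * ψ η * fourier₂ G μ θ ξ η *
        ((G.kernel p.1 (-ξ) : ℂ) * (G.kernel p.2 (-η) : ℂ)) ∂μ ∂μ with hθ'
  have hθ'c : Continuous θ' := by
    refine continuous_integral_of_ne (L := M) ?_ hM ?_
    · refine continuous_integral_of_ne (L := M) ?_ hM ?_
      · have : Continuous fun p : ((A × A) × A) × A => fourier₂ G μ θ p.1.2 p.2 :=
          continuous_fourier₂_comp hθc (by fun_prop) (by fun_prop)
        fun_prop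
      · intro z η h
        exact hMψ _ (right_ne_zero_of_mul (left_ne_zero_of_mul (left_ne_zero_of_mul h)))
    · intro z ξ h
      obtain ⟨η, h⟩ := exists_of_integral_ne_zero h
      exact hMψ _ (left_ne_zero_of_mul (left_ne_zero_of_mul (left_ne_zero_of_mul h)))
  have hcl' : ∀ p, ‖θ p - θ' p‖ ≤ ε / (m + 1) := by
    intro p
    rw [norm_sub_rev, hθ']
    simp only
    rw [← hF.average_eq_integral_fourier₂ hθc]
    exact hcl p.1 p.2
  have hint : ∀ g : A × A → ℂ, Continuous g → (∀ x, Integrable (fun y => g (x, y) * H (x, y)) μ) ∧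
      Integrable (fun x => ∫ y, g (x, y) * H (x, y) ∂μ) μ := by
    intro g hg
    refine ⟨fun x => integrable_of_ne (by fun_prop) hL fun y hy =>
      (hKL _ _ (right_ne_zero_of_mul hy)).2, integrable_of_ne (K := K) ?_ hK ?_⟩
    · exact continuous_integral_of_ne (by fun_prop) hL fun z y hy =>
        (hKL _ _ (right_ne_zero_of_mul hy)).2
    · intro x hx
      obtain ⟨y, hy⟩ := exists_of_integral_ne_zero hx
      exact (hKL _ _ (right_ne_zero_of_mul hy)).1
  have hHn : ∀ x y, ‖H (x, y)‖ ≠ 0 → x ∈ K ∧ y ∈ L := fun x y h => hKL x y (norm_ne_zero_iff.1 h)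
  have hi1 : ∀ x, Integrable (fun y => ‖H (x, y)‖) μ := fun x =>
    integrable_of_ne (by fun_prop) hL fun y hy => (hHn _ _ hy).2
  have hi2 : Integrable (fun x => ∫ y, ‖H (x, y)‖ ∂μ) μ := by
    refine integrable_of_ne (K := K) ?_ hK ?_
    · exact continuous_integral_of_ne (by fun_prop) hL fun z y hy => (hHn _ _ hy).2
    · intro x hx
      obtain ⟨y, hy⟩ := exists_of_integral_ne_zero hx
      exact (hHn _ _ hy).1
  have hA : ‖∫ x, ∫ y, θ (x, y) * H (x, y) ∂μ ∂μ - ∫ x, ∫ y, θ' (x, y) * H (x, y) ∂μ ∂μ‖ ≤ ε := by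
    rw [← integral_sub (hint θ hθ.1).2 (hint θ' hθ'c).2]
    calc _ ≤ ∫ x, (ε / (m + 1)) * ∫ y, ‖H (x, y)‖ ∂μ ∂μ := by
          refine norm_integral_le_of_norm_le (hi2.const_mul _) (Eventually.of_forall fun x => ?_)
          rw [← integral_sub ((hint θ hθ.1).1 x) ((hint θ' hθ'c).1 x), ← integral_const_mul]
          refine norm_integral_le_of_norm_le ((hi1 x).const_mul _)
            (Eventually.of_forall fun y => ?_)
          rw [← sub_mul, norm_mul]
          exact mul_le_mul_of_nonneg_right (hcl' _) (norm_nonneg _)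
      _ = ε / (m + 1) * m := by rw [integral_const_mul]
      _ ≤ ε := by
          rw [div_mul_eq_mul_div, div_le_iff₀ (by positivity)]
          nlinarith
  have hB : ∫ x, ∫ y, θ' (x, y) * H (x, y) ∂μ ∂μ =
      ∫ ξ, ∫ η, ψ ξ * ψ η * fourier₂ G μ θ ξ η * fourier₂ G μ H (-ξ) (-η) ∂μ ∂μ := by
    have := integral_exchange_of_ne (μX := μ) (μY := μ) (μZ := μ) (μW := μ)
      (f := fun x y ξ η => ψ ξ * ψ η * fourier₂ G μ θ ξ η *
        ((G.kernel x (-ξ) : ℂ) * (G.kernel y (-η) : ℂ)) * H (x, y)) (by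
          have : Continuous fun p : A × A × A × A => fourier₂ G μ θ p.2.2.1 p.2.2.2 :=
            continuous_fourier₂_comp hθc (by fun_prop) (by fun_prop)
          fun_prop) hK hL hM hM (by
          intro x y ξ η h
          obtain ⟨h1, h2⟩ := mul_ne_zero_iff.1 h
          have h3 := left_ne_zero_of_mul (left_ne_zero_of_mul h1)
          exact ⟨(hKL _ _ h2).1, (hKL _ _ h2).2, hMψ _ (left_ne_zero_of_mul h3),
            hMψ _ (right_ne_zero_of_mul h3)⟩)
    simp only [hθ', fourier₂, ← integral_mul_const, ← integral_const_mul] at this ⊢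
    rw [this]
    simp only [mul_assoc]
  have hC' : ‖∫ x, ∫ y, θ' (x, y) * H (x, y) ∂μ ∂μ‖ ≤
      (∫⁻ ξ, ∫⁻ η, ‖fourier₂ G μ θ ξ η‖ₑ ∂μ ∂μ).toReal * C := by
    rw [hB]
    refine norm_integral_integral_le _ hθ.2.2.ne hC0 (Θ := fourier₂ G μ θ) (fun ξ η => ?_) le_rfl
    rw [norm_mul, norm_mul, norm_mul]
    have h1 := hF.norm_le ξ
    have h2 := hF.norm_le η
    have h3 : ‖ψ ξ‖ * ‖ψ η‖ ≤ 1 := mul_le_one₀ h1 (norm_nonneg _) h2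
    exact mul_le_mul (mul_le_of_le_one_left (norm_nonneg _) h3) (hC _ _) (norm_nonneg _)
      (norm_nonneg _)
  have := norm_add_le (∫ x, ∫ y, θ (x, y) * H (x, y) ∂μ ∂μ - ∫ x, ∫ y, θ' (x, y) * H (x, y) ∂μ ∂μ)
    (∫ x, ∫ y, θ' (x, y) * H (x, y) ∂μ ∂μ)
  rw [sub_add_cancel] at this
  linarith

end Fourier

/-! ### Bounds and continuity for integrals over compact supports. -/

theorem norm_integral_le_of_ne {X E : Type*} [TopologicalSpace X] [T2Space X] [MeasurableSpace X]
    [OpensMeasurableSpace X] {μ : Measure X} [IsFiniteMeasureOnCompacts μ] [NormedAddCommGroup E]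
    [NormedSpace ℝ E] {f : X → E} {K : Set X} (hK : IsCompact K) (h : ∀ x, f x ≠ 0 → x ∈ K) {C : ℝ}
    (hC : ∀ x, ‖f x‖ ≤ C) : ‖∫ x, f x ∂μ‖ ≤ μ.real K * C := by
  have h1 : ∫ x, f x ∂μ = ∫ x in K, f x ∂μ :=
    (setIntegral_eq_integral_of_forall_compl_eq_zero fun x hx => by
      by_contra h0; exact hx (h x h0)).symm
  rw [h1, mul_comm]
  exact norm_setIntegral_le_of_norm_le_const hK.measure_lt_top fun x _ => hC x

theorem continuous_integral_of_compact {Z Y E : Type*} [TopologicalSpace Z] [LocallyCompactSpace Z]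
    [TopologicalSpace Y] [MeasurableSpace Y] [OpensMeasurableSpace Y] {ν : Measure Y}
    [IsFiniteMeasureOnCompacts ν] [NormedAddCommGroup E] [NormedSpace ℝ E] {f : Z → Y → E}
    (hf : Continuous fun p : Z × Y => f p.1 p.2)
    (h : ∀ K, IsCompact K → ∃ L : Set Y, IsCompact L ∧ ∀ z ∈ K, ∀ y, f z y ≠ 0 → y ∈ L) :
    Continuous fun z => ∫ y, f z y ∂ν := by
  refine continuous_integral_of_locally hf fun z₀ => ?_
  obtain ⟨K, hK, hKz⟩ := exists_compact_mem_nhds z₀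
  obtain ⟨L, hL, h⟩ := h K hK
  exact ⟨K, hKz, L, hL, h⟩

section Fourier

variable {A : Type*} [AddCommGroup A] [TopologicalSpace A] [IsTopologicalAddGroup A]
  [LocallyCompactSpace A] [T2Space A] [MeasurableSpace A] [BorelSpace A]
  {G : GaussianExponential A} {χ : Bicharacter A} {μ : Measure A} [μ.IsAddHaarMeasure] [μ.Regular]
  {B : AddSubgroup A} {ν : Measure B} [ν.IsAddHaarMeasure] [ν.Regular]

/-! ### Windows -/

theorem isCompact_sub {K L : Set A} (hK : IsCompact K) (hL : IsCompact L) : IsCompact (K - L) := by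
  rw [sub_eq_add_neg]
  exact hK.add hL.neg

theorem isCompact_subgroup (hB : IsClosed (B : Set A)) {K : Set A} (hK : IsCompact K) :
    IsCompact {b : B | (b : A) ∈ K} :=
  hB.isClosedEmbedding_subtypeVal.isCompact_preimage hK

/-- The integral depends only on the coset of `s` modulo `B`. If it does not vanish, some
representative lies in the support of `w`, where continuity and compactness give a bound. -/
theorem exists_subgroup_integral_bound (hB : IsClosed (B : Set A)) {w : A → ℝ} (hw : Continuous w)
    (hwc : HasCompactSupport w) :
    ∃ M, 0 ≤ M ∧ ∀ s : A, ∫ a : B, w (s - a) ∂ν ≤ M := by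
  obtain ⟨K, hK, hKw⟩ := exists_compact_of_hasCompactSupport hwc
  have hc : Continuous fun s : A => ∫ a : B, w (s - a) ∂ν := by
    refine continuous_integral_of_compact (by fun_prop) fun K' hK' => ?_
    refine ⟨_, isCompact_subgroup hB (isCompact_sub hK' hK), fun s hs a ha => ?_⟩
    exact ⟨s, hs, s - a, hKw _ ha, by simp⟩
  obtain ⟨M, hM⟩ := hK.exists_bound_of_continuousOn hc.continuousOn
  refine ⟨max M 0, le_max_right _ _, fun s => ?_⟩
  by_cases h0 : ∫ a : B, w (s - a) ∂ν = 0
  · rw [h0]; exact le_max_right _ _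
  obtain ⟨a₀, ha₀⟩ := exists_of_integral_ne_zero h0
  have : ∫ a : B, w (s - a) ∂ν = ∫ a : B, w (s - a₀ - a) ∂ν := by
    rw [← integral_add_left_eq_self (fun a : B => w (s - a)) a₀]
    congr 1
    funext a
    rw [AddSubgroup.coe_add, sub_add_eq_sub_sub]
  rw [this]
  exact ((le_abs_self _).trans (hM _ (hKw _ ha₀))).trans (le_max_left _ _)

theorem fourier_mul_fourier {ψ w : A → ℂ} (hψ : IsCc ψ) (hw : IsCc w) (ζ : A) :
    fourier G μ (fun y => ψ y * fourier G μ w y) ζ = ∫ r, w (r - ζ) * fourier G μ ψ r ∂μ := by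
  obtain ⟨K, hK, hKψ⟩ := exists_compact_of_hasCompactSupport hψ.2
  obtain ⟨L, hL, hLw⟩ := exists_compact_of_hasCompactSupport hw.2
  have h1 := hψ.1
  have h2 := hw.1
  have hsw := integral_swap_of_ne (μ := μ) (ν := μ)
    (f := fun y r => (G.kernel ζ y : ℂ) * (ψ y * ((G.kernel y r : ℂ) * w r))) (by fun_prop)
    hK hL (fun y z hy => by
      have hy := right_ne_zero_of_mul hy
      exact ⟨hKψ _ (left_ne_zero_of_mul hy),
        hLw _ (right_ne_zero_of_mul (right_ne_zero_of_mul hy))⟩)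
  simp only [fourier, ← integral_const_mul]
  rw [hsw, ← integral_sub_right_eq_self _ ζ]
  congr 1
  funext v
  congr 1
  funext y
  simp only [G.kernel_sub_right, G.kernel_comm v y, G.kernel_comm ζ y, Circle.coe_div]
  field_simp [Circle.coe_ne_zero]

/-- The transform of the window is an average, with weight `w`, of the integrable function `𝖥(corr φ
φ)`. Integrating over a coset of `B` first, each point of that function is counted with weight at
most `sup_s ∫_B w(s - a) da`. -/
theorem exists_amalgam_bound (hμ : IsSelfDualMeasure G μ) (hB : IsClosed (B : Set A)) {φ : A → ℂ}
    (hφ : IsCc φ) {w : A → ℝ} (hw : Continuous w) (hwc : HasCompactSupport w)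
    (hw0 : ∀ x, 0 ≤ w x) :
    ∃ M, 0 ≤ M ∧ ∀ (ζ : A) (κ : B → ℝ), Continuous κ → HasCompactSupport κ → (∀ a, 0 ≤ κ a) →
      (∀ a, κ a ≤ 1) → ∫ a : B, κ a * ‖fourier G μ
        (fun y => corr μ φ φ y * fourier G μ (fun r => (w r : ℂ)) y) (a + ζ)‖ ∂ν ≤ M := by
  obtain ⟨M, hM0, hM⟩ := exists_subgroup_integral_bound (ν := ν) hB hw hwc
  have hwC := IsCc.ofReal hw hwc
  have hc := isCc_corr μ hφ hφ
  have hFi := integrable_fourier_corr (G := G) hμ hφ hφ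
  have hFc := continuous_fourier (G := G) (μ := μ) hc
  obtain ⟨K, hK, hKw⟩ := exists_compact_of_hasCompactSupport hwc
  refine ⟨(∫ r, ‖fourier G μ (corr μ φ φ) r‖ ∂μ) * M,
    mul_nonneg (integral_nonneg fun _ => norm_nonneg _) hM0, fun ζ κ hκ hκc hκ0 hκ1 => ?_⟩
  obtain ⟨L, hL, hLκ⟩ := exists_compact_of_hasCompactSupport hκc
  have hL' : IsCompact ((fun b : B => (b : A)) '' L) := hL.image continuous_subtype_val
  have hsupp : ∀ (a : B) r, κ a * (w (r - (a + ζ)) * ‖fourier G μ (corr μ φ φ) r‖) ≠ 0 →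
      a ∈ L ∧ r ∈ K + ((fun b : B => (b : A)) '' L + {ζ}) := by
    intro a r h
    have h1 := hLκ _ (left_ne_zero_of_mul h)
    refine ⟨h1, _, hKw _ (left_ne_zero_of_mul (right_ne_zero_of_mul h)), a + ζ,
      ⟨a, ⟨a, h1, rfl⟩, ζ, rfl, rfl⟩, by simp⟩
  have hK' := hK.add (hL'.add (isCompact_singleton (x := ζ)))
  have hcont : Continuous fun p : B × A =>
      κ p.1 * (w (p.2 - (p.1 + ζ)) * ‖fourier G μ (corr μ φ φ) p.2‖) := by fun_prop
  calc _ ≤ ∫ a : B, ∫ r, κ a * (w (r - (a + ζ)) * ‖fourier G μ (corr μ φ φ) r‖) ∂μ ∂ν := by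
        refine integral_mono_of_nonneg
          (Eventually.of_forall fun a => mul_nonneg (hκ0 a) (norm_nonneg _)) ?_
          (Eventually.of_forall fun a => ?_)
        · refine integrable_of_ne (K := L)
            (continuous_integral_of_ne hcont hK' fun a r h => (hsupp a r h).2) hL fun a h => ?_
          obtain ⟨r, hr⟩ := exists_of_integral_ne_zero h
          exact (hsupp a r hr).1
        · simp only
          rw [integral_const_mul, fourier_mul_fourier hc hwC]
          refine mul_le_mul_of_nonneg_left ?_ (hκ0 a)
          refine (norm_integral_le_integral_norm _).trans_eq ?_
          congr 1
          funext r
          rw [norm_mul, Complex.norm_real, Real.norm_eq_abs, abs_of_nonneg (hw0 _)]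
    _ = ∫ r, ∫ a : B, κ a * (w (r - (a + ζ)) * ‖fourier G μ (corr μ φ φ) r‖) ∂ν ∂μ :=
        integral_swap_of_ne hcont hL hK' hsupp
    _ ≤ ∫ r, ‖fourier G μ (corr μ φ φ) r‖ * M ∂μ := by
        refine integral_mono_of_nonneg (Eventually.of_forall fun r => integral_nonneg fun a =>
          mul_nonneg (hκ0 a) (mul_nonneg (hw0 _) (norm_nonneg _))) (hFi.norm.mul_const M)
          (Eventually.of_forall fun r => ?_)
        calc _ ≤ ∫ a : B, ‖fourier G μ (corr μ φ φ) r‖ * w (r - ζ - a) ∂ν := by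
              refine integral_mono_of_nonneg (Eventually.of_forall fun a =>
                mul_nonneg (hκ0 a) (mul_nonneg (hw0 _) (norm_nonneg _))) ?_
                (Eventually.of_forall fun a => ?_)
              · refine integrable_of_ne (by fun_prop) (isCompact_subgroup hB
                  (isCompact_sub (isCompact_singleton (x := r - ζ)) hK)) fun a ha => ?_
                exact ⟨r - ζ, rfl, r - ζ - a, hKw _ (right_ne_zero_of_mul ha), by simp⟩
              · simp only
                rw [show r - (a + ζ) = r - ζ - a by abel, mul_comm (w _)]
                exact mul_le_of_le_one_left (mul_nonneg (norm_nonneg _) (hw0 _)) (hκ1 a)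
          _ ≤ _ := by
              rw [integral_const_mul]
              exact mul_le_mul_of_nonneg_left (hM _) (norm_nonneg _)
    _ = _ := integral_mul_const _ _

/-- Averages of an integrable function are integrable. -/
theorem integral_cutoff_average_le {D : A → ℝ} (hD : Continuous D) (hDi : Integrable D μ)
    (hD0 : ∀ r, 0 ≤ D r) {w : A → ℝ} (hw : Continuous w) (hwc : HasCompactSupport w)
    (hw0 : ∀ x, 0 ≤ w x) {κ : A → ℝ} (hκ : Continuous κ) (hκc : HasCompactSupport κ)
    (hκ0 : ∀ y, 0 ≤ κ y) (hκ1 : ∀ y, κ y ≤ 1) :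
    ∫ σ, κ σ * ∫ r, w (r - σ) * D r ∂μ ∂μ ≤ (∫ r, D r ∂μ) * ∫ r, w r ∂μ := by
  obtain ⟨K, hK, hKw⟩ := exists_compact_of_hasCompactSupport hwc
  obtain ⟨L, hL, hLκ⟩ := exists_compact_of_hasCompactSupport hκc
  have hsw := integral_swap_of_ne (μ := μ) (ν := μ) (f := fun σ r => κ σ * (w (r - σ) * D r))
    (by fun_prop) hL (hK.add hL) (fun σ r h => by
      have h1 := hLκ _ (left_ne_zero_of_mul h)
      exact ⟨h1, r - σ, hKw _ (left_ne_zero_of_mul (right_ne_zero_of_mul h)), σ, h1, by simp⟩)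
  simp only [integral_const_mul] at hsw
  rw [hsw, ← integral_mul_const]
  refine integral_mono_of_nonneg (Eventually.of_forall fun r => integral_nonneg fun σ =>
    mul_nonneg (hκ0 _) (mul_nonneg (hw0 _) (hD0 _))) (hDi.mul_const _)
    (Eventually.of_forall fun r => ?_)
  beta_reduce
  rw [← integral_sub_left_eq_self w μ r, ← integral_const_mul]
  have hwi : Integrable (fun σ => w (r - σ)) μ :=
    (hw.integrable_of_hasCompactSupport hwc).comp_sub_left r
  refine integral_mono_of_nonneg (Eventually.of_forall fun σ => mul_nonneg (hκ0 _)
    (mul_nonneg (hw0 _) (hD0 _))) (hwi.const_mul _) (Eventually.of_forall fun σ => ?_)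
  simp only
  rw [mul_comm (w _)]
  exact mul_le_of_le_one_left (mul_nonneg (hD0 _) (hw0 _)) (hκ1 σ)

variable (G χ) in
/-- The quadratic phase `⟨x⟩ χ(x,y)`. -/
def quadPhase (x y : A) : Circle := G.toFun x * χ.toFun x y

@[fun_prop]
theorem continuous_quadPhase {X : Type*} [TopologicalSpace X] {f g : X → A}
    (hf : Continuous f) (hg : Continuous g) :
    Continuous fun x => (quadPhase G χ (f x) (g x) : ℂ) := by
  simp only [quadPhase, Circle.coe_mul]
  fun_prop

/-- The phase is of second degree: its quotient by a translate is a constant times characters in `x`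
and `y`. -/
theorem quadPhase_sub (x y t s : A) :
    quadPhase G χ x y * (quadPhase G χ (x - t) (y - s))⁻¹ =
      (quadPhase G χ t s)⁻¹ * (G.kernel x t * χ.toFun x s * χ.toFun t y) := by
  simp only [quadPhase, G.toFun_sub, χ.map_sub_left, χ.map_sub_right]
  apply Additive.ofMul.injective
  simp only [ofMul_mul, ofMul_div, ofMul_inv]
  abel

variable (G μ) in
/-- A window function of the form `y ↦ ψ(y) ŵ(y)`, with `ψ` a correlation and `w` nonnegative. -/
def IsAmalgamWindow (ψ : A → ℂ) : Prop :=
  ∃ (φ : A → ℂ) (w : A → ℝ), IsCc φ ∧ Continuous w ∧ HasCompactSupport w ∧ (∀ x, 0 ≤ w x) ∧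
    ψ = fun y => corr μ φ φ y * fourier G μ (fun r => (w r : ℂ)) y

variable (G χ μ ν) in
/-- A pair of window functions on which the quadratic phase has a nonzero mean, the second with
Fourier transform uniformly integrable over the cosets of `B`. -/
structure IsWindow (ψ₁ ψ₂ : A → ℂ) (M : ℝ) : Prop where
  cc₁ : IsCc ψ₁
  cc₂ : IsCc ψ₂
  rep₁ : IsAmalgamWindow G μ ψ₁
  mean_ne_zero : ∫ t, ∫ s, (((quadPhase G χ t s)⁻¹ : Circle) : ℂ) * (ψ₁ t * ψ₂ s) ∂μ ∂μ ≠ 0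
  nonneg : 0 ≤ M
  amalgam : ∀ (ζ : A) (κ : B → ℝ), Continuous κ → HasCompactSupport κ → (∀ a, 0 ≤ κ a) →
      (∀ a, κ a ≤ 1) → ∫ a : B, κ a * ‖fourier G μ ψ₂ (a + ζ)‖ ∂ν ≤ M

theorem IsAmalgamWindow.isCc {ψ : A → ℂ} (hψ : IsAmalgamWindow G μ ψ) : IsCc ψ := by
  obtain ⟨φ, w, hφ, hw, hwc, -, rfl⟩ := hψ
  have := (isCc_corr μ hφ hφ).mul_left (continuous_fourier (G := G) (μ := μ) (IsCc.ofReal hw hwc))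
  simpa only [mul_comm] using this

/-- The Fourier transform of a window is dominated by an average of an integrable function. -/
theorem IsAmalgamWindow.exists_dominating (hμ : IsSelfDualMeasure G μ) {ψ : A → ℂ}
    (hψ : IsAmalgamWindow G μ ψ) : ∃ D w : A → ℝ, Continuous D ∧ Integrable D μ ∧ (∀ r, 0 ≤ D r) ∧
      Continuous w ∧ HasCompactSupport w ∧ (∀ x, 0 ≤ w x) ∧
        ∀ ζ, ‖fourier G μ ψ ζ‖ ≤ ∫ r, w (r - ζ) * D r ∂μ := by
  obtain ⟨φ, w, hφ, hw, hwc, hw0, rfl⟩ := hψ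
  have hc := isCc_corr μ hφ hφ
  refine ⟨fun r => ‖fourier G μ (corr μ φ φ) r‖, w, (continuous_fourier hc).norm,
    (integrable_fourier_corr hμ hφ hφ).norm, fun _ => norm_nonneg _, hw, hwc, hw0, fun ζ => ?_⟩
  rw [fourier_mul_fourier hc (IsCc.ofReal hw hwc)]
  refine (norm_integral_le_integral_norm _).trans_eq ?_
  congr 1
  funext r
  rw [norm_mul, Complex.norm_real, Real.norm_eq_abs, abs_of_nonneg (hw0 _)]

theorem integrable_of_dominating {f : A → ℂ} (hf : Continuous f) {D : A → ℝ} (hD : Continuous D)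
    (hDi : Integrable D μ) (hD0 : ∀ r, 0 ≤ D r) {w : A → ℝ} (hw : Continuous w)
    (hwc : HasCompactSupport w) (hw0 : ∀ x, 0 ≤ w x)
    (h : ∀ ζ, ‖f ζ‖ ≤ ∫ r, w (r - ζ) * D r ∂μ) : Integrable f μ := by
  obtain ⟨K, hK, hKw⟩ := exists_compact_of_hasCompactSupport hwc
  refine (integrable_of_cutoff hf (M := (∫ r, D r ∂μ) * ∫ r, w r ∂μ)
    fun κ hκ hκc hκ0 hκ1 => ?_).1
  refine le_trans ?_ (integral_cutoff_average_le hD hDi hD0 hw hwc hw0 hκ hκc hκ0 hκ1)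
  refine integral_mono_of_nonneg (Eventually.of_forall fun σ => mul_nonneg (hκ0 _) (norm_nonneg _))
    ?_ (Eventually.of_forall fun σ => mul_le_mul_of_nonneg_left (h σ) (hκ0 _))
  have hc : Continuous fun σ => ∫ r, w (r - σ) * D r ∂μ := by
    refine continuous_integral_of_compact (by fun_prop) fun L hL => ⟨_, hK.add hL, ?_⟩
    exact fun σ hσ r hr => ⟨r - σ, hKw _ (left_ne_zero_of_mul hr), σ, hσ, by simp⟩
  exact (hκ.mul hc).integrable_of_hasCompactSupport hκc.mul_right

theorem IsAmalgamWindow.integrable_fourier (hμ : IsSelfDualMeasure G μ) {ψ : A → ℂ}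
    (hψ : IsAmalgamWindow G μ ψ) : Integrable (fourier G μ ψ) μ := by
  obtain ⟨D, w, hD, hDi, hD0, hw, hwc, hw0, h⟩ := hψ.exists_dominating hμ
  exact integrable_of_dominating (continuous_fourier hψ.isCc) hD hDi hD0 hw hwc hw0 h

theorem exists_corr_bump {V : Set A} (hV : V ∈ 𝓝 (0 : A)) :
    ∃ (φ : A → ℂ) (ψ : A → ℝ), IsCc φ ∧ (∀ x, corr μ φ φ x = ψ x) ∧ Continuous ψ ∧
      HasCompactSupport ψ ∧ (∀ x, 0 ≤ ψ x) ∧ (∀ x, ψ x ≠ 0 → x ∈ V) ∧ 0 < ∫ x, ψ x ∂μ := by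
  obtain ⟨W, hW, hWV⟩ : ∃ W ∈ 𝓝 (0 : A), ∀ x ∈ W, ∀ y ∈ W, x - y ∈ V := by
    have : Tendsto (fun p : A × A => p.1 - p.2) (𝓝 0) (𝓝 0) := by
      have h : Continuous fun p : A × A => p.1 - p.2 := by fun_prop
      simpa using h.tendsto 0
    obtain ⟨U, hU, U', hU', h⟩ := mem_nhds_prod_iff.1 (this hV)
    exact ⟨U ∩ U', inter_mem hU hU', fun x hx y hy => h (Set.mk_mem_prod hx.1 hy.2)⟩
  obtain ⟨g, hg, hgc, hg0, hgp, hgW, -⟩ := exists_bump (μ := μ) hW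
  have hG := IsCc.ofReal hg hgc
  have hre : ∀ x, corr μ (fun x => (g x : ℂ)) (fun x => (g x : ℂ)) x =
      ((∫ y, g (y + x) * g y ∂μ : ℝ) : ℂ) := by
    intro x
    rw [corr, ← integral_complex_ofReal]
    simp
  have hψ := isCc_corr μ hG hG
  have hre' : ∀ x, (∫ y, g (y + x) * g y ∂μ) =
      (corr μ (fun x => (g x : ℂ)) (fun x => (g x : ℂ)) x).re := fun x => by
    rw [hre, Complex.ofReal_re]
  have hψc : Continuous fun x => ∫ y, g (y + x) * g y ∂μ := by
    simp only [hre']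
    exact Complex.continuous_re.comp hψ.1
  have hψs : HasCompactSupport fun x => ∫ y, g (y + x) * g y ∂μ := by
    simp only [hre']
    exact hψ.2.comp_left (g := Complex.re) Complex.zero_re
  have hψ0 : ∀ x, 0 ≤ ∫ y, g (y + x) * g y ∂μ := fun x =>
    integral_nonneg fun y => mul_nonneg (hg0 _) (hg0 _)
  refine ⟨_, _, hG, hre, hψc, hψs, hψ0, fun x hx => ?_, ?_⟩
  · obtain ⟨y, hy⟩ := exists_of_integral_ne_zero hx
    have := hWV _ (hgW _ (left_ne_zero_of_mul hy)) _ (hgW _ (right_ne_zero_of_mul hy))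
    simpa using this
  · refine hψc.integral_pos_of_hasCompactSupport_nonneg_nonzero hψs hψ0 (x := 0) ?_
    have hsq : HasCompactSupport fun y => g (y + 0) * g y := hgc.mul_left
    exact ((by fun_prop : Continuous fun y => g (y + 0) * g y
      ).integral_pos_of_hasCompactSupport_nonneg_nonzero hsq
      (fun y => mul_nonneg (hg0 _) (hg0 _)) (x := 0) (by simp [hgp.ne'])).ne'

variable (χ ν) in
-- Both windows are a narrow nonnegative autocorrelation times `ŵ`, where `∫ w = 1`. The factor `ŵ`
-- provides the bound over cosets of `B`. The phase and `ŵ` equal `1` at the origin, so on a small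
-- support the mean cannot cancel.
theorem exists_isWindow (hμ : IsSelfDualMeasure G μ) (hB : IsClosed (B : Set A)) :
    ∃ ψ₁ ψ₂ M, IsWindow G χ μ ν ψ₁ ψ₂ M := by
  obtain ⟨w, hw, hwc, hw0, -, -, hw1⟩ := exists_bump (A := A) (μ := μ) univ_mem
  have hwC := IsCc.ofReal hw hwc
  have hwF := continuous_fourier (G := G) (μ := μ) hwC
  set f : A × A → ℂ := fun p =>
    (((quadPhase G χ p.1 p.2)⁻¹ : Circle) : ℂ) * (fourier G μ (fun r => (w r : ℂ)) p.1 *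
      fourier G μ (fun r => (w r : ℂ)) p.2) with hf
  have hfc : Continuous f := by
    simp only [hf, Circle.coe_inv_eq_conj]
    have : Continuous fun p : A × A => (starRingEnd ℂ) (quadPhase G χ p.1 p.2 : ℂ) :=
      Complex.continuous_conj.comp (by fun_prop)
    fun_prop
  have hf0 : f 0 = 1 := by
    have h1 : fourier G μ (fun r => (w r : ℂ)) 0 = 1 := by
      simp only [fourier, G.kernel_zero_left, Circle.coe_one, one_mul]
      rw [integral_complex_ofReal, hw1, Complex.ofReal_one]
    simp [hf, quadPhase, G.toFun_zero, χ.map_zero_left, h1]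
  obtain ⟨V₁, hV₁, V₂, hV₂, hVV⟩ := mem_nhds_prod_iff.1
    ((Metric.tendsto_nhds.1 (hfc.tendsto 0) (1 / 2) (by norm_num)))
  obtain ⟨φ, ψ, hφ, hφψ, hψc, hψs, hψ0, hψV, hψp⟩ :=
    exists_corr_bump (μ := μ) (inter_mem hV₁ hV₂)
  obtain ⟨M, hM0, hM⟩ := exists_amalgam_bound (G := G) (ν := ν) hμ hB hφ hw hwc hw0
  have hcc := isCc_corr μ hφ hφ
  obtain ⟨K, hK, hKψ⟩ := exists_compact_of_hasCompactSupport hψs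
  have hcc2 : IsCc fun y => corr μ φ φ y * fourier G μ (fun r => (w r : ℂ)) y := by
    have := hcc.mul_left hwF
    simpa only [mul_comm] using this
  refine ⟨_, _, M, hcc2, hcc2, ⟨φ, w, hφ, hw, hwc, hw0, rfl⟩, fun h0 => ?_, hM0, hM⟩
  have hint1 : ∀ t, Integrable (fun s => (ψ t : ℂ) * ψ s) μ := fun t =>
    (IsCc.ofReal hψc hψs).integrable.const_mul _
  have hE : ∀ t s, (((quadPhase G χ t s)⁻¹ : Circle) : ℂ) *
      (corr μ φ φ t * fourier G μ (fun r => (w r : ℂ)) t * (corr μ φ φ s * fourier G μ (fun r => (w r : ℂ)) s)) = f (t, s) * ((ψ t : ℂ) * ψ s) := by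
    intro t s
    rw [hφψ, hφψ, hf]
    ring
  simp only [hE] at h0
  have hbd : ∀ t s, ‖f (t, s) * ((ψ t : ℂ) * ψ s) - (ψ t : ℂ) * ψ s‖ ≤ 1 / 2 * (ψ t * ψ s) := by
    intro t s
    rw [show f (t, s) * ((ψ t : ℂ) * ψ s) - (ψ t : ℂ) * ψ s = (f (t, s) - 1) * ((ψ t * ψ s : ℝ) : ℂ)
      by push_cast; ring, norm_mul, Complex.norm_real, Real.norm_eq_abs,
      abs_of_nonneg (mul_nonneg (hψ0 t) (hψ0 s))]
    by_cases h : ψ t * ψ s = 0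
    · rw [h]; simp
    · have h1 := hVV (Set.mk_mem_prod (hψV t (left_ne_zero_of_mul h)).1
        (hψV s (right_ne_zero_of_mul h)).2)
      have h2 : dist (f (t, s)) (f 0) < 1 / 2 := h1
      rw [dist_eq_norm, hf0] at h2
      exact mul_le_mul_of_nonneg_right h2.le (mul_nonneg (hψ0 t) (hψ0 s))
  have hi1 : ∀ t, Integrable (fun s => f (t, s) * ((ψ t : ℂ) * ψ s)) μ := fun t =>
    integrable_of_ne (by fun_prop) hK fun s hs => hKψ s (by
      have := right_ne_zero_of_mul (right_ne_zero_of_mul hs)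
      exact_mod_cast this)
  have hi2 : Integrable (fun t => ∫ s, f (t, s) * ((ψ t : ℂ) * ψ s) ∂μ) μ := by
    refine integrable_of_ne (K := K) (continuous_integral_of_ne (by fun_prop) hK fun t s hs => ?_)
      hK fun t ht => ?_
    · have := right_ne_zero_of_mul (right_ne_zero_of_mul hs)
      exact hKψ s (by exact_mod_cast this)
    · obtain ⟨s, hs⟩ := exists_of_integral_ne_zero ht
      have := left_ne_zero_of_mul (right_ne_zero_of_mul hs)
      exact hKψ t (by exact_mod_cast this)
  have hi3 : Integrable (fun t => ∫ s, (ψ t : ℂ) * ψ s ∂μ) μ := by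
    simp only [integral_const_mul]
    exact (IsCc.ofReal hψc hψs).integrable.mul_const _
  have hψi : Integrable ψ μ := hψc.integrable_of_hasCompactSupport hψs
  have key : ‖∫ t, ∫ s, f (t, s) * ((ψ t : ℂ) * ψ s) ∂μ ∂μ - ∫ t, ∫ s, (ψ t : ℂ) * ψ s ∂μ ∂μ‖ ≤
      ∫ t, ∫ s, 1 / 2 * (ψ t * ψ s) ∂μ ∂μ := by
    rw [← integral_sub hi2 hi3]
    refine norm_integral_le_of_norm_le ?_ (Eventually.of_forall fun t => ?_)
    · simp only [integral_const_mul]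
      exact (hψi.mul_const _).const_mul _
    · rw [← integral_sub (hi1 t) (hint1 t)]
      exact norm_integral_le_of_norm_le ((hψi.const_mul _).const_mul _)
        (Eventually.of_forall fun s => hbd t s)
  -- A vanishing mean would give `(∫ψ)² ≤ (∫ψ)²/2`.
  rw [h0] at key
  simp only [integral_const_mul, integral_mul_const, zero_sub, norm_neg, norm_mul,
    integral_complex_ofReal, Complex.norm_real, Real.norm_eq_abs, abs_of_pos hψp] at key
  nlinarith [mul_pos hψp hψp]

end Fourier

section Fourier

variable {A : Type*} [AddCommGroup A] [TopologicalSpace A] [IsTopologicalAddGroup A]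
  [LocallyCompactSpace A] [T2Space A] [MeasurableSpace A] [BorelSpace A]
  {G : GaussianExponential A} {χ : Bicharacter A} {μ : Measure A} [μ.IsAddHaarMeasure] [μ.Regular]
  {B : AddSubgroup A} {ν : Measure B} [ν.IsAddHaarMeasure] [ν.Regular]

/-! ### The basic estimate -/

variable (G χ μ) in
/-- The section `x ↦ ∫ θ(x,y) ⟨x⟩ χ(x,y) ⟨a;y⟩ dy`. -/
def phaseSection (θ : A × A → ℂ) (a x : A) : ℂ :=
  ∫ y, θ (x, y) * (quadPhase G χ x y : ℂ) * (G.kernel a y : ℂ) ∂μ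

theorem continuous_phaseSection {θ : A × A → ℂ} (hθ : IsCc θ) {X : Type*} [TopologicalSpace X]
    {f g : X → A} (hf : Continuous f) (hg : Continuous g) :
    Continuous fun x => phaseSection G χ μ θ (f x) (g x) := by
  obtain ⟨K, L, hK, hL, hKL⟩ := exists_compact_prod_of_hasCompactSupport hθ.2
  have h1 := hθ.1
  exact continuous_integral_of_ne (L := L) (by fun_prop) hL fun z y hy =>
    (hKL _ _ (left_ne_zero_of_mul (left_ne_zero_of_mul hy))).2

theorem exists_compact_phaseSection {θ : A × A → ℂ} (hθ : IsCc θ) :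
    ∃ K : Set A, IsCompact K ∧ ∀ a x, phaseSection G χ μ θ a x ≠ 0 → x ∈ K := by
  obtain ⟨K, L, hK, hL, hKL⟩ := exists_compact_prod_of_hasCompactSupport hθ.2
  refine ⟨K, hK, fun a x hx => ?_⟩
  obtain ⟨y, hy⟩ := exists_of_integral_ne_zero hx
  exact (hKL _ _ (left_ne_zero_of_mul (left_ne_zero_of_mul hy))).1

/-- A family of functions of `x`, parametrized by the subgroup, whose supports are proper. -/
structure IsProperFamily (e : B → A → ℂ) : Prop where
  cont : Continuous fun p : B × A => e p.1 p.2
  proper : ∀ K, IsCompact K → ∃ L, IsCompact L ∧ ∀ x ∈ K, ∀ a, e a x ≠ 0 → a ∈ L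

theorem IsProperFamily.continuous_integral {e : B → A → ℂ} (he : IsProperFamily e) :
    Continuous fun p : A × A => ∫ a : B, (G.kernel a p.2 : ℂ) * e a p.1 ∂ν := by
  have h1 := he.cont
  refine continuous_integral_of_compact (Z := A × A)
    (f := fun p (a : B) => (G.kernel a p.2 : ℂ) * e a p.1) ?_ fun K hK => ?_
  · have : Continuous fun p : (A × A) × B => e p.2 p.1.1 :=
      h1.comp (continuous_snd.prodMk continuous_fst.fst)
    fun_prop
  · obtain ⟨L, hL, h⟩ := he.proper _ (hK.image continuous_fst)
    exact ⟨L, hL, fun z hz a ha => h _ (Set.mem_image_of_mem _ hz) a (right_ne_zero_of_mul ha)⟩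

/-- Brings the pairing into the form `∫∫ θ · quadPhase · H`. Without the phase,
`IsTest.exists_bound` would apply at once. -/
theorem integral_phaseSection_mul {θ : A × A → ℂ} (hθ : IsCc θ) {e : B → A → ℂ}
    (he : IsProperFamily e) :
    ∫ a : B, ∫ x, phaseSection G χ μ θ a x * e a x ∂μ ∂ν =
      ∫ x, ∫ y, θ (x, y) * (quadPhase G χ x y : ℂ) * ∫ a : B, (G.kernel a y : ℂ) * e a x ∂ν
        ∂μ ∂μ := by
  obtain ⟨K, L, hK, hL, hKL⟩ := exists_compact_prod_of_hasCompactSupport hθ.2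
  obtain ⟨M, hM, hMe⟩ := he.proper K hK
  have h1 := hθ.1
  have h2 := he.cont
  have := integral_rotate_of_ne (μX := μ) (μY := μ) (μZ := ν)
    (f := fun x y (a : B) => θ (x, y) * (quadPhase G χ x y : ℂ) * ((G.kernel a y : ℂ) * e a x))
    (by
      have : Continuous fun p : A × A × B => e p.2.2 p.1 :=
        h2.comp (continuous_snd.snd.prodMk continuous_fst)
      fun_prop) hK hL hM (fun x y a h => by
        have hx := hKL _ _ (left_ne_zero_of_mul (left_ne_zero_of_mul h))
        exact ⟨hx.1, hx.2, hMe x hx.1 a (right_ne_zero_of_mul (right_ne_zero_of_mul h))⟩)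
  simp only [integral_const_mul] at this
  rw [this]
  congr 1
  funext a
  congr 1
  funext x
  rw [phaseSection, ← integral_mul_const]
  congr 1
  funext y
  ring

variable {ψ₁ ψ₂ : A → ℂ} {M : ℝ}

/-- The factor `⟨a;y⟩` shifts the frequency in `y` by `a`. The transform is thus an integral over `a
∈ B` of a windowed transform of `e_a`, at most `D`, times a value of `𝖥ψ₂` on a coset of `B`, and
these values are uniformly integrable over the coset. -/
theorem IsWindow.norm_fourier₂_le (hB : IsClosed (B : Set A)) (hw : IsWindow G χ μ ν ψ₁ ψ₂ M)
    {e : B → A → ℂ} (he : IsProperFamily e) {D : ℝ}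
    (hD : ∀ a t ξ, ‖∫ x, ψ₁ (x - t) * (G.kernel x ξ : ℂ) * e a x ∂μ‖ ≤ D) (t s σ σ' ξ η : A) :
    ‖fourier₂ G μ (fun p => (G.kernel p.1 σ : ℂ) * (G.kernel p.2 σ' : ℂ) *
      (ψ₁ (p.1 - t) * ψ₂ (p.2 - s)) * ∫ a : B, (G.kernel a p.2 : ℂ) * e a p.1 ∂ν) ξ η‖ ≤ M * D := by
  have : LocallyCompactSpace B := hB.isClosedEmbedding_subtypeVal.locallyCompactSpace
  have hD0 : 0 ≤ D := (norm_nonneg _).trans (hD 0 0 0)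
  obtain ⟨K₁, hK₁, hψ₁⟩ := exists_compact_of_hasCompactSupport hw.cc₁.2
  obtain ⟨K₂, hK₂, hψ₂⟩ := exists_compact_of_hasCompactSupport hw.cc₂.2
  have c1 := hw.cc₁.1
  have c2 := hw.cc₂.1
  have hK₁' := hK₁.add (isCompact_singleton (x := t))
  have hK₂' := hK₂.add (isCompact_singleton (x := s))
  obtain ⟨L, hL, hLe⟩ := he.proper _ hK₁'
  have h2 := he.cont
  -- Only `a ∈ L` contribute, so the bound over the coset may be applied with a cutoff equal to `1`
  -- on `L`.
  obtain ⟨κ, hκ, hκc, hκ0, hκ1, hκL⟩ := exists_cutoff hL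
  have hrot := integral_rotate_of_ne (μX := μ) (μY := μ) (μZ := ν)
    (f := fun x y (a : B) => (ψ₁ (x - t) * (G.kernel x (ξ + σ) : ℂ) * e a x) *
      ((G.kernel (a + (η + σ')) y : ℂ) * ψ₂ (y - s)))
    (by
      have : Continuous fun p : A × A × B => e p.2.2 p.1 :=
        h2.comp (continuous_snd.snd.prodMk continuous_fst)
      fun_prop) hK₁' hK₂' hL (fun x y a h => by
        have h1 := left_ne_zero_of_mul h
        have hx : x ∈ K₁ + {t} := ⟨x - t, hψ₁ _ (left_ne_zero_of_mul (left_ne_zero_of_mul h1)),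
          t, rfl, by simp⟩
        exact ⟨hx, ⟨y - s, hψ₂ _ (right_ne_zero_of_mul (right_ne_zero_of_mul h)), s, rfl, by simp⟩,
          hLe x hx a (right_ne_zero_of_mul h1)⟩)
  have hfe : fourier₂ G μ (fun p => (G.kernel p.1 σ : ℂ) * (G.kernel p.2 σ' : ℂ) *
      (ψ₁ (p.1 - t) * ψ₂ (p.2 - s)) * ∫ a : B, (G.kernel a p.2 : ℂ) * e a p.1 ∂ν) ξ η =
      ∫ a : B, (∫ x, ψ₁ (x - t) * (G.kernel x (ξ + σ) : ℂ) * e a x ∂μ) *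
        ∫ y, (G.kernel (a + (η + σ')) y : ℂ) * ψ₂ (y - s) ∂μ ∂ν := by
    simp only [integral_const_mul, integral_mul_const] at hrot
    rw [← hrot, fourier₂]
    congr 1
    funext x
    congr 1
    funext y
    simp only [← integral_const_mul]
    congr 1
    funext a
    simp only [G.kernel_add_right, G.kernel_add_left', Circle.coe_mul, G.kernel_comm _ y]
    ring
  rw [hfe]
  have hF : ∀ ζ, ‖∫ y, (G.kernel ζ y : ℂ) * ψ₂ (y - s) ∂μ‖ = ‖fourier G μ ψ₂ ζ‖ := by
    intro ζ
    have := fourier_translate (G := G) (μ := μ) ψ₂ (-s) ζ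
    simp only [fourier, ← sub_eq_add_neg] at this
    rw [this, norm_mul, Circle.norm_coe, one_mul]
    rfl
  have hFc := continuous_fourier (G := G) (μ := μ) hw.cc₂
  calc _ ≤ ∫ a : B, κ a * ‖fourier G μ ψ₂ (a + (η + σ'))‖ * D ∂ν := by
        refine norm_integral_le_of_norm_le ?_ (Eventually.of_forall fun a => ?_)
        · refine integrable_of_ne (K := tsupport κ) (by fun_prop) hκc fun a ha => ?_
          exact subset_tsupport _ (left_ne_zero_of_mul (left_ne_zero_of_mul ha))
        · rw [norm_mul, hF, mul_comm]
          by_cases ha : ∫ x, ψ₁ (x - t) * (G.kernel x (ξ + σ) : ℂ) * e a x ∂μ = 0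
          · rw [ha, norm_zero, mul_zero]
            exact mul_nonneg (mul_nonneg (hκ0 a) (norm_nonneg _)) hD0
          · obtain ⟨x, hx⟩ := exists_of_integral_ne_zero ha
            have hxK : x ∈ K₁ + {t} := ⟨x - t, hψ₁ _ (left_ne_zero_of_mul (left_ne_zero_of_mul hx)),
              t, rfl, by simp⟩
            rw [hκL a (hLe x hxK a (right_ne_zero_of_mul hx)), one_mul]
            exact mul_le_mul_of_nonneg_left (hD _ _ _) (norm_nonneg _)
    _ = (∫ a : B, κ a * ‖fourier G μ ψ₂ (a + (η + σ'))‖ ∂ν) * D := integral_mul_const _ _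
    _ ≤ M * D := mul_le_mul_of_nonneg_right (hw.amalgam _ κ hκ hκc hκ0 hκ1) hD0

/-- By the substitutions `t ↦ x - t`, `s ↦ y - s` and `quadPhase_sub`, the quadratic phase is, up to
the nonzero mean, a superposition of characters cut off by translated windows. -/
theorem mean_mul_quadPhase (x y : A) :
    (∫ t, ∫ s, (((quadPhase G χ t s)⁻¹ : Circle) : ℂ) * (ψ₁ t * ψ₂ s) ∂μ ∂μ) *
      (quadPhase G χ x y : ℂ) =
    ∫ t, ∫ s, (((quadPhase G χ t s)⁻¹ : Circle) : ℂ) *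
      ((G.kernel x t * χ.toFun x s * χ.toFun t y : Circle) : ℂ) *
        (ψ₁ (x - t) * ψ₂ (y - s)) ∂μ ∂μ := by
  rw [← integral_sub_left_eq_self _ _ x, ← integral_mul_const]
  congr 1
  funext t
  rw [← integral_sub_left_eq_self _ _ y, ← integral_mul_const]
  congr 1
  funext s
  rw [← Circle.coe_mul, ← quadPhase_sub, Circle.coe_mul]
  ring

/-- The basic estimate. After `mean_mul_quadPhase`, the pairing is an integral over `(t,s)` of
pairings of `θ` with functions whose Fourier transforms are at most `M D` by
`IsWindow.norm_fourier₂_le`; `IsTest.exists_bound` controls each of them, and only a compact set of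
`(t,s)`, depending on `θ` and the windows, contributes. -/
theorem IsWindow.exists_bound (hμ : IsSelfDualMeasure G μ) (hB : IsClosed (B : Set A))
    (hw : IsWindow G χ μ ν ψ₁ ψ₂ M) {θ : A × A → ℂ} (hθ : IsTest G μ θ) :
    ∃ C : ℝ, 0 ≤ C ∧ ∀ (e : B → A → ℂ) (D : ℝ), IsProperFamily e →
      (∀ a t ξ, ‖∫ x, ψ₁ (x - t) * (G.kernel x ξ : ℂ) * e a x ∂μ‖ ≤ D) →
      ‖∫ a : B, ∫ x, phaseSection G χ μ θ a x * e a x ∂μ ∂ν‖ ≤ C * D := by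
  obtain ⟨N, hN0, hN⟩ := hθ.exists_bound hμ
  have hθc : IsCc θ := ⟨hθ.1, hθ.2.1⟩
  obtain ⟨K, L, hK, hL, hKL⟩ := exists_compact_prod_of_hasCompactSupport hθ.2.1
  obtain ⟨K₁, hK₁, hψ₁⟩ := exists_compact_of_hasCompactSupport hw.cc₁.2
  obtain ⟨K₂, hK₂, hψ₂⟩ := exists_compact_of_hasCompactSupport hw.cc₂.2
  set c := ∫ t, ∫ s, (((quadPhase G χ t s)⁻¹ : Circle) : ℂ) * (ψ₁ t * ψ₂ s) ∂μ ∂μ with hc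
  have hc0 : 0 < ‖c‖ := norm_pos_iff.2 hw.mean_ne_zero
  refine ⟨μ.real (K - K₁) * (μ.real (L - K₂) * (N * M)) / ‖c‖, ?_, fun e D he hD => ?_⟩
  · have := hw.nonneg
    positivity
  have c0 := hθ.1
  have c1 := hw.cc₁.1
  have c2 := hw.cc₂.1
  set h : A × A → ℂ := fun p => ∫ a : B, (G.kernel a p.2 : ℂ) * e a p.1 ∂ν with hh
  have hhc : Continuous h := he.continuous_integral
  have cq : Continuous fun p : A × A => (((quadPhase G χ p.1 p.2)⁻¹ : Circle) : ℂ) := by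
    simp only [Circle.coe_inv_eq_conj]
    exact Complex.continuous_conj.comp (by fun_prop)
  set F : A → A → ℂ := fun t s => ∫ x, ∫ y, θ (x, y) *
    (((G.kernel x t * χ.toFun x s * χ.toFun t y : Circle) : ℂ) *
        (ψ₁ (x - t) * ψ₂ (y - s)) * h (x, y)) ∂μ ∂μ with hFd
  have hsupp : ∀ x y t s, (((quadPhase G χ t s)⁻¹ : Circle) : ℂ) * (θ (x, y) *
      (((G.kernel x t * χ.toFun x s * χ.toFun t y : Circle) : ℂ) *
        (ψ₁ (x - t) * ψ₂ (y - s)) * h (x, y))) ≠ 0 →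
        x ∈ K ∧ y ∈ L ∧ t ∈ K - K₁ ∧ s ∈ L - K₂ := by
    intro x y t s h0
    have h1 := right_ne_zero_of_mul h0
    have h2 := hKL _ _ (left_ne_zero_of_mul h1)
    have h3 := right_ne_zero_of_mul (left_ne_zero_of_mul (right_ne_zero_of_mul h1))
    exact ⟨h2.1, h2.2, ⟨x, h2.1, x - t, hψ₁ _ (left_ne_zero_of_mul h3), by simp⟩,
      ⟨y, h2.2, y - s, hψ₂ _ (right_ne_zero_of_mul h3), by simp⟩⟩
  have hex := integral_exchange_of_ne (μX := μ) (μY := μ) (μZ := μ) (μW := μ)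
    (f := fun x y t s => (((quadPhase G χ t s)⁻¹ : Circle) : ℂ) * (θ (x, y) *
      (((G.kernel x t * χ.toFun x s * χ.toFun t y : Circle) : ℂ) *
        (ψ₁ (x - t) * ψ₂ (y - s)) * h (x, y))))
    (by
      have h1 : Continuous fun p : A × A × A × A =>
          (((quadPhase G χ p.2.2.1 p.2.2.2)⁻¹ : Circle) : ℂ) := cq.comp (continuous_snd.snd)
      have h2 : Continuous fun p : A × A × A × A => h (p.1, p.2.1) := by fun_prop
      simp only [Circle.coe_mul]
      fun_prop) hK hL (isCompact_sub hK hK₁) (isCompact_sub hL hK₂) hsupp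
  have hmain : c * ∫ a : B, ∫ x, phaseSection G χ μ θ a x * e a x ∂μ ∂ν =
      ∫ t, ∫ s, (((quadPhase G χ t s)⁻¹ : Circle) : ℂ) * F t s ∂μ ∂μ := by
    rw [integral_phaseSection_mul hθc he]
    simp only [hFd, ← integral_const_mul]
    rw [← hex]
    congr 1
    funext x
    congr 1
    funext y
    calc _ = (c * (quadPhase G χ x y : ℂ)) * (θ (x, y) * h (x, y)) := by
          simp only [integral_const_mul, hh]
          ring
      _ = _ := by
        rw [hc, mean_mul_quadPhase]
        simp only [← integral_mul_const]
        congr 1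
        funext t
        congr 1
        funext s
        ring
  have hFb : ∀ t s, ‖(((quadPhase G χ t s)⁻¹ : Circle) : ℂ) * F t s‖ ≤ N * M * D := by
    intro t s
    rw [norm_mul, Circle.norm_coe, one_mul, mul_assoc]
    -- By self-duality `χ(·,s)` and `χ(t,·)` are of the form `⟨·;σ⟩` and `⟨·;σ'⟩`. They only shift
    -- frequencies, which does not affect a supremum over all of them.
    obtain ⟨σ, hσ⟩ := χ.exists_kernel_right G s
    obtain ⟨σ', hσ'⟩ := χ.exists_kernel_left G t
    have hH : (fun p : A × A => ((G.kernel p.1 t * χ.toFun p.1 s * χ.toFun t p.2 : Circle) : ℂ) *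
        (ψ₁ (p.1 - t) * ψ₂ (p.2 - s)) * h p) = fun p => (G.kernel p.1 (t + σ) : ℂ) *
        (G.kernel p.2 σ' : ℂ) * (ψ₁ (p.1 - t) * ψ₂ (p.2 - s)) *
          ∫ a : B, (G.kernel a p.2 : ℂ) * e a p.1 ∂ν := by
      funext p
      rw [hσ, hσ', ← G.kernel_add_right, Circle.coe_mul]
    have hHc : IsCc fun p : A × A => ((G.kernel p.1 t * χ.toFun p.1 s * χ.toFun t p.2 : Circle) : ℂ) *
        (ψ₁ (p.1 - t) * ψ₂ (p.2 - s)) * h p := by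
      constructor
      · simp only [Circle.coe_mul]
        fun_prop
      · refine hasCompactSupport_of_ne ((hK₁.add (isCompact_singleton (x := t))).prod
          (hK₂.add (isCompact_singleton (x := s)))) fun p hp => ?_
        have h3 := right_ne_zero_of_mul (left_ne_zero_of_mul hp)
        exact ⟨⟨p.1 - t, hψ₁ _ (left_ne_zero_of_mul h3), t, rfl, by simp⟩,
          ⟨p.2 - s, hψ₂ _ (right_ne_zero_of_mul h3), s, rfl, by simp⟩⟩
    refine hN _ hHc (M * D) fun ξ η => ?_
    rw [hH]
    exact hw.norm_fourier₂_le hB he hD t s _ _ ξ η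
  have hsuppF : ∀ t s, (((quadPhase G χ t s)⁻¹ : Circle) : ℂ) * F t s ≠ 0 →
      t ∈ K - K₁ ∧ s ∈ L - K₂ := by
    intro t s h0
    simp only [hFd, ← integral_const_mul] at h0
    obtain ⟨x, hx⟩ := exists_of_integral_ne_zero h0
    obtain ⟨y, hy⟩ := exists_of_integral_ne_zero hx
    exact (hsupp x y t s hy).2.2
  have hb : ‖∫ t, ∫ s, (((quadPhase G χ t s)⁻¹ : Circle) : ℂ) * F t s ∂μ ∂μ‖ ≤
      μ.real (K - K₁) * (μ.real (L - K₂) * (N * M * D)) := by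
    refine norm_integral_le_of_ne (isCompact_sub hK hK₁) (fun t ht => ?_) fun t => ?_
    · obtain ⟨s, hs⟩ := exists_of_integral_ne_zero ht
      exact (hsuppF t s hs).1
    · exact norm_integral_le_of_ne (isCompact_sub hL hK₂) (fun s hs => (hsuppF t s hs).2)
        fun s => hFb t s
  rw [← hmain, norm_mul, mul_comm, ← le_div_iff₀ hc0] at hb
  refine hb.trans_eq ?_
  field_simp

end Fourier

section Fourier

variable {A : Type*} [AddCommGroup A] [TopologicalSpace A] [IsTopologicalAddGroup A]
  [LocallyCompactSpace A] [T2Space A] [MeasurableSpace A] [BorelSpace A]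
  {G : GaussianExponential A} {χ : Bicharacter A} {μ : Measure A} [μ.IsAddHaarMeasure] [μ.Regular]
  {B : AddSubgroup A} {ν : Measure B} [ν.IsAddHaarMeasure] [ν.Regular]

/-! ### Automorphy -/

/-- Both rules hold already for the transposes of test functions. For the first, shift the variable
of `B` and rewrite `⟨b;y⟩` through `χ`; for the second, shift `y` and use `⟨b';b⟩ = 1`. -/
theorem isAutomorphic_gDist (hχ : χ.Splits G) (hB : IsIsotropic G B) (f : A → ℂ) :
    IsAutomorphic G χ μ B (gDist G χ μ ν f) := by
  intro θ _ b hb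
  have h1 : transposeTest G χ μ ν (fun p => θ (p.1 - b, p.2)) =
      transposeTest G χ μ ν fun p => (χ.toFun (-p.2) b : ℂ) * θ p := by
    funext x
    simp only [transposeTest]
    rw [← integral_sub_right_eq_self _ (⟨b, hb⟩ : B)]
    congr 1
    funext b'
    congr 1
    funext y
    have key : χ.toFun (x - b' + b) y * G.kernel (b' - b) y =
        χ.toFun (-y) b * (χ.toFun (x - b') y * G.kernel b' y) := by
      rw [G.kernel_sub_left, hχ b y, χ.map_neg_left, χ.map_add_left]
      apply Additive.ofMul.injective
      simp only [ofMul_mul, ofMul_div, ofMul_inv]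
      abel
    have key' := congrArg (fun z : Circle => (z : ℂ)) key
    push_cast at key'
    rw [AddSubgroupClass.coe_sub, show x - ((b' : A) - b) - b = x - b' by abel,
      show x - ((b' : A) - b) = x - b' + b by abel]
    linear_combination θ (x - b', y) * key'
  have h2 : transposeTest G χ μ ν (fun p => θ (p.1, p.2 - b)) =
      transposeTest G χ μ ν fun p => (χ.toFun p.1 b : ℂ) * θ p := by
    funext x
    simp only [transposeTest]
    congr 1
    funext b'
    rw [← integral_add_right_eq_self _ b]
    congr 1
    funext y
    rw [add_sub_cancel_right, χ.map_add_right, G.kernel_add_right, hB _ b'.2 _ hb, mul_one]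
    push_cast
    ring
  simp only [gDist, h1, h2, and_self]

/-! ### Convergence -/

variable (G χ μ ν) in
/-- The function `x ↦ ⟨x⟩ t(x)` with `t` the transpose of `θ`. -/
def phaseTranspose (θ : A × A → ℂ) (x : A) : ℂ :=
  (G.toFun x : ℂ) * transposeTest G χ μ ν θ x

/-- From `⟨x⟩ = ⟨x-b⟩⟨b⟩⟨x-b;b⟩`. It exhibits `P` as a superposition over `B` of translated and
modulated sections. -/
theorem phaseTranspose_eq (θ : A × A → ℂ) (x : A) :
    phaseTranspose G χ μ ν θ x =
      ∫ b : B, (G.toFun b : ℂ) * (G.kernel (x - b) b : ℂ) * phaseSection G χ μ θ b (x - b) ∂ν := by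
  rw [phaseTranspose, transposeTest, ← integral_const_mul]
  congr 1
  funext b
  rw [phaseSection, ← integral_const_mul, ← integral_const_mul]
  congr 1
  funext y
  have : G.toFun x = G.toFun (x - b) * G.toFun b * G.kernel (x - b) b := by
    rw [← G.toFun_add, sub_add_cancel]
  rw [this, quadPhase]
  push_cast
  ring

theorem continuous_phaseTranspose (hB : IsClosed (B : Set A)) {θ : A × A → ℂ} (hθ : IsCc θ) :
    Continuous (phaseTranspose G χ μ ν θ) := by
  obtain ⟨K, hK, hKθ⟩ := exists_compact_phaseSection (G := G) (χ := χ) (μ := μ) hθ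
  have : phaseTranspose G χ μ ν θ = fun x => ∫ b : B, (G.toFun b : ℂ) * (G.kernel (x - b) b : ℂ) *
      phaseSection G χ μ θ b (x - b) ∂ν := funext (phaseTranspose_eq θ)
  rw [this]
  refine continuous_integral_of_compact ?_ fun L hL => ?_
  · have : Continuous fun p : A × B => phaseSection G χ μ θ p.2 (p.1 - p.2) :=
      continuous_phaseSection hθ (by fun_prop) (by fun_prop)
    fun_prop
  · refine ⟨_, isCompact_subgroup hB (isCompact_sub hL hK), fun x hx b hb => ?_⟩
    exact ⟨x, hx, x - b, hKθ _ _ (right_ne_zero_of_mul hb), by simp⟩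

theorem isProperFamily_translate (hB : IsClosed (B : Set A)) {k : A → ℂ} (hk : IsCc k) :
    IsProperFamily fun (b : B) (x : A) =>
      (G.toFun b : ℂ) * (G.kernel x b : ℂ) * k (x + b) := by
  obtain ⟨K, hK, hKk⟩ := exists_compact_of_hasCompactSupport hk.2
  have h1 := hk.1
  refine ⟨by fun_prop, fun L hL => ⟨_, isCompact_subgroup hB (isCompact_sub hK hL),
    fun x hx b hb => ?_⟩⟩
  exact ⟨x + b, hKk _ (right_ne_zero_of_mul hb), x, hx, by simp⟩

theorem integral_phaseTranspose_mul (hB : IsClosed (B : Set A)) {θ : A × A → ℂ} (hθ : IsCc θ)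
    {k : A → ℂ} (hk : IsCc k) :
    ∫ x, phaseTranspose G χ μ ν θ x * k x ∂μ =
      ∫ b : B, ∫ x, phaseSection G χ μ θ b x *
        ((G.toFun b : ℂ) * (G.kernel x b : ℂ) * k (x + b)) ∂μ ∂ν := by
  obtain ⟨K, hK, hKθ⟩ := exists_compact_phaseSection (G := G) (χ := χ) (μ := μ) hθ
  obtain ⟨L, hL, hLk⟩ := exists_compact_of_hasCompactSupport hk.2
  have h1 := hk.1
  have hsw := integral_swap_of_ne (μ := μ) (ν := ν) (f := fun x (b : B) =>
    (G.toFun b : ℂ) * (G.kernel (x - b) b : ℂ) * phaseSection G χ μ θ b (x - b) * k x)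
    (by
      have : Continuous fun p : A × B => phaseSection G χ μ θ p.2 (p.1 - p.2) :=
        continuous_phaseSection hθ (by fun_prop) (by fun_prop)
      fun_prop) hL (isCompact_subgroup hB (isCompact_sub hL hK)) (fun x b h => by
      have hx := hLk _ (right_ne_zero_of_mul h)
      exact ⟨hx, x, hx, x - b, hKθ _ _ (right_ne_zero_of_mul (left_ne_zero_of_mul h)), by simp⟩)
  simp only [phaseTranspose_eq, ← integral_mul_const]
  rw [hsw]
  congr 1
  funext b
  rw [← integral_add_right_eq_self _ (b : A)]
  congr 1
  funext x
  rw [add_sub_cancel_right]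
  ring

/-- The constant `C` bounds the pairing with `phaseSection θ` by window transforms. -/
def IsSectionBound (G : GaussianExponential A) (χ : Bicharacter A) (μ : Measure A) (ν : Measure B)
    (θ : A × A → ℂ) (ψ : A → ℂ) (C : ℝ) : Prop :=
  ∀ (e : B → A → ℂ) (D : ℝ), IsProperFamily e →
      (∀ a t ξ, ‖∫ x, ψ (x - t) * (G.kernel x ξ : ℂ) * e a x ∂μ‖ ≤ D) →
      ‖∫ a : B, ∫ x, phaseSection G χ μ θ a x * e a x ∂μ ∂ν‖ ≤ C * D

/-- The family belonging to `k` consists of translates of `k` times characters and constants of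
modulus one. Translation and modulation only move the parameters `(t, ξ)` of the windowed transform,
so one supremum serves all `b`. -/
theorem IsSectionBound.norm_integral_phaseTranspose_le (hB : IsClosed (B : Set A)) {θ : A × A → ℂ}
    (hθ : IsCc θ) {ψ : A → ℂ} {C : ℝ} (h : IsSectionBound G χ μ ν θ ψ C) {k : A → ℂ} (hk : IsCc k)
    {D : ℝ} (hD : ∀ t ξ, ‖∫ x, ψ (x - t) * (G.kernel x ξ : ℂ) * k x ∂μ‖ ≤ D) :
    ‖∫ x, phaseTranspose G χ μ ν θ x * k x ∂μ‖ ≤ C * D := by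
  rw [integral_phaseTranspose_mul hB hθ hk]
  refine h _ D (isProperFamily_translate hB hk) fun a t ξ => ?_
  refine le_of_eq_of_le ?_ (hD (a + t) (ξ + a))
  rw [← integral_sub_right_eq_self _ (a : A)]
  have : ∀ x, ψ (x - a - t) * (G.kernel (x - a) ξ : ℂ) *
      ((G.toFun a : ℂ) * (G.kernel (x - a) a : ℂ) * k (x - a + a)) =
      ((G.toFun a / (G.kernel a (ξ + a)) : Circle) : ℂ) *
        (ψ (x - (a + t)) * (G.kernel x (ξ + a) : ℂ) * k x) := by
    intro x
    rw [sub_add_cancel, sub_sub, G.kernel_add_right x, G.kernel_add_right (a : A),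
      G.kernel_sub_left, G.kernel_sub_left]
    push_cast
    field_simp [Circle.coe_ne_zero]
  simp only [this]
  rw [integral_const_mul, norm_mul, Circle.norm_coe, one_mul]

theorem norm_integral_window_mul_le {ψ : A → ℂ} (hψ : IsCc ψ) {k : A → ℂ} (hk : ∀ x, ‖k x‖ ≤ 1)
    (t ξ : A) : ‖∫ x, ψ (x - t) * (G.kernel x ξ : ℂ) * k x ∂μ‖ ≤ ∫ x, ‖ψ x‖ ∂μ := by
  rw [← integral_sub_right_eq_self (fun x => ‖ψ x‖) t]
  have hi : Integrable (fun x => ψ (x - t)) μ := by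
    simpa only [sub_eq_add_neg] using (hψ.translate (-t)).integrable
  refine norm_integral_le_of_norm_le hi.norm (Eventually.of_forall fun x => ?_)
  rw [norm_mul, norm_mul, Circle.norm_coe, mul_one]
  exact mul_le_of_le_one_right (norm_nonneg _) (hk x)

theorem fourierInv_window (ψ : A → ℂ) (t ξ ζ : A) :
    fourierInv G μ (fun x => ψ (x - t) * (G.kernel x ξ : ℂ)) ζ =
      (G.kernel (ξ - ζ) t : ℂ) * fourier G μ ψ (ξ - ζ) := by
  have h := fourier_translate (G := G) (μ := μ) ψ (-t) (ξ - ζ)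
  rw [neg_neg] at h
  rw [← h, fourier, fourierInv]
  congr 1
  funext x
  rw [G.kernel_neg_right, G.kernel_sub_left, G.kernel_comm x ξ, sub_eq_add_neg]
  push_cast
  ring

/-- Duality: for `‖g‖ ≤ 1` the windowed transforms are at most `∫‖ψ‖`. -/
theorem IsSectionBound.integrable_phaseTranspose (hB : IsClosed (B : Set A)) {θ : A × A → ℂ}
    (hθ : IsCc θ) {ψ : A → ℂ} (hψ : IsCc ψ) {C : ℝ} (h : IsSectionBound G χ μ ν θ ψ C) :
    Integrable (phaseTranspose G χ μ ν θ) μ :=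
  (integrable_of_pairing (continuous_phaseTranspose hB hθ) (M := C * ∫ x, ‖ψ x‖ ∂μ)
    fun _ hg hgc hg1 => h.norm_integral_phaseTranspose_le hB hθ ⟨hg, hgc⟩ fun t ξ =>
      norm_integral_window_mul_le hψ hg1 t ξ).1

/-- An integrable function is nearly unchanged, in `L¹`, by a suitable Fejér multiplier. -/
theorem exists_isFejer_integral_le (hμ : IsSelfDualMeasure G μ) {P : A → ℂ} (hP : Integrable P μ)
    {ε : ℝ} (hε : 0 < ε) :
    ∃ V δ ψ D, IsFejer G μ V δ ψ D ∧ Integrable (fun x => ‖P x‖ * ‖1 - ψ x‖) μ ∧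
      ∫ x, ‖P x‖ * ‖1 - ψ x‖ ∂μ ≤ ε := by
  obtain ⟨g, hg, hgε⟩ := exists_isCc_integral_sub_le hP (show 0 < ε / 4 by positivity)
  obtain ⟨K, hK, hKg⟩ := exists_compact_of_hasCompactSupport hg.2
  set m := ∫ x, ‖g x‖ ∂μ with hm
  have hm0 : 0 ≤ m := integral_nonneg fun _ => norm_nonneg _
  obtain ⟨ψ, D, U, hF, -, -, hψK⟩ := exists_isFejer_adapted (G := G) hμ (univ_mem (f := 𝓝 (0 : A)))
    hK (show 0 < ε / (2 * (m + 1)) by positivity)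
  have hψ1 : ∀ x, ‖1 - ψ x‖ ≤ 2 := fun x => by
    have := norm_sub_le (1 : ℂ) (ψ x)
    have h1 := hF.norm_le x
    rw [norm_one] at this
    linarith
  have hc := hF.cc.1
  have hi : Integrable (fun x => ‖P x‖ * ‖1 - ψ x‖) μ :=
    hP.norm.mul_bdd (c := 2) (by fun_prop : Continuous fun x => ‖1 - ψ x‖
      ).measurable.aestronglyMeasurable
      (Eventually.of_forall fun x => by rw [norm_norm]; exact hψ1 x)
  have hi1 : Integrable (fun x => ‖P x - g x‖) μ := (hP.sub hg.integrable).norm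
  refine ⟨U, _, ψ, D, hF, hi, ?_⟩
  calc _ ≤ ∫ x, (‖P x - g x‖ * 2 + ‖g x‖ * (ε / (2 * (m + 1)))) ∂μ := by
        refine integral_mono_of_nonneg (Eventually.of_forall fun x => by positivity)
          ((hi1.mul_const 2).add (hg.integrable.norm.mul_const _))
          (Eventually.of_forall fun x => ?_)
        have h1 : ‖P x‖ ≤ ‖P x - g x‖ + ‖g x‖ := by
          have := norm_add_le (P x - g x) (g x)
          rwa [sub_add_cancel] at this
        have h2 : ‖g x‖ * ‖1 - ψ x‖ ≤ ‖g x‖ * (ε / (2 * (m + 1))) := by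
          by_cases h0 : g x = 0
          · simp [h0]
          · have := hψK x (hKg x h0)
            rw [norm_sub_rev] at this
            exact mul_le_mul_of_nonneg_left this (norm_nonneg _)
        have h3 := mul_le_mul_of_nonneg_left (hψ1 x) (norm_nonneg (P x - g x))
        have h4 := mul_le_mul_of_nonneg_right h1 (norm_nonneg (1 - ψ x))
        simp only
        linarith
    _ = (∫ x, ‖P x - g x‖ ∂μ) * 2 + m * (ε / (2 * (m + 1))) := by
        rw [integral_add (hi1.mul_const 2) (hg.integrable.norm.mul_const _), integral_mul_const,
          integral_mul_const]
    _ ≤ ε := by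
        have : m * (ε / (2 * (m + 1))) ≤ ε / 2 := by
          rw [mul_div_assoc', div_le_div_iff₀ (by positivity) (by positivity)]
          nlinarith
        linarith

theorem isCc_window {ψ : A → ℂ} (hψ : IsCc ψ) (t ξ : A) :
    IsCc fun x => ψ (x - t) * (G.kernel x ξ : ℂ) := by
  have h := (hψ.translate (-t)).mul_left (g := fun x => (G.kernel x ξ : ℂ)) (by fun_prop)
  simpa only [sub_eq_add_neg, mul_comm] using h

theorem norm_integral_window_mul_fourierInv_le {ψ : A → ℂ} (hψ : IsCc ψ) {g : A → ℂ} (hg : IsCc g)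
    (t ξ : A) : ‖∫ x, ψ (x - t) * (G.kernel x ξ : ℂ) * fourierInv G μ g x ∂μ‖ ≤
      ∫ ζ, ‖fourier G μ ψ (ξ - ζ)‖ * ‖g ζ‖ ∂μ := by
  rw [← integral_fourierInv_mul_of_integrable (isCc_window hψ t ξ).integrable hg]
  refine (norm_integral_le_integral_norm _).trans_eq ?_
  congr 1
  funext ζ
  rw [fourierInv_window, norm_mul, norm_mul, Circle.norm_coe, one_mul]

/-- Multiplication by `ω` averages over the frequency `ξ` with a probability density, so a bound
uniform in `ξ` persists. The factor `ω` serves to make `𝖥⁻¹g` compactly supported. -/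
theorem IsFejer.norm_integral_window_mul_le {V : Set A} {ε : ℝ} {ω : A → ℂ} {D : A → ℝ}
    (h : IsFejer G μ V ε ω D) {ψ : A → ℂ} (hψ : IsCc ψ) {g : A → ℂ} (hg : IsCc g) {C : ℝ}
    (hC : ∀ ξ, ∫ ζ, ‖fourier G μ ψ (ξ - ζ)‖ * ‖g ζ‖ ∂μ ≤ C) (t ξ : A) :
    ‖∫ x, ψ (x - t) * (G.kernel x ξ : ℂ) * (fourierInv G μ g x * ω x) ∂μ‖ ≤ C := by
  have hm : IsCc fun x => ψ (x - t) * (G.kernel x ξ : ℂ) * fourierInv G μ g x := by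
    have := (isCc_window (G := G) hψ t ξ).mul_left (continuous_fourierInv (G := G) (μ := μ) hg)
    simpa only [mul_comm] using this
  have h1 : ∫ x, ψ (x - t) * (G.kernel x ξ : ℂ) * (fourierInv G μ g x * ω x) ∂μ =
      ∫ v, (D v : ℂ) * fourierInv G μ
        (fun x => ψ (x - t) * (G.kernel x ξ : ℂ) * fourierInv G μ g x) v ∂μ := by
    rw [← integral_fourierInv_mul_of_integrable (G := G) (f := fun v => (D v : ℂ))
      h.integrable.ofReal hm]
    congr 1
    funext x
    rw [show ω x = fourierInv G μ (fun v => (D v : ℂ)) x from h.eq_integral x]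
    ring
  rw [h1]
  calc _ ≤ ∫ v, D v * C ∂μ := by
        refine norm_integral_le_of_norm_le (h.integrable.mul_const C)
          (Eventually.of_forall fun v => ?_)
        rw [norm_mul, Complex.norm_real, Real.norm_eq_abs, abs_of_nonneg (h.nonneg v)]
        refine mul_le_mul_of_nonneg_left ?_ (h.nonneg v)
        refine le_trans (le_of_eq ?_)
          ((norm_integral_window_mul_fourierInv_le hψ hg t (ξ - v)).trans (hC _))
        rw [fourierInv]
        congr 2
        funext x
        rw [G.kernel_neg_right, G.kernel_sub_right, G.kernel_comm v x]
        push_cast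
        ring
    _ = C := by rw [integral_mul_const, h.integral_eq, one_mul]

/-- The pairing equals that of `P` with `𝖥⁻¹g`, to which the section bound does not apply directly
as `𝖥⁻¹g` has no compact support. Multiply by `ω`, which is close to `1` in the `L¹` sense weighted
by `‖P‖`. -/
theorem IsSectionBound.norm_integral_fourierInv_mul_le (hμ : IsSelfDualMeasure G μ)
    (hB : IsClosed (B : Set A)) {θ : A × A → ℂ} (hθ : IsCc θ) {ψ : A → ℂ} (hψ : IsCc ψ)
    {C : ℝ} (h : IsSectionBound G χ μ ν θ ψ C) {g : A → ℂ} (hgC : IsCc g) {D' : ℝ}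
    (hD' : ∀ ξ, ∫ ζ, ‖fourier G μ ψ (ξ - ζ)‖ * ‖g ζ‖ ∂μ ≤ D') :
    ‖∫ ζ, fourierInv G μ (phaseTranspose G χ μ ν θ) ζ * g ζ ∂μ‖ ≤ C * D' := by
  have hP := h.integrable_phaseTranspose hB hθ hψ
  rw [integral_fourierInv_mul_of_integrable hP hgC]
  refine le_of_forall_pos_le_add fun ε hε => ?_
  set m := ∫ x, ‖g x‖ ∂μ with hm
  have hm0 : 0 ≤ m := integral_nonneg fun _ => norm_nonneg _
  obtain ⟨V, δ, ω, D, hF, hi, hle⟩ := exists_isFejer_integral_le (G := G) hμ hP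
    (show 0 < ε / (m + 1) by positivity)
  have hc1 := continuous_fourierInv (G := G) (μ := μ) hgC
  have hk : IsCc fun y => fourierInv G μ g y * ω y := hF.cc.mul_left hc1
  have h1 := h.norm_integral_phaseTranspose_le hB hθ hk fun t ξ =>
    hF.norm_integral_window_mul_le hψ hgC hD' t ξ
  have hi1 : Integrable (fun x => phaseTranspose G χ μ ν θ x * fourierInv G μ g x) μ :=
    hP.mul_bdd (c := m) hc1.measurable.aestronglyMeasurable
      (Eventually.of_forall fun x => norm_fourierInv_le _ _)
  have hi2 : Integrable (fun x => phaseTranspose G χ μ ν θ x * (fourierInv G μ g x * ω x)) μ := by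
    have hc := hF.cc.1
    refine hP.mul_bdd (c := m) (by fun_prop : Continuous fun x => fourierInv G μ g x * ω x
      ).measurable.aestronglyMeasurable (Eventually.of_forall fun x => ?_)
    rw [norm_mul]
    exact (mul_le_of_le_one_right (norm_nonneg _) (hF.norm_le x)).trans (norm_fourierInv_le _ _)
  have h2 : ‖∫ x, phaseTranspose G χ μ ν θ x * fourierInv G μ g x ∂μ -
      ∫ x, phaseTranspose G χ μ ν θ x * (fourierInv G μ g x * ω x) ∂μ‖ ≤ ε := by
    rw [← integral_sub hi1 hi2]
    calc _ ≤ ∫ x, m * (‖phaseTranspose G χ μ ν θ x‖ * ‖1 - ω x‖) ∂μ := by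
          refine norm_integral_le_of_norm_le (hi.const_mul m) (Eventually.of_forall fun x => ?_)
          rw [show phaseTranspose G χ μ ν θ x * fourierInv G μ g x -
            phaseTranspose G χ μ ν θ x * (fourierInv G μ g x * ω x) =
            fourierInv G μ g x * (phaseTranspose G χ μ ν θ x * (1 - ω x)) by ring, norm_mul,
            norm_mul]
          exact mul_le_mul_of_nonneg_right (norm_fourierInv_le _ _) (by positivity)
      _ ≤ m * (ε / (m + 1)) := by
          rw [integral_const_mul]
          exact mul_le_mul_of_nonneg_left hle hm0
      _ ≤ ε := by
          rw [mul_div_assoc', div_le_iff₀ (by positivity)]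
          nlinarith
  have := norm_add_le (∫ x, phaseTranspose G χ μ ν θ x * fourierInv G μ g x ∂μ -
      ∫ x, phaseTranspose G χ μ ν θ x * (fourierInv G μ g x * ω x) ∂μ)
      (∫ x, phaseTranspose G χ μ ν θ x * (fourierInv G μ g x * ω x) ∂μ)
  rw [sub_add_cancel] at this
  linarith

/-- Duality again: for `‖g‖ ≤ 1` the convolution of `‖𝖥ψ‖` with `‖g‖` is at most `∫‖𝖥ψ‖`. -/
theorem IsSectionBound.integrable_fourierInv (hμ : IsSelfDualMeasure G μ)
    (hB : IsClosed (B : Set A)) {θ : A × A → ℂ} (hθ : IsCc θ) {ψ : A → ℂ} (hψ : IsCc ψ)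
    (hψi : Integrable (fourier G μ ψ) μ) {C : ℝ} (h : IsSectionBound G χ μ ν θ ψ C) :
    Integrable (fourierInv G μ (phaseTranspose G χ μ ν θ)) μ := by
  have hP := h.integrable_phaseTranspose hB hθ hψ
  refine (integrable_of_pairing (continuous_fourierInv_of_integrable hP)
    (M := C * (∫ x, ‖fourier G μ ψ x‖ ∂μ)) fun g hg hgc hg1 => ?_).1
  refine h.norm_integral_fourierInv_mul_le hμ hB hθ hψ ⟨hg, hgc⟩ fun ξ => ?_
  rw [← integral_sub_left_eq_self (fun x => ‖fourier G μ ψ x‖) μ ξ]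
  exact integral_mono_of_nonneg (Eventually.of_forall fun ζ => by positivity)
    (hψi.comp_sub_left ξ).norm
    (Eventually.of_forall fun ζ => mul_le_of_le_one_right (norm_nonneg _) (hg1 ζ))

variable (χ ν) in
theorem exists_isSectionBound (hμ : IsSelfDualMeasure G μ) (hB : IsClosed (B : Set A))
    {θ : A × A → ℂ} (hθ : IsTest G μ θ) :
    ∃ ψ C, IsAmalgamWindow G μ ψ ∧ 0 ≤ C ∧ IsSectionBound G χ μ ν θ ψ C := by
  obtain ⟨ψ₁, ψ₂, M, hw⟩ := exists_isWindow χ ν hμ hB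
  obtain ⟨C, hC0, hC⟩ := hw.exists_bound hμ hB hθ
  exact ⟨ψ₁, C, hw.rep₁, hC0, hC⟩

theorem gDistConverges (hμ : IsSelfDualMeasure G μ) (hB : IsClosed (B : Set A))
    {θ : A × A → ℂ} (hθ : IsTest G μ θ) : GDistConverges G χ μ ν θ := by
  obtain ⟨ψ, C, hψ', -, h⟩ := exists_isSectionBound χ ν hμ hB hθ
  have hψ := hψ'.isCc
  have hψi := hψ'.integrable_fourier hμ
  have hθc : IsCc θ := ⟨hθ.1, hθ.2.1⟩
  obtain ⟨K, L, hK, hL, hKL⟩ := exists_compact_prod_of_hasCompactSupport hθ.2.1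
  have h1 := hθ.1
  refine ⟨fun x b => ?_, fun x => ?_, h.integrable_phaseTranspose hB hθc hψ,
    h.integrable_fourierInv hμ hB hθc hψ hψi⟩
  · exact integrable_of_ne (by fun_prop) hL fun y hy =>
      (hKL _ _ (left_ne_zero_of_mul (left_ne_zero_of_mul hy))).2
  · refine integrable_of_ne (continuous_integral_of_ne (by fun_prop) hL fun b y hy =>
      (hKL _ _ (left_ne_zero_of_mul (left_ne_zero_of_mul hy))).2)
      (isCompact_subgroup hB (isCompact_sub (isCompact_singleton (x := x)) hK)) fun b hb => ?_
    obtain ⟨y, hy⟩ := exists_of_integral_ne_zero hb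
    exact ⟨x, rfl, x - b, (hKL _ _ (left_ne_zero_of_mul (left_ne_zero_of_mul hy))).1, by simp⟩

/-! ### The Fourier transform of the sections -/

variable (G χ μ) in
/-- The inverse Fourier transform `η ↦ ∫ ⟨η;-x⟩ R_a(x) dx` of the section `R_a` of `θ`. -/
def sectionTransform (θ : A × A → ℂ) (a η : A) : ℂ :=
  fourierInv G μ (phaseSection G χ μ θ a) η

theorem continuous_sectionTransform {θ : A × A → ℂ} (hθ : IsCc θ) {X : Type*} [TopologicalSpace X]
    {f g : X → A} (hf : Continuous f) (hg : Continuous g) :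
    Continuous fun x => sectionTransform G χ μ θ (f x) (g x) := by
  obtain ⟨K, hK, hKθ⟩ := exists_compact_phaseSection (G := G) (χ := χ) (μ := μ) hθ
  refine continuous_integral_of_ne (L := K) ?_ hK fun z y hy => hKθ _ _ (right_ne_zero_of_mul hy)
  have : Continuous fun p : X × A => phaseSection G χ μ θ (f p.1) p.2 :=
    continuous_phaseSection hθ (by fun_prop) (by fun_prop)
  fun_prop

theorem integral_sectionTransform_mul {θ : A × A → ℂ} (hθ : IsCc θ) (a : A) {g : A → ℂ}
    (hg : IsCc g) : ∫ η, sectionTransform G χ μ θ a η * g η ∂μ =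
      ∫ x, phaseSection G χ μ θ a x * fourierInv G μ g x ∂μ := by
  obtain ⟨K, hK, hKθ⟩ := exists_compact_phaseSection (G := G) (χ := χ) (μ := μ) hθ
  have hs : IsCc (phaseSection G χ μ θ a) :=
    ⟨continuous_phaseSection hθ continuous_const continuous_id,
      hasCompactSupport_of_ne hK fun x hx => hKθ _ _ hx⟩
  exact integral_fourierInv_mul_of_integrable hs.integrable hg

/-- The section bound for the family `e_a = 𝖥⁻¹ g(a,·)`: a bound for all `a` jointly, which
estimates for single sections would not give. -/
theorem IsSectionBound.norm_integral_sectionTransform_le {θ : A × A → ℂ}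
    (hθ : IsCc θ) {ψ : A → ℂ} (hψ : IsCc ψ) (hψi : Integrable (fourier G μ ψ) μ) {C : ℝ}
    (h : IsSectionBound G χ μ ν θ ψ C) {g : B × A → ℂ} (hg : IsCc g) (hg1 : ∀ p, ‖g p‖ ≤ 1) :
    ‖∫ a : B, ∫ η, sectionTransform G χ μ θ a η * g (a, η) ∂μ ∂ν‖ ≤
      C * ∫ x, ‖fourier G μ ψ x‖ ∂μ := by
  obtain ⟨K, L, hK, hL, hKL⟩ := exists_compact_prod_of_hasCompactSupport hg.2
  have hgc := hg.1
  have hsl : ∀ a, IsCc fun η => g (a, η) := fun a =>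
    ⟨by fun_prop, hasCompactSupport_of_ne hL fun η hη => (hKL _ _ hη).2⟩
  have : ∀ a : B, ∫ η, sectionTransform G χ μ θ a η * g (a, η) ∂μ =
      ∫ x, phaseSection G χ μ θ a x * fourierInv G μ (fun η => g (a, η)) x ∂μ := fun a =>
    integral_sectionTransform_mul hθ a (hsl a)
  simp only [this]
  refine h (fun a x => fourierInv G μ (fun η => g (a, η)) x) _ ⟨?_, fun _ _ => ⟨K, hK, ?_⟩⟩ ?_
  · exact continuous_integral_of_ne (L := L) (by fun_prop) hL fun z y hy =>
      (hKL _ _ (right_ne_zero_of_mul hy)).2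
  · intro x _ a ha
    obtain ⟨η, hη⟩ := exists_of_integral_ne_zero ha
    exact (hKL _ _ (right_ne_zero_of_mul hη)).1
  · intro a t ξ
    refine (norm_integral_window_mul_fourierInv_le hψ (hsl a) t ξ).trans ?_
    rw [← integral_sub_left_eq_self (fun x => ‖fourier G μ ψ x‖) μ ξ]
    exact integral_mono_of_nonneg (Eventually.of_forall fun ζ => by positivity)
      (hψi.comp_sub_left ξ).norm
      (Eventually.of_forall fun ζ => mul_le_of_le_one_right (norm_nonneg _) (hg1 _))

variable (χ ν) in
-- Duality on `B × A` turns the previous bound into absolute convergence. It is expressed through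
-- cutoffs, for which iterated integrals are unproblematic.
theorem exists_sectionTransform_bound (hμ : IsSelfDualMeasure G μ) (hB : IsClosed (B : Set A))
    {θ : A × A → ℂ} (hθ : IsTest G μ θ) :
    ∃ M : ℝ, 0 ≤ M ∧ ∀ κ : B × A → ℝ, Continuous κ → HasCompactSupport κ → (∀ p, 0 ≤ κ p) →
      (∀ p, κ p ≤ 1) → ∫ a : B, ∫ η, κ (a, η) * ‖sectionTransform G χ μ θ a η‖ ∂μ ∂ν ≤ M := by
  obtain ⟨ψ, C, hψ', hC0, h⟩ := exists_isSectionBound χ ν hμ hB hθ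
  have hψ := hψ'.isCc
  have hψi := hψ'.integrable_fourier hμ
  have hθc : IsCc θ := ⟨hθ.1, hθ.2.1⟩
  refine ⟨C * ∫ x, ‖fourier G μ ψ x‖ ∂μ, mul_nonneg hC0 (integral_nonneg fun _ => norm_nonneg _),
    fun κ hκ hκc hκ0 hκ1 => ?_⟩
  have hint : ∀ f : B × A → ℝ, Continuous f → HasCompactSupport f →
      (∀ a, Integrable (fun η => f (a, η)) μ) ∧ Integrable (fun a => ∫ η, f (a, η) ∂μ) ν := by
    intro f hf hfs
    obtain ⟨K, L, hK, hL, hKL⟩ := exists_compact_prod_of_hasCompactSupport hfs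
    refine ⟨fun a => integrable_of_ne (by fun_prop) hL fun η hη => (hKL _ _ hη).2,
      integrable_of_ne (continuous_integral_of_ne (by fun_prop) hL fun a η hη => (hKL _ _ hη).2)
        hK fun a ha => ?_⟩
    obtain ⟨η, hη⟩ := exists_of_integral_ne_zero ha
    exact (hKL _ _ hη).1
  have hrc : Continuous fun p : B × A => sectionTransform G χ μ θ p.1 p.2 :=
    continuous_sectionTransform hθc (by fun_prop) (by fun_prop)
  set m := ∫ a : B, ∫ η, κ (a, η) ∂μ ∂ν with hm
  have hm0 : 0 ≤ m := integral_nonneg fun a => integral_nonneg fun η => hκ0 _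
  refine le_of_forall_pos_le_add fun ε hε => ?_
  obtain ⟨g, s, hg, hgc, hg1, hs, hsc, hgs, hκs⟩ := exists_phase hrc hκ hκc hκ0 hκ1
    (show 0 < ε / (m + 1) by positivity)
  have h1 := h.norm_integral_sectionTransform_le hθc hψ hψi ⟨hg, hgc⟩ hg1
  have h2 : ∫ a : B, ∫ η, sectionTransform G χ μ θ a η * g (a, η) ∂μ ∂ν =
      ((∫ a : B, ∫ η, s (a, η) ∂μ ∂ν : ℝ) : ℂ) := by
    rw [← integral_complex_ofReal]
    congr 1
    funext a
    rw [← integral_complex_ofReal]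
    congr 1
    funext η
    exact hgs (a, η)
  rw [h2, Complex.norm_real, Real.norm_eq_abs] at h1
  have is := hint s hs hsc
  have ik := hint κ hκ hκc
  calc _ ≤ ∫ a : B, ∫ η, (s (a, η) + ε / (m + 1) * κ (a, η)) ∂μ ∂ν := by
        refine integral_mono_of_nonneg (Eventually.of_forall fun a => integral_nonneg fun η =>
          mul_nonneg (hκ0 _) (norm_nonneg _)) ?_ (Eventually.of_forall fun a => ?_)
        · have : (fun a : B => ∫ η, (s (a, η) + ε / (m + 1) * κ (a, η)) ∂μ) =
              fun a => (∫ η, s (a, η) ∂μ) + ε / (m + 1) * ∫ η, κ (a, η) ∂μ := by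
            funext a
            rw [integral_add (is.1 a) ((ik.1 a).const_mul _), integral_const_mul]
          rw [this]
          exact is.2.add (ik.2.const_mul _)
        · exact integral_mono_of_nonneg (Eventually.of_forall fun η =>
            mul_nonneg (hκ0 _) (norm_nonneg _)) ((is.1 a).add ((ik.1 a).const_mul _))
            (Eventually.of_forall fun η => hκs (a, η))
    _ = (∫ a : B, ∫ η, s (a, η) ∂μ ∂ν) + ε / (m + 1) * m := by
        rw [hm, ← integral_const_mul, ← integral_add is.2 (ik.2.const_mul _)]
        congr 1
        funext a
        rw [integral_add (is.1 a) ((ik.1 a).const_mul _), integral_const_mul]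
    _ ≤ _ := by
        have h3 : ε / (m + 1) * m ≤ ε := by
          rw [div_mul_eq_mul_div, div_le_iff₀ (by positivity)]
          nlinarith
        have := le_abs_self (∫ a : B, ∫ η, s (a, η) ∂μ ∂ν)
        linarith

end Fourier

/-! ### Monotone limits along directed families -/

/-- Dini's argument: the superlevel sets form a directed open cover. -/
theorem exists_forall_mem_compact_lt {X ι : Type*} [TopologicalSpace X] [Nonempty ι]
    {f : ι → X → ℝ≥0∞} (hdir : Directed (· ≤ ·) f) (hf : ∀ i c, IsOpen {x | c < f i x})
    {K : Set X} (hK : IsCompact K) {c : ℝ≥0∞} (h : ∀ x ∈ K, ∃ i, c < f i x) :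
    ∃ i, ∀ x ∈ K, c < f i x := by
  refine hK.elim_directed_cover (fun i => {x | c < f i x}) (fun i => hf i c)
    (fun x hx => Set.mem_iUnion.2 (h x hx)) ?_
  intro i j
  obtain ⟨k, hik, hjk⟩ := hdir i j
  exact ⟨k, fun x hx => lt_of_lt_of_le hx (hik x), fun x hx => lt_of_lt_of_le hx (hjk x)⟩

/-- Monotone convergence for a directed, possibly uncountable family of lower semicontinuous
functions. A simple function below `h` is cut down to compact parts of its level sets, and there a
single `f i` exceeds `t` times its values, for any `t < 1`. -/
theorem lintegral_le_of_directed {X ι : Type*} [TopologicalSpace X] [T2Space X] [MeasurableSpace X]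
    [BorelSpace X] {μ : Measure X} [μ.Regular] [Nonempty ι] {f : ι → X → ℝ≥0∞} {h : X → ℝ≥0∞}
    (hdir : Directed (· ≤ ·) f) (hf : ∀ i c, IsOpen {x | c < f i x})
    (hfh : ∀ x c, c < h x → ∃ i, c < f i x) {N : ℝ≥0∞} (hN : ∀ i, ∫⁻ x, f i x ∂μ ≤ N) :
    ∫⁻ x, h x ∂μ ≤ N := by
  classical
  rcases eq_or_ne N ∞ with rfl | hNt
  · exact le_top
  rw [lintegral_eq_nnreal]
  refine iSup₂_le fun φ hφ => ?_
  have hlt : ∀ t : ℝ≥0, t < 1 → ∀ x, φ x ≠ 0 → ∃ i, ((t * φ x : ℝ≥0) : ℝ≥0∞) < f i x := by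
    intro t ht x hx
    refine hfh x _ (lt_of_lt_of_le ?_ (hφ x))
    exact_mod_cast mul_lt_of_lt_one_left (pos_iff_ne_zero.2 hx) ht
  -- Approximation of level sets by compact sets requires finite measure. Otherwise the open set
  -- where some `f i` exceeds `c/2` would have infinite measure and contain a compact set of measure
  -- above `N / d`; one `f i` exceeds `d` on all of it, so its integral exceeds `N`.
  have hfin : ∀ c : ℝ≥0, c ≠ 0 → μ (φ ⁻¹' {c}) ≠ ∞ := by
    intro c hc htop
    set d : ℝ≥0∞ := ((2⁻¹ * c : ℝ≥0) : ℝ≥0∞) with hd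
    have hd0 : d ≠ 0 := by
      rw [hd]
      exact_mod_cast mul_ne_zero (by norm_num) hc
    have hU : IsOpen (⋃ i, {x | d < f i x}) := isOpen_iUnion fun i => hf i d
    have hUt : μ (⋃ i, {x | d < f i x}) = ∞ := by
      refine measure_mono_top (fun x hx => ?_) htop
      have hx : φ x = c := hx
      obtain ⟨i, hi⟩ := hlt 2⁻¹ (by norm_num) x (hx.symm ▸ hc)
      rw [hx] at hi
      exact Set.mem_iUnion.2 ⟨i, hi⟩
    have hlt2 : N / d < μ (⋃ i, {x | d < f i x}) := by
      rw [hUt]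
      exact ENNReal.div_lt_top hNt hd0
    obtain ⟨K, hKU, hK, hKN⟩ := hU.exists_lt_isCompact hlt2
    obtain ⟨i, hi⟩ := exists_forall_mem_compact_lt hdir hf hK (c := d)
      (fun x hx => by
        obtain ⟨i, hi⟩ := Set.mem_iUnion.1 (hKU hx)
        exact ⟨i, hi⟩)
    have h1 : d * μ K ≤ N := by
      calc d * μ K = ∫⁻ x in K, d ∂μ := by rw [setLIntegral_const]
        _ ≤ ∫⁻ x in K, f i x ∂μ := setLIntegral_mono' hK.measurableSet fun x hx => (hi x hx).le
        _ ≤ ∫⁻ x, f i x ∂μ := setLIntegral_le_lintegral _ _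
        _ ≤ N := hN i
    have h2 := (ENNReal.div_lt_iff (Or.inl hd0) (Or.inl ENNReal.coe_ne_top)).1 hKN
    rw [mul_comm] at h2
    exact absurd h1 (not_le.2 h2)
  have hcore : ∀ t : ℝ≥0, t < 1 → ∀ ε : ℝ≥0, 0 < ε →
      (t : ℝ≥0∞) * ∑ c ∈ φ.range, (c : ℝ≥0∞) * μ (φ ⁻¹' {c}) ≤
        N + ε * ∑ c ∈ φ.range, (c : ℝ≥0∞) := by
    intro t ht ε hε
    have hKex : ∀ c : ℝ≥0, ∃ K, IsCompact K ∧ K ⊆ φ ⁻¹' {c} ∧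
        (c : ℝ≥0∞) * μ (φ ⁻¹' {c}) ≤ c * (μ K + ε) := by
      intro c
      by_cases hc : c = 0
      · exact ⟨∅, isCompact_empty, Set.empty_subset _, by simp [hc]⟩
      · obtain ⟨K, hKs, hK, hlt⟩ := (φ.measurableSet_fiber c).exists_isCompact_lt_add (hfin c hc)
          (ε := ε) (by exact_mod_cast hε.ne')
        exact ⟨K, hK, hKs, by gcongr⟩
    choose K hK hKs hKμ using hKex
    have hi : ∃ i, ∀ c ∈ φ.range, ∀ x ∈ K c, ((t * c : ℝ≥0) : ℝ≥0∞) ≤ f i x := by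
      have hone : ∀ c, ∃ i, ∀ x ∈ K c, ((t * c : ℝ≥0) : ℝ≥0∞) ≤ f i x := by
        intro c
        by_cases hc : c = 0
        · exact ⟨Classical.arbitrary ι, fun x _ => by simp [hc]⟩
        · obtain ⟨i, hi⟩ := exists_forall_mem_compact_lt hdir hf (hK c)
            (c := ((t * c : ℝ≥0) : ℝ≥0∞)) fun x hx => by
              have hx : φ x = c := hKs c hx
              have := hlt t ht x (hx.symm ▸ hc)
              rwa [hx] at this
          exact ⟨i, fun x hx => (hi x hx).le⟩
      choose i hi using hone
      obtain ⟨j, hj⟩ := hdir.finset_le (φ.range.image i)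
      exact ⟨j, fun c hc x hx => (hi c x hx).trans
        (hj (i c) (Finset.mem_image_of_mem i hc) x)⟩
    obtain ⟨i, hi⟩ := hi
    have hsum : ∑ c ∈ φ.range, ((t * c : ℝ≥0) : ℝ≥0∞) * μ (K c) ≤ N := by
      calc _ ≤ ∑ c ∈ φ.range, ∫⁻ x in K c, f i x ∂μ := by
            refine Finset.sum_le_sum fun c hc => ?_
            rw [← setLIntegral_const]
            exact setLIntegral_mono' (hK c).measurableSet fun x hx => hi c hc x hx
        _ = ∫⁻ x in ⋃ c ∈ φ.range, K c, f i x ∂μ := by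
            rw [lintegral_biUnion_finset]
            · intro c _ c' _ hcc'
              refine Set.disjoint_left.2 fun x hx hx' => hcc' ?_
              have h1 : φ x = c := hKs c hx
              have h2 : φ x = c' := hKs c' hx'
              rw [← h1, ← h2]
            · exact fun c _ => (hK c).measurableSet
        _ ≤ ∫⁻ x, f i x ∂μ := setLIntegral_le_lintegral _ _
        _ ≤ N := hN i
    calc (t : ℝ≥0∞) * ∑ c ∈ φ.range, (c : ℝ≥0∞) * μ (φ ⁻¹' {c})
        ≤ t * ∑ c ∈ φ.range, (c : ℝ≥0∞) * (μ (K c) + ε) :=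
          mul_le_mul' le_rfl (Finset.sum_le_sum fun c _ => hKμ c)
      _ = ∑ c ∈ φ.range, ((t * c : ℝ≥0) : ℝ≥0∞) * μ (K c) +
            t * (ε * ∑ c ∈ φ.range, (c : ℝ≥0∞)) := by
          simp only [mul_add, Finset.sum_add_distrib, Finset.mul_sum, ENNReal.coe_mul, mul_assoc]
          congr 1
          refine Finset.sum_congr rfl fun c _ => ?_
          rw [mul_comm (c : ℝ≥0∞)]
      _ ≤ N + 1 * (ε * ∑ c ∈ φ.range, (c : ℝ≥0∞)) := by
          gcongr
          exact_mod_cast ht.le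
      _ = _ := by rw [one_mul]
  rw [SimpleFunc.map_lintegral]
  set s := ∑ c ∈ φ.range, (c : ℝ≥0∞) * μ (φ ⁻¹' {c}) with hs
  set m := ∑ c ∈ φ.range, (c : ℝ≥0∞) with hm
  have hmt : m ≠ ∞ := ENNReal.sum_ne_top.2 fun c _ => ENNReal.coe_ne_top
  have hst : s ≠ ∞ := by
    refine ENNReal.sum_ne_top.2 fun c _ => ?_
    by_cases hc : c = 0
    · simp [hc]
    · exact ENNReal.mul_ne_top ENNReal.coe_ne_top (hfin c hc)
  have h1 : ∀ t : ℝ≥0, t < 1 → (t : ℝ≥0∞) * s ≤ N := by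
    intro t ht
    refine ENNReal.le_of_forall_pos_le_add fun δ hδ _ => ?_
    set ε : ℝ≥0 := δ / (m.toNNReal + 1) with hε
    refine (hcore t ht ε (by positivity)).trans ?_
    gcongr
    rw [← ENNReal.coe_toNNReal hmt]
    norm_cast
    rw [hε, div_mul_eq_mul_div, div_le_iff₀ (by positivity), mul_add, mul_one]
    exact le_self_add
  have h2 : Tendsto (fun t : ℝ≥0 => (t : ℝ≥0∞) * s) (𝓝[<] 1) (𝓝 ((1 : ℝ≥0) * s)) :=
    (ENNReal.Tendsto.mul_const (ENNReal.tendsto_coe.2 tendsto_id)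
      (Or.inr hst)).mono_left nhdsWithin_le_nhds
  rw [ENNReal.coe_one, one_mul] at h2
  have : (𝓝[<] (1 : ℝ≥0)).NeBot := nhdsLT_neBot_of_exists_lt ⟨0, zero_lt_one⟩
  exact le_of_tendsto h2 (by filter_upwards [self_mem_nhdsWithin] with t ht using h1 t ht)

/-- A continuous function whose iterated integrals against all cutoff functions are bounded has a
bounded iterated integral. -/
theorem lintegral_lintegral_le_of_cutoff {X Y : Type*} [TopologicalSpace X] [T2Space X]
    [LocallyCompactSpace X] [MeasurableSpace X] [BorelSpace X] [TopologicalSpace Y] [T2Space Y]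
    [LocallyCompactSpace Y] [MeasurableSpace Y] [BorelSpace Y]
    {μ : Measure X} {ν : Measure Y} [μ.Regular] [ν.Regular] {g : X → Y → ℂ}
    (hg : Continuous fun p : X × Y => g p.1 p.2) {M : ℝ}
    (h : ∀ κ : X × Y → ℝ, Continuous κ → HasCompactSupport κ → (∀ p, 0 ≤ κ p) → (∀ p, κ p ≤ 1) →
      ∫ x, ∫ y, κ (x, y) * ‖g x y‖ ∂ν ∂μ ≤ M) :
    ∫⁻ x, ∫⁻ y, ‖g x y‖ₑ ∂ν ∂μ ≤ ENNReal.ofReal M := by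
  let ι := {κ : Y → ℝ // Continuous κ ∧ HasCompactSupport κ ∧ (∀ y, 0 ≤ κ y) ∧ ∀ y, κ y ≤ 1}
  have : Nonempty ι := ⟨⟨0, continuous_zero, HasCompactSupport.zero, fun _ => le_rfl,
    fun _ => zero_le_one⟩⟩
  let F : ι → X → ℝ := fun κ x => ∫ y, κ.1 y * ‖g x y‖ ∂ν
  have hsl : ∀ x, Continuous (g x) := fun x => hg.comp (by fun_prop : Continuous fun y => (x, y))
  have hFc : ∀ κ, Continuous (F κ) := by
    intro κ
    have := κ.2.1
    exact continuous_integral_of_ne (by fun_prop) κ.2.2.1 fun x y hy =>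
      subset_tsupport _ (left_ne_zero_of_mul hy)
  have hF0 : ∀ κ x, 0 ≤ F κ x := fun κ x =>
    integral_nonneg fun y => mul_nonneg (κ.2.2.2.1 y) (norm_nonneg _)
  have hi : ∀ (κ : ι) x, Integrable (fun y => κ.1 y * ‖g x y‖) ν := fun κ x =>
    ((κ.2.1).mul (hsl x).norm).integrable_of_hasCompactSupport κ.2.2.1.mul_right
  have hmono : ∀ (κ κ' : ι), (∀ y, κ.1 y ≤ κ'.1 y) → ∀ x, F κ x ≤ F κ' x := fun κ κ' h x =>
    integral_mono (hi κ x) (hi κ' x) fun y => mul_le_mul_of_nonneg_right (h y) (norm_nonneg _)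
  -- The inner integral is the supremum of the integrals with cutoffs in `y`, which are continuous
  -- in `x` and directed under the maximum of cutoffs.
  refine lintegral_le_of_directed (f := fun κ x => ENNReal.ofReal (F κ x)) ?_ ?_ ?_ ?_
  · intro κ κ'
    refine ⟨⟨fun y => max (κ.1 y) (κ'.1 y), κ.2.1.max κ'.2.1, ?_, fun y =>
      (κ.2.2.2.1 y).trans (le_max_left _ _), fun y => max_le (κ.2.2.2.2 y) (κ'.2.2.2.2 y)⟩, ?_, ?_⟩
    · refine hasCompactSupport_of_ne (κ.2.2.1.union κ'.2.2.1) fun y hy => ?_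
      by_contra h0
      simp only [Set.mem_union, not_or] at h0
      exact hy (by rw [image_eq_zero_of_notMem_tsupport h0.1,
        image_eq_zero_of_notMem_tsupport h0.2, max_self])
    · exact fun x => ENNReal.ofReal_le_ofReal (hmono _ _ (fun y => le_max_left _ _) x)
    · exact fun x => ENNReal.ofReal_le_ofReal (hmono _ _ (fun y => le_max_right _ _) x)
  · exact fun κ c => isOpen_lt continuous_const (ENNReal.continuous_ofReal.comp (hFc κ))
  · intro x c hc
    by_contra! hcon
    have hct : c ≠ ∞ := (hc.trans_le le_top).ne
    have h1 := integrable_of_cutoff (μ := ν) (hsl x) (M := c.toReal) fun κ hκ hκc hκ0 hκ1 =>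
      (ENNReal.ofReal_le_iff_le_toReal hct).1 (hcon ⟨κ, hκ, hκc, hκ0, hκ1⟩)
    have h2 : ∫⁻ y, ‖g x y‖ₑ ∂ν ≤ c := by
      rw [← ofReal_integral_norm_eq_lintegral_enorm h1.1]
      exact (ENNReal.ofReal_le_ofReal h1.2).trans (ENNReal.ofReal_toReal hct).le
    exact absurd h2 (not_le.2 hc)
  · intro κ
    have h1 := integrable_of_cutoff (μ := μ) (hFc κ) (M := M) fun κ' hκ' hκc' hκ0' hκ1' => by
      have h2 := h (fun p => κ' p.1 * κ.1 p.2)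
        ((hκ'.comp continuous_fst).mul (κ.2.1.comp continuous_snd))
        (hasCompactSupport_of_ne (hκc'.prod κ.2.2.1) fun p hp =>
          ⟨subset_tsupport _ (left_ne_zero_of_mul hp),
            subset_tsupport _ (right_ne_zero_of_mul hp)⟩)
        (fun p => mul_nonneg (hκ0' _) (κ.2.2.2.1 _))
        (fun p => mul_le_one₀ (hκ1' _) (κ.2.2.2.1 _) (κ.2.2.2.2 _))
      refine le_of_eq_of_le ?_ h2
      congr 1
      funext x
      rw [Real.norm_of_nonneg (hF0 κ x), ← integral_const_mul]
      congr 1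
      funext y
      ring
    calc _ = ∫⁻ x, ‖F κ x‖ₑ ∂μ := by
          congr 1
          funext x
          rw [Real.enorm_of_nonneg (hF0 κ x)]
      _ = ENNReal.ofReal (∫ x, ‖F κ x‖ ∂μ) := (ofReal_integral_norm_eq_lintegral_enorm h1.1).symm
      _ ≤ _ := ENNReal.ofReal_le_ofReal h1.2

section Fourier

variable {A : Type*} [AddCommGroup A] [TopologicalSpace A] [IsTopologicalAddGroup A]
  [LocallyCompactSpace A] [T2Space A] [MeasurableSpace A] [BorelSpace A]
  {G : GaussianExponential A} {χ : Bicharacter A} {μ : Measure A} [μ.IsAddHaarMeasure] [μ.Regular]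

/-! ### A change of variables in test functions -/

/-- The map is composed of an exchange of variables, a reflection and a translation. -/
theorem integral_shear {E : Type*} [NormedAddCommGroup E] [NormedSpace ℝ E] {Φ : A × A → E}
    (hΦ : Continuous Φ) (hΦc : HasCompactSupport Φ) :
    ∫ x, ∫ y, Φ (x + y, -x) ∂μ ∂μ = ∫ x, ∫ y, Φ (x, y) ∂μ ∂μ := by
  obtain ⟨K, L, hK, hL, hKL⟩ := exists_compact_prod_of_hasCompactSupport hΦc
  have hsw := integral_swap_of_ne (μ := μ) (ν := μ) (f := fun x y => Φ (x, y)) (by fun_prop) hK hL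
    (fun x y h => hKL x y h)
  rw [hsw, ← integral_neg_eq_self (fun y => ∫ x, Φ (x, y) ∂μ) μ]
  congr 1
  funext x
  exact integral_add_left_eq_self (μ := μ) (fun y => Φ (y, -x)) x

theorem isCc_shear {θ : A × A → ℂ} (hθ : IsCc θ) : IsCc fun p : A × A => θ (p.1 + p.2, -p.1) := by
  obtain ⟨K, L, hK, hL, hKL⟩ := exists_compact_prod_of_hasCompactSupport hθ.2
  have h1 := hθ.1
  refine ⟨by fun_prop, hasCompactSupport_of_ne (hL.neg.prod (hK.add hL)) fun p hp => ?_⟩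
  have := hKL _ _ hp
  exact ⟨by simpa using this.2, ⟨p.1 + p.2, this.1, -p.1, this.2, by simp⟩⟩

theorem fourier₂_shear {θ : A × A → ℂ} (hθ : IsCc θ) (ξ η : A) :
    fourier₂ G μ (fun p : A × A => θ (p.1 + p.2, -p.1)) ξ η = fourier₂ G μ θ η (η - ξ) := by
  have h1 := hθ.1
  have hc : IsCc fun p : A × A => (G.kernel p.1 η : ℂ) * (G.kernel p.2 (η - ξ) : ℂ) * θ p :=
    ⟨by fun_prop, hθ.2.mul_left⟩
  rw [fourier₂, fourier₂, ← integral_shear (Φ := fun p : A × A =>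
    (G.kernel p.1 η : ℂ) * (G.kernel p.2 (η - ξ) : ℂ) * θ p) hc.1 hc.2]
  congr 1
  funext x
  congr 1
  funext y
  simp only [G.kernel_add_left', G.kernel_neg_left, G.kernel_sub_right, Circle.coe_mul,
    Circle.coe_inv, Circle.coe_div]
  field_simp [Circle.coe_ne_zero]

/-- The transform of the sheared function is the transform of `θ` in sheared variables
(`fourier₂_shear`). Tonelli's theorem is not at hand for the iterated lower integral, so the
variables are changed under a cutoff, which `lintegral_lintegral_le_of_cutoff` removes. -/
theorem isTest_shear {θ : A × A → ℂ} (hθ : IsTest G μ θ) :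
    IsTest G μ fun p : A × A => θ (p.1 + p.2, -p.1) := by
  have hθc : IsCc θ := ⟨hθ.1, hθ.2.1⟩
  have hc := isCc_shear hθc
  refine ⟨hc.1, hc.2, ?_⟩
  change ∫⁻ ξ, ∫⁻ η, ‖fourier₂ G μ (fun p : A × A => θ (p.1 + p.2, -p.1)) ξ η‖ₑ ∂μ ∂μ < ∞
  simp only [fourier₂_shear hθc]
  set N := ∫⁻ ξ, ∫⁻ η, ‖fourier₂ G μ θ ξ η‖ₑ ∂μ ∂μ with hN
  have hNt : N ≠ ∞ := hθ.2.2.ne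
  refine lt_of_le_of_lt (lintegral_lintegral_le_of_cutoff (M := N.toReal)
    (g := fun ξ η => fourier₂ G μ θ η (η - ξ))
    (continuous_fourier₂_comp hθc (by fun_prop) (by fun_prop)) ?_) ENNReal.ofReal_lt_top
  intro κ hκ hκc hκ0 hκ1
  -- change variables so that the integrand is a cutoff of the original transform
  set Φ : A × A → ℝ := fun p => κ (p.1 - p.2, p.1) * ‖fourier₂ G μ θ p.1 p.2‖ with hΦ
  obtain ⟨K, L, hK, hL, hKL⟩ := exists_compact_prod_of_hasCompactSupport hκc
  have hfc : Continuous fun p : A × A => fourier₂ G μ θ p.1 p.2 :=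
    continuous_fourier₂_comp hθc (by fun_prop) (by fun_prop)
  have hfc' : Continuous fun p : A × A => fourier₂ G μ θ p.2 (p.2 - p.1) :=
    continuous_fourier₂_comp hθc (by fun_prop) (by fun_prop)
  have hsw : ∫ ξ, ∫ η, κ (ξ, η) * ‖fourier₂ G μ θ η (η - ξ)‖ ∂μ ∂μ =
      ∫ x, ∫ y, Φ (x, y) ∂μ ∂μ := by
    rw [integral_swap_of_ne (μ := μ) (ν := μ)
      (f := fun ξ η => κ (ξ, η) * ‖fourier₂ G μ θ η (η - ξ)‖) (by fun_prop) hK hL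
      (fun x y h => hKL x y (left_ne_zero_of_mul h))]
    congr 1
    funext η
    rw [← integral_sub_left_eq_self _ μ η]
    simp only [hΦ, sub_sub_cancel]
  rw [hsw]
  have hb := norm_integral_integral_le (μ := μ) (fun x y => ((Φ (x, y) : ℝ) : ℂ)) hNt zero_le_one
    (Θ := fourier₂ G μ θ) (fun x y => by
      rw [Complex.norm_real, Real.norm_of_nonneg (mul_nonneg (hκ0 _) (norm_nonneg _)), mul_one]
      exact mul_le_of_le_one_left (norm_nonneg _) (hκ1 _)) le_rfl
  simp only [integral_complex_ofReal, Complex.norm_real, mul_one] at hb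
  exact (le_abs_self _).trans hb

end Fourier

section Fourier

variable {A : Type*} [AddCommGroup A] [TopologicalSpace A] [IsTopologicalAddGroup A]
  [LocallyCompactSpace A] [T2Space A] [MeasurableSpace A] [BorelSpace A]
  {G : GaussianExponential A} {χ : Bicharacter A} {μ : Measure A} [μ.IsAddHaarMeasure] [μ.Regular]
  {B : AddSubgroup A} {ν : Measure B} [ν.IsAddHaarMeasure] [ν.Regular]

/-! ### Integrals over the quotient -/

theorem gFun_add_left (hχ : χ.Splits G) (k : A → ℂ) (x y : A) {b : A} (hb : b ∈ B) :
    gFun G χ ν k (x + b) y = (χ.toFun (-y) b : ℂ) * gFun G χ ν k x y := by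
  simp only [gFun]
  rw [← integral_sub_right_eq_self _ (⟨b, hb⟩ : B), ← integral_const_mul, ← integral_const_mul,
    ← integral_const_mul]
  congr 1
  funext b'
  have key : χ.toFun (x + b) y * G.kernel (b' - b) y =
      χ.toFun (-y) b * (χ.toFun x y * G.kernel b' y) := by
    rw [G.kernel_sub_left, hχ b y, χ.map_neg_left, χ.map_add_left]
    apply Additive.ofMul.injective
    simp only [ofMul_mul, ofMul_div, ofMul_inv]
    abel
  have key' := congrArg (fun z : Circle => (z : ℂ)) key
  push_cast at key'
  rw [AddSubgroupClass.coe_sub, show x + b + ((b' : A) - b) = x + b' by abel]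
  linear_combination k (x + b') * (G.toFun (x + b') : ℂ) * key'

theorem gFun_add_right (hB : IsIsotropic G B) (k : A → ℂ) (x y : A) {b : A} (hb : b ∈ B) :
    gFun G χ ν k x (y + b) = (χ.toFun x b : ℂ) * gFun G χ ν k x y := by
  simp only [gFun]
  rw [← integral_const_mul, ← integral_const_mul, ← integral_const_mul]
  congr 1
  funext b'
  rw [G.kernel_add_right, hB _ b'.2 _ hb, mul_one, χ.map_add_right]
  push_cast
  ring

theorem gFun_sub_add (hχ : χ.Splits G) (hB : IsIsotropic G B) (k : A → ℂ) (x y : A) {b : A}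
    (hb : b ∈ B) : gFun G χ ν k (x - b) (y + b) =
      (χ.toFun (x + y) b * χ.toFun b b : Circle) * gFun G χ ν k x y := by
  rw [sub_eq_add_neg, gFun_add_left hχ k x (y + b) (neg_mem hb), gFun_add_right hB k x y hb,
    ← mul_assoc, ← Circle.coe_mul]
  congr 2
  rw [χ.map_neg_left, χ.map_neg_right, inv_inv, χ.map_add_left, χ.map_add_left]
  rw [mul_comm, ← mul_assoc]

/-- `χ(b,b)` is a sign. It arises once from `g₄` and once from `g₀` when `z` moves by `b`, and
cancels. -/
theorem Bicharacter.Splits.self_mul_self (hχ : χ.Splits G) (hB : IsIsotropic G B) {b : A}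
    (hb : b ∈ B) : χ.toFun b b * χ.toFun b b = 1 := by
  rw [← hχ b b, hB b hb b hb]

theorem gFun_mul_gFun (hχ : χ.Splits G) (hB : IsIsotropic G B) (k k' : A → ℂ) (x y u v z : A) {b : A}
    (hb : b ∈ B) :
    gFun G χ ν k (u - (z + b)) (v + (z + b) - x) * gFun G χ ν k' (x - (z + b)) (y + (z + b) - u) =
      (χ.toFun (y + v) b : ℂ) *
        (gFun G χ ν k (u - z) (v + z - x) * gFun G χ ν k' (x - z) (y + z - u)) := by
  rw [show u - (z + b) = u - z - b by abel, show v + (z + b) - x = v + z - x + b by abel,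
    show x - (z + b) = x - z - b by abel, show y + (z + b) - u = y + z - u + b by abel,
    gFun_sub_add hχ hB _ _ _ hb, gFun_sub_add hχ hB _ _ _ hb]
  have : χ.toFun (u - z + (v + z - x)) b * χ.toFun b b *
      (χ.toFun (x - z + (y + z - u)) b * χ.toFun b b) = χ.toFun (y + v) b := by
    rw [mul_mul_mul_comm, hχ.self_mul_self hB hb, mul_one, ← χ.map_add_left]
    congr 1
    abel
  rw [← this]
  push_cast
  ring

theorem gIntegrand_add (hχ : χ.Splits G) (hB : IsIsotropic G B) (k₄ k₂ k₀ : A → ℂ)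
    (x y u v z : A) {b : A} (hb : b ∈ B) :
    gIntegrand G χ ν k₄ k₂ k₀ x y u v (z + b) = gIntegrand G χ ν k₄ k₂ k₀ x y u v z := by
  have h1 := gFun_mul_gFun (ν := ν) hχ hB k₄ k₀ x y u v z hb
  have h2 := gFun_add_left (ν := ν) hχ k₂ z (y + v) hb
  have h3 : (χ.toFun (-(y + v)) b : ℂ) * (χ.toFun (y + v) b : ℂ) = 1 := by
    rw [← Circle.coe_mul, χ.map_neg_left, inv_mul_cancel, Circle.coe_one]
  simp only [gIntegrand]
  rw [h2]
  linear_combination (χ.toFun (-(y + v)) b : ℂ) * gFun G χ ν k₂ z (y + v) * h1 +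
    gFun G χ ν k₂ z (y + v) * (gFun G χ ν k₄ (u - z) (v + z - x) *
      gFun G χ ν k₀ (x - z) (y + z - u)) * h3

variable (G χ ν) in
/-- The integrand over `A/B` before summation over `B` in the middle factor. -/
def unfoldedIntegrand (k₄ k₂ k₀ : A → ℂ) (x y u v z : A) : ℂ :=
  gFun G χ ν k₄ (u - z) (v + z - x) * gFun G χ ν k₀ (x - z) (y + z - u) *
    ((χ.toFun z (y + v) : ℂ) * (k₂ z * (G.toFun z : ℂ)))

/-- The factor `⟨b;y+v⟩` in the sum defining `g₂` equals `χ(b,y+v)` times the character that the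
product of `g₄` and `g₀` acquires under `z ↦ z + b`. So the whole integrand is the sum over `B` of
translates of one compactly supported function. -/
theorem gIntegrand_eq_integral (hχ : χ.Splits G) (hB : IsIsotropic G B) (k₄ k₂ k₀ : A → ℂ)
    (x y u v z : A) : gIntegrand G χ ν k₄ k₂ k₀ x y u v z =
      ∫ b : B, unfoldedIntegrand G χ ν k₄ k₂ k₀ x y u v (z + b) ∂ν := by
  simp only [unfoldedIntegrand, gFun_mul_gFun hχ hB k₄ k₀ x y u v z (Subtype.coe_prop _)]
  rw [gIntegrand, mul_right_comm]
  generalize gFun G χ ν k₄ (u - z) (v + z - x) * gFun G χ ν k₀ (x - z) (y + z - u) = c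
  rw [gFun, ← integral_const_mul, ← integral_const_mul]
  congr 1
  funext b
  have key : χ.toFun (y + v) b * χ.toFun (z + b) (y + v) = χ.toFun z (y + v) * G.kernel b (y + v) := by
    rw [hχ b (y + v), χ.map_add_left z]
    apply Additive.ofMul.injective
    simp only [ofMul_mul]
    abel
  have key' := congrArg (fun z : Circle => (z : ℂ)) key
  push_cast at key'
  linear_combination -c * (k₂ (z + b) * (G.toFun (z + b) : ℂ)) * key'

theorem continuous_gFun (hB : IsClosed (B : Set A)) {k : A → ℂ} (hk : IsCc k) {X : Type*}
    [TopologicalSpace X] {f g : X → A} (hf : Continuous f) (hg : Continuous g) :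
    Continuous fun x => gFun G χ ν k (f x) (g x) := by
  obtain ⟨K, hK, hKk⟩ := exists_compact_of_hasCompactSupport hk.2
  have h1 := hk.1
  have : Continuous fun p : A × A => gFun G χ ν k p.1 p.2 := by
    simp only [gFun]
    refine Continuous.mul (by fun_prop) ?_
    refine continuous_integral_of_compact (Z := A × A) (by fun_prop) fun L hL => ?_
    refine ⟨_, isCompact_subgroup hB (isCompact_sub hK (hL.image continuous_fst)), fun p hp b hb => ?_⟩
    exact ⟨p.1 + b, hKk _ (left_ne_zero_of_mul (left_ne_zero_of_mul hb)), p.1,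
      Set.mem_image_of_mem _ hp, by simp⟩
  exact this.comp (hf.prodMk hg)

theorem continuous_unfoldedIntegrand (hB : IsClosed (B : Set A)) {k₄ k₂ k₀ : A → ℂ} (h₄ : IsCc k₄)
    (h₂ : IsCc k₂) (h₀ : IsCc k₀) {X : Type*} [TopologicalSpace X] {x y u v z : X → A}
    (hx : Continuous x) (hy : Continuous y) (hu : Continuous u) (hv : Continuous v)
    (hz : Continuous z) : Continuous fun p =>
      unfoldedIntegrand G χ ν k₄ k₂ k₀ (x p) (y p) (u p) (v p) (z p) := by
  have c₂ := h₂.1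
  refine Continuous.mul (Continuous.mul ?_ ?_) (by fun_prop)
  · exact continuous_gFun hB h₄ (by fun_prop) (by fun_prop)
  · exact continuous_gFun hB h₀ (by fun_prop) (by fun_prop)

theorem isCc_unfoldedIntegrand (hB : IsClosed (B : Set A)) {k₄ k₂ k₀ : A → ℂ} (h₄ : IsCc k₄)
    (h₂ : IsCc k₂) (h₀ : IsCc k₀) (x y u v : A) :
    IsCc (unfoldedIntegrand G χ ν k₄ k₂ k₀ x y u v) := by
  obtain ⟨K, hK, hKk⟩ := exists_compact_of_hasCompactSupport h₂.2
  exact ⟨continuous_unfoldedIntegrand hB h₄ h₂ h₀ (by fun_prop) (by fun_prop) (by fun_prop)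
    (by fun_prop) (by fun_prop), hasCompactSupport_of_ne hK fun z hz =>
      hKk _ (left_ne_zero_of_mul (right_ne_zero_of_mul (right_ne_zero_of_mul hz)))⟩

theorem continuous_integral_unfoldedIntegrand (hB : IsClosed (B : Set A)) {k₄ k₂ k₀ : A → ℂ}
    (h₄ : IsCc k₄) (h₂ : IsCc k₂) (h₀ : IsCc k₀) {X : Type*} [TopologicalSpace X] {x y u v : X → A}
    (hx : Continuous x) (hy : Continuous y) (hu : Continuous u) (hv : Continuous v) :
    Continuous fun p => ∫ z, unfoldedIntegrand G χ ν k₄ k₂ k₀ (x p) (y p) (u p) (v p) z ∂μ := by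
  obtain ⟨K, hK, hKk⟩ := exists_compact_of_hasCompactSupport h₂.2
  refine continuous_integral_of_ne (L := K) ?_ hK fun p z hz =>
    hKk _ (left_ne_zero_of_mul (right_ne_zero_of_mul (right_ne_zero_of_mul hz)))
  exact continuous_unfoldedIntegrand hB h₄ h₂ h₀ (by fun_prop) (by fun_prop) (by fun_prop)
    (by fun_prop) (by fun_prop)

variable [MeasurableSpace (A ⧸ B)] [BorelSpace (A ⧸ B)] {ρ : Measure (A ⧸ B)}

/-- Weil's formula for the function whose translates are summed in `gIntegrand_eq_integral`. -/
theorem quotientIntegral_gIntegrand (hχ : χ.Splits G) (hB : IsIsotropic G B)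
    (hBc : IsClosed (B : Set A)) (hρ : WeilFormula μ ν ρ) {k₄ k₂ k₀ : A → ℂ} (h₄ : IsCc k₄)
    (h₂ : IsCc k₂) (h₀ : IsCc k₀) (x y u v : A) :
    quotientIntegral ρ (gIntegrand G χ ν k₄ k₂ k₀ x y u v) =
      ∫ z, unfoldedIntegrand G χ ν k₄ k₂ k₀ x y u v z ∂μ := by
  have h := isCc_unfoldedIntegrand (G := G) (χ := χ) (ν := ν) hBc h₄ h₂ h₀ x y u v
  rw [hρ _ h.1 h.2]
  congr 1
  funext z
  exact gIntegrand_eq_integral hχ hB k₄ k₂ k₀ x y u v z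

theorem apply_out_of_periodic {J : A → ℂ} (hJ : ∀ z, ∀ b ∈ B, J (z + b) = J z) (z : A) :
    J (z : A ⧸ B).out = J z := by
  obtain ⟨b, hb⟩ := QuotientAddGroup.mk_out_eq_add B z
  rw [hb, hJ z b b.2]

/-- The definition of `φ` amounts to the substitution `(x,y) ↦ (-y,x+y)` in both pairs of variables,
together with `z ↦ -z`. -/
theorem phiIntegrand_eq (k₄ k₂ k₀ : A → ℂ) (x y u v z : A) :
    phiIntegrand G χ ν k₄ k₂ k₀ x y u v z =
      gIntegrand G χ ν k₄ k₂ k₀ (-y) (x + y) (-v) (u + v) (-z) := by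
  simp only [phiIntegrand, phiFun, gIntegrand]
  congr 2
  · congr 1 <;> abel
  · congr 1
    abel
  · abel
  · abel

variable [ρ.IsAddHaarMeasure] [ρ.Regular]

theorem quotientIntegrable_gIntegrand (hχ : χ.Splits G) (hB : IsIsotropic G B)
    (hBc : IsClosed (B : Set A)) : QuotientIntegrable ρ (gIntegrand G χ ν) := by
  intro k₄ k₂ k₀ c₄ s₄ c₂ s₂ c₀ s₀ x y u v
  have hper : ∀ z, ∀ b ∈ B, gIntegrand G χ ν k₄ k₂ k₀ x y u v (z + b) =
      gIntegrand G χ ν k₄ k₂ k₀ x y u v z := fun z b hb => gIntegrand_add hχ hB k₄ k₂ k₀ x y u v z hb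
  refine ⟨hper, ?_⟩
  obtain ⟨K, hK, hKk⟩ := exists_compact_of_hasCompactSupport s₂
  have hcont : Continuous (gIntegrand G χ ν k₄ k₂ k₀ x y u v) :=
    ((continuous_gFun hBc ⟨c₄, s₄⟩ (by fun_prop) (by fun_prop)).mul
      (continuous_gFun hBc ⟨c₂, s₂⟩ (by fun_prop) (by fun_prop))).mul
      (continuous_gFun hBc ⟨c₀, s₀⟩ (by fun_prop) (by fun_prop))
  -- Closedness of `B` as an instance makes `A ⧸ B` Hausdorff.
  have := hBc
  have hq : Continuous fun z : A ⧸ B => gIntegrand G χ ν k₄ k₂ k₀ x y u v z.out := by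
    rw [(QuotientAddGroup.isQuotientMap_mk B).continuous_iff]
    exact hcont.congr fun z => (apply_out_of_periodic hper z).symm
  refine integrable_of_ne hq (hK.image (QuotientAddGroup.continuous_mk (N := B))) fun z hz => ?_
  rw [gIntegrand_eq_integral hχ hB] at hz
  obtain ⟨b, hb⟩ := exists_of_integral_ne_zero hz
  refine ⟨z.out + b,
    hKk _ (left_ne_zero_of_mul (right_ne_zero_of_mul (right_ne_zero_of_mul hb))), ?_⟩
  rw [QuotientAddGroup.mk_add_of_mem _ b.2]
  exact QuotientAddGroup.out_eq' z

theorem quotientIntegrable_phiIntegrand (hχ : χ.Splits G) (hB : IsIsotropic G B)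
    (hBc : IsClosed (B : Set A)) : QuotientIntegrable ρ (phiIntegrand G χ ν) := by
  intro k₄ k₂ k₀ c₄ s₄ c₂ s₂ c₀ s₀ x y u v
  have h := quotientIntegrable_gIntegrand (ν := ν) (ρ := ρ) hχ hB hBc k₄ k₂ k₀ c₄ s₄ c₂ s₂ c₀ s₀ (-y) (x + y)
    (-v) (u + v)
  simp only [phiIntegrand_eq]
  refine ⟨fun z b hb => ?_, ?_⟩
  · rw [neg_add, h.1 _ _ (neg_mem hb)]
  · have h2 := h.2.comp_neg
    refine h2.congr (Eventually.of_forall fun z => ?_)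
    simp only
    rw [← apply_out_of_periodic h.1 (-z.out), QuotientAddGroup.mk_neg, QuotientAddGroup.out_eq']

theorem quotientIntegral_phiIntegrand (hχ : χ.Splits G) (hB : IsIsotropic G B)
    (k₄ k₂ k₀ : A → ℂ) (x y u v : A) :
    quotientIntegral ρ (phiIntegrand G χ ν k₄ k₂ k₀ x y u v) =
      quotientIntegral ρ (gIntegrand G χ ν k₄ k₂ k₀ (-y) (x + y) (-v) (u + v)) := by
  have hper : ∀ z, ∀ b ∈ B, gIntegrand G χ ν k₄ k₂ k₀ (-y) (x + y) (-v) (u + v) (z + b) =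
      gIntegrand G χ ν k₄ k₂ k₀ (-y) (x + y) (-v) (u + v) z :=
    fun z b hb => gIntegrand_add hχ hB k₄ k₂ k₀ _ _ _ _ z hb
  simp only [quotientIntegral, phiIntegrand_eq]
  rw [← integral_neg_eq_self (fun z : A ⧸ B =>
    gIntegrand G χ ν k₄ k₂ k₀ (-y) (x + y) (-v) (u + v) z.out) ρ]
  congr 1
  funext z
  rw [← apply_out_of_periodic hper (-z.out), QuotientAddGroup.mk_neg, QuotientAddGroup.out_eq']

/-! ### Equivalence of the two identities -/

theorem integral_phiIntegrand (hχ : χ.Splits G) (hB : IsIsotropic G B)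
    (hBc : IsClosed (B : Set A)) (hρ : WeilFormula μ ν ρ) {θ θ' : A × A → ℂ} (hθ : IsCc θ)
    (hθ' : IsCc θ') {k₄ k₂ k₀ : A → ℂ} (h₄ : IsCc k₄) (h₂ : IsCc k₂) (h₀ : IsCc k₀) :
    ∫ x, ∫ y, ∫ u, ∫ v, θ (x, y) * θ' (u, v) *
        quotientIntegral ρ (phiIntegrand G χ ν k₄ k₂ k₀ x y u v) ∂μ ∂μ ∂μ ∂μ =
      ∫ x, ∫ y, ∫ u, ∫ v, θ (x + y, -x) * θ' (u + v, -u) *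
        quotientIntegral ρ (gIntegrand G χ ν k₄ k₂ k₀ x y u v) ∂μ ∂μ ∂μ ∂μ := by
  simp only [quotientIntegral_phiIntegrand hχ hB,
    quotientIntegral_gIntegrand hχ hB hBc hρ h₄ h₂ h₀]
  have c := hθ.1
  have c' := hθ'.1
  obtain ⟨K, L, hK, hL, hKL⟩ := exists_compact_prod_of_hasCompactSupport hθ'.2
  have hQ : ∀ {X : Type _} [TopologicalSpace X] {x y u v : X → A}, Continuous x → Continuous y →
      Continuous u → Continuous v → Continuous fun p =>
        ∫ z, unfoldedIntegrand G χ ν k₄ k₂ k₀ (x p) (y p) (u p) (v p) z ∂μ :=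
    fun hx hy hu hv => continuous_integral_unfoldedIntegrand hBc h₄ h₂ h₀ hx hy hu hv
  have hinner : ∀ x y, ∫ u, ∫ v, θ' (u, v) *
      ∫ z, unfoldedIntegrand G χ ν k₄ k₂ k₀ x y (-v) (u + v) z ∂μ ∂μ ∂μ =
      ∫ u, ∫ v, θ' (u + v, -u) *
      ∫ z, unfoldedIntegrand G χ ν k₄ k₂ k₀ x y u v z ∂μ ∂μ ∂μ := by
    intro x y
    have hq : Continuous fun p : A × A =>
        ∫ z, unfoldedIntegrand G χ ν k₄ k₂ k₀ x y (-p.2) (p.1 + p.2) z ∂μ :=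
      hQ (by fun_prop) (by fun_prop) (by fun_prop) (by fun_prop)
    rw [← integral_shear (Φ := fun p : A × A => θ' p *
      ∫ z, unfoldedIntegrand G χ ν k₄ k₂ k₀ x y (-p.2) (p.1 + p.2) z ∂μ) (by fun_prop)
      hθ'.2.mul_right]
    congr 1
    funext u
    congr 1
    funext v
    simp
  simp only [mul_assoc, integral_const_mul, hinner]
  have hout : Continuous fun p : A × A => ∫ u, ∫ v, θ' (u + v, -u) *
      ∫ z, unfoldedIntegrand G χ ν k₄ k₂ k₀ (-p.2) (p.1 + p.2) u v z ∂μ ∂μ ∂μ := by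
    refine continuous_integral_of_ne (L := -L) (continuous_integral_of_ne (L := K + L) ?_
      (hK.add hL) ?_) hL.neg ?_
    · have : Continuous fun q : ((A × A) × A) × A => ∫ z,
          unfoldedIntegrand G χ ν k₄ k₂ k₀ (-q.1.1.2) (q.1.1.1 + q.1.1.2) q.1.2 q.2 z ∂μ :=
        hQ (by fun_prop) (by fun_prop) (by fun_prop) (by fun_prop)
      fun_prop
    · intro p v hv
      have := hKL _ _ (left_ne_zero_of_mul hv)
      exact ⟨_, this.1, _, this.2, by simp⟩
    · intro p u hu
      obtain ⟨v, hv⟩ := exists_of_integral_ne_zero hu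
      have := hKL _ _ (left_ne_zero_of_mul hv)
      simpa using this.2
  rw [← integral_shear (Φ := fun p : A × A => θ p * ∫ u, ∫ v, θ' (u + v, -u) *
      ∫ z, unfoldedIntegrand G χ ν k₄ k₂ k₀ (-p.2) (p.1 + p.2) u v z ∂μ ∂μ ∂μ) (by fun_prop)
      hθ.2.mul_right]
  congr 1
  funext x
  congr 1
  funext y
  simp

theorem hasRegularizedValue_congr {T T' : (A → ℂ) → (A → ℂ) → (A → ℂ) → ℂ}
    (h : ∀ k₄ k₂ k₀, IsCc k₄ → IsCc k₂ → IsCc k₀ → T k₄ k₂ k₀ = T' k₄ k₂ k₀) {f₄ f₂ f₀ : A → ℂ}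
    {c : ℂ} (hT : HasRegularizedValue G μ T f₄ f₂ f₀ c) : HasRegularizedValue G μ T' f₄ f₂ f₀ c := by
  intro C h₄ h₂ h₀
  obtain ⟨h1, h2⟩ := hT C h₄ h₂ h₀
  refine ⟨h1, h2.congr' ?_⟩
  filter_upwards [(isCc_of_mem_regularizations (G := G) (μ := μ) C f₄).prod_mk
    ((isCc_of_mem_regularizations (G := G) (μ := μ) C f₂).prod_mk
      (isCc_of_mem_regularizations (G := G) (μ := μ) C f₀))] with k hk
  exact h _ _ _ hk.1.1 hk.2.1.1 hk.2.2.1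

theorem betaPentagon_of_integralIdentity (hχ : χ.Splits G) (hB : IsIsotropic G B)
    (hBc : IsClosed (B : Set A)) (hρ : WeilFormula μ ν ρ) {f : Fin 5 → A → ℂ}
    (h : IntegralIdentity G χ μ ν ρ f) : BetaPentagon G χ μ ν ρ f := by
  intro θ θ' hθ hθ'
  refine hasRegularizedValue_congr (fun k₄ k₂ k₀ h₄ h₂ h₀ => ?_)
    (h _ _ (isTest_shear hθ) (isTest_shear hθ'))
  exact (integral_phiIntegrand hχ hB hBc hρ ⟨hθ.1, hθ.2.1⟩ ⟨hθ'.1, hθ'.2.1⟩ h₄ h₂ h₀).symm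

/-- The shear has order six: its cube is `-1`. Five further shears invert it. -/
theorem exists_isTest_unshear {θ : A × A → ℂ} (hθ : IsTest G μ θ) :
    ∃ ϑ, IsTest G μ ϑ ∧ (fun p : A × A => ϑ (p.1 + p.2, -p.1)) = θ := by
  have h := isTest_shear (isTest_shear (isTest_shear (isTest_shear (isTest_shear hθ))))
  refine ⟨_, h, ?_⟩
  funext p
  simp only
  congr 1
  ext
  · simp only; abel
  · simp only; abel

theorem integralIdentity_of_betaPentagon (hχ : χ.Splits G) (hB : IsIsotropic G B)
    (hBc : IsClosed (B : Set A)) (hρ : WeilFormula μ ν ρ) {f : Fin 5 → A → ℂ}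
    (h : BetaPentagon G χ μ ν ρ f) : IntegralIdentity G χ μ ν ρ f := by
  intro θ θ' hθ hθ'
  obtain ⟨ϑ, hϑ, rfl⟩ := exists_isTest_unshear hθ
  obtain ⟨ϑ', hϑ', rfl⟩ := exists_isTest_unshear hθ'
  refine hasRegularizedValue_congr (fun k₄ k₂ k₀ h₄ h₂ h₀ => ?_) (h _ _ hϑ hϑ')
  exact integral_phiIntegrand hχ hB hBc hρ ⟨hϑ.1, hϑ.2.1⟩ ⟨hϑ'.1, hϑ'.2.1⟩ h₄ h₂ h₀

end Fourier

section Fourier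

variable {A : Type*} [AddCommGroup A] [TopologicalSpace A] [IsTopologicalAddGroup A]
  [LocallyCompactSpace A] [T2Space A] [MeasurableSpace A] [BorelSpace A]
  {G : GaussianExponential A} {χ : Bicharacter A} {μ : Measure A} [μ.IsAddHaarMeasure] [μ.Regular]
  {B : AddSubgroup A} {ν : Measure B} [ν.IsAddHaarMeasure] [ν.Regular]

/-! ### The right-hand side as a pairing -/

/-- Confirms that `transposeTest` is the transpose when the distribution is a function in `C_c`. -/
theorem integral_mul_subgroup_integral (hB : IsClosed (B : Set A)) {θ : A × A → ℂ} (hθ : IsCc θ)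
    {E : A → ℂ} (hE : IsCc E) :
    ∫ x, ∫ y, θ (x, y) * (χ.toFun x y : ℂ) * ∫ a : B, (G.kernel a y : ℂ) * E (x + a) ∂ν ∂μ ∂μ =
      ∫ x, transposeTest G χ μ ν θ x * E x ∂μ := by
  obtain ⟨K, L, hK, hL, hKL⟩ := exists_compact_prod_of_hasCompactSupport hθ.2
  obtain ⟨M, hM, hME⟩ := exists_compact_of_hasCompactSupport hE.2
  have c1 := hθ.1
  have c2 := hE.1
  have hB' := isCompact_subgroup hB (isCompact_sub hM hK)
  have hrot := integral_rotate_of_ne (μX := μ) (μY := μ) (μZ := ν)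
    (f := fun x y (a : B) => θ (x, y) * (χ.toFun x y : ℂ) * ((G.kernel a y : ℂ) * E (x + a)))
    (by fun_prop) hK hL hB' (fun x y a h => by
      have hx := hKL _ _ (left_ne_zero_of_mul (left_ne_zero_of_mul h))
      exact ⟨hx.1, hx.2, x + a, hME _ (right_ne_zero_of_mul (right_ne_zero_of_mul h)), x, hx.1,
        by simp⟩)
  simp only [integral_const_mul] at hrot
  rw [hrot]
  have hsw := integral_swap_of_ne (μ := ν) (ν := μ)
    (f := fun (a : B) x => (∫ y, θ (x - a, y) * (χ.toFun (x - a) y : ℂ) * (G.kernel a y : ℂ) ∂μ)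
      * E x) (by
        refine Continuous.mul ?_ (by fun_prop)
        exact continuous_integral_of_ne (L := L) (by fun_prop) hL fun z y hy =>
          (hKL _ _ (left_ne_zero_of_mul (left_ne_zero_of_mul hy))).2) hB' hM (by
      intro a x h
      have hx := hME _ (right_ne_zero_of_mul h)
      obtain ⟨y, hy⟩ := exists_of_integral_ne_zero (left_ne_zero_of_mul h)
      exact ⟨⟨x, hx, x - a, (hKL _ _ (left_ne_zero_of_mul (left_ne_zero_of_mul hy))).1, by simp⟩,
        hx⟩)
  simp only [transposeTest, ← integral_mul_const] at hsw ⊢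
  rw [← hsw]
  congr 1
  funext a
  rw [← integral_sub_right_eq_self _ (a : A)]
  congr 1
  funext x
  congr 1
  funext y
  rw [sub_add_cancel]
  ring

variable (G μ) in
/-- The kernel `∫ ⟨z⟩ k₄(u-z) k₂(z) k₀(x-z) dz` of the triple product of operators. -/
def tripleKernel (k₄ k₂ k₀ : A → ℂ) (x u : A) : ℂ :=
  (G.kernel u (-x) : ℂ) * ∫ z, (G.toFun z : ℂ) * (k₄ (u - z) * k₂ z * k₀ (x - z)) ∂μ

theorem isCc_tripleKernel {k₄ k₂ k₀ : A → ℂ} (h₄ : IsCc k₄) (h₂ : IsCc k₂) (h₀ : IsCc k₀) :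
    IsCc fun p : A × A => tripleKernel G μ k₄ k₂ k₀ p.1 p.2 := by
  obtain ⟨K₄, hK₄, hk₄⟩ := exists_compact_of_hasCompactSupport h₄.2
  obtain ⟨K₂, hK₂, hk₂⟩ := exists_compact_of_hasCompactSupport h₂.2
  obtain ⟨K₀, hK₀, hk₀⟩ := exists_compact_of_hasCompactSupport h₀.2
  have c₄ := h₄.1
  have c₂ := h₂.1
  have c₀ := h₀.1
  refine ⟨Continuous.mul (by fun_prop) (continuous_integral_of_ne (L := K₂) (by fun_prop) hK₂
    fun p z hz => ?_), hasCompactSupport_of_ne ((hK₀.add hK₂).prod (hK₄.add hK₂)) fun p hp => ?_⟩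
  · exact hk₂ _ (right_ne_zero_of_mul (left_ne_zero_of_mul (right_ne_zero_of_mul hz)))
  · obtain ⟨z, hz⟩ := exists_of_integral_ne_zero (right_ne_zero_of_mul hp)
    have h1 := right_ne_zero_of_mul hz
    have hz2 := hk₂ _ (right_ne_zero_of_mul (left_ne_zero_of_mul h1))
    exact ⟨⟨p.1 - z, hk₀ _ (right_ne_zero_of_mul h1), z, hz2, by simp⟩,
      ⟨p.2 - z, hk₄ _ (left_ne_zero_of_mul (left_ne_zero_of_mul h1)), z, hz2, by simp⟩⟩

/-- The first arguments of `χ` in `g₄` and `g₀` each contribute `χ(z,z)⁻¹`, and the gaussians of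
`u-z+c` and `x-z+a` each contribute `⟨z⟩`. Since `⟨z⟩² = ⟨z;z⟩ = χ(z,z)²`, these cancel and a single
`⟨z⟩` remains, as in `tripleKernel`. The other factors in `z` cancel because `χ` splits the kernel,
and the mixed term of the two sums over `B` is `⟨c;a⟩ = 1`. -/
theorem unfolded_phase (hχ : χ.Splits G) (x y u v z : A) {a c : A} (hac : G.kernel c a = 1) :
    χ.toFun (u - z) (v + z - x) * (G.toFun (u - z + c) * G.kernel c (v + z - x)) *
      (χ.toFun (x - z) (y + z - u) * (G.toFun (x - z + a) * G.kernel a (y + z - u))) *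
      (χ.toFun z (y + v) * G.toFun z) =
    χ.toFun x y * χ.toFun u v * (G.kernel a y * G.kernel c v) *
      (G.toFun (x + a) * G.toFun (u + c) * (G.kernel (u + c) (-(x + a)) * G.toFun z)) := by
  have e1 : G.toFun (u - z + c) = G.toFun (u + c) * G.toFun z / G.kernel (u + c) z := by
    rw [← G.toFun_sub]; congr 1; abel
  have e2 : G.toFun (x - z + a) = G.toFun (x + a) * G.toFun z / G.kernel (x + a) z := by
    rw [← G.toFun_sub]; congr 1; abel
  have e3 : G.toFun z * G.toFun z = χ.toFun z z * χ.toFun z z := by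
    rw [← G.kernel_self, hχ]
  have e4 := hχ u z
  have e5 := hχ x z
  have e6 := hχ u x
  have e7 : G.kernel a u = G.kernel u a := G.kernel_comm _ _
  have e8 : G.kernel c x = G.kernel x c := G.kernel_comm _ _
  rw [e1, e2]
  simp only [χ.map_sub_left, χ.map_sub_right, χ.map_add_right, G.kernel_add_left',
    G.kernel_neg_right, G.kernel_add_right, G.kernel_sub_right, e4, e5, e6, e7, hac]
  have e3' := congrArg Additive.ofMul e3
  apply Additive.ofMul.injective
  simp only [ofMul_mul, ofMul_div, ofMul_inv, ofMul_one] at e3' ⊢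
  have e0 := sub_eq_zero.2 e3'
  rw [← sub_eq_zero]
  refine Eq.trans ?_ e0
  abel

/-- The sums over `B` in `g₄` and `g₀` are moved outside the integral over `z`. By `unfolded_phase`
what remains inside depends on `x + a` and `u + c` only. -/
theorem integral_unfoldedIntegrand (hχ : χ.Splits G) (hB : IsIsotropic G B)
    (hBc : IsClosed (B : Set A)) {k₄ k₂ k₀ : A → ℂ} (h₄ : IsCc k₄) (h₂ : IsCc k₂) (h₀ : IsCc k₀)
    (x y u v : A) :
    ∫ z, unfoldedIntegrand G χ ν k₄ k₂ k₀ x y u v z ∂μ =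
      (χ.toFun x y : ℂ) * (χ.toFun u v : ℂ) * ∫ c : B, (G.kernel c v : ℂ) *
        ∫ a : B, (G.kernel a y : ℂ) * ((G.toFun (x + a) : ℂ) * (G.toFun (u + c) : ℂ) *
          tripleKernel G μ k₄ k₂ k₀ (x + a) (u + c)) ∂ν ∂ν := by
  obtain ⟨K₄, hK₄, hk₄⟩ := exists_compact_of_hasCompactSupport h₄.2
  obtain ⟨K₂, hK₂, hk₂⟩ := exists_compact_of_hasCompactSupport h₂.2
  obtain ⟨K₀, hK₀, hk₀⟩ := exists_compact_of_hasCompactSupport h₀.2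
  have c₄ := h₄.1
  have c₂ := h₂.1
  have c₀ := h₀.1
  have hrot := integral_rotate_of_ne (μX := ν) (μY := ν) (μZ := μ)
    (f := fun (c a : B) z => (χ.toFun x y : ℂ) * (χ.toFun u v : ℂ) * ((G.kernel c v : ℂ) *
      ((G.kernel a y : ℂ) * ((G.toFun (x + a) : ℂ) * (G.toFun (u + c) : ℂ) *
        ((G.kernel (u + c) (-(x + a)) : ℂ) *
          ((G.toFun z : ℂ) * (k₄ (u + c - z) * k₂ z * k₀ (x + a - z))))))))
    (by fun_prop) (isCompact_subgroup hBc (isCompact_sub (hK₄.add hK₂) (isCompact_singleton (x := u))))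
    (isCompact_subgroup hBc (isCompact_sub (hK₀.add hK₂) (isCompact_singleton (x := x)))) hK₂
    (fun c a z h => by
      have h1 := right_ne_zero_of_mul (right_ne_zero_of_mul (right_ne_zero_of_mul
        (right_ne_zero_of_mul (right_ne_zero_of_mul (right_ne_zero_of_mul h)))))
      have hz2 := hk₂ _ (right_ne_zero_of_mul (left_ne_zero_of_mul h1))
      exact ⟨⟨_, ⟨u + c - z, hk₄ _ (left_ne_zero_of_mul (left_ne_zero_of_mul h1)), z, hz2, rfl⟩,
        u, rfl, by simp⟩, ⟨_, ⟨x + a - z, hk₀ _ (right_ne_zero_of_mul h1), z, hz2, rfl⟩, x, rfl,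
        by simp⟩, hz2⟩)
  simp only [tripleKernel, ← integral_const_mul] at hrot ⊢
  rw [hrot]
  congr 1
  funext z
  rw [unfoldedIntegrand, mul_comm (gFun G χ ν k₄ _ _)]
  simp only [gFun, ← integral_const_mul, ← integral_mul_const]
  congr 1
  funext c
  congr 1
  funext a
  have key := congrArg (fun z : Circle => (z : ℂ))
    (unfolded_phase hχ x y u v z (hB c c.2 a a.2))
  push_cast at key
  rw [show u + (c : A) - z = u - z + c by abel, show x + (a : A) - z = x - z + a by abel]
  linear_combination (k₄ (u - z + c) * k₂ z * k₀ (x - z + a)) * key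

/-- The two sums over `B` are transposed onto `θ` and `θ'`, and the gaussians of `x` and `u` are
absorbed into `P` and `P'`. The right-hand side becomes a pairing with the symbol of the triple
product. -/
theorem integral_gIntegrand [MeasurableSpace (A ⧸ B)] [BorelSpace (A ⧸ B)] {ρ : Measure (A ⧸ B)}
    (hχ : χ.Splits G) (hB : IsIsotropic G B) (hBc : IsClosed (B : Set A))
    (hρ : WeilFormula μ ν ρ) {θ θ' : A × A → ℂ} (hθ : IsCc θ) (hθ' : IsCc θ') {k₄ k₂ k₀ : A → ℂ}
    (h₄ : IsCc k₄) (h₂ : IsCc k₂) (h₀ : IsCc k₀) :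
    ∫ x, ∫ y, ∫ u, ∫ v, θ (x, y) * θ' (u, v) *
        quotientIntegral ρ (gIntegrand G χ ν k₄ k₂ k₀ x y u v) ∂μ ∂μ ∂μ ∂μ =
      ∫ x, ∫ u, phaseTranspose G χ μ ν θ x * phaseTranspose G χ μ ν θ' u *
        tripleKernel G μ k₄ k₂ k₀ x u ∂μ ∂μ := by
  simp only [quotientIntegral_gIntegrand hχ hB hBc hρ h₄ h₂ h₀,
    integral_unfoldedIntegrand hχ hB hBc h₄ h₂ h₀]
  have hE := isCc_tripleKernel (G := G) (μ := μ) h₄ h₂ h₀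
  set E : A × A → ℂ := fun p => (G.toFun p.1 : ℂ) * (G.toFun p.2 : ℂ) *
    tripleKernel G μ k₄ k₂ k₀ p.1 p.2 with hEd
  have hEc : IsCc E := ⟨by have := hE.1; fun_prop, hE.2.mul_left⟩
  obtain ⟨K, L, hK, hL, hKL⟩ := exists_compact_prod_of_hasCompactSupport hEc.2
  have cE := hEc.1
  have hPt : ∀ θ : A × A → ℂ, ∀ x, phaseTranspose G χ μ ν θ x =
    (G.toFun x : ℂ) * transposeTest G χ μ ν θ x := fun _ _ => rfl
  have ht'c : Continuous (transposeTest G χ μ ν θ') := by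
    have h1 := continuous_phaseTranspose (G := G) (χ := χ) (μ := μ) (ν := ν) hBc hθ'
    have h2 : transposeTest G χ μ ν θ' = fun x => (starRingEnd ℂ) (G.toFun x : ℂ) *
        phaseTranspose G χ μ ν θ' x := by
      funext x
      rw [hPt, ← mul_assoc, ← Complex.normSq_eq_conj_mul_self, Circle.normSq_coe,
        Complex.ofReal_one, one_mul]
    rw [h2]
    exact (Complex.continuous_conj.comp (by fun_prop)).mul h1
  have hinner : ∀ x y, ∫ u, ∫ v, θ' (u, v) * (χ.toFun u v : ℂ) * (∫ c : B, (G.kernel c v : ℂ) *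
      ∫ a : B, (G.kernel a y : ℂ) * E (x + a, u + c) ∂ν ∂ν) ∂μ ∂μ =
      ∫ a : B, (G.kernel a y : ℂ) * ∫ u, transposeTest G χ μ ν θ' u * E (x + a, u) ∂μ ∂ν := by
    intro x y
    have hax : IsCompact {a : B | (a : A) ∈ K - {x}} :=
      isCompact_subgroup hBc (isCompact_sub hK isCompact_singleton)
    have hax' : ∀ (a : B) u, E (x + a, u) ≠ 0 → a ∈ {a : B | (a : A) ∈ K - {x}} := fun a u h =>
      ⟨x + a, (hKL _ _ h).1, x, rfl, by simp⟩
    rw [integral_mul_subgroup_integral hBc hθ'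
      (E := fun u => ∫ a : B, (G.kernel a y : ℂ) * E (x + a, u) ∂ν) ⟨?_, ?_⟩]
    · have hsw := integral_swap_of_ne (μ := μ) (ν := ν)
        (f := fun u (a : B) => transposeTest G χ μ ν θ' u * ((G.kernel a y : ℂ) * E (x + a, u)))
        (by fun_prop) hL hax (fun u a h => by
          have h1 := right_ne_zero_of_mul (right_ne_zero_of_mul h)
          exact ⟨(hKL _ _ h1).2, hax' a u h1⟩)
      simp only [← integral_const_mul] at hsw ⊢
      rw [hsw]
      congr 1
      funext a
      congr 1
      funext u
      ring
    · exact continuous_integral_of_ne (by fun_prop) hax fun u a h =>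
        hax' a u (right_ne_zero_of_mul h)
    · refine hasCompactSupport_of_ne hL fun u hu => ?_
      obtain ⟨a, ha⟩ := exists_of_integral_ne_zero hu
      exact (hKL _ _ (right_ne_zero_of_mul ha)).2
  have hE1 : IsCc fun x => ∫ u, transposeTest G χ μ ν θ' u * E (x, u) ∂μ := by
    refine ⟨continuous_integral_of_ne (by fun_prop) hL fun x u h =>
      (hKL _ _ (right_ne_zero_of_mul h)).2, hasCompactSupport_of_ne hK fun x hx => ?_⟩
    obtain ⟨u, hu⟩ := exists_of_integral_ne_zero hx
    exact (hKL _ _ (right_ne_zero_of_mul hu)).1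
  have hout := integral_mul_subgroup_integral (G := G) (χ := χ) (μ := μ) (ν := ν) hBc hθ hE1
  calc _ = ∫ x, ∫ y, θ (x, y) * (χ.toFun x y : ℂ) * ∫ a : B, (G.kernel a y : ℂ) *
        ∫ u, transposeTest G χ μ ν θ' u * E (x + a, u) ∂μ ∂ν ∂μ ∂μ := by
        congr 1
        funext x
        congr 1
        funext y
        rw [← hinner x y]
        simp only [← integral_const_mul]
        congr 1
        funext u
        congr 1
        funext v
        congr 1
        funext c
        congr 1
        funext a
        rw [hEd]
        ring
    _ = _ := by
        rw [hout]
        simp only [← integral_const_mul]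
        congr 1
        funext x
        congr 1
        funext u
        rw [hPt, hPt, hEd]
        ring

end Fourier

section Fourier

variable {A : Type*} [AddCommGroup A] [TopologicalSpace A] [IsTopologicalAddGroup A]
  [LocallyCompactSpace A] [T2Space A] [MeasurableSpace A] [BorelSpace A]
  {G : GaussianExponential A} {χ : Bicharacter A} {μ : Measure A} [μ.IsAddHaarMeasure] [μ.Regular]
  {B : AddSubgroup A} {ν : Measure B} [ν.IsAddHaarMeasure] [ν.Regular]

/-! ### Operators on continuous functions with compact support -/

theorem memLp_top_of_bounded {f : A → ℂ} (hf : Measurable f) {C : ℝ} (hC : ∀ x, ‖f x‖ ≤ C) :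
    MemLp f ∞ μ :=
  memLp_top_of_bound hf.aestronglyMeasurable C (Eventually.of_forall hC)

theorem norm_opQ_apply_le {f : A → ℂ} (hf : Measurable f) {C : ℝ} (hC : ∀ x, ‖f x‖ ≤ C)
    (v : Lp ℂ 2 μ) : ‖opQ μ f v‖ ≤ C * ‖v‖ := by
  refine Lp.norm_le_mul_norm_of_ae_le_mul ?_
  filter_upwards [opQ_apply μ (memLp_top_of_bounded hf hC) v] with x hx
  rw [hx, norm_mul]
  exact mul_le_mul_of_nonneg_right (hC x) (norm_nonneg _)

theorem norm_adjoint_fourierOp (hμ : IsSelfDualMeasure G μ) (v : Lp ℂ 2 μ) :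
    ‖ContinuousLinearMap.adjoint (fourierOp G μ hμ) v‖ = ‖v‖ := by
  rw [← norm_fourierOp hμ, fourierOp_adjoint_fourierOp]

theorem norm_opP_apply_le (hμ : IsSelfDualMeasure G μ) {f : A → ℂ} (hf : Measurable f) {C : ℝ}
    (hC : ∀ x, ‖f x‖ ≤ C) (v : Lp ℂ 2 μ) : ‖opP G μ hμ f v‖ ≤ C * ‖v‖ := by
  rw [opP, ContinuousLinearMap.comp_apply, ContinuousLinearMap.comp_apply, norm_fourierOp]
  exact (norm_opQ_apply_le hf hC _).trans_eq (by rw [norm_adjoint_fourierOp])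

theorem measurable_toFun : Measurable fun x => (G.toFun x : ℂ) :=
  (G.continuous_coe continuous_id).measurable

theorem adjoint_opQ {f : A → ℂ} (hf : Measurable f) {C : ℝ} (hC : ∀ x, ‖f x‖ ≤ C) :
    ContinuousLinearMap.adjoint (opQ μ f) = opQ μ fun x => (starRingEnd ℂ) (f x) := by
  symm
  rw [ContinuousLinearMap.eq_adjoint_iff]
  intro v w
  rw [L2.inner_def, L2.inner_def]
  refine integral_congr_ae ?_
  filter_upwards [opQ_apply μ (memLp_top_of_bounded hf hC) w, opQ_apply μ (memLp_top_of_bounded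
    (f := fun x => (starRingEnd ℂ) (f x)) (Complex.continuous_conj.measurable.comp hf) (C := C)
    (fun x => by rw [RCLike.norm_conj]; exact hC x)) v] with x h1 h2
  rw [h1, h2]
  simp only [RCLike.inner_apply, map_mul, Complex.conj_conj]
  ring

theorem norm_adjoint_toFun_apply_le (v : Lp ℂ 2 μ) :
    ‖ContinuousLinearMap.adjoint (opQ μ fun x => (G.toFun x : ℂ)) v‖ ≤ ‖v‖ := by
  rw [adjoint_opQ measurable_toFun (C := 1) fun x => (Circle.norm_coe _).le]
  refine (norm_opQ_apply_le (C := 1) (Complex.continuous_conj.measurable.comp measurable_toFun)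
    (fun x => ?_) v).trans_eq (one_mul _)
  rw [Function.comp_apply, RCLike.norm_conj, Circle.norm_coe]

theorem norm_opPQ_apply_le (hμ : IsSelfDualMeasure G μ) {f : A → ℂ} (hf : Measurable f) {C : ℝ}
    (hC : ∀ x, ‖f x‖ ≤ C) (v : Lp ℂ 2 μ) : ‖opPQ G μ hμ f v‖ ≤ C * ‖v‖ := by
  have hC0 : 0 ≤ C := (norm_nonneg _).trans (hC 0)
  rw [opPQ, ContinuousLinearMap.comp_apply, ContinuousLinearMap.comp_apply]
  refine (norm_adjoint_toFun_apply_le _).trans ((norm_opP_apply_le hμ hf hC _).trans ?_)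
  refine mul_le_mul_of_nonneg_left ?_ hC0
  exact (norm_opQ_apply_le measurable_toFun (C := 1) (fun x => (Circle.norm_coe _).le) v).trans_eq
    (one_mul _)

theorem IsCc.toL2_congr {h g : A → ℂ} (hh : IsCc h) (hg : IsCc g) (e : h = g) :
    hh.toL2 μ = hg.toL2 μ := by
  subst e
  rfl

theorem inner_toL2 {h g : A → ℂ} (hh : IsCc h) (hg : IsCc g) :
    inner ℂ (hh.toL2 μ) (hg.toL2 μ) = ∫ x, (starRingEnd ℂ) (h x) * g x ∂μ := by
  rw [L2.inner_def]
  refine integral_congr_ae ?_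
  filter_upwards [hh.coeFn_toL2 (μ := μ), hg.coeFn_toL2 (μ := μ)] with x h1 h2
  rw [h1, h2, RCLike.inner_apply, mul_comm]

theorem opQ_toL2 {f : A → ℂ} (hf : Continuous f) {C : ℝ} (hC : ∀ x, ‖f x‖ ≤ C) {h : A → ℂ}
    (hh : IsCc h) : opQ μ f (hh.toL2 μ) = (hh.mul_left hf).toL2 μ := by
  refine Lp.ext ?_
  filter_upwards [opQ_apply μ (memLp_top_of_bounded hf.measurable hC) (hh.toL2 μ),
    hh.coeFn_toL2 (μ := μ), (hh.mul_left hf).coeFn_toL2 (μ := μ)] with x h1 h2 h3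
  rw [h1, h2, h3]

/-- For `f = 𝖥k` the operator `f(𝗉)` is the superposition of the translations `h ↦ h(·+x)` with
weight `k(x)`; the conjugate only undoes the one in `corr`. -/
theorem opP_fourier_toL2 (hμ : IsSelfDualMeasure G μ) {k h : A → ℂ} (hk : IsCc k)
    (hh : IsCc h) : opP G μ hμ (fourier G μ k) (hh.toL2 μ) = (isCc_corr μ hh hk.conj).toL2 μ := by
  rw [← fourierOp_adjoint_fourierOp hμ ((isCc_corr μ hh hk.conj).toL2 μ), opP,
    ContinuousLinearMap.comp_apply, ContinuousLinearMap.comp_apply]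
  congr 1
  rw [adjoint_fourierOp_toL2, adjoint_fourierOp_toL2]
  refine Lp.ext ?_
  filter_upwards [opQ_apply μ (memLp_top_of_bounded (continuous_fourier (G := G) (μ := μ)
    hk).measurable (norm_fourier_le k)) ((memLp_fourierInv hμ hh).toLp _),
    (memLp_fourierInv hμ hh).coeFn_toLp,
    (memLp_fourierInv hμ (isCc_corr μ hh hk.conj)).coeFn_toLp] with x h1 h2 h3
  rw [h1, h2, h3, fourierInv_eq, fourierInv_eq, fourier_corr hh hk.conj, conj_fourier,
    fourierInv_eq, neg_neg]
  simp only [Complex.conj_conj]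
  ring

variable (G μ) in
/-- The operator `S` has matrix elements `∫∫ E(x,u) (h', ⟨u;·+x⟩ h(·+x)) dx du`. -/
def HasSymbol (S : Lp ℂ 2 μ →L[ℂ] Lp ℂ 2 μ) (E : A → A → ℂ) : Prop :=
  ∀ h h' : A → ℂ, ∀ (hh : IsCc h) (hh' : IsCc h'),
    inner ℂ (hh'.toL2 μ) (S (hh.toL2 μ)) =
      ∫ x, ∫ u, E x u * ∫ y, (starRingEnd ℂ) (h' y) * ((G.kernel u (y + x) : ℂ) * h (y + x))
        ∂μ ∂μ ∂μ

/-- `f₃(𝗊)` multiplies by the characters `⟨u;·⟩` with weight `k₃(u)`, and then `f₁(𝗉)` translates by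
`x` with weight `k₁(x)`, in the order used by the symbol. -/
theorem hasSymbol_opP_opQ (hμ : IsSelfDualMeasure G μ) {k₁ k₃ : A → ℂ} (h₁ : IsCc k₁)
    (h₃ : IsCc k₃) :
    HasSymbol G μ (opP G μ hμ (fourier G μ k₁) ∘L opQ μ (fourier G μ k₃))
      fun x u => k₁ x * k₃ u := by
  intro h h' hh hh'
  rw [ContinuousLinearMap.comp_apply, opQ_toL2 (continuous_fourier h₃) (norm_fourier_le k₃) hh,
    opP_fourier_toL2 hμ h₁, inner_toL2]
  obtain ⟨K₁, hK₁, hk₁⟩ := exists_compact_of_hasCompactSupport h₁.2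
  obtain ⟨K₃, hK₃, hk₃⟩ := exists_compact_of_hasCompactSupport h₃.2
  obtain ⟨L, hL, hLh⟩ := exists_compact_of_hasCompactSupport hh'.2
  have c₁ := h₁.1
  have c₃ := h₃.1
  have c := hh.1
  have c' := hh'.1
  have hrot := integral_rotate_of_ne (μX := μ) (μY := μ) (μZ := μ)
    (f := fun x u y => k₁ x * k₃ u * ((starRingEnd ℂ) (h' y) *
      ((G.kernel u (y + x) : ℂ) * h (y + x))))
    (by have := Complex.continuous_conj; fun_prop) hK₁ hK₃ hL (fun x u y hne =>
      ⟨hk₁ _ (left_ne_zero_of_mul (left_ne_zero_of_mul hne)),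
        hk₃ _ (right_ne_zero_of_mul (left_ne_zero_of_mul hne)),
        hLh _ fun h0 => left_ne_zero_of_mul (right_ne_zero_of_mul hne) (by rw [h0, map_zero])⟩)
  simp only [← integral_const_mul, corr, fourier] at hrot ⊢
  rw [hrot]
  congr 1
  funext y
  congr 1
  funext x
  simp only [← integral_mul_const, ← integral_const_mul]
  congr 1
  funext u
  rw [Complex.conj_conj, G.kernel_comm, add_comm x y]
  ring

/-- Conjugating the translation by `z` with the gaussian multiplies it by `⟨y+z⟩/⟨y⟩ = ⟨y;z⟩⟨z⟩`. -/
theorem opPQ_fourier_toL2 (hμ : IsSelfDualMeasure G μ) {k h : A → ℂ} (hk : IsCc k)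
    (hh : IsCc h) (hg : IsCc fun y => ∫ z, (G.kernel y z : ℂ) * (G.toFun z : ℂ) * k z * h (y + z) ∂μ) :
    opPQ G μ hμ (fourier G μ k) (hh.toL2 μ) = hg.toL2 μ := by
  have c := G.continuous_coe continuous_id
  have c' : Continuous fun x => (starRingEnd ℂ) (G.toFun x : ℂ) := Complex.continuous_conj.comp c
  rw [opPQ, ContinuousLinearMap.comp_apply, ContinuousLinearMap.comp_apply,
    opQ_toL2 (f := fun x => (G.toFun x : ℂ)) c (C := 1) (fun x => (Circle.norm_coe _).le) hh,
    opP_fourier_toL2 hμ hk, adjoint_opQ measurable_toFun (C := 1) (fun x => (Circle.norm_coe _).le),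
    opQ_toL2 c' (C := 1) (fun x => by rw [RCLike.norm_conj, Circle.norm_coe])]
  refine IsCc.toL2_congr _ _ (funext fun y => ?_)
  rw [corr, ← integral_const_mul]
  congr 1
  funext z
  have key : (G.toFun y)⁻¹ * G.toFun (z + y) = G.kernel y z * G.toFun z := by
    rw [add_comm, G.toFun_add, G.kernel_comm]
    apply Additive.ofMul.injective
    simp only [ofMul_mul, ofMul_inv]
    abel
  have key' := congrArg (fun z : Circle => (z : ℂ)) key
  beta_reduce at key'
  rw [Circle.coe_mul, Circle.coe_mul, Circle.coe_inv_eq_conj] at key'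
  rw [Complex.conj_conj, add_comm y z]
  linear_combination k z * h (z + y) * key'

/-- The middle operator contributes a translation by `z` and the character `⟨·;z⟩`. Shifting the
variables of `k₀` and `k₄` by `z` collects the total translation `x` and the total frequency `u`;
evaluating the character at `y + x` instead of `y` costs `⟨u;-x⟩`. -/
theorem hasSymbol_tripleKernel (hμ : IsSelfDualMeasure G μ) {k₄ k₂ k₀ : A → ℂ} (h₄ : IsCc k₄)
    (h₂ : IsCc k₂) (h₀ : IsCc k₀) :
    HasSymbol G μ (opQ μ (fourier G μ k₄) ∘L opPQ G μ hμ (fourier G μ k₂) ∘L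
      opP G μ hμ (fourier G μ k₀)) (tripleKernel G μ k₄ k₂ k₀) := by
  intro h h' hh hh'
  obtain ⟨K₄, hK₄, hk₄⟩ := exists_compact_of_hasCompactSupport h₄.2
  obtain ⟨K₂, hK₂, hk₂⟩ := exists_compact_of_hasCompactSupport h₂.2
  obtain ⟨K₀, hK₀, hk₀⟩ := exists_compact_of_hasCompactSupport h₀.2
  obtain ⟨L, hL, hLh⟩ := exists_compact_of_hasCompactSupport hh'.2
  have c₄ := h₄.1
  have c₂ := h₂.1
  have c₀ := h₀.1
  have c := hh.1
  have c' : Continuous fun y => (starRingEnd ℂ) (h' y) := hh'.conj.1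
  have hcorr := isCc_corr μ hh h₀.conj
  obtain ⟨K, hK, hKh⟩ := exists_compact_of_hasCompactSupport hcorr.2
  have ccorr := hcorr.1
  have hg : IsCc fun y => ∫ z, (G.kernel y z : ℂ) * (G.toFun z : ℂ) * k₂ z *
      corr μ h (fun x => (starRingEnd ℂ) (k₀ x)) (y + z) ∂μ := by
    refine ⟨continuous_integral_of_ne (by fun_prop) hK₂ fun y z hz =>
      hk₂ _ (right_ne_zero_of_mul (left_ne_zero_of_mul hz)),
      hasCompactSupport_of_ne (isCompact_sub hK hK₂) fun y hy => ?_⟩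
    obtain ⟨z, hz⟩ := exists_of_integral_ne_zero hy
    exact ⟨y + z, hKh _ (right_ne_zero_of_mul hz), z,
      hk₂ _ (right_ne_zero_of_mul (left_ne_zero_of_mul hz)), by simp⟩
  rw [ContinuousLinearMap.comp_apply, ContinuousLinearMap.comp_apply, opP_fourier_toL2 hμ h₀,
    opPQ_fourier_toL2 hμ h₂ hcorr hg, opQ_toL2 (continuous_fourier h₄) (norm_fourier_le k₄) hg,
    inner_toL2]
  set F : A → A → A → A → ℂ := fun x u y z => (starRingEnd ℂ) (h' y) * (G.kernel y u : ℂ) *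
    (G.toFun z : ℂ) * k₄ (u - z) * k₂ z * k₀ (x - z) * h (y + x) with hF
  have hFc : Continuous fun p : A × A × A × A => F p.1 p.2.1 p.2.2.1 p.2.2.2 := by
    have c'' := hh'.1
    have := Complex.continuous_conj
    rw [hF]
    fun_prop
  have hFs : ∀ x u y z, F x u y z ≠ 0 → x ∈ K₀ + K₂ ∧ u ∈ K₄ + K₂ ∧ y ∈ L ∧ z ∈ K₂ := by
    intro x u y z hne
    rw [hF] at hne
    have e1 := left_ne_zero_of_mul hne
    have e2 := left_ne_zero_of_mul e1
    have e3 := left_ne_zero_of_mul e2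
    have e4 := left_ne_zero_of_mul (left_ne_zero_of_mul (left_ne_zero_of_mul e3))
    have hz := hk₂ _ (right_ne_zero_of_mul e2)
    exact ⟨⟨x - z, hk₀ _ (right_ne_zero_of_mul e1), z, hz, by simp⟩,
      ⟨u - z, hk₄ _ (right_ne_zero_of_mul e3), z, hz, by simp⟩,
      hLh _ fun h0 => e4 (by rw [h0, map_zero]), hz⟩
  have hex := integral_exchange_of_ne (μX := μ) (μY := μ) (μZ := μ) (μW := μ) hFc (hK₀.add hK₂)
    (hK₄.add hK₂) hL hK₂ hFs
  have hrhs : ∀ x u, tripleKernel G μ k₄ k₂ k₀ x u * ∫ y, (starRingEnd ℂ) (h' y) *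
      ((G.kernel u (y + x) : ℂ) * h (y + x)) ∂μ = ∫ y, ∫ z, F x u y z ∂μ ∂μ := by
    intro x u
    rw [tripleKernel, ← integral_const_mul]
    congr 1
    funext y
    rw [← integral_const_mul, ← integral_mul_const]
    congr 1
    funext z
    have key : G.kernel u (-x) * G.kernel u (y + x) = G.kernel y u := by
      rw [← G.kernel_add_right, G.kernel_comm]
      congr 1
      abel
    have key' := congrArg (fun z : Circle => (z : ℂ)) key
    push_cast at key'
    rw [hF]
    linear_combination (G.toFun z : ℂ) * (k₄ (u - z) * k₂ z * k₀ (x - z)) *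
      (starRingEnd ℂ) (h' y) * h (y + x) * key'
  simp only [hrhs]
  rw [hex]
  congr 1
  funext y
  rw [← mul_assoc, ← integral_const_mul]
  congr 1
  funext z
  have e1 : corr μ h (fun x => (starRingEnd ℂ) (k₀ x)) (y + z) =
      ∫ x, h (y + x) * k₀ (x - z) ∂μ := by
    rw [corr, ← integral_sub_right_eq_self _ z]
    congr 1
    funext x
    rw [Complex.conj_conj, show x - z + (y + z) = y + x by abel]
  have e2 : fourier G μ k₄ y = ∫ u, (G.kernel y (u - z) : ℂ) * k₄ (u - z) ∂μ := by
    rw [fourier, ← integral_sub_right_eq_self _ z]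
  rw [e1, e2, ← integral_const_mul, ← integral_const_mul, ← integral_const_mul]
  congr 1
  funext x
  rw [← integral_mul_const]
  congr 1
  funext u
  have key : G.kernel y (u - z) * G.kernel y z = G.kernel y u := by
    rw [← G.kernel_add_right, sub_add_cancel]
  have key' := congrArg (fun z : Circle => (z : ℂ)) key
  push_cast at key'
  rw [hF]
  linear_combination (starRingEnd ℂ) (h' y) * (G.toFun z : ℂ) * (k₄ (u - z) * k₂ z * k₀ (x - z)) *
    h (y + x) * key'

end Fourier

section Fourier

variable {A : Type*} [AddCommGroup A] [TopologicalSpace A] [IsTopologicalAddGroup A]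
  [LocallyCompactSpace A] [T2Space A] [MeasurableSpace A] [BorelSpace A]
  {G : GaussianExponential A} {χ : Bicharacter A} {μ : Measure A} [μ.IsAddHaarMeasure] [μ.Regular]
  {B : AddSubgroup A} {ν : Measure B} [ν.IsAddHaarMeasure] [ν.Regular]

/-! ### Strong convergence -/

/-- One of the two factors `‖f - g‖` is bounded by `2C`, so that `L¹` closeness on the support of
`h` suffices. -/
theorem norm_opQ_sub_sq_le {f g : A → ℂ} (hf : Measurable f) (hg : Measurable g) {C : ℝ}
    (hfC : ∀ x, ‖f x‖ ≤ C) (hgC : ∀ x, ‖g x‖ ≤ C) {h : A → ℂ} (hh : IsCc h) {K : Set A}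
    (hK : IsCompact K) (hhK : ∀ x, h x ≠ 0 → x ∈ K) {b : ℝ} (hb : ∀ x, ‖h x‖ ≤ b) :
    ‖opQ μ f (hh.toL2 μ) - opQ μ g (hh.toL2 μ)‖ ^ 2 ≤
      2 * C * b ^ 2 * ∫ x in K, ‖f x - g x‖ ∂μ := by
  have hC0 : 0 ≤ C := (norm_nonneg _).trans (hfC 0)
  have hb0 : 0 ≤ b := (norm_nonneg _).trans (hb 0)
  rw [norm_sq_eq_integral]
  have h1 : ∫ x, ‖(opQ μ f (hh.toL2 μ) - opQ μ g (hh.toL2 μ) : Lp ℂ 2 μ) x‖ ^ 2 ∂μ =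
      ∫ x, ‖(f x - g x) * h x‖ ^ 2 ∂μ := by
    refine integral_congr_ae ?_
    filter_upwards [opQ_apply μ (memLp_top_of_bounded hf hfC) (hh.toL2 μ),
      opQ_apply μ (memLp_top_of_bounded hg hgC) (hh.toL2 μ), hh.coeFn_toL2 (μ := μ),
      Lp.coeFn_sub (opQ μ f (hh.toL2 μ)) (opQ μ g (hh.toL2 μ))] with x e1 e2 e3 e4
    rw [e4, Pi.sub_apply, e1, e2, e3, sub_mul]
  rw [h1, ← setIntegral_eq_integral_of_forall_compl_eq_zero (s := K), ← integral_const_mul]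
  · refine integral_mono_of_nonneg (Eventually.of_forall fun x => by positivity) ?_
      (Eventually.of_forall fun x => ?_)
    · exact (((integrableOn_of_bounded_measurable hf hfC hK).sub
        (integrableOn_of_bounded_measurable hg hgC hK)).norm).const_mul _
    · have e1 : ‖f x - g x‖ ≤ 2 * C := (norm_sub_le _ _).trans (by linarith [hfC x, hgC x])
      have e2 : ‖h x‖ ^ 2 ≤ b ^ 2 := pow_le_pow_left₀ (norm_nonneg _) (hb x) 2
      simp only [norm_mul]
      calc (‖f x - g x‖ * ‖h x‖) ^ 2 = ‖f x - g x‖ * ‖h x‖ ^ 2 * ‖f x - g x‖ := by ring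
        _ ≤ 2 * C * b ^ 2 * ‖f x - g x‖ := by gcongr
  · intro x hx
    rw [show h x = 0 from by_contra fun h0 => hx (hhK x h0)]
    simp

/-- On `C_c` this is the convergence in `L¹` on compact sets; the common bound `C` extends it to all
of `L²` by density. -/
theorem tendsto_opQ {f : A → ℂ} (hf : Measurable f) {C : ℝ} (hC : ∀ x, ‖f x‖ ≤ C)
    (v : Lp ℂ 2 μ) : Tendsto (fun k => opQ μ (fourier G μ k) v) (regularizations G μ C f)
      (𝓝 (opQ μ f v)) := by
  have hC0 : 0 ≤ C := (norm_nonneg _).trans (hC 0)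
  rw [Metric.tendsto_nhds]
  intro ε hε
  have hδ : 0 < ε / (4 * (C + 1)) := by positivity
  obtain ⟨_, hvh, h, hh, rfl⟩ := Metric.dense_iff.1 (dense_cc μ) v _ hδ
  rw [Metric.mem_ball, dist_eq_norm] at hvh
  obtain ⟨K, hK, hhK⟩ := exists_compact_of_hasCompactSupport hh.2
  obtain ⟨b, hb⟩ := hh.1.bounded_above_of_compact_support hh.2
  have hη : 0 < (ε / 4) ^ 2 / (2 * C * b ^ 2 + 1) := by positivity
  filter_upwards [(regularizations_hasBasis (G := G) (μ := μ) hf hC).mem_of_mem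
    (i := (K, (ε / 4) ^ 2 / (2 * C * b ^ 2 + 1))) ⟨hK, hη⟩] with k hk
  obtain ⟨hk1, hk2, hk3, hk4⟩ := hk
  have hkm := (continuous_fourier (G := G) (μ := μ) ⟨hk1, hk2⟩).measurable
  have e1 := norm_opQ_sub_sq_le (μ := μ) hkm hf hk3 hC hh hK hhK hb
  have e2 : ‖opQ μ (fourier G μ k) (hh.toL2 μ) - opQ μ f (hh.toL2 μ)‖ ≤ ε / 4 := by
    refine le_of_sq_le_sq ?_ (by positivity)
    refine e1.trans ?_
    have hk4' := (lt_div_iff₀ (by positivity)).1 hk4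
    have h0 : 0 ≤ ∫ y in K, ‖fourier G μ k y - f y‖ ∂μ := integral_nonneg fun _ => norm_nonneg _
    nlinarith
  have e3 := norm_opQ_apply_le hkm hk3 (v - hh.toL2 μ)
  have e4 := norm_opQ_apply_le hf hC (hh.toL2 μ - v)
  have e5 : C * ‖hh.toL2 μ - v‖ ≤ ε / 4 := by
    have h1 : C * ‖hh.toL2 μ - v‖ ≤ (C + 1) * (ε / (4 * (C + 1))) :=
      mul_le_mul (by linarith) hvh.le (norm_nonneg _) (by positivity)
    refine h1.trans_eq ?_
    field_simp
  rw [norm_sub_rev] at e3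
  rw [dist_eq_norm]
  have e6 : opQ μ (fourier G μ k) v - opQ μ f v = opQ μ (fourier G μ k) (v - hh.toL2 μ) +
      (opQ μ (fourier G μ k) (hh.toL2 μ) - opQ μ f (hh.toL2 μ)) + opQ μ f (hh.toL2 μ - v) := by
    rw [map_sub, map_sub]
    abel
  rw [e6]
  linarith [norm_add₃_le (a := opQ μ (fourier G μ k) (v - hh.toL2 μ))
    (b := opQ μ (fourier G μ k) (hh.toL2 μ) - opQ μ f (hh.toL2 μ))
    (c := opQ μ f (hh.toL2 μ - v))]

theorem tendsto_opP (hμ : IsSelfDualMeasure G μ) {f : A → ℂ} (hf : Measurable f) {C : ℝ}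
    (hC : ∀ x, ‖f x‖ ≤ C) (v : Lp ℂ 2 μ) :
    Tendsto (fun k => opP G μ hμ (fourier G μ k) v) (regularizations G μ C f)
      (𝓝 (opP G μ hμ f v)) :=
  ((fourierOp G μ hμ).continuous.tendsto _).comp (tendsto_opQ hf hC _)

theorem tendsto_opPQ (hμ : IsSelfDualMeasure G μ) {f : A → ℂ} (hf : Measurable f) {C : ℝ}
    (hC : ∀ x, ‖f x‖ ≤ C) (v : Lp ℂ 2 μ) :
    Tendsto (fun k => opPQ G μ hμ (fourier G μ k) v) (regularizations G μ C f)
      (𝓝 (opPQ G μ hμ f v)) :=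
  ((ContinuousLinearMap.adjoint (opQ μ fun x => (G.toFun x : ℂ))).continuous.tendsto _).comp
    (tendsto_opP hμ hf hC _)

/-! ### Strong convergence of bounded families of operators. -/

section Strong

variable {ι V : Type*} {l : Filter ι} [NormedAddCommGroup V] [NormedSpace ℂ V]
  {T : ι → V →L[ℂ] V} {S : V →L[ℂ] V} {M : ℝ}

theorem tendsto_apply_of_bounded (hT : ∀ v, Tendsto (fun i => T i v) l (𝓝 (S v)))
    (hM : ∀ᶠ i in l, ∀ v, ‖T i v‖ ≤ M * ‖v‖) {w : ι → V} {w₀ : V} (hw : Tendsto w l (𝓝 w₀)) :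
    Tendsto (fun i => T i (w i)) l (𝓝 (S w₀)) := by
  have h1 : Tendsto (fun i => T i (w i - w₀)) l (𝓝 0) := by
    refine squeeze_zero_norm' (a := fun i => M * ‖w i - w₀‖) ?_ ?_
    · filter_upwards [hM] with i hi using hi _
    · have := (tendsto_iff_norm_sub_tendsto_zero.1 hw).const_mul M
      rwa [mul_zero] at this
  have h2 := h1.add (hT w₀)
  rw [zero_add] at h2
  refine h2.congr fun i => ?_
  rw [map_sub, sub_add_cancel]

/-- Cover the compact set by finitely many small balls; the uniform bound handles the distance to
the centres. -/
theorem eventually_forall_mem_compact_norm_sub_le (hT : ∀ v, Tendsto (fun i => T i v) l (𝓝 (S v)))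
    (hM0 : 0 ≤ M) (hM : ∀ᶠ i in l, ∀ v, ‖T i v‖ ≤ M * ‖v‖) {K : Set V} (hK : IsCompact K) {ε : ℝ}
    (hε : 0 < ε) : ∀ᶠ i in l, ∀ v ∈ K, ‖T i v - S v‖ ≤ ε := by
  have hδ : 0 < ε / (2 * (M + ‖S‖ + 1)) := by positivity
  obtain ⟨t, htf, htK⟩ := Metric.totallyBounded_iff.1 hK.totallyBounded _ hδ
  have h1 : ∀ᶠ i in l, ∀ w ∈ t, ‖T i w - S w‖ < ε / 2 := by
    rw [eventually_all_finite htf]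
    intro w _
    have := (Metric.tendsto_nhds.1 (hT w)) (ε / 2) (by positivity)
    simpa only [dist_eq_norm] using this
  filter_upwards [h1, hM] with i h2 h3 v hv
  obtain ⟨w, hw, hvw⟩ := Set.mem_iUnion₂.1 (htK hv)
  rw [Metric.mem_ball, dist_eq_norm] at hvw
  have e1 : T i v - S v = T i (v - w) + (T i w - S w) - S (v - w) := by
    rw [map_sub, map_sub]
    abel
  have e2 := h3 (v - w)
  have e3 := S.le_opNorm (v - w)
  have e4 : (M + ‖S‖) * ‖v - w‖ ≤ ε / 2 := by
    have : (M + ‖S‖) * ‖v - w‖ ≤ (M + ‖S‖ + 1) * (ε / (2 * (M + ‖S‖ + 1))) :=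
      mul_le_mul (by linarith) hvw.le (norm_nonneg _) (by positivity)
    refine this.trans_eq ?_
    field_simp
  rw [e1]
  have e5 := norm_sub_le (T i (v - w) + (T i w - S w)) (S (v - w))
  have e6 := norm_add_le (T i (v - w)) (T i w - S w)
  have e7 := h2 w hw
  linarith

end Strong

theorem eventually_norm_le_of_regularizations (C : ℝ) (f : A → ℂ) :
    ∀ᶠ k in regularizations G μ C f, IsCc k ∧ Measurable (fourier G μ k) ∧
      ∀ y, ‖fourier G μ k y‖ ≤ C := by
  filter_upwards [isCc_of_mem_regularizations (G := G) (μ := μ) C f] with k hk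
  exact ⟨hk.1, (continuous_fourier hk.1).measurable, hk.2⟩

theorem tendsto_opP_opQ (hμ : IsSelfDualMeasure G μ) {f₁ f₃ : A → ℂ} (hf₁ : Measurable f₁)
    (hf₃ : Measurable f₃) {C : ℝ} (hC₁ : ∀ x, ‖f₁ x‖ ≤ C) (hC₃ : ∀ x, ‖f₃ x‖ ≤ C)
    (v : Lp ℂ 2 μ) :
    Tendsto (fun k : (A → ℂ) × (A → ℂ) =>
      (opP G μ hμ (fourier G μ k.1) ∘L opQ μ (fourier G μ k.2)) v)
      (regularizations G μ C f₁ ×ˢ regularizations G μ C f₃)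
      (𝓝 ((opP G μ hμ f₁ ∘L opQ μ f₃) v)) := by
  refine tendsto_apply_of_bounded (M := C) (T := fun k : (A → ℂ) × (A → ℂ) =>
    opP G μ hμ (fourier G μ k.1)) (fun w => (tendsto_opP hμ hf₁ hC₁ w).comp tendsto_fst) ?_
    ((tendsto_opQ hf₃ hC₃ v).comp tendsto_snd)
  filter_upwards [tendsto_fst.eventually (eventually_norm_le_of_regularizations C f₁)] with k hk w
  exact norm_opP_apply_le hμ hk.2.1 hk.2.2 w

theorem tendsto_opQ_opPQ_opP (hμ : IsSelfDualMeasure G μ) {f₄ f₂ f₀ : A → ℂ} (hf₄ : Measurable f₄)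
    (hf₂ : Measurable f₂) (hf₀ : Measurable f₀) {C : ℝ} (hC₄ : ∀ x, ‖f₄ x‖ ≤ C)
    (hC₂ : ∀ x, ‖f₂ x‖ ≤ C) (hC₀ : ∀ x, ‖f₀ x‖ ≤ C) (v : Lp ℂ 2 μ) :
    Tendsto (fun k : (A → ℂ) × (A → ℂ) × (A → ℂ) =>
      (opQ μ (fourier G μ k.1) ∘L opPQ G μ hμ (fourier G μ k.2.1) ∘L
        opP G μ hμ (fourier G μ k.2.2)) v)
      (regularizations G μ C f₄ ×ˢ regularizations G μ C f₂ ×ˢ regularizations G μ C f₀)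
      (𝓝 ((opQ μ f₄ ∘L opPQ G μ hμ f₂ ∘L opP G μ hμ f₀) v)) := by
  refine tendsto_apply_of_bounded (M := C) (T := fun k : (A → ℂ) × (A → ℂ) × (A → ℂ) =>
    opQ μ (fourier G μ k.1)) (fun w => (tendsto_opQ hf₄ hC₄ w).comp tendsto_fst) ?_ ?_
  · filter_upwards [tendsto_fst.eventually (eventually_norm_le_of_regularizations C f₄)] with k hk w
    exact norm_opQ_apply_le hk.2.1 hk.2.2 w
  refine tendsto_apply_of_bounded (M := C) (T := fun k : (A → ℂ) × (A → ℂ) × (A → ℂ) =>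
    opPQ G μ hμ (fourier G μ k.2.1))
    (fun w => (tendsto_opPQ hμ hf₂ hC₂ w).comp (tendsto_fst.comp tendsto_snd)) ?_
    ((tendsto_opP hμ hf₀ hC₀ v).comp (tendsto_snd.comp tendsto_snd))
  filter_upwards [(tendsto_fst.comp tendsto_snd).eventually
    (eventually_norm_le_of_regularizations C f₂)] with k hk w
  exact norm_opPQ_apply_le hμ hk.2.1 hk.2.2 w

theorem norm_opP_opQ_apply_le (hμ : IsSelfDualMeasure G μ) {f₁ f₃ : A → ℂ} (hf₁ : Measurable f₁)
    (hf₃ : Measurable f₃) {C : ℝ} (hC₁ : ∀ x, ‖f₁ x‖ ≤ C) (hC₃ : ∀ x, ‖f₃ x‖ ≤ C)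
    (v : Lp ℂ 2 μ) : ‖(opP G μ hμ f₁ ∘L opQ μ f₃) v‖ ≤ C ^ 2 * ‖v‖ := by
  have hC0 : 0 ≤ C := (norm_nonneg _).trans (hC₁ 0)
  refine (norm_opP_apply_le hμ hf₁ hC₁ _).trans ?_
  rw [sq, mul_assoc]
  exact mul_le_mul_of_nonneg_left (norm_opQ_apply_le hf₃ hC₃ v) hC0

theorem norm_opQ_opPQ_opP_apply_le (hμ : IsSelfDualMeasure G μ) {f₄ f₂ f₀ : A → ℂ}
    (hf₄ : Measurable f₄) (hf₂ : Measurable f₂) (hf₀ : Measurable f₀) {C : ℝ}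
    (hC₄ : ∀ x, ‖f₄ x‖ ≤ C) (hC₂ : ∀ x, ‖f₂ x‖ ≤ C) (hC₀ : ∀ x, ‖f₀ x‖ ≤ C) (v : Lp ℂ 2 μ) :
    ‖(opQ μ f₄ ∘L opPQ G μ hμ f₂ ∘L opP G μ hμ f₀) v‖ ≤ C ^ 3 * ‖v‖ := by
  have hC0 : 0 ≤ C := (norm_nonneg _).trans (hC₄ 0)
  refine (norm_opQ_apply_le hf₄ hC₄ _).trans ?_
  rw [show C ^ 3 * ‖v‖ = C * (C * (C * ‖v‖)) by ring]
  refine mul_le_mul_of_nonneg_left ((norm_opPQ_apply_le hμ hf₂ hC₂ _).trans ?_) hC0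
  exact mul_le_mul_of_nonneg_left (norm_opP_apply_le hμ hf₀ hC₀ v) hC0

theorem continuous_toL2 {Z : Type*} [TopologicalSpace Z] {g : Z → A → ℂ}
    (hg : Continuous fun p : Z × A => g p.1 p.2) (hcc : ∀ z, IsCc (g z))
    (h : ∀ z₀, ∃ U ∈ 𝓝 z₀, ∃ L : Set A, IsCompact L ∧ ∀ z ∈ U, ∀ y, g z y ≠ 0 → y ∈ L) :
    Continuous fun z => (hcc z).toL2 μ := by
  rw [continuous_iff_continuousAt]
  intro z₀
  obtain ⟨U, hU, L, hL, hUL⟩ := h z₀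
  rw [ContinuousAt, Metric.tendsto_nhds]
  intro ε hε
  set m := (μ L ^ (2 : ℝ)⁻¹).toReal
  have hδ : 0 < ε / (m + 1) := by positivity
  have h1 : ∀ᶠ z in 𝓝 z₀, ∀ y ∈ L, ‖g z y - g z₀ y‖ < ε / (m + 1) := by
    refine hL.eventually_forall_of_forall_eventually fun y _ => ?_
    have hc : Continuous fun p : Z × A => ‖g p.1 p.2 - g z₀ p.2‖ :=
      (hg.sub (hg.comp (by fun_prop : Continuous fun p : Z × A => (z₀, p.2)))).norm
    have := hc.continuousAt (x := (z₀, y))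
    refine this.eventually (gt_mem_nhds ?_)
    simpa using hδ
  filter_upwards [h1, hU] with z h2 hz
  rw [dist_eq_norm, ← toL2_sub]
  have hne : ∀ y, g z y - g z₀ y ≠ 0 → y ∈ L := by
    intro y hy
    by_contra hyL
    refine hy ?_
    rw [show g z y = 0 from by_contra fun h0 => hyL (hUL z hz y h0),
      show g z₀ y = 0 from by_contra fun h0 => hyL (hUL z₀ (mem_of_mem_nhds hU) y h0), sub_zero]
  refine (norm_toL2_le ((hcc z).sub (hcc z₀)) hne hL hδ.le fun y => ?_).trans_lt ?_
  · by_cases hy : y ∈ L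
    · exact (h2 y hy).le
    · rw [not_imp_comm.1 (hne y) hy, norm_zero]
      exact hδ.le
  · have hm : 0 ≤ m := ENNReal.toReal_nonneg
    have : (m + 1) * (ε / (m + 1)) = ε := mul_div_cancel₀ _ (by positivity)
    change m * (ε / (m + 1)) < ε
    linarith

end Fourier

section Fourier

variable {A : Type*} [AddCommGroup A] [TopologicalSpace A] [IsTopologicalAddGroup A]
  [LocallyCompactSpace A] [T2Space A] [MeasurableSpace A] [BorelSpace A]
  {G : GaussianExponential A} {χ : Bicharacter A} {μ : Measure A} [μ.IsAddHaarMeasure] [μ.Regular]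
  {B : AddSubgroup A} {ν : Measure B} [ν.IsAddHaarMeasure] [ν.Regular]

/-! ### Local `L²` norms -/

theorem norm_toL2_sq {h : A → ℂ} (hh : IsCc h) : ‖hh.toL2 μ‖ ^ 2 = ∫ x, ‖h x‖ ^ 2 ∂μ := by
  rw [norm_sq_eq_integral]
  refine integral_congr_ae ?_
  filter_upwards [hh.coeFn_toL2 (μ := μ)] with x hx
  rw [hx]

theorem integral_norm_mul_norm_le {f g : A → ℂ} (hf : IsCc f) (hg : IsCc g) :
    ∫ x, ‖f x‖ * ‖g x‖ ∂μ ≤ ‖hf.toL2 μ‖ * ‖hg.toL2 μ‖ := by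
  have hf' : IsCc fun x => (‖f x‖ : ℂ) := IsCc.ofReal hf.1.norm hf.2.norm
  have hg' : IsCc fun x => (‖g x‖ : ℂ) := IsCc.ofReal hg.1.norm hg.2.norm
  have h1 := norm_inner_le_norm (𝕜 := ℂ) (hf'.toL2 μ) (hg'.toL2 μ)
  have e1 : ‖hf'.toL2 μ‖ = ‖hf.toL2 μ‖ := by
    rw [← sq_eq_sq₀ (norm_nonneg _) (norm_nonneg _), norm_toL2_sq, norm_toL2_sq]
    simp
  have e2 : ‖hg'.toL2 μ‖ = ‖hg.toL2 μ‖ := by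
    rw [← sq_eq_sq₀ (norm_nonneg _) (norm_nonneg _), norm_toL2_sq, norm_toL2_sq]
    simp
  rw [inner_toL2, e1, e2] at h1
  refine le_trans ?_ h1
  have e3 : ∫ x, (starRingEnd ℂ) (‖f x‖ : ℂ) * (‖g x‖ : ℂ) ∂μ =
      ((∫ x, ‖f x‖ * ‖g x‖ ∂μ : ℝ) : ℂ) := by
    rw [← integral_complex_ofReal]
    congr 1
    funext x
    rw [Complex.conj_ofReal, Complex.ofReal_mul]
  rw [e3, Complex.norm_real]
  exact le_abs_self _

theorem isCc_localize {q : A → ℂ} (hq : Continuous q) {h : A → ℝ} (hc : Continuous h)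
    (hs : HasCompactSupport h) (s : A) : IsCc fun y => q y * (h (y - s) : ℂ) := by
  have h1 := ((IsCc.ofReal hc hs).translate (-s)).mul_left hq
  simpa only [← sub_eq_add_neg] using h1

theorem continuous_norm_localize {q : A → ℂ} (hq : Continuous q) {h : A → ℝ} (hc : Continuous h)
    (hs : HasCompactSupport h) : Continuous fun s => ‖(isCc_localize hq hc hs s).toL2 μ‖ := by
  obtain ⟨L, hL, hLh⟩ := exists_compact_of_hasCompactSupport hs
  refine (continuous_toL2 (g := fun s y => q y * (h (y - s) : ℂ)) (by fun_prop)
    (isCc_localize hq hc hs) fun s₀ => ?_).norm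
  obtain ⟨U, hU, hUs⟩ := exists_compact_mem_nhds s₀
  refine ⟨U, hUs, L + U, hL.add hU, fun s hs y hy => ⟨y - s, hLh _ fun h0 => ?_, s, hs, by simp⟩⟩
  exact right_ne_zero_of_mul hy (by rw [h0, Complex.ofReal_zero])

theorem norm_localize_sq {q : A → ℂ} (hq : Continuous q) {h : A → ℝ} (hc : Continuous h)
    (hs : HasCompactSupport h) (s : A) :
    ‖(isCc_localize hq hc hs s).toL2 μ‖ ^ 2 = ∫ y, ‖q y‖ ^ 2 * h (y - s) ^ 2 ∂μ := by
  rw [norm_toL2_sq]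
  congr 1
  funext y
  rw [norm_mul, mul_pow, Complex.norm_real, Real.norm_eq_abs, sq_abs]

theorem exists_shifted_dominating {w : A → ℝ} (hw : Continuous w) (hwc : HasCompactSupport w)
    {L : Set A} (hL : IsCompact L) : ∃ w' : A → ℝ, Continuous w' ∧ HasCompactSupport w' ∧
      (∀ x, 0 ≤ w' x) ∧ ∀ x, ∀ τ ∈ L, w (x + τ) ≤ w' x := by
  obtain ⟨K, hK, hwK⟩ := exists_compact_of_hasCompactSupport hwc
  obtain ⟨b, hb⟩ := hw.bounded_above_of_compact_support hwc
  have hb0 : 0 ≤ b := (norm_nonneg _).trans (hb 0)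
  obtain ⟨κ, c1, c2, c3, -, c5⟩ := exists_cutoff (isCompact_sub hK hL)
  refine ⟨fun x => b * κ x, by fun_prop, c2.mul_left, fun x => mul_nonneg hb0 (c3 x),
    fun x τ hτ => ?_⟩
  by_cases h0 : w (x + τ) = 0
  · rw [h0]
    exact mul_nonneg hb0 (c3 x)
  · beta_reduce
    rw [c5 x ⟨x + τ, hwK _ h0, τ, hτ, by simp⟩, mul_one]
    exact (le_abs_self _).trans (hb _)

/-- With `N(s) = ‖q h(·-s)‖₂`, test `q` against `g = q̄ c`, where `c(y) = ∫ κ(s) h(y-s)²/(N(s)+δ)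
ds`. Then `∫ q g = ∫ κ N²/(N+δ)`, which tends to `∫ κN` as `δ → 0`. On the other side, by
Cauchy–Schwarz the part of `‖𝖥ψ‖ * ‖g‖` at `s` is at most an integrable function of `ξ - s` times
`N(s)/(N(s)+δ) ≤ 1`. The bound is therefore uniform in `ξ`. -/
theorem IsAmalgamWindow.exists_localNorm_bound (hμ : IsSelfDualMeasure G μ) {ψ : A → ℂ}
    (hψ : IsAmalgamWindow G μ ψ) {q : A → ℂ} (hq : Continuous q) {C : ℝ} (hC0 : 0 ≤ C)
    (hqC : ∀ g : A → ℂ, IsCc g → ∀ D' : ℝ,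
      (∀ ξ, ∫ ζ, ‖fourier G μ ψ (ξ - ζ)‖ * ‖g ζ‖ ∂μ ≤ D') → ‖∫ ζ, q ζ * g ζ ∂μ‖ ≤ C * D')
    {h : A → ℝ} (hc : Continuous h) (hs : HasCompactSupport h) :
    ∃ M, 0 ≤ M ∧ ∀ κ : A → ℝ, Continuous κ → HasCompactSupport κ → (∀ s, 0 ≤ κ s) →
      (∀ s, κ s ≤ 1) → ∫ s, κ s * ‖(isCc_localize hq hc hs s).toL2 μ‖ ∂μ ≤ M := by
  obtain ⟨D, w, hD, hDi, hD0, hw, hwc, hw0, hdom⟩ := hψ.exists_dominating hμ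
  obtain ⟨L, hL, hLh⟩ := exists_compact_of_hasCompactSupport hs
  obtain ⟨w', cw', hw'c, hw'0, hww'⟩ := exists_shifted_dominating hw hwc hL
  set N : A → ℝ := fun s => ‖(isCc_localize hq hc hs s).toL2 μ‖ with hN
  have hNc : Continuous N := continuous_norm_localize hq hc hs
  have hN0 : ∀ s, 0 ≤ N s := fun s => norm_nonneg _
  set H : ℝ := ‖(IsCc.ofReal hc hs).toL2 μ‖ with hH
  have hψc := continuous_fourier (G := G) (μ := μ) hψ.isCc
  set D' : ℝ := H * ((∫ r, D r ∂μ) * ∫ r, w' r ∂μ) with hD'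
  have hD'0 : 0 ≤ D' := mul_nonneg (norm_nonneg _) (mul_nonneg (integral_nonneg hD0)
    (integral_nonneg hw'0))
  -- On the support of `h(·-s)` the transform `𝖥ψ(ξ-ζ)` is dominated by a quantity that no longer
  -- depends on `ζ`; replacing `w` by `w'` pays for this.
  have hA : ∀ ξ s ζ, ζ - s ∈ L →
      ‖fourier G μ ψ (ξ - ζ)‖ ≤ ∫ r, w' (r - (ξ - s)) * D r ∂μ := by
    intro ξ s ζ hζ
    refine (hdom _).trans (integral_mono ?_ ?_ fun r => ?_)
    · exact (((hw.comp (by fun_prop : Continuous fun r => r - (ξ - ζ))).mul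
        hD).integrable_of_hasCompactSupport
        ((hwc.comp_homeomorph (Homeomorph.subRight (ξ - ζ))).mul_right))
    · exact (((cw'.comp (by fun_prop : Continuous fun r => r - (ξ - s))).mul
        hD).integrable_of_hasCompactSupport
        ((hw'c.comp_homeomorph (Homeomorph.subRight (ξ - s))).mul_right))
    · refine mul_le_mul_of_nonneg_right ?_ (hD0 r)
      rw [show r - (ξ - ζ) = r - (ξ - s) + (ζ - s) by abel]
      exact hww' _ _ hζ
  have hA0 : ∀ σ, 0 ≤ ∫ r, w' (r - σ) * D r ∂μ := fun σ =>
    integral_nonneg fun r => mul_nonneg (hw'0 _) (hD0 r)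
  have hAc : Continuous fun σ => ∫ r, w' (r - σ) * D r ∂μ := by
    obtain ⟨W, hW, hWw⟩ := exists_compact_of_hasCompactSupport hw'c
    refine continuous_integral_of_compact (by fun_prop) fun K hK => ⟨W + K, hW.add hK,
      fun σ hσ r hr => ⟨r - σ, hWw _ (left_ne_zero_of_mul hr), σ, hσ, by simp⟩⟩
  have hloc : ∀ ξ s, ∫ ζ, ‖fourier G μ ψ (ξ - ζ)‖ * (‖q ζ‖ * h (ζ - s) ^ 2) ∂μ ≤
      (∫ r, w' (r - (ξ - s)) * D r ∂μ) * (N s * H) := by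
    intro ξ s
    have hhs : IsCc fun y => (h (y - s) : ℂ) := by
      simpa only [one_mul] using isCc_localize (q := fun _ => 1) continuous_const hc hs s
    have hHs : ‖hhs.toL2 μ‖ = H := by
      rw [← sq_eq_sq₀ (norm_nonneg _) (norm_nonneg _), norm_toL2_sq, norm_toL2_sq]
      exact integral_sub_right_eq_self (fun y => ‖(h y : ℂ)‖ ^ 2) s
    have hcs := integral_norm_mul_norm_le (μ := μ) (isCc_localize hq hc hs s) hhs
    rw [hHs] at hcs
    have hi : Integrable (fun y => ‖q y * (h (y - s) : ℂ)‖ * ‖(h (y - s) : ℂ)‖) μ :=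
      ((isCc_localize hq hc hs s).1.norm.mul hhs.1.norm).integrable_of_hasCompactSupport
        hhs.2.norm.mul_left
    refine le_trans ?_ (mul_le_mul_of_nonneg_left hcs (hA0 _))
    rw [← integral_const_mul]
    refine integral_mono_of_nonneg (Eventually.of_forall fun y => by positivity)
      (hi.const_mul _) (Eventually.of_forall fun ζ => ?_)
    have e1 : ‖q ζ‖ * h (ζ - s) ^ 2 = ‖q ζ * (h (ζ - s) : ℂ)‖ * ‖(h (ζ - s) : ℂ)‖ := by
      rw [norm_mul, Complex.norm_real, Real.norm_eq_abs, mul_assoc, ← sq, sq_abs]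
    simp only
    rw [e1]
    by_cases h0 : h (ζ - s) = 0
    · simp [h0]
    · exact mul_le_mul_of_nonneg_right (hA ξ s ζ (hLh _ h0)) (by positivity)
  refine ⟨C * D', mul_nonneg hC0 hD'0, fun κ k1 k2 k3 k4 => ?_⟩
  obtain ⟨K, hK, hKκ⟩ := exists_compact_of_hasCompactSupport k2
  have hκi : Integrable κ μ := k1.integrable_of_hasCompactSupport k2
  refine le_of_forall_pos_le_add fun ε hε => ?_
  obtain ⟨δ, hδ, hδε⟩ : ∃ δ : ℝ, 0 < δ ∧ δ * ∫ s, κ s ∂μ ≤ ε := by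
    have h0 : 0 ≤ ∫ s, κ s ∂μ := integral_nonneg k3
    refine ⟨ε / ((∫ s, κ s ∂μ) + 1), by positivity, ?_⟩
    rw [div_mul_eq_mul_div, div_le_iff₀ (by positivity)]
    nlinarith
  have hNδ : ∀ s, N s + δ ≠ 0 := fun s => by linarith [hN0 s]
  -- The summand `δ` keeps the denominator away from zero where `q` vanishes on the window.
  set c : A → ℝ := fun y => ∫ s, κ s * (h (y - s) ^ 2 / (N s + δ)) ∂μ with hcdef
  have hcc : Continuous c := continuous_integral_of_ne
    (f := fun y s => κ s * (h (y - s) ^ 2 / (N s + δ)))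
    ((by fun_prop : Continuous fun p : A × A => κ p.2).mul
      (Continuous.div (by fun_prop) (by fun_prop) fun p => hNδ p.2)) hK
    fun y s hys => hKκ _ (left_ne_zero_of_mul hys)
  have hc0 : ∀ y, 0 ≤ c y := fun y => integral_nonneg fun s =>
    mul_nonneg (k3 s) (div_nonneg (sq_nonneg _) (by linarith [hN0 s]))
  have hcs : ∀ y, c y ≠ 0 → y ∈ L + K := by
    intro y hy
    obtain ⟨s, hys⟩ := exists_of_integral_ne_zero hy
    have h1 : h (y - s) ≠ 0 := fun h0 => right_ne_zero_of_mul hys (by rw [h0]; simp)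
    exact ⟨y - s, hLh _ h1, s, hKκ _ (left_ne_zero_of_mul hys), by simp⟩
  have hswap : ∀ m : A → ℝ, Continuous m → ∫ y, m y * c y ∂μ =
      ∫ s, κ s * ((∫ y, m y * h (y - s) ^ 2 ∂μ) / (N s + δ)) ∂μ := by
    intro m hm
    have := integral_swap_of_ne (μ := μ) (ν := μ)
      (f := fun y s => m y * (κ s * (h (y - s) ^ 2 / (N s + δ))))
      ((by fun_prop : Continuous fun p : A × A => m p.1).mul
        ((by fun_prop : Continuous fun p : A × A => κ p.2).mul
          (Continuous.div (by fun_prop) (by fun_prop) fun p => hNδ p.2)))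
      (hL.add hK) hK (fun y s hys => by
        have h2 := right_ne_zero_of_mul hys
        have h1 : h (y - s) ≠ 0 := fun h0 => right_ne_zero_of_mul h2 (by rw [h0]; simp)
        exact ⟨⟨y - s, hLh _ h1, s, hKκ _ (left_ne_zero_of_mul h2), by simp⟩,
          hKκ _ (left_ne_zero_of_mul h2)⟩)
    simp only [integral_const_mul] at this
    rw [hcdef, this]
    congr 1
    funext s
    rw [← integral_div, ← integral_const_mul]
    congr 1
    funext y
    ring
  have hg : IsCc fun y => (starRingEnd ℂ) (q y) * (c y : ℂ) :=
    (IsCc.ofReal hcc (hasCompactSupport_of_ne (hL.add hK) hcs)).mul_left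
      (Complex.continuous_conj.comp hq)
  have hbound := hqC _ hg D' ?_
  · have e1 : ∫ ζ, q ζ * ((starRingEnd ℂ) (q ζ) * (c ζ : ℂ)) ∂μ =
        ((∫ ζ, ‖q ζ‖ ^ 2 * c ζ ∂μ : ℝ) : ℂ) := by
      rw [← integral_complex_ofReal]
      congr 1
      funext ζ
      rw [← mul_assoc, Complex.mul_conj']
      push_cast
      ring
    rw [e1, Complex.norm_real, hswap _ (by fun_prop)] at hbound
    have e2 := (le_abs_self _).trans hbound
    simp only [← norm_localize_sq hq hc hs] at e2
    have i1 : Integrable (fun s => κ s * (N s ^ 2 / (N s + δ))) μ :=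
      (k1.mul ((hNc.pow 2).div (by fun_prop) hNδ)).integrable_of_hasCompactSupport k2.mul_right
    have i2 : Integrable (fun s => κ s * N s) μ :=
      (k1.mul hNc).integrable_of_hasCompactSupport k2.mul_right
    calc ∫ s, κ s * N s ∂μ ≤ ∫ s, (κ s * (N s ^ 2 / (N s + δ)) + δ * κ s) ∂μ := by
          refine integral_mono i2 (i1.add (hκi.const_mul δ)) fun s => ?_
          have h1 : N s ≤ N s ^ 2 / (N s + δ) + δ := by
            have h2 : 0 < N s + δ := by linarith [hN0 s]
            rw [← sub_le_iff_le_add, le_div_iff₀ h2]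
            nlinarith
          have := mul_le_mul_of_nonneg_left h1 (k3 s)
          simp only
          linarith
      _ = (∫ s, κ s * (N s ^ 2 / (N s + δ)) ∂μ) + δ * ∫ s, κ s ∂μ := by
          rw [integral_add i1 (hκi.const_mul δ), integral_const_mul]
      _ ≤ C * D' + ε := add_le_add e2 hδε
  · intro ξ
    have e1 : ∀ ζ, ‖fourier G μ ψ (ξ - ζ)‖ * ‖(starRingEnd ℂ) (q ζ) * (c ζ : ℂ)‖ =
        ‖fourier G μ ψ (ξ - ζ)‖ * ‖q ζ‖ * c ζ := by
      intro ζ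
      rw [norm_mul, RCLike.norm_conj, Complex.norm_real, Real.norm_eq_abs, abs_of_nonneg (hc0 ζ),
        mul_assoc]
    simp only [e1]
    rw [hswap (fun ζ => ‖fourier G μ ψ (ξ - ζ)‖ * ‖q ζ‖) (by fun_prop)]
    calc _ ≤ ∫ s, H * (κ s * ∫ r, w' (r - (ξ - s)) * D r ∂μ) ∂μ := by
          refine integral_mono_of_nonneg (Eventually.of_forall fun s => ?_) ?_
            (Eventually.of_forall fun s => ?_)
          · exact mul_nonneg (k3 s) (div_nonneg (integral_nonneg fun y => by positivity)
              (by linarith [hN0 s]))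
          · have : Continuous fun s => κ s * ∫ r, w' (r - (ξ - s)) * D r ∂μ :=
              k1.mul (hAc.comp (by fun_prop : Continuous fun s => ξ - s))
            exact (this.integrable_of_hasCompactSupport k2.mul_right).const_mul H
          · have h2 : 0 < N s + δ := by linarith [hN0 s]
            have h3 := hloc ξ s
            simp only [← mul_assoc] at h3
            have h4 : (∫ y, ‖fourier G μ ψ (ξ - y)‖ * ‖q y‖ * h (y - s) ^ 2 ∂μ) / (N s + δ) ≤
                H * ∫ r, w' (r - (ξ - s)) * D r ∂μ := by
              rw [div_le_iff₀ h2]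
              refine h3.trans ?_
              have h5 : 0 ≤ H * (∫ r, w' (r - (ξ - s)) * D r ∂μ) * δ :=
                mul_nonneg (mul_nonneg (norm_nonneg _) (hA0 _)) hδ.le
              linarith
            have := mul_le_mul_of_nonneg_left h4 (k3 s)
            simp only
            linarith
      _ = H * ∫ σ, κ (ξ - σ) * ∫ r, w' (r - σ) * D r ∂μ ∂μ := by
          rw [integral_const_mul, ← integral_sub_left_eq_self _ μ ξ]
          simp only [sub_sub_cancel]
      _ ≤ D' := by
          refine mul_le_mul_of_nonneg_left ?_ (norm_nonneg _)
          exact integral_cutoff_average_le hD hDi hD0 cw' hw'c hw'0 (by fun_prop)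
            (k2.comp_homeomorph (Homeomorph.subLeft ξ)) (fun y => k3 _) (fun y => k4 _)

end Fourier

section Fourier

variable {A : Type*} [AddCommGroup A] [TopologicalSpace A] [IsTopologicalAddGroup A]
  [LocallyCompactSpace A] [T2Space A] [MeasurableSpace A] [BorelSpace A]
  {G : GaussianExponential A} {χ : Bicharacter A} {μ : Measure A} [μ.IsAddHaarMeasure] [μ.Regular]
  {B : AddSubgroup A} {ν : Measure B} [ν.IsAddHaarMeasure] [ν.Regular]

/-! ### Tails of iterated integrals -/

section Tails

variable {X Y E : Type*} [TopologicalSpace X] [T2Space X] [MeasurableSpace X] [BorelSpace X]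
  [TopologicalSpace Y] [T2Space Y] [MeasurableSpace Y] [BorelSpace Y]
  {m : Measure X} {n : Measure Y} [IsFiniteMeasureOnCompacts m] [IsFiniteMeasureOnCompacts n]
  [NormedAddCommGroup E] [NormedSpace ℝ E]

theorem integrable_integral_of_ne {f : X → Y → E} (hf : Continuous fun p : X × Y => f p.1 p.2)
    {K : Set X} {L : Set Y} (hK : IsCompact K) (hL : IsCompact L)
    (h : ∀ x y, f x y ≠ 0 → x ∈ K ∧ y ∈ L) :
    (∀ x, Integrable (f x) n) ∧ Integrable (fun x => ∫ y, f x y ∂n) m := by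
  refine ⟨fun x => integrable_of_ne (hf.comp (by fun_prop : Continuous fun y : Y => (x, y))) hL
    fun y hy => (h x y hy).2, integrable_of_ne (continuous_integral_of_ne hf hL
      fun x y hy => (h x y hy).2) hK fun x hx => ?_⟩
  obtain ⟨y, hy⟩ := exists_of_integral_ne_zero hx
  exact (h x y hy).1

theorem integral_integral_sub_of_ne {f g : X → Y → E}
    (hf : Continuous fun p : X × Y => f p.1 p.2) (hg : Continuous fun p : X × Y => g p.1 p.2)
    {K : Set X} {L : Set Y} (hK : IsCompact K) (hL : IsCompact L)
    (h : ∀ x y, f x y ≠ 0 → x ∈ K ∧ y ∈ L) (h' : ∀ x y, g x y ≠ 0 → x ∈ K ∧ y ∈ L) :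
    ∫ x, ∫ y, (f x y - g x y) ∂n ∂m = ∫ x, ∫ y, f x y ∂n ∂m - ∫ x, ∫ y, g x y ∂n ∂m := by
  obtain ⟨f1, f2⟩ := integrable_integral_of_ne (m := m) (n := n) hf hK hL h
  obtain ⟨g1, g2⟩ := integrable_integral_of_ne (m := m) (n := n) hg hK hL h'
  rw [← integral_sub f2 g2]
  congr 1
  funext x
  exact integral_sub (f1 x) (g1 x)

theorem norm_integral_integral_le_of_le {f : X → Y → E} {g : X → Y → ℝ}
    (hg : Continuous fun p : X × Y => g p.1 p.2) {K : Set X} {L : Set Y} (hK : IsCompact K)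
    (hL : IsCompact L) (h : ∀ x y, g x y ≠ 0 → x ∈ K ∧ y ∈ L) (hfg : ∀ x y, ‖f x y‖ ≤ g x y) :
    ‖∫ x, ∫ y, f x y ∂n ∂m‖ ≤ ∫ x, ∫ y, g x y ∂n ∂m := by
  obtain ⟨g1, g2⟩ := integrable_integral_of_ne (m := m) (n := n) hg hK hL h
  exact norm_integral_le_of_norm_le g2 (Eventually.of_forall fun x =>
    norm_integral_le_of_norm_le (g1 x) (Eventually.of_forall fun y => hfg x y))

/-- Let `κ₀` bring `∫∫ κ‖r‖` within `ε` of its supremum `σ` over cutoffs. If `ω` is close to `1` on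
a compact set containing the support of `κ₀`, then `‖ω - κ₀‖ ≤ (1+ε)κ₁ - κ₀` for a cutoff `κ₁` equal
to `1` wherever either lives, and the integral is at most `(1+ε)σ - (σ-ε) ≤ ε(1+M)`. -/
theorem exists_cutoff_weighted_tail [LocallyCompactSpace X] [LocallyCompactSpace Y] {r : X → Y → ℂ}
    (hr : Continuous fun p : X × Y => r p.1 p.2) {M : ℝ}
    (hM : ∀ κ : X × Y → ℝ, Continuous κ → HasCompactSupport κ → (∀ p, 0 ≤ κ p) →
      (∀ p, κ p ≤ 1) → ∫ x, ∫ y, κ (x, y) * ‖r x y‖ ∂n ∂m ≤ M) {ε : ℝ} (hε : 0 < ε) :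
    ∃ κ₀ : X × Y → ℝ, Continuous κ₀ ∧ HasCompactSupport κ₀ ∧ (∀ p, 0 ≤ κ₀ p) ∧ (∀ p, κ₀ p ≤ 1) ∧
      ∃ (K : Set X) (L : Set Y), IsCompact K ∧ IsCompact L ∧ ∀ ω : X × Y → ℂ, IsCc ω →
        (∀ p, ‖ω p‖ ≤ 1) → (∀ p ∈ K ×ˢ L, ‖ω p - 1‖ ≤ ε) →
          ∫ x, ∫ y, ‖ω (x, y) - κ₀ (x, y)‖ * ‖r x y‖ ∂n ∂m ≤ ε * (1 + M) := by
  set T : Set ℝ := {t | ∃ κ : X × Y → ℝ, Continuous κ ∧ HasCompactSupport κ ∧ (∀ p, 0 ≤ κ p) ∧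
    (∀ p, κ p ≤ 1) ∧ t = ∫ x, ∫ y, κ (x, y) * ‖r x y‖ ∂n ∂m} with hT
  have hbdd : BddAbove T := ⟨M, by rintro _ ⟨κ, h1, h2, h3, h4, rfl⟩; exact hM κ h1 h2 h3 h4⟩
  have hne : T.Nonempty := ⟨_, fun _ => 0, continuous_const, HasCompactSupport.zero,
    fun _ => le_rfl, fun _ => zero_le_one, rfl⟩
  obtain ⟨_, ⟨κ₀, a1, a2, a3, a4, rfl⟩, hκ₀⟩ := exists_lt_of_lt_csSup hne (sub_lt_self (sSup T) hε)
  obtain ⟨K, L, hK, hL, hKL⟩ := exists_compact_prod_of_hasCompactSupport a2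
  refine ⟨κ₀, a1, a2, a3, a4, K, L, hK, hL, fun ω hω hω1 hωK => ?_⟩
  obtain ⟨K', L', hK', hL', hKL'⟩ := exists_compact_prod_of_hasCompactSupport hω.2
  obtain ⟨κ₁, b1, b2, b3, b4, b5⟩ := exists_cutoff ((hK.prod hL).union (hK'.prod hL'))
  obtain ⟨K₁, L₁, hK₁, hL₁, hKL₁⟩ := exists_compact_prod_of_hasCompactSupport b2
  have c1 : ∀ x y, ‖ω (x, y) - κ₀ (x, y)‖ ≤ (1 + ε) * κ₁ (x, y) - κ₀ (x, y) := by
    intro x y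
    by_cases h1 : (x, y) ∈ K ×ˢ L
    · rw [b5 _ (Or.inl h1)]
      have e1 : ω (x, y) - κ₀ (x, y) = (ω (x, y) - 1) + ((1 - κ₀ (x, y) : ℝ) : ℂ) := by
        push_cast
        ring
      rw [e1]
      refine (norm_add_le _ _).trans ?_
      rw [Complex.norm_real, Real.norm_eq_abs, abs_of_nonneg (by linarith [a4 (x, y)])]
      linarith [hωK _ h1]
    · have h2 : κ₀ (x, y) = 0 := by_contra fun h0 => h1 (hKL x y h0)
      rw [h2, Complex.ofReal_zero, sub_zero, sub_zero]
      by_cases h3 : (x, y) ∈ K' ×ˢ L'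
      · rw [b5 _ (Or.inr h3)]
        linarith [hω1 (x, y)]
      · rw [show ω (x, y) = 0 from by_contra fun h0 => h3 (hKL' x y h0), norm_zero]
        have := b3 (x, y)
        positivity
  have hrn : Continuous fun p : X × Y => ‖r p.1 p.2‖ := hr.norm
  have c2 : ∫ x, ∫ y, ‖ω (x, y) - κ₀ (x, y)‖ * ‖r x y‖ ∂n ∂m ≤
      ∫ x, ∫ y, ((1 + ε) * (κ₁ (x, y) * ‖r x y‖) - κ₀ (x, y) * ‖r x y‖) ∂n ∂m := by
    refine (Real.le_norm_self _).trans (norm_integral_integral_le_of_le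
      (g := fun x y => (1 + ε) * (κ₁ (x, y) * ‖r x y‖) - κ₀ (x, y) * ‖r x y‖) (by fun_prop)
      (hK₁.union hK) (hL₁.union hL) (fun x y hxy => ?_) fun x y => ?_)
    · by_cases h0 : κ₀ (x, y) = 0
      · rw [h0, zero_mul, sub_zero] at hxy
        have := hKL₁ x y (left_ne_zero_of_mul (right_ne_zero_of_mul hxy))
        exact ⟨Or.inl this.1, Or.inl this.2⟩
      · exact ⟨Or.inr (hKL x y h0).1, Or.inr (hKL x y h0).2⟩
    · rw [Real.norm_eq_abs, abs_of_nonneg (by positivity)]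
      have := mul_le_mul_of_nonneg_right (c1 x y) (norm_nonneg (r x y))
      linarith
  refine c2.trans ?_
  rw [integral_integral_sub_of_ne (f := fun x y => (1 + ε) * (κ₁ (x, y) * ‖r x y‖))
    (g := fun x y => κ₀ (x, y) * ‖r x y‖) (by fun_prop) (by fun_prop)
    (hK₁.union hK) (hL₁.union hL)
    (fun x y hxy => by
      have := hKL₁ x y (left_ne_zero_of_mul (right_ne_zero_of_mul hxy))
      exact ⟨Or.inl this.1, Or.inl this.2⟩)
    (fun x y hxy => by
      have := hKL x y (left_ne_zero_of_mul hxy)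
      exact ⟨Or.inr this.1, Or.inr this.2⟩)]
  simp only [integral_const_mul]
  have d1 := hM κ₁ b1 b2 b3 b4
  have d2 : ∫ x, ∫ y, κ₁ (x, y) * ‖r x y‖ ∂n ∂m ≤ sSup T := le_csSup hbdd ⟨κ₁, b1, b2, b3, b4, rfl⟩
  nlinarith

end Tails

theorem exists_compact_tail {f : A → ℂ} (hf : Integrable f μ) {ε : ℝ} (hε : 0 < ε) :
    ∃ K : Set A, IsCompact K ∧ ∀ κ : A → ℝ, (∀ x, 0 ≤ κ x) → (∀ x, κ x ≤ 1) →
      (∀ x ∈ K, κ x = 1) → ∫ x, (1 - κ x) * ‖f x‖ ∂μ ≤ ε := by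
  obtain ⟨g, hgc, hg⟩ := exists_isCc_integral_sub_le hf hε
  have hgi : Integrable g μ := hgc.integrable
  obtain ⟨K, hK, hKg⟩ := exists_compact_of_hasCompactSupport hgc.2
  refine ⟨K, hK, fun κ k2 k3 k4 => ?_⟩
  refine le_trans (integral_mono_of_nonneg (Eventually.of_forall fun x =>
    mul_nonneg (by linarith [k3 x]) (norm_nonneg _)) (hf.sub hgi).norm
    (Eventually.of_forall fun x => ?_)) hg
  by_cases hx : x ∈ K
  · simp only [k4 x hx, sub_self, zero_mul]
    exact norm_nonneg _
  · simp only [Pi.sub_apply]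
    rw [show g x = 0 from by_contra fun h0 => hx (hKg x h0), sub_zero]
    exact mul_le_of_le_one_left (norm_nonneg _) (by linarith [k2 x])

theorem eq_of_integral_mul_eq {f g : A → ℂ} (hf : Continuous f) (hg : Continuous g)
    (h : ∀ k : A → ℂ, IsCc k → ∫ x, f x * k x ∂μ = ∫ x, g x * k x ∂μ) : f = g := by
  funext x
  by_contra hne
  obtain ⟨κ, k1, k2, k3, -, k5⟩ := exists_cutoff (isCompact_singleton (x := x))
  have hk : IsCc fun y => (starRingEnd ℂ) (f y - g y) * (κ y : ℂ) :=
    (IsCc.ofReal k1 k2).mul_left (Complex.continuous_conj.comp (hf.sub hg))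
  have h1 := h _ hk
  have i1 : Integrable (fun y => f y * ((starRingEnd ℂ) (f y - g y) * (κ y : ℂ))) μ :=
    (hk.mul_left hf).integrable
  have i2 : Integrable (fun y => g y * ((starRingEnd ℂ) (f y - g y) * (κ y : ℂ))) μ :=
    (hk.mul_left hg).integrable
  rw [← sub_eq_zero, ← integral_sub i1 i2] at h1
  have h2 : ∫ y, ‖f y - g y‖ ^ 2 * κ y ∂μ = 0 := by
    rw [← Complex.ofReal_eq_zero, ← integral_complex_ofReal, ← h1]
    congr 1
    funext y
    rw [← sub_mul, ← mul_assoc, Complex.mul_conj']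
    push_cast
    rfl
  have h3 : 0 < ∫ y, ‖f y - g y‖ ^ 2 * κ y ∂μ := by
    refine Continuous.integral_pos_of_hasCompactSupport_nonneg_nonzero (x := x) (by fun_prop)
      k2.mul_left (fun y => mul_nonneg (by positivity) (k3 y)) ?_
    rw [k5 x rfl, mul_one]
    exact pow_ne_zero 2 (norm_ne_zero_iff.2 (sub_ne_zero.2 hne))
  exact h3.ne' h2

/-- Both sides are continuous and agree weakly by `integral_mul_eq_of_integrable_fourierInv`. -/
theorem fourier_fourierInv (hμ : IsSelfDualMeasure G μ) {P : A → ℂ} (hPc : Continuous P)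
    (hP : Integrable P μ) (hPi : Integrable (fourierInv G μ P) μ) :
    fourier G μ (fourierInv G μ P) = P := by
  refine eq_of_integral_mul_eq (μ := μ) (continuous_fourier_of_integrable hPi) hPc fun k hk => ?_
  rw [integral_mul_eq_of_integrable_fourierInv hμ hP hPi hk,
    integral_fourier_mul_of_integrable hPi hk]

end Fourier

section Fourier

variable {A : Type*} [AddCommGroup A] [TopologicalSpace A] [IsTopologicalAddGroup A]
  [LocallyCompactSpace A] [T2Space A] [MeasurableSpace A] [BorelSpace A]
  {G : GaussianExponential A} {χ : Bicharacter A} {μ : Measure A} [μ.IsAddHaarMeasure] [μ.Regular]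
  {B : AddSubgroup A} {ν : Measure B} [ν.IsAddHaarMeasure] [ν.Regular]

/-! ### Wave packets -/

variable (G) in
/-- The function `y ↦ ⟨y;η⟩ q(y) h(y-s)`. -/
def wavePacket (q : A → ℂ) (h : A → ℝ) (s η y : A) : ℂ :=
  (G.kernel y η : ℂ) * (q y * (h (y - s) : ℂ))

theorem isCc_wavePacket {q : A → ℂ} (hq : Continuous q) {h : A → ℝ} (hc : Continuous h)
    (hs : HasCompactSupport h) (s η : A) : IsCc (wavePacket G q h s η) :=
  (isCc_localize hq hc hs s).mul_left (by fun_prop)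

theorem continuous_wavePacket {q : A → ℂ} (hq : Continuous q) {h : A → ℝ} (hc : Continuous h)
    (hs : HasCompactSupport h) :
    Continuous fun p : A × A => (isCc_wavePacket (G := G) hq hc hs p.1 p.2).toL2 μ := by
  obtain ⟨L, hL, hLh⟩ := exists_compact_of_hasCompactSupport hs
  refine continuous_toL2 (g := fun p : A × A => wavePacket G q h p.1 p.2)
    (by unfold wavePacket; fun_prop) (fun p => isCc_wavePacket hq hc hs p.1 p.2) fun p₀ => ?_
  obtain ⟨U, hU, hUs⟩ := exists_compact_mem_nhds p₀.1
  refine ⟨Prod.fst ⁻¹' U, continuous_fst.continuousAt.preimage_mem_nhds hUs, L + U, hL.add hU,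
    fun p hp y hy => ⟨y - p.1, hLh _ fun h0 => ?_, p.1, hp, by simp⟩⟩
  exact right_ne_zero_of_mul (right_ne_zero_of_mul hy) (by rw [h0, Complex.ofReal_zero])

theorem norm_wavePacket {q : A → ℂ} (hq : Continuous q) {h : A → ℝ} (hc : Continuous h)
    (hs : HasCompactSupport h) (s η : A) :
    ‖(isCc_wavePacket (G := G) hq hc hs s η).toL2 μ‖ = ‖(isCc_localize hq hc hs s).toL2 μ‖ := by
  rw [← sq_eq_sq₀ (norm_nonneg _) (norm_nonneg _), norm_toL2_sq, norm_toL2_sq]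
  congr 1
  funext y
  rw [wavePacket, norm_mul (G.kernel y η : ℂ), Circle.norm_coe, one_mul]

theorem norm_wavePacket_one {h : A → ℝ} (hc : Continuous h) (hs : HasCompactSupport h) (s η : A) :
    ‖(isCc_wavePacket (G := G) (q := fun _ => 1) continuous_const hc hs s η).toL2 μ‖ =
      ‖(IsCc.ofReal hc hs).toL2 μ‖ := by
  rw [norm_wavePacket continuous_const hc hs, ← sq_eq_sq₀ (norm_nonneg _) (norm_nonneg _), norm_toL2_sq, norm_toL2_sq]
  simp only [one_mul]
  exact integral_sub_right_eq_self (fun y => ‖(h y : ℂ)‖ ^ 2) s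

variable (A) in
/-- A continuous function `q` and two continuous windows with compact support. -/
structure PacketData where
  /-- the function to be localized -/
  q : A → ℂ
  /-- the window on the right -/
  h₁ : A → ℝ
  /-- the window on the left -/
  h₂ : A → ℝ
  cq : Continuous q
  c₁ : Continuous h₁
  s₁ : HasCompactSupport h₁
  c₂ : Continuous h₂
  s₂ : HasCompactSupport h₂

namespace PacketData

variable (d : PacketData A)

variable (μ) in
/-- The overlap `∫ h₁(t) h₂(t-x) dt` of the windows. -/
def overlap (x : A) : ℝ := ∫ t, d.h₁ t * d.h₂ (t - x) ∂μ

variable (G μ) in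
/-- The packet `y ↦ ⟨y;η⟩ q(y) h₁(y-s)`. -/
def right (s η : A) : Lp ℂ 2 μ := (isCc_wavePacket (G := G) d.cq d.c₁ d.s₁ s η).toL2 μ

variable (G μ) in
/-- The packet `y ↦ ⟨y;η⟩ h₂(y-s)`. -/
def left (s η : A) : Lp ℂ 2 μ :=
  (isCc_wavePacket (G := G) (q := fun _ => 1) continuous_const d.c₂ d.s₂ s η).toL2 μ

variable (G) in
/-- The matrix element of `S` between two packets. -/
def pairing (S : Lp ℂ 2 μ →L[ℂ] Lp ℂ 2 μ) (a η s : A) : ℂ :=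
  inner ℂ (d.left G μ (s - a) η) (S (d.right G μ s η))

theorem continuous_right {X : Type*} [TopologicalSpace X] {f g : X → A} (hf : Continuous f)
    (hg : Continuous g) : Continuous fun x => d.right G μ (f x) (g x) := by
  have h1 : Continuous fun p : A × A => d.right G μ p.1 p.2 := by
    unfold right
    exact continuous_wavePacket (G := G) (μ := μ) d.cq d.c₁ d.s₁
  have h2 := h1.comp (hf.prodMk hg)
  exact h2

theorem continuous_left {X : Type*} [TopologicalSpace X] {f g : X → A} (hf : Continuous f)
    (hg : Continuous g) : Continuous fun x => d.left G μ (f x) (g x) := by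
  have h1 : Continuous fun p : A × A => d.left G μ p.1 p.2 := by
    unfold left
    exact continuous_wavePacket (G := G) (μ := μ) continuous_const d.c₂ d.s₂
  have h2 := h1.comp (hf.prodMk hg)
  exact h2

theorem continuous_overlap : Continuous (d.overlap μ) := by
  obtain ⟨L₁, hL₁, hLh₁⟩ := exists_compact_of_hasCompactSupport d.s₁
  have c1 := d.c₁
  have c2 := d.c₂
  exact continuous_integral_of_ne (f := fun x t => d.h₁ t * d.h₂ (t - x)) (by fun_prop) hL₁
    fun x t ht => hLh₁ _ (left_ne_zero_of_mul ht)

variable (G) in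
theorem continuous_pairing (S : Lp ℂ 2 μ →L[ℂ] Lp ℂ 2 μ) {X : Type*} [TopologicalSpace X]
    {f g k : X → A} (hf : Continuous f) (hg : Continuous g) (hk : Continuous k) :
    Continuous fun x => d.pairing G S (f x) (g x) (k x) :=
  (d.continuous_left (hk.sub hf) hg).inner (S.continuous.comp (d.continuous_right hk hg))

theorem norm_left (s η : A) : ‖d.left G μ s η‖ = ‖(IsCc.ofReal d.c₂ d.s₂).toL2 μ‖ :=
  norm_wavePacket_one d.c₂ d.s₂ s η

theorem norm_right (s η : A) :
    ‖d.right G μ s η‖ = ‖(isCc_localize d.cq d.c₁ d.s₁ s).toL2 μ‖ :=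
  norm_wavePacket d.cq d.c₁ d.s₁ s η

theorem norm_pairing_le {S : Lp ℂ 2 μ →L[ℂ] Lp ℂ 2 μ} {M : ℝ} (hS : ∀ v, ‖S v‖ ≤ M * ‖v‖)
    (a η s : A) : ‖d.pairing G S a η s‖ ≤
      M * ‖(IsCc.ofReal d.c₂ d.s₂).toL2 μ‖ * ‖(isCc_localize d.cq d.c₁ d.s₁ s).toL2 μ‖ := by
  refine (norm_inner_le_norm _ _).trans ?_
  rw [norm_left, ← d.norm_right (G := G) s η]
  have := mul_le_mul_of_nonneg_left (hS (d.right G μ s η))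
    (norm_nonneg ((IsCc.ofReal d.c₂ d.s₂).toL2 μ))
  linarith

/-- Both packets have the frequency `η`, so that only the character `⟨x;η⟩` of the translation
survives. The left packet is centred at `s - a`; the windows are therefore compared at the offset `x
- a`. -/
theorem pairing_eq {S : Lp ℂ 2 μ →L[ℂ] Lp ℂ 2 μ} {E : A → A → ℂ} (hS : HasSymbol G μ S E)
    (a η s : A) : d.pairing G S a η s = ∫ x, ∫ u, E x u * ((G.kernel x η : ℂ) *
      ∫ w, (G.kernel u w : ℂ) * d.q w * ((d.h₁ (w - s) * d.h₂ (w - s - (x - a)) : ℝ) : ℂ) ∂μ)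
        ∂μ ∂μ := by
  rw [pairing, left, right, hS]
  congr 1
  funext x
  congr 1
  funext u
  congr 1
  rw [← integral_sub_right_eq_self _ x, ← integral_const_mul]
  congr 1
  funext w
  have key : (G.kernel (w - x) η)⁻¹ * G.kernel w η = G.kernel x η := by
    rw [G.kernel_sub_left]
    apply Additive.ofMul.injective
    simp only [ofMul_mul, ofMul_div, ofMul_inv]
    abel
  have key' := congrArg (fun z : Circle => (z : ℂ)) key
  beta_reduce at key'
  rw [Circle.coe_mul, Circle.coe_inv_eq_conj] at key'
  simp only [wavePacket, map_mul, Complex.conj_ofReal, one_mul]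
  rw [sub_add_cancel, show w - x - (s - a) = w - s - (x - a) by abel]
  push_cast
  linear_combination (d.h₂ (w - s - (x - a)) : ℂ) * (G.kernel u w : ℂ) * d.q w *
    (d.h₁ (w - s) : ℂ) * key'

theorem integral_cutoff_mul_pairing {S : Lp ℂ 2 μ →L[ℂ] Lp ℂ 2 μ} {E : A → A → ℂ}
    (hS : HasSymbol G μ S E) (hE : IsCc fun p : A × A => E p.1 p.2) {κ : A → ℝ}
    (hκ : Continuous κ) (hκc : HasCompactSupport κ) (a η : A) :
    ∫ s, (κ s : ℂ) * d.pairing G S a η s ∂μ = ∫ x, ∫ u, E x u * ((G.kernel x η : ℂ) *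
      ∫ w, (G.kernel u w : ℂ) * d.q w *
        ((∫ s, κ s * (d.h₁ (w - s) * d.h₂ (w - s - (x - a))) ∂μ : ℝ) : ℂ) ∂μ) ∂μ ∂μ := by
  obtain ⟨K, L, hK, hL, hKL⟩ := exists_compact_prod_of_hasCompactSupport hE.2
  obtain ⟨M, hM, hMκ⟩ := exists_compact_of_hasCompactSupport hκc
  obtain ⟨L₁, hL₁, hLh₁⟩ := exists_compact_of_hasCompactSupport d.s₁
  have cE := hE.1
  have c1 := d.c₁
  have c2 := d.c₂
  have cq := d.cq
  have hsupp : ∀ s w (z : ℂ) t, z * ((κ s * (d.h₁ (w - s) * t) : ℝ) : ℂ) ≠ 0 →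
      w ∈ L₁ + M ∧ s ∈ M := by
    intro s w z t hne
    have h1 : κ s * (d.h₁ (w - s) * t) ≠ 0 := fun h0 =>
      right_ne_zero_of_mul hne (by rw [h0, Complex.ofReal_zero])
    have h2 := hMκ _ (left_ne_zero_of_mul h1)
    exact ⟨⟨w - s, hLh₁ _ (left_ne_zero_of_mul (right_ne_zero_of_mul h1)), s, h2, by simp⟩, h2⟩
  have hrot := integral_rotate_of_ne (μX := μ) (μY := μ) (μZ := μ)
    (f := fun x u s => E x u * ((G.kernel x η : ℂ) * ∫ w, (G.kernel u w : ℂ) * d.q w *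
      ((κ s * (d.h₁ (w - s) * d.h₂ (w - s - (x - a))) : ℝ) : ℂ) ∂μ))
    (Continuous.mul (by fun_prop) (Continuous.mul (by fun_prop) (continuous_integral_of_ne
      (f := fun (p : A × A × A) w => (G.kernel p.2.1 w : ℂ) * d.q w *
        ((κ p.2.2 * (d.h₁ (w - p.2.2) * d.h₂ (w - p.2.2 - (p.1 - a))) : ℝ) : ℂ))
      (by fun_prop) (hL₁.add hM) fun p w hne => (hsupp _ _ _ _ hne).1))) hK hL hM
    (fun x u s hne => by
      have h1 := hKL x u (left_ne_zero_of_mul hne)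
      obtain ⟨w, hw⟩ := exists_of_integral_ne_zero
        (right_ne_zero_of_mul (right_ne_zero_of_mul hne))
      exact ⟨h1.1, h1.2, (hsupp _ _ _ _ hw).2⟩)
  calc _ = ∫ s, ∫ x, ∫ u, E x u * ((G.kernel x η : ℂ) * ∫ w, (G.kernel u w : ℂ) * d.q w *
        ((κ s * (d.h₁ (w - s) * d.h₂ (w - s - (x - a))) : ℝ) : ℂ) ∂μ) ∂μ ∂μ ∂μ := by
        congr 1
        funext s
        rw [d.pairing_eq hS]
        simp only [← integral_const_mul]
        congr 1
        funext x
        congr 1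
        funext u
        congr 1
        funext w
        push_cast
        ring
    _ = _ := by
        rw [← hrot]
        congr 1
        funext x
        congr 1
        funext u
        rw [integral_const_mul, integral_const_mul]
        congr 2
        have hsw := integral_swap_of_ne (μ := μ) (ν := μ)
          (f := fun s w => (G.kernel u w : ℂ) * d.q w *
            ((κ s * (d.h₁ (w - s) * d.h₂ (w - s - (x - a))) : ℝ) : ℂ)) (by fun_prop) hM
          (hL₁.add hM) (fun s w hne => (hsupp _ _ _ _ hne).symm)
        rw [hsw]
        congr 1
        funext w
        rw [integral_const_mul, integral_complex_ofReal]

variable (μ) in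
-- With `κ = 1` the integral over `s` would be the overlap, for every `w`, and the integral over `w`
-- the transform of `q`. Where `κ' w ≠ 0`, the cutoff `κ` equals `1` on every `s` seen by the
-- window, so the error comes from the part `(1-κ')q`.
theorem norm_integral_localized_sub_le (hq : Integrable d.q μ) (h₁0 : ∀ x, 0 ≤ d.h₁ x) {b : ℝ}
    (hb : ∀ x, |d.h₂ x| ≤ b) {κ κ' : A → ℝ} (hκ : Continuous κ) (hκ0 : ∀ x, 0 ≤ κ x)
    (hκ1 : ∀ x, κ x ≤ 1) (hκ'0 : ∀ x, 0 ≤ κ' x) (hκ'1 : ∀ x, κ' x ≤ 1)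
    (hκ' : Continuous κ') (hκκ' : ∀ w s, κ' w ≠ 0 → d.h₁ (w - s) ≠ 0 → κ s = 1) (u z : A) :
    ‖(∫ w, (G.kernel u w : ℂ) * d.q w *
        ((∫ s, κ s * (d.h₁ (w - s) * d.h₂ (w - s - z)) ∂μ : ℝ) : ℂ) ∂μ) -
      fourier G μ d.q u * (d.overlap μ z : ℂ)‖ ≤
      (∫ t, d.h₁ t ∂μ) * b * ∫ w, (1 - κ' w) * ‖d.q w‖ ∂μ := by
  obtain ⟨L₁, hL₁, hLh₁⟩ := exists_compact_of_hasCompactSupport d.s₁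
  have c1 := d.c₁
  have c2 := d.c₂
  have hb0 : 0 ≤ b := (abs_nonneg _).trans (hb 0)
  have hi1 : ∀ w, Integrable (fun s => d.h₁ (w - s)) μ := fun w =>
    (d.c₁.comp (by fun_prop : Continuous fun s => w - s)).integrable_of_hasCompactSupport
      (d.s₁.comp_homeomorph (Homeomorph.subLeft w))
  have hI1 : ∀ w, ∫ s, d.h₁ (w - s) ∂μ = ∫ t, d.h₁ t ∂μ := fun w =>
    integral_sub_left_eq_self d.h₁ μ w
  have hov : ∀ w, d.overlap μ z = ∫ s, d.h₁ (w - s) * d.h₂ (w - s - z) ∂μ := fun w =>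
    (integral_sub_left_eq_self (fun t => d.h₁ t * d.h₂ (t - z)) μ w).symm
  have hint : ∀ (m : A → ℝ), Continuous m → ∀ w,
      Integrable (fun s => m s * (d.h₁ (w - s) * d.h₂ (w - s - z))) μ := fun m hm w =>
    integrable_of_ne (by fun_prop) (isCompact_sub (isCompact_singleton (x := w)) hL₁)
      fun s hs => ⟨w, rfl, w - s, hLh₁ _ (left_ne_zero_of_mul (right_ne_zero_of_mul hs)), by simp⟩
  have hpt : ∀ (m : A → ℝ) w s, |m s| ≤ 1 →
      ‖m s * (d.h₁ (w - s) * d.h₂ (w - s - z))‖ ≤ d.h₁ (w - s) * b := by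
    intro m w s hm
    rw [Real.norm_eq_abs, abs_mul, abs_mul, abs_of_nonneg (h₁0 _)]
    calc _ ≤ 1 * (d.h₁ (w - s) * b) := mul_le_mul hm
          (mul_le_mul_of_nonneg_left (hb _) (h₁0 _)) (mul_nonneg (h₁0 _) (abs_nonneg _)) zero_le_one
      _ = _ := one_mul _
  have hle : ∀ (m : A → ℝ), (∀ s, |m s| ≤ 1) → ∀ w,
      ‖∫ s, m s * (d.h₁ (w - s) * d.h₂ (w - s - z)) ∂μ‖ ≤ (∫ t, d.h₁ t ∂μ) * b := by
    intro m hm w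
    rw [← hI1 w, ← integral_mul_const]
    exact norm_integral_le_of_norm_le ((hi1 w).mul_const b)
      (Eventually.of_forall fun s => hpt m w s (hm s))
  have hκabs : ∀ s, |κ s| ≤ 1 := fun s => by rw [abs_of_nonneg (hκ0 s)]; exact hκ1 s
  have hΘc : Continuous fun w => ∫ s, κ s * (d.h₁ (w - s) * d.h₂ (w - s - z)) ∂μ :=
    continuous_integral_of_compact (by fun_prop) fun K hK => ⟨K - L₁, isCompact_sub hK hL₁,
      fun w hw s hs => ⟨w, hw, w - s,
        hLh₁ _ (left_ne_zero_of_mul (right_ne_zero_of_mul hs)), by simp⟩⟩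
  have i1 : Integrable (fun w => (G.kernel u w : ℂ) * d.q w) μ := integrable_kernel_mul hq u
  have i2 : Integrable (fun w => (G.kernel u w : ℂ) * d.q w *
      ((∫ s, κ s * (d.h₁ (w - s) * d.h₂ (w - s - z)) ∂μ : ℝ) : ℂ)) μ :=
    i1.mul_bdd (c := (∫ t, d.h₁ t ∂μ) * b)
      (Complex.continuous_ofReal.comp hΘc).measurable.aestronglyMeasurable
      (Eventually.of_forall fun w => by
        rw [Complex.norm_real]
        exact hle κ hκabs w)
  rw [fourier, ← integral_mul_const, ← integral_sub i2 (i1.mul_const _), ← integral_const_mul]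
  refine norm_integral_le_of_norm_le ?_ (Eventually.of_forall fun w => ?_)
  · refine Integrable.const_mul ?_ _
    exact hq.norm.bdd_mul (c := 1) (by fun_prop : Continuous fun w => 1 - κ' w).measurable.aestronglyMeasurable
      (Eventually.of_forall fun w => by
        rw [Real.norm_eq_abs, abs_le]
        exact ⟨by linarith [hκ'1 w], by linarith [hκ'0 w]⟩)
  · have e1 : (∫ s, κ s * (d.h₁ (w - s) * d.h₂ (w - s - z)) ∂μ) - d.overlap μ z =
        ∫ s, (κ s - 1) * (d.h₁ (w - s) * d.h₂ (w - s - z)) ∂μ := by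
      rw [hov w, ← integral_sub (hint κ hκ w) (by simpa using hint (fun _ => 1) continuous_const w)]
      congr 1
      funext s
      ring
    rw [← mul_sub, ← Complex.ofReal_sub, e1, norm_mul, norm_mul, Circle.norm_coe, one_mul,
      Complex.norm_real]
    by_cases h0 : κ' w = 0
    · rw [h0, sub_zero, one_mul, mul_comm ‖d.q w‖]
      refine mul_le_mul_of_nonneg_right (hle (fun s => κ s - 1) (fun s => ?_) w) (norm_nonneg _)
      rw [abs_le]
      exact ⟨by linarith [hκ0 s], by linarith [hκ1 s]⟩
    · have e2 : ∀ s, (κ s - 1) * (d.h₁ (w - s) * d.h₂ (w - s - z)) = 0 := by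
        intro s
        by_cases h1 : d.h₁ (w - s) = 0
        · rw [h1]
          ring
        · rw [hκκ' w s h0 h1]
          ring
      simp only [e2, integral_zero, norm_zero, mul_zero]
      exact mul_nonneg (mul_nonneg (integral_nonneg h₁0) hb0)
        (mul_nonneg (by linarith [hκ'1 w]) (norm_nonneg _))

/-- The cutoff `κ₀` depends only on the packets and on `ε`: integrability of the local norms of `q`
bounds the discarded part of the integral over `s` by the bound on `S`. This uniformity is what
allows a passage to the limit in `S`. -/
theorem exists_cutoff_pairing (hq : Integrable d.q μ) (h₁0 : ∀ x, 0 ≤ d.h₁ x) {M : ℝ}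
    (hN : ∀ κ : A → ℝ, Continuous κ → HasCompactSupport κ → (∀ s, 0 ≤ κ s) →
      (∀ s, κ s ≤ 1) → ∫ s, κ s * ‖(isCc_localize d.cq d.c₁ d.s₁ s).toL2 μ‖ ∂μ ≤ M)
    {ε : ℝ} (hε : 0 < ε) :
    ∃ κ₀ : A → ℝ, Continuous κ₀ ∧ HasCompactSupport κ₀ ∧ (∀ s, 0 ≤ κ₀ s) ∧ (∀ s, κ₀ s ≤ 1) ∧
      ∀ (S : Lp ℂ 2 μ →L[ℂ] Lp ℂ 2 μ) (E : A → A → ℂ) (M₀ : ℝ), HasSymbol G μ S E →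
        IsCc (fun p : A × A => E p.1 p.2) → 0 ≤ M₀ → (∀ v, ‖S v‖ ≤ M₀ * ‖v‖) → ∀ a η,
          ‖(∫ s, (κ₀ s : ℂ) * d.pairing G S a η s ∂μ) - ∫ x, ∫ u, E x u * ((G.kernel x η : ℂ) *
            (fourier G μ d.q u * (d.overlap μ (x - a) : ℂ))) ∂μ ∂μ‖ ≤ ε * M₀ := by
  set N : A → ℝ := fun s => ‖(isCc_localize d.cq d.c₁ d.s₁ s).toL2 μ‖ with hNdef
  have hNc : Continuous N := continuous_norm_localize d.cq d.c₁ d.s₁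
  have hNi : Integrable (fun s => (N s : ℂ)) μ := by
    refine (integrable_of_cutoff (μ := μ) (f := fun s => (N s : ℂ)) (M := M) (by fun_prop)
      fun κ k1 k2 k3 k4 => ?_).1
    simp only [Complex.norm_real, hNdef, norm_norm]
    exact hN κ k1 k2 k3 k4
  set H : ℝ := ‖(IsCc.ofReal d.c₂ d.s₂).toL2 μ‖ with hH
  have hH0 : 0 ≤ H := norm_nonneg _
  obtain ⟨KN, hKN, htail⟩ := exists_compact_tail hNi (ε := ε / (H + 1)) (by positivity)
  obtain ⟨κ₀, a1, a2, a3, a4, a5⟩ := exists_cutoff hKN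
  refine ⟨κ₀, a1, a2, a3, a4, fun S E M₀ hS hE hM₀ hSM a η => ?_⟩
  refine le_of_forall_pos_le_add fun δ hδ => ?_
  obtain ⟨L₁, hL₁, hLh₁⟩ := exists_compact_of_hasCompactSupport d.s₁
  obtain ⟨b, hb⟩ := d.c₂.bounded_above_of_compact_support d.s₂
  have hb0 : 0 ≤ b := (norm_nonneg _).trans (hb 0)
  obtain ⟨K, L, hK, hL, hKL⟩ := exists_compact_prod_of_hasCompactSupport hE.2
  set e : ℝ := ∫ x, ∫ u, ‖E x u‖ ∂μ ∂μ with he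
  have he0 : 0 ≤ e := integral_nonneg fun x => integral_nonneg fun u => norm_nonneg _
  have hh₁ : 0 ≤ ∫ t, d.h₁ t ∂μ := integral_nonneg h₁0
  set cst : ℝ := e * ((∫ t, d.h₁ t ∂μ) * b) with hcst
  have hcst0 : 0 ≤ cst := by positivity
  -- The further cutoffs `κ'` and `κ` may depend on `E`. They only identify the integral over all
  -- `s`, with an error `δ` that is sent to zero.
  obtain ⟨Kq, hKq, hqtail⟩ := exists_compact_tail hq (ε := δ / (cst + 1)) (by positivity)
  obtain ⟨κ', p1, p2, p3, p4, p5⟩ := exists_cutoff hKq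
  obtain ⟨K', hK', hKκ'⟩ := exists_compact_of_hasCompactSupport p2
  obtain ⟨K₀, hK₀, hKκ₀⟩ := exists_compact_of_hasCompactSupport a2
  obtain ⟨κ, b1, b2, b3, b4, b5⟩ := exists_cutoff (hK₀.union (isCompact_sub hK' hL₁))
  have cJ : Continuous fun s => d.pairing G S a η s :=
    d.continuous_pairing G S continuous_const continuous_const continuous_id
  have d1 : ‖(∫ s, (κ₀ s : ℂ) * d.pairing G S a η s ∂μ) -
      ∫ s, (κ s : ℂ) * d.pairing G S a η s ∂μ‖ ≤ ε * M₀ := by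
    have i1 : Integrable (fun s => (κ₀ s : ℂ) * d.pairing G S a η s) μ :=
      integrable_of_ne (by fun_prop) hK₀ fun s hs => hKκ₀ _ fun h0 =>
        left_ne_zero_of_mul hs (by rw [h0, Complex.ofReal_zero])
    have i2 : Integrable (fun s => (κ s : ℂ) * d.pairing G S a η s) μ := by
      obtain ⟨Kκ, hKκ, hKκ'⟩ := exists_compact_of_hasCompactSupport b2
      exact integrable_of_ne (by fun_prop) hKκ fun s hs => hKκ' _ fun h0 =>
        left_ne_zero_of_mul hs (by rw [h0, Complex.ofReal_zero])
    have i3 : Integrable (fun s => (1 - κ₀ s) * ‖(N s : ℂ)‖) μ :=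
      hNi.norm.bdd_mul (c := 1)
        (by fun_prop : Continuous fun w => 1 - κ₀ w).measurable.aestronglyMeasurable
        (Eventually.of_forall fun w => by
          rw [Real.norm_eq_abs, abs_le]
          exact ⟨by linarith [a4 w], by linarith [a3 w]⟩)
    rw [← integral_sub i1 i2]
    calc _ ≤ ∫ s, (M₀ * H) * ((1 - κ₀ s) * ‖(N s : ℂ)‖) ∂μ := by
          refine norm_integral_le_of_norm_le (i3.const_mul _) (Eventually.of_forall fun s => ?_)
          have h1 := d.norm_pairing_le (G := G) hSM a η s
          have h2 : |κ₀ s - κ s| ≤ 1 - κ₀ s := by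
            by_cases h0 : κ₀ s = 0
            · rw [h0, zero_sub, sub_zero, abs_neg, abs_of_nonneg (b3 s)]
              exact b4 s
            · rw [b5 s (Or.inl (hKκ₀ s h0)), abs_sub_comm, abs_of_nonneg (by linarith [a4 s])]
          rw [← sub_mul, ← Complex.ofReal_sub, norm_mul, Complex.norm_real, Real.norm_eq_abs,
            Complex.norm_real, Real.norm_eq_abs, abs_of_nonneg (norm_nonneg _ : 0 ≤ N s)]
          calc _ ≤ (1 - κ₀ s) * (M₀ * H * N s) :=
                mul_le_mul h2 h1 (norm_nonneg _) (by linarith [a4 s])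
            _ = _ := by ring
      _ = (M₀ * H) * ∫ s, (1 - κ₀ s) * ‖(N s : ℂ)‖ ∂μ := integral_const_mul _ _
      _ ≤ (M₀ * H) * (ε / (H + 1)) :=
          mul_le_mul_of_nonneg_left (htail κ₀ a3 a4 a5) (by positivity)
      _ ≤ ε * M₀ := by
          have : H * (ε / (H + 1)) ≤ ε := by
            rw [mul_div_assoc', div_le_iff₀ (by positivity)]
            nlinarith
          nlinarith
  have d2 : ‖(∫ s, (κ s : ℂ) * d.pairing G S a η s ∂μ) - ∫ x, ∫ u, E x u *
      ((G.kernel x η : ℂ) * (fourier G μ d.q u * (d.overlap μ (x - a) : ℂ))) ∂μ ∂μ‖ ≤ δ := by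
    obtain ⟨Kκ, hKκ, hκK⟩ := exists_compact_of_hasCompactSupport b2
    have cE := hE.1
    have c1 := d.c₁
    have c2 := d.c₂
    have cq := d.cq
    have cF := continuous_fourier_of_integrable (G := G) hq
    have cO := d.continuous_overlap (μ := μ)
    rw [d.integral_cutoff_mul_pairing hS hE b1 b2]
    have hΘc : Continuous fun p : (A × A) × A =>
        ∫ s, κ s * (d.h₁ (p.2 - s) * d.h₂ (p.2 - s - (p.1.1 - a))) ∂μ :=
      continuous_integral_of_ne (f := fun (p : (A × A) × A) s =>
        κ s * (d.h₁ (p.2 - s) * d.h₂ (p.2 - s - (p.1.1 - a)))) (by fun_prop) hKκ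
        fun p s hs => hκK _ (left_ne_zero_of_mul hs)
    have hwc : Continuous fun p : A × A => ∫ w, (G.kernel p.2 w : ℂ) * d.q w *
        ((∫ s, κ s * (d.h₁ (w - s) * d.h₂ (w - s - (p.1 - a))) ∂μ : ℝ) : ℂ) ∂μ := by
      refine continuous_integral_of_ne (f := fun (p : A × A) w => (G.kernel p.2 w : ℂ) * d.q w *
        ((∫ s, κ s * (d.h₁ (w - s) * d.h₂ (w - s - (p.1 - a))) ∂μ : ℝ) : ℂ))
        (Continuous.mul (by fun_prop) (Complex.continuous_ofReal.comp hΘc)) (hL₁.add hKκ)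
        fun p w hw => ?_
      obtain ⟨s, hs⟩ := exists_of_integral_ne_zero fun h0 : ∫ s, κ s * (d.h₁ (w - s) *
        d.h₂ (w - s - (p.1 - a))) ∂μ = 0 => right_ne_zero_of_mul hw (by rw [h0]; simp)
      exact ⟨w - s, hLh₁ _ (left_ne_zero_of_mul (right_ne_zero_of_mul hs)), s,
        hκK _ (left_ne_zero_of_mul hs), by simp⟩
    rw [← integral_integral_sub_of_ne
      (f := fun x u => E x u * ((G.kernel x η : ℂ) * ∫ w, (G.kernel u w : ℂ) * d.q w *
        ((∫ s, κ s * (d.h₁ (w - s) * d.h₂ (w - s - (x - a))) ∂μ : ℝ) : ℂ) ∂μ))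
      (g := fun x u => E x u *
        ((G.kernel x η : ℂ) * (fourier G μ d.q u * (d.overlap μ (x - a) : ℂ))))
      (cE.mul (Continuous.mul (by fun_prop) hwc)) (by fun_prop) hK hL
      (fun x u h => hKL x u (left_ne_zero_of_mul h)) (fun x u h => hKL x u (left_ne_zero_of_mul h))]
    have hκκ' : ∀ w s, κ' w ≠ 0 → d.h₁ (w - s) ≠ 0 → κ s = 1 := fun w s h1 h2 =>
      b5 s (Or.inr ⟨w, hKκ' w h1, w - s, hLh₁ _ h2, by simp⟩)
    set τ : ℝ := (∫ t, d.h₁ t ∂μ) * b * (δ / (cst + 1)) with hτ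
    calc _ ≤ ∫ x, ∫ u, ‖E x u‖ * τ ∂μ ∂μ := by
          refine norm_integral_integral_le_of_le (g := fun x u => ‖E x u‖ * τ) (by fun_prop) hK hL
            (fun x u h => hKL x u (norm_ne_zero_iff.1 (left_ne_zero_of_mul h))) fun x u => ?_
          rw [← mul_sub, ← mul_sub, norm_mul, norm_mul, Circle.norm_coe, one_mul]
          refine mul_le_mul_of_nonneg_left ?_ (norm_nonneg _)
          refine (d.norm_integral_localized_sub_le μ hq h₁0 hb b1 b3 b4 p3 p4 p1 hκκ' u
            (x - a)).trans ?_
          exact mul_le_mul_of_nonneg_left (hqtail κ' p3 p4 p5) (by positivity)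
      _ = cst * (δ / (cst + 1)) := by
          simp only [integral_mul_const]
          rw [hcst, hτ]
          ring
      _ ≤ δ := by
          rw [mul_div_assoc', div_le_iff₀ (by positivity)]
          nlinarith
  calc _ ≤ _ := norm_sub_le_norm_sub_add_norm_sub _ (∫ s, (κ s : ℂ) * d.pairing G S a η s ∂μ) _
    _ ≤ _ := add_le_add d1 d2

end PacketData

end Fourier

section Fourier

variable {A : Type*} [AddCommGroup A] [TopologicalSpace A] [IsTopologicalAddGroup A]
  [LocallyCompactSpace A] [T2Space A] [MeasurableSpace A] [BorelSpace A]
  {G : GaussianExponential A} {χ : Bicharacter A} {μ : Measure A} [μ.IsAddHaarMeasure] [μ.Regular]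
  {B : AddSubgroup A} {ν : Measure B} [ν.IsAddHaarMeasure] [ν.Regular]

/-! ### Resummation of the sections -/

theorem exists_phaseSection_bound (G : GaussianExponential A) (χ : Bicharacter A)
    {θ : A × A → ℂ} (hθ : IsCc θ) : ∃ M, ∀ a x, ‖phaseSection G χ μ θ a x‖ ≤ M := by
  obtain ⟨K, L, -, hL, hKL⟩ := exists_compact_prod_of_hasCompactSupport hθ.2
  obtain ⟨b, hb⟩ := hθ.1.bounded_above_of_compact_support hθ.2
  refine ⟨μ.real L * b, fun a x => norm_integral_le_of_ne hL (fun y hy =>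
    (hKL x y (left_ne_zero_of_mul (left_ne_zero_of_mul hy))).2) fun y => ?_⟩
  rw [norm_mul, norm_mul, Circle.norm_coe, Circle.norm_coe, mul_one, mul_one]
  exact hb _

/-- Fourier inversion for a single section, regularized by `ψ`. -/
theorem IsFejer.integral_mul_sectionTransform {V : Set A} {ε : ℝ} {ψ : A → ℂ} {D : A → ℝ}
    (h : IsFejer G μ V ε ψ D) {θ : A × A → ℂ} (hθ : IsCc θ) (a y : A) :
    ∫ η, ψ η * (sectionTransform G χ μ θ a η * (G.kernel y η : ℂ)) ∂μ =
      ∫ v, (D v : ℂ) * phaseSection G χ μ θ a (y - v) ∂μ := by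
  have hg : IsCc fun η => (G.kernel y η : ℂ) * ψ η := h.cc.mul_left (by fun_prop)
  have h1 := integral_sectionTransform_mul (G := G) (χ := χ) (μ := μ) hθ a hg
  calc _ = ∫ η, sectionTransform G χ μ θ a η * ((G.kernel y η : ℂ) * ψ η) ∂μ := by
        congr 1
        funext η
        ring
    _ = _ := by
        rw [h1, ← integral_sub_left_eq_self _ μ y]
        congr 1
        funext v
        rw [mul_comm, ← h.fourier_eq, fourierInv, fourier]
        congr 2
        funext η
        have key : G.kernel (y - v) (-η) * G.kernel y η = G.kernel v η := by
          rw [G.kernel_sub_left, G.kernel_neg_right, G.kernel_neg_right]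
          apply Additive.ofMul.injective
          simp only [ofMul_mul, ofMul_div, ofMul_inv]
          abel
        have key' := congrArg (fun z : Circle => (z : ℂ)) key
        push_cast at key'
        linear_combination ψ η * key'

variable (G χ μ) in
/-- The coefficient `⟨a⟩ ⟨-a;η+a⟩ r(a,η)`, where `r(a,·)` is the transform of a section. -/
def sectionCoeff (θ : A × A → ℂ) (a η : A) : ℂ :=
  sectionTransform G χ μ θ a η * ((G.toFun a : ℂ) * (G.kernel (-a) (η + a) : ℂ))

theorem norm_sectionCoeff (θ : A × A → ℂ) (a η : A) :
    ‖sectionCoeff G χ μ θ a η‖ = ‖sectionTransform G χ μ θ a η‖ := by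
  rw [sectionCoeff, norm_mul, norm_mul, Circle.norm_coe, Circle.norm_coe, mul_one, mul_one]

theorem continuous_sectionCoeff {θ : A × A → ℂ} (hθ : IsCc θ) {X : Type*} [TopologicalSpace X]
    {f g : X → A} (hf : Continuous f) (hg : Continuous g) :
    Continuous fun x => sectionCoeff G χ μ θ (f x) (g x) :=
  (continuous_sectionTransform hθ hf hg).mul (by fun_prop)

theorem PacketData.exists_overlap_bound (d : PacketData A) : ∃ b, 0 ≤ b ∧ ∀ x,
    |d.overlap μ x| ≤ b := by
  obtain ⟨L, hL, hLh⟩ := exists_compact_of_hasCompactSupport d.s₁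
  obtain ⟨b₁, hb₁⟩ := d.c₁.bounded_above_of_compact_support d.s₁
  obtain ⟨b₂, hb₂⟩ := d.c₂.bounded_above_of_compact_support d.s₂
  have h0 : 0 ≤ b₁ := (norm_nonneg _).trans (hb₁ 0)
  have h0' : 0 ≤ b₂ := (norm_nonneg _).trans (hb₂ 0)
  refine ⟨μ.real L * (b₁ * b₂), by positivity, fun x => norm_integral_le_of_ne hL
    (fun t ht => hLh _ (left_ne_zero_of_mul ht)) fun t => ?_⟩
  rw [norm_mul]
  exact mul_le_mul (hb₁ _) (hb₂ _) (norm_nonneg _) h0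

/-- The coefficients are made so that `∫_B ∫ sectionCoeff(a,η) ⟨x;η+a⟩ dη da` is formally the
expansion of `P(x)` from `phaseTranspose_eq`, with each section written by Fourier inversion. The
weight `ω = κ ⊗ ψ` makes this legitimate: the integral over `η` returns averages of the sections,
uniformly close to the sections, and the overlap equals `1` where a section does not vanish. -/
theorem PacketData.exists_weight (hμ : IsSelfDualMeasure G μ) (hB : IsClosed (B : Set A))
    (d : PacketData A) {θ : A × A → ℂ} (hθ : IsCc θ)
    (hd : ∀ a x, phaseSection G χ μ θ a x ≠ 0 → d.overlap μ x = 1) {e : A → ℂ} (he : IsCc e)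
    {K₀ : Set B} {L₀ : Set A} (hK₀ : IsCompact K₀) (hL₀ : IsCompact L₀) {ε δ : ℝ} (hε : 0 < ε)
    (hδ : 0 < δ) : ∃ ω : B × A → ℂ, IsCc ω ∧ (∀ p, ‖ω p‖ ≤ 1) ∧
      (∀ p ∈ K₀ ×ˢ L₀, ‖ω p - 1‖ ≤ ε) ∧
      ‖(∫ a : B, ∫ η, ω (a, η) * (sectionCoeff G χ μ θ a η * ∫ x, e x *
        ((G.kernel x (η + a) : ℂ) * (d.overlap μ (x - a) : ℂ)) ∂μ) ∂μ ∂ν) -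
        ∫ x, e x * phaseTranspose G χ μ ν θ x ∂μ‖ ≤ δ := by
  have : LocallyCompactSpace B := hB.isClosedEmbedding_subtypeVal.locallyCompactSpace
  obtain ⟨X, hX, hXe⟩ := exists_compact_of_hasCompactSupport he.2
  obtain ⟨K, hK, hKR⟩ := exists_compact_phaseSection (G := G) (χ := χ) (μ := μ) hθ
  -- Besides `K₀`, the cutoff is `1` at every `a` for which some `x` in the support of `e` has `x -
  -- a` in the support of a section. Hence it loses nothing of `P` there.
  obtain ⟨κ, k1, k2, k3, k4, k5⟩ := exists_cutoff
    (hK₀.union (isCompact_subgroup hB (isCompact_sub hX hK)))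
  obtain ⟨KB, hKB, hKBκ⟩ := exists_compact_of_hasCompactSupport k2
  obtain ⟨MR, hMR⟩ := exists_phaseSection_bound (μ := μ) G χ hθ
  have hMR0 : 0 ≤ MR := (norm_nonneg _).trans (hMR 0 0)
  obtain ⟨bO, hbO0, hbO⟩ := d.exists_overlap_bound (μ := μ)
  set e₁ : ℝ := ∫ x, ‖e x‖ ∂μ with he₁
  have he₁0 : 0 ≤ e₁ := integral_nonneg fun x => norm_nonneg _
  set cst : ℝ := e₁ * (ν.real KB * bO) with hcst
  have hcst0 : 0 ≤ cst := by positivity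
  set δ₁ : ℝ := δ / (2 * (cst + 1)) with hδ₁
  have hδ₁0 : 0 < δ₁ := by positivity
  set ε₂ : ℝ := min ε (δ₁ / (2 * MR + 1)) with hε₂
  have hε₂0 : 0 < ε₂ := by positivity
  have hδ₂ : δ₁ + 2 * MR * ε₂ ≤ 2 * δ₁ := by
    have h1 : ε₂ ≤ δ₁ / (2 * MR + 1) := min_le_right _ _
    rw [le_div_iff₀ (by positivity)] at h1
    nlinarith
  have cR : Continuous fun p : (B × A) × A =>
      phaseSection G χ μ θ (p.1.1 : A) (p.1.2 - p.1.1 - p.2) :=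
    continuous_phaseSection hθ (by fun_prop) (by fun_prop)
  obtain ⟨V, hV, hVR⟩ := exists_nhds_uniform (f := fun (z : B × A) v =>
    phaseSection G χ μ θ (z.1 : A) (z.2 - z.1 - v)) cR (hKB.prod hX) hδ₁0
  obtain ⟨ψ, D, U, hψ, hUV, hUm, hψ1⟩ := exists_isFejer_adapted hμ hV hL₀ hε₂0
  have cψ := hψ.cc.1
  obtain ⟨Lψ, hLψ, hψL⟩ := exists_compact_of_hasCompactSupport hψ.cc.2
  have ce := he.1
  have cO := d.continuous_overlap (μ := μ)
  have hω0 : ∀ a η, (κ a : ℂ) * ψ η ≠ 0 → a ∈ KB ∧ η ∈ Lψ := fun a η h =>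
    ⟨hKBκ _ fun h0 => left_ne_zero_of_mul h (by rw [h0, Complex.ofReal_zero]),
      hψL _ (right_ne_zero_of_mul h)⟩
  refine ⟨fun p => (κ p.1 : ℂ) * ψ p.2, ⟨by fun_prop, hasCompactSupport_of_ne (hKB.prod hLψ)
    fun p hp => hω0 _ _ hp⟩, fun p => ?_, fun p hp => ?_, ?_⟩
  · rw [norm_mul, Complex.norm_real, Real.norm_eq_abs, abs_of_nonneg (k3 _)]
    exact mul_le_one₀ (k4 _) (norm_nonneg _) (hψ.norm_le _)
  · beta_reduce
    rw [k5 _ (Or.inl hp.1), Complex.ofReal_one, one_mul]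
    exact (hψ1 _ hp.2).trans (min_le_left _ _)
  set Av : B → A → ℂ := fun a y =>
    ∫ η, ψ η * (sectionTransform G χ μ θ a η * (G.kernel y η : ℂ)) ∂μ with hAv
  have cAv : Continuous fun p : A × B => Av p.2 (p.1 - p.2) :=
    continuous_integral_of_ne (f := fun (p : A × B) η => ψ η *
      (sectionTransform G χ μ θ p.2 η * (G.kernel (p.1 - p.2) η : ℂ)))
      (Continuous.mul (by fun_prop) ((continuous_sectionTransform hθ (by fun_prop)
        (by fun_prop)).mul (by fun_prop))) hLψ fun p η h => hψL _ (left_ne_zero_of_mul h)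
  set Q : A → ℂ := fun x => ∫ a : B, (κ a : ℂ) * ((G.toFun a : ℂ) * (G.kernel (x - a) a : ℂ) *
    ((d.overlap μ (x - a) : ℂ) * Av a (x - a))) ∂ν with hQ
  have hκK : ∀ (a : B) (z : ℂ), (κ a : ℂ) * z ≠ 0 → a ∈ KB := fun a z h =>
    hKBκ _ fun h0 => left_ne_zero_of_mul h (by rw [h0, Complex.ofReal_zero])
  have cQi : Continuous fun p : A × B => (κ p.2 : ℂ) * ((G.toFun p.2 : ℂ) *
      (G.kernel (p.1 - p.2) p.2 : ℂ) * ((d.overlap μ (p.1 - p.2) : ℂ) * Av p.2 (p.1 - p.2))) :=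
    Continuous.mul (by fun_prop) (Continuous.mul (by fun_prop)
      (Continuous.mul (by fun_prop) cAv))
  have cQ : Continuous Q := continuous_integral_of_ne cQi hKB fun x a h => hκK _ _ h
  have hLHS : ∫ a : B, ∫ η, (κ a : ℂ) * ψ η * (sectionCoeff G χ μ θ a η * ∫ x, e x *
      ((G.kernel x (η + a) : ℂ) * (d.overlap μ (x - a) : ℂ)) ∂μ) ∂μ ∂ν = ∫ x, e x * Q x ∂μ := by
    have hrot := integral_rotate_of_ne (μX := ν) (μY := μ) (μZ := μ)
      (f := fun (a : B) η x => (κ a : ℂ) * ψ η * (sectionCoeff G χ μ θ a η * (e x *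
        ((G.kernel x (η + a) : ℂ) * (d.overlap μ (x - a) : ℂ)))))
      (Continuous.mul (by fun_prop) ((continuous_sectionCoeff hθ (by fun_prop)
        (by fun_prop)).mul (by fun_prop))) hKB hLψ hX
      (fun a η x h => ⟨(hω0 _ _ (left_ne_zero_of_mul h)).1, (hω0 _ _ (left_ne_zero_of_mul h)).2,
        hXe _ (left_ne_zero_of_mul (right_ne_zero_of_mul (right_ne_zero_of_mul h)))⟩)
    simp only [integral_const_mul] at hrot
    rw [hrot]
    congr 1
    funext x
    rw [hQ, ← integral_const_mul]
    congr 1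
    funext a
    simp only [hAv, ← integral_const_mul]
    congr 1
    funext η
    have key : G.kernel (-a) (η + a) * G.kernel x (η + a) =
        G.kernel (x - a) a * G.kernel (x - a) η := by
      rw [← G.kernel_add_left', ← G.kernel_add_right, add_comm (-(a : A)) x, ← sub_eq_add_neg,
        add_comm η (a : A)]
    have key' := congrArg (fun z : Circle => (z : ℂ)) key
    push_cast at key'
    rw [sectionCoeff]
    linear_combination (κ a : ℂ) * ψ η * sectionTransform G χ μ θ a η * (G.toFun a : ℂ) * e x *
      (d.overlap μ (x - a) : ℂ) * key'
  have cP := continuous_phaseTranspose (G := G) (χ := χ) (μ := μ) (ν := ν) hB hθ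
  have hQP : ∀ x ∈ X, ‖Q x - phaseTranspose G χ μ ν θ x‖ ≤ ν.real KB * (bO * (2 * δ₁)) := by
    intro x hx
    have hPx : phaseTranspose G χ μ ν θ x = ∫ a : B, (κ a : ℂ) * ((G.toFun a : ℂ) *
        (G.kernel (x - a) a : ℂ) * phaseSection G χ μ θ a (x - a)) ∂ν := by
      rw [phaseTranspose_eq]
      congr 1
      funext a
      by_cases h0 : phaseSection G χ μ θ a (x - a) = 0
      · rw [h0]
        ring
      · rw [k5 a (Or.inr ⟨x, hx, x - a, hKR _ _ h0, by simp⟩), Complex.ofReal_one, one_mul]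
    have cRx : Continuous fun a : B => phaseSection G χ μ θ a (x - a) :=
      continuous_phaseSection hθ (by fun_prop) (by fun_prop)
    have iQ : Integrable (fun a : B => (κ a : ℂ) * ((G.toFun a : ℂ) * (G.kernel (x - a) a : ℂ) *
        ((d.overlap μ (x - a) : ℂ) * Av a (x - a)))) ν :=
      integrable_of_ne (cQi.comp (by fun_prop : Continuous fun a : B => (x, a))) hKB
        fun a h => hκK _ _ h
    have iP : Integrable (fun a : B => (κ a : ℂ) * ((G.toFun a : ℂ) *
        (G.kernel (x - a) a : ℂ) * phaseSection G χ μ θ a (x - a))) ν :=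
      integrable_of_ne (by fun_prop) hKB fun a h => hκK _ _ h
    rw [hPx, hQ]
    beta_reduce
    rw [← integral_sub iQ iP]
    refine norm_integral_le_of_ne hKB (fun a h => ?_) fun a => ?_
    · rw [← mul_sub] at h
      exact hκK _ _ h
    rw [← mul_sub, ← mul_sub, norm_mul, norm_mul, norm_mul, Circle.norm_coe, Circle.norm_coe,
      one_mul, one_mul, Complex.norm_real, Real.norm_eq_abs, abs_of_nonneg (k3 _)]
    by_cases ha : a ∈ KB
    · have e1 : (d.overlap μ (x - a) : ℂ) * Av a (x - a) - phaseSection G χ μ θ a (x - a) =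
          (d.overlap μ (x - a) : ℂ) * (Av a (x - a) - phaseSection G χ μ θ a (x - a)) := by
        by_cases h0 : phaseSection G χ μ θ a (x - a) = 0
        · rw [h0, sub_zero, sub_zero]
        · rw [hd _ _ h0, Complex.ofReal_one, one_mul, one_mul]
      have e2 : ‖Av a (x - a) - phaseSection G χ μ θ a (x - a)‖ ≤ 2 * δ₁ := by
        have h3 := hψ.average_close hUm (H := fun v => phaseSection G χ μ θ a (x - a - v))
          (continuous_phaseSection hθ (by fun_prop) (by fun_prop)) (M := MR) (δ := δ₁)
          (fun v => hMR _ _) hδ₁0.le (fun v hv => (hVR (a, x) ⟨ha, hx⟩ v (hUV hv)).le)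
        rw [← hψ.integral_mul_sectionTransform hθ, sub_zero] at h3
        exact h3.trans hδ₂
      rw [e1, norm_mul, Complex.norm_real]
      calc _ ≤ 1 * (bO * (2 * δ₁)) := mul_le_mul (k4 _)
            (mul_le_mul (hbO _) e2 (norm_nonneg _) hbO0) (by positivity) zero_le_one
        _ = _ := one_mul _
    · rw [show κ a = 0 from by_contra fun h0 => ha (hKBκ _ h0), zero_mul]
      positivity
  have i1 : Integrable (fun x => e x * Q x) μ :=
    integrable_of_ne (by fun_prop) hX fun x h => hXe _ (left_ne_zero_of_mul h)
  have i2 : Integrable (fun x => e x * phaseTranspose G χ μ ν θ x) μ :=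
    integrable_of_ne (by fun_prop) hX fun x h => hXe _ (left_ne_zero_of_mul h)
  simp only
  rw [hLHS, ← integral_sub i1 i2]
  calc _ ≤ ∫ x, ‖e x‖ * (ν.real KB * (bO * (2 * δ₁))) ∂μ := by
        refine norm_integral_le_of_norm_le (he.integrable.norm.mul_const _)
          (Eventually.of_forall fun x => ?_)
        rw [← mul_sub, norm_mul]
        by_cases h0 : e x = 0
        · simp [h0]
        · exact mul_le_mul_of_nonneg_left (hQP x (hXe _ h0)) (norm_nonneg _)
    _ = cst * (2 * δ₁) := by
        rw [integral_mul_const, hcst]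
        ring
    _ ≤ δ := by
        have h1 : (cst + 1) * (2 * δ₁) = δ := by
          rw [hδ₁]
          field_simp
        nlinarith

end Fourier

section Fourier

variable {A : Type*} [AddCommGroup A] [TopologicalSpace A] [IsTopologicalAddGroup A]
  [LocallyCompactSpace A] [T2Space A] [MeasurableSpace A] [BorelSpace A]
  {G : GaussianExponential A} {χ : Bicharacter A} {μ : Measure A} [μ.IsAddHaarMeasure] [μ.Regular]
  {B : AddSubgroup A} {ν : Measure B} [ν.IsAddHaarMeasure] [ν.Regular]

/-! ### Approximation by finite sums of matrix elements -/

namespace PacketData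

variable (d : PacketData A)

variable (G χ ν) in
/-- A truncated superposition of matrix elements of `S` between packets. -/
def packetSum (θ : A × A → ℂ) (κ : B × A → ℝ) (κ' : A → ℝ) (S : Lp ℂ 2 μ →L[ℂ] Lp ℂ 2 μ) : ℂ :=
  ∫ a : B, ∫ η, (κ (a, η) : ℂ) * (sectionCoeff G χ μ θ a η *
    ∫ s, (κ' s : ℂ) * d.pairing G S a (η + a) s ∂μ) ∂μ ∂ν

variable (G) in
theorem continuous_integral_pairing {κ' : A → ℝ} (k1 : Continuous κ') (k2 : HasCompactSupport κ')
    (S : Lp ℂ 2 μ →L[ℂ] Lp ℂ 2 μ) :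
    Continuous fun p : B × A => ∫ s, (κ' s : ℂ) * d.pairing G S p.1 (p.2 + p.1) s ∂μ := by
  obtain ⟨L, hL, hLκ⟩ := exists_compact_of_hasCompactSupport k2
  refine continuous_integral_of_ne (f := fun (p : B × A) s => (κ' s : ℂ) *
    d.pairing G S p.1 (p.2 + p.1) s) (Continuous.mul (by fun_prop)
      (d.continuous_pairing G S (by fun_prop) (by fun_prop) (by fun_prop))) hL fun p s h =>
        hLκ _ fun h0 => left_ne_zero_of_mul h (by rw [h0, Complex.ofReal_zero])

/-- The packets on the right form a compact subset of `L²`, on which strong convergence with bounded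
norms is uniform. -/
theorem tendsto_packetSum {θ : A × A → ℂ} (hθ : IsCc θ) {κ : B × A → ℝ} (k1 : Continuous κ)
    (k2 : HasCompactSupport κ) (k3 : ∀ p, 0 ≤ κ p) {κ' : A → ℝ} (k1' : Continuous κ')
    (k2' : HasCompactSupport κ') (k3' : ∀ s, 0 ≤ κ' s) {ι : Type*} {l : Filter ι}
    {T : ι → Lp ℂ 2 μ →L[ℂ] Lp ℂ 2 μ} {S : Lp ℂ 2 μ →L[ℂ] Lp ℂ 2 μ}
    (hT : ∀ v, Tendsto (fun i => T i v) l (𝓝 (S v))) {M : ℝ} (hM0 : 0 ≤ M)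
    (hM : ∀ᶠ i in l, ∀ v, ‖T i v‖ ≤ M * ‖v‖) :
    Tendsto (fun i => d.packetSum G χ ν θ κ κ' (T i)) l (𝓝 (d.packetSum G χ ν θ κ κ' S)) := by
  obtain ⟨K, L, hK, hL, hKL⟩ := exists_compact_prod_of_hasCompactSupport k2
  obtain ⟨L', hL', hLκ'⟩ := exists_compact_of_hasCompactSupport k2'
  set R : ℝ := ∫ a : B, ∫ η, κ (a, η) * ‖sectionCoeff G χ μ θ a η‖ ∂μ ∂ν with hR
  have hR0 : 0 ≤ R := integral_nonneg fun a => integral_nonneg fun η =>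
    mul_nonneg (k3 _) (norm_nonneg _)
  set H : ℝ := ‖(IsCc.ofReal d.c₂ d.s₂).toL2 μ‖ with hH
  have hH0 : 0 ≤ H := norm_nonneg _
  set N : ℝ := ∫ s, κ' s ∂μ with hN
  have hN0 : 0 ≤ N := integral_nonneg k3'
  have hcoe : Continuous fun p : B × A => sectionCoeff G χ μ θ p.1 p.2 :=
    continuous_sectionCoeff hθ (by fun_prop) (by fun_prop)
  rw [Metric.tendsto_nhds]
  intro ε hε
  set δ : ℝ := ε / (2 * (R * (N * H) + 1)) with hδ
  have hδ0 : 0 < δ := by positivity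
  have hcomp : IsCompact ((fun p : (B × A) × A => d.right G μ p.2 (p.1.2 + p.1.1)) ''
      ((K ×ˢ L) ×ˢ L')) :=
    ((hK.prod hL).prod hL').image (d.continuous_right (by fun_prop) (by fun_prop))
  filter_upwards [eventually_forall_mem_compact_norm_sub_le hT hM0 hM hcomp hδ0] with i hi
  have hpt : ∀ a ∈ K, ∀ η ∈ L,
      ‖(∫ s, (κ' s : ℂ) * d.pairing G (T i) a (η + a) s ∂μ) -
        ∫ s, (κ' s : ℂ) * d.pairing G S a (η + a) s ∂μ‖ ≤ N * H * δ := by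
    intro a ha η hη
    have hint : ∀ S' : Lp ℂ 2 μ →L[ℂ] Lp ℂ 2 μ,
        Integrable (fun s => (κ' s : ℂ) * d.pairing G S' a (η + a) s) μ := fun S' =>
      integrable_of_ne (Continuous.mul (by fun_prop)
        (d.continuous_pairing G S' continuous_const continuous_const continuous_id)) hL' fun s h =>
          hLκ' _ fun h0 => left_ne_zero_of_mul h (by rw [h0, Complex.ofReal_zero])
    rw [← integral_sub (hint _) (hint _)]
    calc _ ≤ ∫ s, κ' s * (H * δ) ∂μ := by
          refine norm_integral_le_of_norm_le
            ((k1'.integrable_of_hasCompactSupport k2').mul_const _)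
            (Eventually.of_forall fun s => ?_)
          rw [← mul_sub, norm_mul, Complex.norm_real, Real.norm_eq_abs, abs_of_nonneg (k3' s)]
          by_cases h0 : κ' s = 0
          · rw [h0, zero_mul, zero_mul]
          · refine mul_le_mul_of_nonneg_left ?_ (k3' s)
            rw [pairing, pairing, ← inner_sub_right]
            refine (norm_inner_le_norm _ _).trans ?_
            rw [norm_left]
            exact mul_le_mul_of_nonneg_left
              (hi _ ⟨((a, η), s), ⟨⟨ha, hη⟩, hLκ' s h0⟩, rfl⟩) hH0
      _ = N * H * δ := by
          rw [integral_mul_const, mul_assoc]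
  have hsupp : ∀ (a : B) η (z : ℂ), (κ (a, η) : ℂ) * z ≠ 0 → a ∈ K ∧ η ∈ L := fun a η z h =>
    hKL a η fun h0 => left_ne_zero_of_mul h (by rw [h0, Complex.ofReal_zero])
  have hcont : ∀ S' : Lp ℂ 2 μ →L[ℂ] Lp ℂ 2 μ, Continuous fun p : B × A => (κ (p.1, p.2) : ℂ) *
      (sectionCoeff G χ μ θ p.1 p.2 * ∫ s, (κ' s : ℂ) * d.pairing G S' p.1 (p.2 + p.1) s ∂μ) :=
    fun S' => Continuous.mul (by fun_prop)
      (hcoe.mul (d.continuous_integral_pairing G k1' k2' S'))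
  rw [dist_eq_norm, packetSum, packetSum, ← integral_integral_sub_of_ne
    (f := fun (a : B) η => (κ (a, η) : ℂ) * (sectionCoeff G χ μ θ a η *
      ∫ s, (κ' s : ℂ) * d.pairing G (T i) a (η + a) s ∂μ))
    (g := fun (a : B) η => (κ (a, η) : ℂ) * (sectionCoeff G χ μ θ a η *
      ∫ s, (κ' s : ℂ) * d.pairing G S a (η + a) s ∂μ))
    (hcont _) (hcont _) hK hL (fun a η h => hsupp a η _ h) (fun a η h => hsupp a η _ h)]
  calc _ ≤ ∫ a : B, ∫ η, κ (a, η) * ‖sectionCoeff G χ μ θ a η‖ * (N * H * δ) ∂μ ∂ν := by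
        refine norm_integral_integral_le_of_le
          (g := fun (a : B) η => κ (a, η) * ‖sectionCoeff G χ μ θ a η‖ * (N * H * δ))
          (Continuous.mul (Continuous.mul (by fun_prop) hcoe.norm) continuous_const) hK hL
          (fun a η h => hKL a η (left_ne_zero_of_mul (left_ne_zero_of_mul h))) fun a η => ?_
        rw [← mul_sub, ← mul_sub, norm_mul, norm_mul, Complex.norm_real, Real.norm_eq_abs,
          abs_of_nonneg (k3 _), mul_assoc]
        by_cases h0 : κ (a, η) = 0
        · rw [h0, zero_mul, zero_mul]
        · have := hKL a η h0
          exact mul_le_mul_of_nonneg_left (mul_le_mul_of_nonneg_left (hpt a this.1 η this.2)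
            (norm_nonneg _)) (k3 _)
    _ = R * (N * H) * δ := by
        simp only [integral_mul_const]
        rw [hR]
        ring
    _ < ε := by
        have h1 : 2 * (R * (N * H) + 1) * δ = ε := by
          rw [hδ]
          field_simp
        have h2 : 0 ≤ R * (N * H) := by positivity
        nlinarith

/-- The cutoffs precede `S`, and the error is relative to the bound `M₀` of `S`. Three replacements
lead from the truncated sum to the pairing of the symbol: the truncated integral over `s` by the
full one, the cutoff `κ` by a summability weight `ω`, and the weighted sum by `P`. The first two
cost `ε M₀/2` each; the last may depend on `E` and costs an arbitrary `δ`. -/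
theorem exists_packetSum_close (hμ : IsSelfDualMeasure G μ) (hB : IsClosed (B : Set A))
    {θ : A × A → ℂ} (hθ : IsTest G μ θ)
    (hd : ∀ a x, phaseSection G χ μ θ a x ≠ 0 → d.overlap μ x = 1) (hq : Integrable d.q μ)
    (h₁0 : ∀ x, 0 ≤ d.h₁ x) {M : ℝ}
    (hN : ∀ κ : A → ℝ, Continuous κ → HasCompactSupport κ → (∀ s, 0 ≤ κ s) →
      (∀ s, κ s ≤ 1) → ∫ s, κ s * ‖(isCc_localize d.cq d.c₁ d.s₁ s).toL2 μ‖ ∂μ ≤ M)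
    {ε : ℝ} (hε : 0 < ε) :
    ∃ (κ : B × A → ℝ) (κ' : A → ℝ), Continuous κ ∧ HasCompactSupport κ ∧ (∀ p, 0 ≤ κ p) ∧
      Continuous κ' ∧ HasCompactSupport κ' ∧ (∀ s, 0 ≤ κ' s) ∧
      ∀ (S : Lp ℂ 2 μ →L[ℂ] Lp ℂ 2 μ) (E : A → A → ℂ) (M₀ : ℝ), HasSymbol G μ S E →
        IsCc (fun p : A × A => E p.1 p.2) → 0 ≤ M₀ → (∀ v, ‖S v‖ ≤ M₀ * ‖v‖) →
          ‖d.packetSum G χ ν θ κ κ' S -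
            ∫ x, ∫ u, E x u * (phaseTranspose G χ μ ν θ x * fourier G μ d.q u) ∂μ ∂μ‖ ≤
              ε * M₀ := by
  have : LocallyCompactSpace B := hB.isClosedEmbedding_subtypeVal.locallyCompactSpace
  have hθc : IsCc θ := ⟨hθ.1, hθ.2.1⟩
  obtain ⟨M₁, hM₁0, hM₁⟩ := exists_sectionTransform_bound χ ν hμ hB hθ
  have hM0 : 0 ≤ M := by
    simpa using hN (fun _ => 0) continuous_const HasCompactSupport.zero (fun _ => le_rfl)
      fun _ => zero_le_one
  set H : ℝ := ‖(IsCc.ofReal d.c₂ d.s₂).toL2 μ‖ with hH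
  have hH0 : 0 ≤ H := norm_nonneg _
  set ε₁ : ℝ := ε / (2 * (M₁ + 1)) with hε₁
  have hε₁0 : 0 < ε₁ := by positivity
  set ε₂ : ℝ := ε / (2 * ((1 + M₁) * (H * M + ε₁) + 1)) with hε₂
  have hε₂0 : 0 < ε₂ := by positivity
  obtain ⟨κ', p1, p2, p3, p4, hκ'⟩ := d.exists_cutoff_pairing (G := G) hq h₁0 hN hε₁0
  have hcoe : Continuous fun p : B × A => sectionCoeff G χ μ θ p.1 p.2 :=
    continuous_sectionCoeff hθc (by fun_prop) (by fun_prop)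
  obtain ⟨κ, b1, b2, b3, b4, K, L, hK, hL, hκ⟩ := exists_cutoff_weighted_tail (m := ν) (n := μ)
    (r := fun (a : B) η => sectionCoeff G χ μ θ a η) hcoe (M := M₁)
    (fun κ h1 h2 h3 h4 => by simpa only [norm_sectionCoeff] using hM₁ κ h1 h2 h3 h4) hε₂0
  refine ⟨κ, κ', b1, b2, b3, p1, p2, p3, fun S E M₀ hS hE hM₀ hSM => ?_⟩
  refine le_of_forall_pos_le_add fun δ hδ => ?_
  obtain ⟨X, U, hX, hU, hXU⟩ := exists_compact_prod_of_hasCompactSupport hE.2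
  have cE := hE.1
  have cF := continuous_fourier_of_integrable (G := G) hq
  have cO := d.continuous_overlap (μ := μ)
  set e : A → ℂ := fun x => ∫ u, E x u * fourier G μ d.q u ∂μ with he
  have hec : IsCc e := by
    refine ⟨continuous_integral_of_ne (f := fun x u => E x u * fourier G μ d.q u) (by fun_prop) hU
      fun x u h => (hXU x u (left_ne_zero_of_mul h)).2, hasCompactSupport_of_ne hX fun x hx => ?_⟩
    obtain ⟨u, hu⟩ := exists_of_integral_ne_zero hx
    exact (hXU x u (left_ne_zero_of_mul hu)).1
  obtain ⟨X', hX', hXe⟩ := exists_compact_of_hasCompactSupport hec.2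
  have ce := hec.1
  obtain ⟨ω, hω, hω1, hωK, hωδ⟩ := d.exists_weight (χ := χ) (ν := ν) hμ hB hθc hd hec hK hL hε₂0 hδ
  set J : B → A → ℂ := fun a η => ∫ s, (κ' s : ℂ) * d.pairing G S a (η + a) s ∂μ with hJ
  set T : B → A → ℂ := fun a η => ∫ x, e x *
    ((G.kernel x (η + a) : ℂ) * (d.overlap μ (x - a) : ℂ)) ∂μ with hT
  have cJ : Continuous fun p : B × A => J p.1 p.2 := d.continuous_integral_pairing G p1 p2 S
  have cT : Continuous fun p : B × A => T p.1 p.2 :=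
    continuous_integral_of_ne (f := fun (p : B × A) x => e x *
      ((G.kernel x (p.2 + p.1) : ℂ) * (d.overlap μ (x - p.1) : ℂ))) (by fun_prop) hX'
      fun p x h => hXe _ (left_ne_zero_of_mul h)
  have hJT : ∀ a η, ‖J a η - T a η‖ ≤ ε₁ * M₀ := by
    intro a η
    have h1 := hκ' S E M₀ hS hE hM₀ hSM a (η + a)
    have h2 : ∫ x, ∫ u, E x u * ((G.kernel x (η + a) : ℂ) *
        (fourier G μ d.q u * (d.overlap μ (x - a) : ℂ))) ∂μ ∂μ = T a η := by
      rw [hT]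
      congr 1
      funext x
      rw [he]
      beta_reduce
      rw [← integral_mul_const]
      congr 1
      funext u
      ring
    rwa [h2] at h1
  have hJle : ∀ a η, ‖J a η‖ ≤ M₀ * (H * M) := by
    intro a η
    have cN := continuous_norm_localize (μ := μ) d.cq d.c₁ d.s₁
    calc _ ≤ ∫ s, (M₀ * H) * (κ' s * ‖(isCc_localize d.cq d.c₁ d.s₁ s).toL2 μ‖) ∂μ := by
          refine norm_integral_le_of_norm_le (((p1.mul cN).integrable_of_hasCompactSupport
            p2.mul_right).const_mul _) (Eventually.of_forall fun s => ?_)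
          rw [norm_mul, Complex.norm_real, Real.norm_eq_abs, abs_of_nonneg (p3 s)]
          have := mul_le_mul_of_nonneg_left (d.norm_pairing_le (G := G) hSM a (η + a) s) (p3 s)
          linarith
      _ ≤ (M₀ * H) * M := by
          rw [integral_const_mul]
          exact mul_le_mul_of_nonneg_left (hN κ' p1 p2 p3 p4) (by positivity)
      _ = _ := mul_assoc _ _ _
  -- `T` is defined through the symbol, for which no bound in terms of `M₀` is available; the bound
  -- is inherited from the matrix elements in `J`.
  have hTle : ∀ a η, ‖T a η‖ ≤ M₀ * (H * M + ε₁) := by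
    intro a η
    have h1 := norm_sub_norm_le (T a η) (J a η)
    rw [norm_sub_rev] at h1
    linarith [hJT a η, hJle a η]
  obtain ⟨K₁, L₁, hK₁, hL₁, hKL₁⟩ := exists_compact_prod_of_hasCompactSupport b2
  obtain ⟨K₂, L₂, hK₂, hL₂, hKL₂⟩ := exists_compact_prod_of_hasCompactSupport hω.2
  have hs₁ : ∀ (a : B) η (z : ℂ), (κ (a, η) : ℂ) * z ≠ 0 → a ∈ K₁ ∧ η ∈ L₁ := fun a η z h =>
    hKL₁ a η fun h0 => left_ne_zero_of_mul h (by rw [h0, Complex.ofReal_zero])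
  have cω := hω.1
  have e₁ : ‖(∫ a : B, ∫ η, (κ (a, η) : ℂ) * (sectionCoeff G χ μ θ a η * J a η) ∂μ ∂ν) -
      ∫ a : B, ∫ η, (κ (a, η) : ℂ) * (sectionCoeff G χ μ θ a η * T a η) ∂μ ∂ν‖ ≤
      M₁ * (ε₁ * M₀) := by
    rw [← integral_integral_sub_of_ne
      (f := fun (a : B) η => (κ (a, η) : ℂ) * (sectionCoeff G χ μ θ a η * J a η))
      (g := fun (a : B) η => (κ (a, η) : ℂ) * (sectionCoeff G χ μ θ a η * T a η))
      (by fun_prop) (by fun_prop) hK₁ hL₁ (fun a η h => hs₁ a η _ h) (fun a η h => hs₁ a η _ h)]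
    calc _ ≤ ∫ a : B, ∫ η, κ (a, η) * ‖sectionCoeff G χ μ θ a η‖ * (ε₁ * M₀) ∂μ ∂ν := by
          refine norm_integral_integral_le_of_le
            (g := fun (a : B) η => κ (a, η) * ‖sectionCoeff G χ μ θ a η‖ * (ε₁ * M₀))
            (by fun_prop) hK₁ hL₁
            (fun a η h => hKL₁ a η (left_ne_zero_of_mul (left_ne_zero_of_mul h))) fun a η => ?_
          rw [← mul_sub, ← mul_sub, norm_mul, norm_mul, Complex.norm_real, Real.norm_eq_abs,
            abs_of_nonneg (b3 _), mul_assoc]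
          exact mul_le_mul_of_nonneg_left (mul_le_mul_of_nonneg_left (hJT a η)
            (norm_nonneg _)) (b3 _)
      _ ≤ _ := by
          simp only [integral_mul_const, norm_sectionCoeff]
          exact mul_le_mul_of_nonneg_right (hM₁ κ b1 b2 b3 b4) (by positivity)
  have e₂ : ‖(∫ a : B, ∫ η, (κ (a, η) : ℂ) * (sectionCoeff G χ μ θ a η * T a η) ∂μ ∂ν) -
      ∫ a : B, ∫ η, ω (a, η) * (sectionCoeff G χ μ θ a η * T a η) ∂μ ∂ν‖ ≤
      ε₂ * (1 + M₁) * (M₀ * (H * M + ε₁)) := by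
    have hs₂ : ∀ a η, ω (a, η) - κ (a, η) ≠ 0 → a ∈ K₁ ∪ K₂ ∧ η ∈ L₁ ∪ L₂ := by
      intro a η h
      by_cases h0 : κ (a, η) = 0
      · rw [h0, Complex.ofReal_zero, sub_zero] at h
        exact ⟨Or.inr (hKL₂ a η h).1, Or.inr (hKL₂ a η h).2⟩
      · exact ⟨Or.inl (hKL₁ a η h0).1, Or.inl (hKL₁ a η h0).2⟩
    rw [← integral_integral_sub_of_ne
      (f := fun (a : B) η => (κ (a, η) : ℂ) * (sectionCoeff G χ μ θ a η * T a η))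
      (g := fun (a : B) η => ω (a, η) * (sectionCoeff G χ μ θ a η * T a η))
      (by fun_prop) (by fun_prop) (hK₁.union hK₂) (hL₁.union hL₂)
      (fun a η h => ⟨Or.inl (hs₁ a η _ h).1, Or.inl (hs₁ a η _ h).2⟩)
      (fun a η h => ⟨Or.inr (hKL₂ a η (left_ne_zero_of_mul h)).1,
        Or.inr (hKL₂ a η (left_ne_zero_of_mul h)).2⟩)]
    calc _ ≤ ∫ a : B, ∫ η, ‖ω (a, η) - κ (a, η)‖ * ‖sectionCoeff G χ μ θ a η‖ *
          (M₀ * (H * M + ε₁)) ∂μ ∂ν := by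
          refine norm_integral_integral_le_of_le
            (g := fun (a : B) η => ‖ω (a, η) - κ (a, η)‖ * ‖sectionCoeff G χ μ θ a η‖ *
              (M₀ * (H * M + ε₁))) (by fun_prop) (hK₁.union hK₂) (hL₁.union hL₂)
            (fun a η h => hs₂ a η (norm_ne_zero_iff.1
              (left_ne_zero_of_mul (left_ne_zero_of_mul h)))) fun a η => ?_
          rw [← sub_mul, norm_mul, norm_mul, norm_sub_rev, mul_assoc]
          exact mul_le_mul_of_nonneg_left (mul_le_mul_of_nonneg_left (hTle a η)
            (norm_nonneg _)) (norm_nonneg _)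
      _ ≤ _ := by
          simp only [integral_mul_const]
          exact mul_le_mul_of_nonneg_right (hκ ω hω hω1 hωK) (by positivity)
  have e₃ : ∫ x, ∫ u, E x u * (phaseTranspose G χ μ ν θ x * fourier G μ d.q u) ∂μ ∂μ =
      ∫ x, e x * phaseTranspose G χ μ ν θ x ∂μ := by
    congr 1
    funext x
    rw [he]
    beta_reduce
    rw [← integral_mul_const]
    congr 1
    funext u
    ring
  have e₄ : M₁ * (ε₁ * M₀) ≤ ε / 2 * M₀ := by
    have h1 : 2 * (M₁ + 1) * ε₁ = ε := by
      rw [hε₁]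
      field_simp
    have h2 : M₁ * ε₁ ≤ ε / 2 := by linarith
    have := mul_le_mul_of_nonneg_right h2 hM₀
    linarith
  have e₅ : ε₂ * (1 + M₁) * (M₀ * (H * M + ε₁)) ≤ ε / 2 * M₀ := by
    have h1 : 2 * ((1 + M₁) * (H * M + ε₁) + 1) * ε₂ = ε := by
      rw [hε₂]
      field_simp
    have h2 : ε₂ * ((1 + M₁) * (H * M + ε₁)) ≤ ε / 2 := by linarith
    have := mul_le_mul_of_nonneg_right h2 hM₀
    linarith
  rw [e₃]
  have h1 := norm_sub_le_norm_sub_add_norm_sub (d.packetSum G χ ν θ κ κ' S)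
    (∫ a : B, ∫ η, (κ (a, η) : ℂ) * (sectionCoeff G χ μ θ a η * T a η) ∂μ ∂ν)
    (∫ x, e x * phaseTranspose G χ μ ν θ x ∂μ)
  have h2 := norm_sub_le_norm_sub_add_norm_sub
    (∫ a : B, ∫ η, (κ (a, η) : ℂ) * (sectionCoeff G χ μ θ a η * T a η) ∂μ ∂ν)
    (∫ a : B, ∫ η, ω (a, η) * (sectionCoeff G χ μ θ a η * T a η) ∂μ ∂ν)
    (∫ x, e x * phaseTranspose G χ μ ν θ x ∂μ)
  have h3 : ‖d.packetSum G χ ν θ κ κ' S -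
    ∫ a : B, ∫ η, (κ (a, η) : ℂ) * (sectionCoeff G χ μ θ a η * T a η) ∂μ ∂ν‖ ≤ M₁ * (ε₁ * M₀) := e₁
  linarith

end PacketData

end Fourier

section Fourier

variable {A : Type*} [AddCommGroup A] [TopologicalSpace A] [IsTopologicalAddGroup A]
  [LocallyCompactSpace A] [T2Space A] [MeasurableSpace A] [BorelSpace A]
  {G : GaussianExponential A} {χ : Bicharacter A} {μ : Measure A} [μ.IsAddHaarMeasure] [μ.Regular]
  {B : AddSubgroup A} {ν : Measure B} [ν.IsAddHaarMeasure] [ν.Regular]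

/-! ### The integral identity -/

/-- Bounded convergence in `L¹` on compact sets, against an integrable `p`; with `p = 𝖥⁻¹P` it
yields the value of `gDist` as a limit. -/
theorem tendsto_integral_mul_fourier {p f : A → ℂ} (hp : Integrable p μ) (hf : Measurable f)
    {C : ℝ} (hC : ∀ x, ‖f x‖ ≤ C) :
    Tendsto (fun k => ∫ ξ, p ξ * fourier G μ k ξ ∂μ) (regularizations G μ C f)
      (𝓝 (∫ ξ, f ξ * p ξ ∂μ)) := by
  have hC0 : 0 ≤ C := (norm_nonneg _).trans (hC 0)
  rw [Metric.tendsto_nhds]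
  intro ε hε
  obtain ⟨g, hg, hpg⟩ := exists_isCc_integral_sub_le hp (ε := ε / (4 * (C + 1))) (by positivity)
  obtain ⟨K, hK, hKg⟩ := exists_compact_of_hasCompactSupport hg.2
  obtain ⟨b, hb⟩ := hg.1.bounded_above_of_compact_support hg.2
  have hb0 : 0 ≤ b := (norm_nonneg _).trans (hb 0)
  filter_upwards [(regularizations_hasBasis (G := G) (μ := μ) hf hC).mem_of_mem
    (i := (K, ε / (4 * (b + 1)))) ⟨hK, by positivity⟩] with k hk
  obtain ⟨hk1, hk2, hk3, hk4⟩ := hk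
  have hkm := (continuous_fourier (G := G) (μ := μ) ⟨hk1, hk2⟩).measurable
  have hd : ∀ ξ, ‖fourier G μ k ξ - f ξ‖ ≤ 2 * C := fun ξ =>
    (norm_sub_le _ _).trans (by linarith [hk3 ξ, hC ξ])
  have i1 : Integrable (fun ξ => p ξ * fourier G μ k ξ) μ :=
    hp.mul_bdd (c := C) hkm.aestronglyMeasurable (Eventually.of_forall hk3)
  have i2 : Integrable (fun ξ => p ξ * f ξ) μ :=
    hp.mul_bdd (c := C) hf.aestronglyMeasurable (Eventually.of_forall hC)
  have hKi : IntegrableOn (fun ξ => ‖fourier G μ k ξ - f ξ‖) K μ :=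
    ((integrableOn_of_bounded_measurable hkm hk3 hK).sub
      (integrableOn_of_bounded_measurable hf hC hK)).norm
  have hgi : Integrable (fun ξ => ‖g ξ‖ * ‖fourier G μ k ξ - f ξ‖) μ := by
    refine hg.integrable.norm.mul_bdd (c := 2 * C)
      (hkm.sub hf).norm.aestronglyMeasurable (Eventually.of_forall fun ξ => ?_)
    rw [norm_norm]
    exact hd ξ
  have e1 : ∫ ξ, ‖g ξ‖ * ‖fourier G μ k ξ - f ξ‖ ∂μ ≤ ε / 4 := by
    rw [← setIntegral_eq_integral_of_forall_compl_eq_zero (s := K)]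
    · calc _ ≤ ∫ ξ in K, b * ‖fourier G μ k ξ - f ξ‖ ∂μ :=
            integral_mono_of_nonneg (Eventually.of_forall fun ξ => by positivity)
              (hKi.const_mul b) (Eventually.of_forall fun ξ =>
                mul_le_mul_of_nonneg_right (hb ξ) (norm_nonneg _))
        _ ≤ ε / 4 := by
            rw [integral_const_mul]
            rw [lt_div_iff₀ (by positivity)] at hk4
            have h0 : 0 ≤ ∫ ξ in K, ‖fourier G μ k ξ - f ξ‖ ∂μ :=
              integral_nonneg fun _ => norm_nonneg _
            nlinarith
    · intro x hx
      rw [show g x = 0 from by_contra fun h0 => hx (hKg x h0), norm_zero, zero_mul]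
  have e2 : 2 * C * ∫ ξ, ‖p ξ - g ξ‖ ∂μ ≤ ε / 2 := by
    rw [le_div_iff₀ (by positivity)] at hpg
    have h0 : 0 ≤ ∫ ξ, ‖p ξ - g ξ‖ ∂μ := integral_nonneg fun _ => norm_nonneg _
    nlinarith
  have i3 : Integrable (fun ξ => 2 * C * ‖p ξ - g ξ‖) μ := (hp.sub hg.integrable).norm.const_mul _
  have e3 : ∫ ξ, f ξ * p ξ ∂μ = ∫ ξ, p ξ * f ξ ∂μ := by simp only [mul_comm]
  rw [dist_eq_norm, e3, ← integral_sub i1 i2]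
  calc _ ≤ ∫ ξ, (2 * C * ‖p ξ - g ξ‖ + ‖g ξ‖ * ‖fourier G μ k ξ - f ξ‖) ∂μ := by
        refine norm_integral_le_of_norm_le (i3.add hgi)
          (Eventually.of_forall fun ξ => ?_)
        have h1 : p ξ * fourier G μ k ξ - p ξ * f ξ = (p ξ - g ξ) * (fourier G μ k ξ - f ξ) +
            g ξ * (fourier G μ k ξ - f ξ) := by ring
        rw [h1]
        refine (norm_add_le _ _).trans ?_
        rw [norm_mul, norm_mul]
        have := mul_le_mul_of_nonneg_left (hd ξ) (norm_nonneg (p ξ - g ξ))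
        linarith
    _ = 2 * C * (∫ ξ, ‖p ξ - g ξ‖ ∂μ) + ∫ ξ, ‖g ξ‖ * ‖fourier G μ k ξ - f ξ‖ ∂μ := by
        rw [integral_add i3 hgi, integral_const_mul]
    _ < ε := by linarith

/-- `h₁` has integral `1`, and `h₂` equals `1` on the support of `h₁` minus that of the sections.
There the overlap reduces to `∫ h₁`. -/
theorem exists_packetData {θ : A × A → ℂ} (hθ : IsCc θ) {q : A → ℂ}
    (hq : Continuous q) : ∃ d : PacketData A, d.q = q ∧ (∀ x, 0 ≤ d.h₁ x) ∧
      ∀ a x, phaseSection G χ μ θ a x ≠ 0 → d.overlap μ x = 1 := by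
  obtain ⟨h₁, a1, a2, a3, -, -, a6⟩ := exists_bump (μ := μ) (A := A) univ_mem
  obtain ⟨K, hK, hKR⟩ := exists_compact_phaseSection (G := G) (χ := χ) (μ := μ) hθ
  obtain ⟨L, hL, hLh⟩ := exists_compact_of_hasCompactSupport a2
  obtain ⟨h₂, b1, b2, -, -, b5⟩ := exists_cutoff (isCompact_sub hL hK)
  refine ⟨⟨q, h₁, h₂, hq, a1, a2, b1, b2⟩, rfl, a3, fun a x hx => ?_⟩
  rw [PacketData.overlap, ← a6]
  congr 1
  funext t
  change h₁ t * h₂ (t - x) = h₁ t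
  by_cases h0 : h₁ t = 0
  · rw [h0, zero_mul]
  · rw [b5 _ ⟨t, hLh t h0, x, hKR a x hx, rfl⟩, mul_one]

/-- Let `S` be the common value of the two sides of the Faddeev relation. One truncated sum of
matrix elements is compared with the symbol pairings on both sides: through regularizations of `f₁,
f₃` it is close to the product of distributions, and through regularizations of `f₄, f₂, f₀` it is
close to the pairings with `tripleKernel`. The uniformity in `exists_packetSum_close` lets the same
cutoffs serve both. -/
theorem tendsto_integral_tripleKernel (hμ : IsSelfDualMeasure G μ) (hB : IsClosed (B : Set A))
    {f : Fin 5 → A → ℂ} (hf : IsFaddeevType G μ hμ f) {θ θ' : A × A → ℂ} (hθ : IsTest G μ θ)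
    (hθ' : IsTest G μ θ') {C : ℝ} (h₄ : ∀ x, ‖f 4 x‖ ≤ C) (h₂ : ∀ x, ‖f 2 x‖ ≤ C)
    (h₀ : ∀ x, ‖f 0 x‖ ≤ C) :
    Tendsto (fun k : (A → ℂ) × (A → ℂ) × (A → ℂ) =>
      ∫ x, ∫ u, phaseTranspose G χ μ ν θ x * phaseTranspose G χ μ ν θ' u *
        tripleKernel G μ k.1 k.2.1 k.2.2 x u ∂μ ∂μ)
      (regularizations G μ C (f 4) ×ˢ regularizations G μ C (f 2) ×ˢ regularizations G μ C (f 0))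
      (𝓝 (gDist G χ μ ν (f 1) θ * gDist G χ μ ν (f 3) θ')) := by
  obtain ⟨⟨hmeas, C', hC'⟩, hrel⟩ := hf
  have hC0 : 0 ≤ C := (norm_nonneg _).trans (h₄ 0)
  have hθc : IsCc θ := ⟨hθ.1, hθ.2.1⟩
  have hθc' : IsCc θ' := ⟨hθ'.1, hθ'.2.1⟩
  obtain ⟨-, -, hP, hPi⟩ := gDistConverges (χ := χ) (ν := ν) hμ hB hθ
  obtain ⟨-, -, hP', hPi'⟩ := gDistConverges (χ := χ) (ν := ν) hμ hB hθ'
  change Integrable (phaseTranspose G χ μ ν θ) μ at hP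
  change Integrable (phaseTranspose G χ μ ν θ') μ at hP'
  change Integrable (fourierInv G μ (phaseTranspose G χ μ ν θ)) μ at hPi
  change Integrable (fourierInv G μ (phaseTranspose G χ μ ν θ')) μ at hPi'
  have cP' := continuous_phaseTranspose (G := G) (χ := χ) (μ := μ) (ν := ν) hB hθc'
  have cq := continuous_fourierInv_of_integrable (G := G) hP'
  obtain ⟨d, hdq, hd0, hdo⟩ := exists_packetData (G := G) (χ := χ) (μ := μ) hθc cq
  have hFq : fourier G μ d.q = phaseTranspose G χ μ ν θ' := by
    rw [hdq]
    exact fourier_fourierInv hμ cP' hP' hPi'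
  obtain ⟨ψ, C₁, hψ, hC₁, hsec⟩ := exists_isSectionBound χ ν hμ hB hθ'
  obtain ⟨M, -, hM⟩ := hψ.exists_localNorm_bound hμ d.cq hC₁ (fun g hg D' hD' => by
    rw [hdq]
    exact hsec.norm_integral_fourierInv_mul_le hμ hB hθc' hψ.isCc hg hD') d.c₁ d.s₁
  set S : Lp ℂ 2 μ →L[ℂ] Lp ℂ 2 μ := opP G μ hμ (f 1) ∘L opQ μ (f 3) with hS
  rw [Metric.tendsto_nhds]
  intro ε hε
  set ε' : ℝ := ε / (2 * (C' ^ 2 + C ^ 3 + 1)) with hε'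
  have hε'0 : 0 < ε' := by positivity
  obtain ⟨κ, κ', a1, a2, a3, b1, b2, b3, hclose⟩ := d.exists_packetSum_close (χ := χ) (ν := ν) hμ hB
    hθ hdo (by rw [hdq]; exact hPi') hd0 hM hε'0
  -- Regularize `f₁` and `f₃`. Their symbol `k₁(x)k₃(u)` pairs with `P ⊗ P'` to a product, each
  -- factor of which tends to a value of `gDist`.
  have hlim : ‖d.packetSum G χ ν θ κ κ' S -
      gDist G χ μ ν (f 1) θ * gDist G χ μ ν (f 3) θ'‖ ≤ ε' * C' ^ 2 := by
    have : (regularizations G μ C' (f 1)).NeBot := regularizations_neBot hμ (hmeas 1) (hC' 1)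
    have : (regularizations G μ C' (f 3)).NeBot := regularizations_neBot hμ (hmeas 3) (hC' 3)
    have t1 := d.tendsto_packetSum (G := G) (χ := χ) (ν := ν) hθc a1 a2 a3 b1 b2 b3
      (tendsto_opP_opQ hμ (hmeas 1) (hmeas 3) (hC' 1) (hC' 3)) (sq_nonneg C') (by
        filter_upwards [tendsto_fst.eventually (eventually_norm_le_of_regularizations C' (f 1)),
          tendsto_snd.eventually (eventually_norm_le_of_regularizations C' (f 3))] with k hk hk' v
        exact norm_opP_opQ_apply_le hμ hk.2.1 hk'.2.1 hk.2.2 hk'.2.2 v)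
    have t2 : Tendsto (fun k : (A → ℂ) × (A → ℂ) =>
        (∫ ξ, fourierInv G μ (phaseTranspose G χ μ ν θ) ξ * fourier G μ k.1 ξ ∂μ) *
          ∫ ξ, fourierInv G μ (phaseTranspose G χ μ ν θ') ξ * fourier G μ k.2 ξ ∂μ)
        (regularizations G μ C' (f 1) ×ˢ regularizations G μ C' (f 3))
        (𝓝 (gDist G χ μ ν (f 1) θ * gDist G χ μ ν (f 3) θ')) :=
      ((tendsto_integral_mul_fourier hPi (hmeas 1) (hC' 1)).comp tendsto_fst).mul
        ((tendsto_integral_mul_fourier hPi' (hmeas 3) (hC' 3)).comp tendsto_snd)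
    refine le_of_tendsto (t1.sub t2).norm ?_
    filter_upwards [tendsto_fst.eventually (eventually_norm_le_of_regularizations C' (f 1)),
      tendsto_snd.eventually (eventually_norm_le_of_regularizations C' (f 3))] with k hk hk'
    have h1 := hclose _ _ (C' ^ 2) (hasSymbol_opP_opQ hμ hk.1 hk'.1) ⟨?_, ?_⟩ (sq_nonneg C')
      (norm_opP_opQ_apply_le hμ hk.2.1 hk'.2.1 hk.2.2 hk'.2.2)
    · refine le_of_eq_of_le ?_ h1
      congr 2
      rw [← integral_mul_eq_of_integrable_fourierInv hμ hP hPi hk.1,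
        ← integral_mul_eq_of_integrable_fourierInv hμ hP' hPi' hk'.1, hFq, ← integral_mul_const]
      congr 1
      funext x
      rw [← integral_const_mul]
      congr 1
      funext u
      ring
    · have := hk.1.1
      have := hk'.1.1
      fun_prop
    · obtain ⟨K, hK, hKk⟩ := exists_compact_of_hasCompactSupport hk.1.2
      obtain ⟨K', hK', hKk'⟩ := exists_compact_of_hasCompactSupport hk'.1.2
      exact hasCompactSupport_of_ne (hK.prod hK') fun p hp =>
        ⟨hKk _ (left_ne_zero_of_mul hp), hKk' _ (right_ne_zero_of_mul hp)⟩
  have hbound : ∀ᶠ k : (A → ℂ) × (A → ℂ) × (A → ℂ) in regularizations G μ C (f 4) ×ˢ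
      regularizations G μ C (f 2) ×ˢ regularizations G μ C (f 0),
      (IsCc k.1 ∧ IsCc k.2.1 ∧ IsCc k.2.2) ∧ ∀ v, ‖(opQ μ (fourier G μ k.1) ∘L
        opPQ G μ hμ (fourier G μ k.2.1) ∘L opP G μ hμ (fourier G μ k.2.2)) v‖ ≤ C ^ 3 * ‖v‖ := by
    filter_upwards [tendsto_fst.eventually (eventually_norm_le_of_regularizations C (f 4)),
      (tendsto_fst.comp tendsto_snd).eventually (eventually_norm_le_of_regularizations C (f 2)),
      (tendsto_snd.comp tendsto_snd).eventually (eventually_norm_le_of_regularizations C (f 0))]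
      with k k4 k2 k0
    exact ⟨⟨k4.1, k2.1, k0.1⟩, norm_opQ_opPQ_opP_apply_le hμ k4.2.1 k2.2.1 k0.2.1 k4.2.2 k2.2.2
      k0.2.2⟩
  have t3 := d.tendsto_packetSum (G := G) (χ := χ) (ν := ν) hθc a1 a2 a3 b1 b2 b3
    (tendsto_opQ_opPQ_opP hμ (hmeas 4) (hmeas 2) (hmeas 0) h₄ h₂ h₀) (pow_nonneg hC0 3)
    (hbound.mono fun k hk => hk.2)
  -- The operator relation enters here: the regularized triple products converge strongly to the
  -- same `S`.
  rw [← hrel] at t3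
  filter_upwards [Metric.tendsto_nhds.1 t3 (ε / 2) (by positivity), hbound] with k hk1 hk2
  have h1 := hclose _ _ (C ^ 3) (hasSymbol_tripleKernel hμ hk2.1.1 hk2.1.2.1 hk2.1.2.2)
    (isCc_tripleKernel hk2.1.1 hk2.1.2.1 hk2.1.2.2) (pow_nonneg hC0 3) hk2.2
  have e1 : ∫ x, ∫ u, tripleKernel G μ k.1 k.2.1 k.2.2 x u *
      (phaseTranspose G χ μ ν θ x * fourier G μ d.q u) ∂μ ∂μ =
      ∫ x, ∫ u, phaseTranspose G χ μ ν θ x * phaseTranspose G χ μ ν θ' u *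
        tripleKernel G μ k.1 k.2.1 k.2.2 x u ∂μ ∂μ := by
    rw [hFq]
    simp only [mul_comm]
  rw [e1, norm_sub_rev] at h1
  rw [dist_eq_norm] at hk1 ⊢
  have h2 : ε' * C' ^ 2 + ε' * C ^ 3 < ε / 2 := by
    have h3 : 2 * (C' ^ 2 + C ^ 3 + 1) * ε' = ε := by
      rw [hε']
      field_simp
    linarith
  have h4 := norm_sub_le_norm_sub_add_norm_sub
    (∫ x, ∫ u, phaseTranspose G χ μ ν θ x * phaseTranspose G χ μ ν θ' u *
        tripleKernel G μ k.1 k.2.1 k.2.2 x u ∂μ ∂μ)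
    (d.packetSum G χ ν θ κ κ' (opQ μ (fourier G μ k.1) ∘L
        opPQ G μ hμ (fourier G μ k.2.1) ∘L opP G μ hμ (fourier G μ k.2.2)))
    (gDist G χ μ ν (f 1) θ * gDist G χ μ ν (f 3) θ')
  have h5 := norm_sub_le_norm_sub_add_norm_sub
    (d.packetSum G χ ν θ κ κ' (opQ μ (fourier G μ k.1) ∘L
        opPQ G μ hμ (fourier G μ k.2.1) ∘L opP G μ hμ (fourier G μ k.2.2)))
    (d.packetSum G χ ν θ κ κ' S)
    (gDist G χ μ ν (f 1) θ * gDist G χ μ ν (f 3) θ')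
  linarith

theorem integralIdentity_of_isFaddeevType [MeasurableSpace (A ⧸ B)] [BorelSpace (A ⧸ B)]
    {ρ : Measure (A ⧸ B)} (hμ : IsSelfDualMeasure G μ) (hχ : χ.Splits G) (hB : IsIsotropic G B)
    (hBc : IsClosed (B : Set A)) (hρ : WeilFormula μ ν ρ) {f : Fin 5 → A → ℂ}
    (hf : IsFaddeevType G μ hμ f) : IntegralIdentity G χ μ ν ρ f := by
  intro θ θ' hθ hθ' C h₄ h₂ h₀
  have := regularizations_neBot (C := C) hμ (hf.1.1 4) h₄
  have := regularizations_neBot (C := C) hμ (hf.1.1 2) h₂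
  have := regularizations_neBot (C := C) hμ (hf.1.1 0) h₀
  refine ⟨inferInstance, (tendsto_integral_tripleKernel (χ := χ) (ν := ν) hμ hBc hf hθ hθ' h₄ h₂
    h₀).congr' ?_⟩
  filter_upwards [tendsto_fst.eventually (isCc_of_mem_regularizations C (f 4)),
    (tendsto_fst.comp tendsto_snd).eventually (isCc_of_mem_regularizations C (f 2)),
    (tendsto_snd.comp tendsto_snd).eventually (isCc_of_mem_regularizations C (f 0))]
    with k k4 k2 k0
  exact (integral_gIntegrand hχ hB hBc hρ ⟨hθ.1, hθ.2.1⟩ ⟨hθ'.1, hθ'.2.1⟩ k4.1 k2.1 k0.1).symm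

end Fourier

end AutomorphicBeta

end

/-! ### Assembly of the theorem. -/

open AutomorphicBeta in
theorem mainTheorem6 {A : Type*} [AddCommGroup A] [TopologicalSpace A] [IsTopologicalAddGroup A]
    [LocallyCompactSpace A] [T2Space A] [MeasurableSpace A] [BorelSpace A]
    (G : GaussianExponential A)
    (μ : Measure A) [μ.IsAddHaarMeasure] [μ.Regular] (hμ : IsSelfDualMeasure G μ)
    (χ : Bicharacter A) (hχ : χ.Splits G)
    (B : AddSubgroup A) (hBclosed : IsClosed (B : Set A)) (hB : IsIsotropic G B)
    (ν : Measure B) [ν.IsAddHaarMeasure] [ν.Regular]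
    [MeasurableSpace (A ⧸ B)] [BorelSpace (A ⧸ B)]
    (ρ : Measure (A ⧸ B)) [ρ.IsAddHaarMeasure] [ρ.Regular] (hρ : WeilFormula μ ν ρ) :
    (∀ θ, IsTest G μ θ → GDistConverges G χ μ ν θ) ∧
    QuotientIntegrable ρ (gIntegrand G χ ν) ∧
    QuotientIntegrable ρ (phiIntegrand G χ ν) ∧
    (∀ f : Fin 5 → A → ℂ, IsFaddeevType G μ hμ f →
      (∀ i, IsAutomorphic G χ μ B (gDist G χ μ ν (f i))) ∧
      IntegralIdentity G χ μ ν ρ f ∧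
      BetaPentagon G χ μ ν ρ f) ∧
    (∀ f : Fin 5 → A → ℂ, IsBoundedFamily f →
      (IntegralIdentity G χ μ ν ρ f ↔ BetaPentagon G χ μ ν ρ f)) := by
  refine ⟨fun θ hθ => gDistConverges hμ hBclosed hθ, quotientIntegrable_gIntegrand hχ hB hBclosed,
    quotientIntegrable_phiIntegrand hχ hB hBclosed, fun f hf => ?_, fun f _ =>
      ⟨betaPentagon_of_integralIdentity hχ hB hBclosed hρ,
        integralIdentity_of_betaPentagon hχ hB hBclosed hρ⟩⟩
  have h := integralIdentity_of_isFaddeevType hμ hχ hB hBclosed hρ hf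
  exact ⟨fun i => isAutomorphic_gDist hχ hB (f i), h,
    betaPentagon_of_integralIdentity hχ hB hBclosed hρ h⟩
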